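/- Throughout, manifolds are smooth, finite-dimensional, Hausdorff, $\sigma$-compact and without boundary, and $T>0$. \textbf{Processes and most probable paths.} A sub-Riemannian structure $(E,g)$ on $M$ is a smooth subbundle $E\subseteq TM$ with a smooth inner product $g=\langle\cdot,\cdot\rangle_g$. Fix $o\in M$, a smooth connection $\nabla$ on $TM$ compatible with $(E,g)$ (it preserves sections of $E$, and $\nabla g=0$), a smooth curve $\Sigma_t$, $t\in[0,T]$, of symmetric positive definite endomorphisms of $E_o$, and a smooth time-dependent vector field $u_t$, $t\in[0,T]$. Let $\mathbb H^T(E_o)$ be the space of absolutely continuous curves $\omega:[0,T]\to E_o$ with $\omega_0=0$ and $\dot\omega\in L^2$. A curve $\gamma:[0,T]\to M$ is \emph{driven by} $\omega\in\mathbb H^T(E_o)$ if it is absolutely continuous and $$\dot\gamma_t=/\!/_t\,\Sigma_t^{1/2}\dot\omega_t+u_t(\gamma_t)\ \text{ for a.e. } t,\qquad \gamma_0=o,$$ where $/\!/_t:T_oM\to T_{\gamma_t}M$ is $\nabla$-parallel transport along $\gamma$; write then $\Pi(\omega)=\gamma_T$. The curve $\gamma$ is a \emph{most probable path} of the process $dx_t=/\!/_t\Sigma_t^{1/2}\circ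 dB_t+u_t(x_t)\,dt$, $x_0=o$ ($B_t$ a Brownian motion in $E_o$), if it is driven by some $\omega$ that minimizes the Onsager--Machlup functional $\mathrm{OM}(\omega)=\frac12\int_0^T|\dot\omega_t|_g^2\,dt$ of $B_t$ among all $\omega_1\in\mathbb H^T(E_o)$ that drive a curve with the same endpoint $\Pi(\omega_1)=\gamma_T$. It is \emph{singular} if it is driven by some $\omega$ that is not a regular point of $\Pi$. \textbf{Equations.} Let $R$ and $\mathcal T$ be the curvature and torsion of $\nabla$, let $\sharp^g:T^*M\to E$ be given by $\alpha(v)=\langle\sharp^g\alpha,v\rangle_g$ for $v\in E$, and let $K(v_1\wedge v_2,w_1)(w_2)=\langle R(w_1,w_2)v_1,v_2\rangle_g$ for $v_1,v_2\in E_x$, $w_1,w_2\in T_xM$, extended linearly to $\wedge^2E_x$. Let $\Sigma_t$ act on $E_{\gamma_t}$ by $/\!/_t\Sigma_t/\!/_t^{-1}$. A solution on $[0,T]$ of (MPPu) is a $C^1$ curve $\gamma$ together with a one-form $\lambda_t\in T^*_{\gamma_t}M$ and a two-vector $\chi_t\in\wedge^2E_{\gamma_t}$ along $\gamma$ such that $$\sharp^g\lambda_t=\Sigma_t^{-1}(\dot\gamma_t-u_t(\gamma_t)),\quad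 \tfrac{D}{dt}\lambda_t=-\lambda_t(\nabla u_t)-\lambda_t(\mathcal T(\dot\gamma_t,\cdot))+K(\chi_t,\dot\gamma_t),\quad \tfrac{D}{dt}\chi_t=\Sigma_t\sharp^g\lambda_t\wedge\sharp^g\lambda_t,\quad \chi_T=0 .$$ \textbf{Submersion.} Let $(E,g,\nabla,\Sigma_t,u_t)$ be such data on $M$ at $o$, let $\pi:M\to N$ be a smooth surjective submersion, $\mathcal V=\ker\pi_*$, $\check o=\pi(o)$, and let $(\check E,\check g,\check\nabla,\check\Sigma_t,\check u_t)$ be such data on $N$ at $\check o$. Let $\mathcal H$ be the orthogonal complement of $E\cap\mathcal V$ in $E$. Assume: \begin{itemize} \item $\pi_*E_y=\check E_{\pi(y)}$ for all $y\in M$, and $\langle v,w\rangle_g=\langle\pi_*v,\pi_*w\rangle_{\check g}$ for $v,w\in\mathcal H_y$; for $w\in\check E_{\pi(y)}$ let $h_yw\in\mathcal H_y$ be the element with $\pi_*h_yw=w$; \item $\langle\Sigma_tv,w\rangle_g=\langle v,\Sigma_tw\rangle_g=0$ for $v\in\mathcal H_o$, $w\in E_o\cap\mathcal V_o$, and $\check\Sigma_t$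 is the induced map: $\check\Sigma_t\pi_*v=\pi_*\Sigma_tv$ for $v\in\mathcal H_o$; \item $\pi_*u_t=\check u_t\circ\pi$; \item $\mathcal H$ is parallel for $\nabla$, and $\nabla|_{\mathcal H}$ is the pull-back of $\check\nabla|_{\check E}$: $\nabla_v hY=h\check\nabla_{\pi_*v}Y$ for every smooth section $Y$ of $\check E$ and every $v\in TM$; \item (completeness) every $\omega\in\mathbb H^T(E_o)$ drives a curve $\gamma$ in $M$ on all of $[0,T]$. \end{itemize} \textbf{Proposition.} Let $\check\gamma:[0,T]\to N$ be a most probable path of $d\check x_t=/\!\check/_t\check\Sigma_t^{1/2}\circ d\check B_t+\check u_t(\check x_t)\,dt$, $\check x_0=\check o$, that is not singular. Then there is a solution $(\gamma,\lambda,\chi)$ of (MPPu) on $M$ with $\gamma_0=o$, such that $\lambda_0$ vanishes on $\mathcal V_o$ and $\pi(\gamma_t)=\check\gamma_t$ for all $t\in[0,T]$. -/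

import Mathlib

open Set MeasureTheory
open scoped Manifold ContDiff Topology RealInnerProductSpace

noncomputable section

namespace SubRiem

/-! ### Vector fields, connections, curvature

Manifolds are smooth, without boundary, modelled on `EuclideanSpace ℝ (Fin d)`. -/

section Connections

variable {d : ℕ} {M : Type*} [TopologicalSpace M] [ChartedSpace (EuclideanSpace ℝ (Fin d)) M]
  [IsManifold (𝓡 d) ∞ M]

/-- The vector field `X` is smooth on the set `U`. -/
def SmoothFieldOn (X : (x : M) → TangentSpace (𝓡 d) x) (U : Set M) : Prop :=
  ContMDiffOn (𝓡 d) ((𝓡 d).prod (𝓡 d)) ∞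
    (fun x => (⟨x, X x⟩ : TangentBundle (𝓡 d) M)) U

/-- The curvature `R(X, Y) Z = ∇_X ∇_Y Z - ∇_Y ∇_X Z - ∇_[X,Y] Z` of an affine connection, at the
point `x`. The three tangent vectors are extended to vector fields that are smooth near `x`; by
tensoriality the value does not depend on the extensions.
In Mathlib's argument order, `cov Z x v` is `∇_v Z` at `x`. -/
def curvature
    (cov : CovariantDerivative (𝓡 d) (EuclideanSpace ℝ (Fin d))
      (TangentSpace (𝓡 d) : M → Type _))
    (x : M) (X₀ Y₀ Z₀ : TangentSpace (𝓡 d) x) : TangentSpace (𝓡 d) x :=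
  letI X := FiberBundle.extend (EuclideanSpace ℝ (Fin d)) X₀
  letI Y := FiberBundle.extend (EuclideanSpace ℝ (Fin d)) Y₀
  letI Z := FiberBundle.extend (EuclideanSpace ℝ (Fin d)) Z₀
  cov (fun y => cov Z y (Y y)) x X₀ - cov (fun y => cov Z y (X y)) x Y₀
    - cov Z x (VectorField.mlieBracket (𝓡 d) X Y x)

/-- `γ : [0,T] → M` is absolutely continuous with velocity `γ'` (a.e.): tested against
smooth functions, `f(γ_t) - f(γ_0) = ∫₀ᵗ df(γ'_s) ds` with an integrable integrand. -/
def IsACCurve (T : ℝ) (γ : ℝ → M) (γ' : (t : ℝ) → TangentSpace (𝓡 d) (γ t)) : Prop :=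
  ContinuousOn γ (Icc 0 T) ∧
  ∀ f : M → ℝ, ContMDiff (𝓡 d) 𝓘(ℝ, ℝ) ∞ f →
    IntervalIntegrable (fun s => (mfderiv (𝓡 d) 𝓘(ℝ, ℝ) f (γ s) (γ' s) : ℝ)) volume 0 T ∧
    ∀ t ∈ Icc 0 T,
      f (γ t) - f (γ 0) = ∫ s in (0 : ℝ)..t, (mfderiv (𝓡 d) 𝓘(ℝ, ℝ) f (γ s) (γ' s) : ℝ)

/-- `P t : T_o M → T_{γ_t} M`, `t ∈ [0,T]`, is parallel transport along a curve `γ` from `o` with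
velocity `γ'`, i.e. for every smooth vector field `X` the curve `t ↦ P_t⁻¹ X(γ_t)` in `T_o M`
is absolutely continuous, starts at `X(o)` and has derivative `P_t⁻¹ ∇_{γ'_t} X`
(integrated, and tested against linear forms on `T_o M`). -/
def IsParallelTransport
    (cov : CovariantDerivative (𝓡 d) (EuclideanSpace ℝ (Fin d))
      (TangentSpace (𝓡 d) : M → Type _))
    (T : ℝ) (o : M) (γ : ℝ → M) (γ' : (t : ℝ) → TangentSpace (𝓡 d) (γ t))
    (P : (t : ℝ) → TangentSpace (𝓡 d) o ≃ₗ[ℝ] TangentSpace (𝓡 d) (γ t)) : Prop :=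
  ∀ X : (x : M) → TangentSpace (𝓡 d) x, SmoothFieldOn X univ →
    ∀ l : Module.Dual ℝ (TangentSpace (𝓡 d) o),
      IntervalIntegrable (fun s => l ((P s).symm (cov X (γ s) (γ' s)))) volume 0 T ∧
      ∀ t ∈ Icc 0 T,
        l ((P t).symm (X (γ t))) - l (X o)
          = ∫ s in (0 : ℝ)..t, l ((P s).symm (cov X (γ s) (γ' s)))

end Connections

/-! ### Sub-Riemannian structures -/

/-- A sub-Riemannian structure `(E, g)`: a smooth subbundle `E ⊆ TM` with a smooth inner product
`g`, i.e. a family of inner product spaces that has smooth orthonormal frames locally. -/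
structure SubRiemannianStructure (d : ℕ) (M : Type*) [TopologicalSpace M]
    [ChartedSpace (EuclideanSpace ℝ (Fin d)) M] [IsManifold (𝓡 d) ∞ M] where
  E : (x : M) → Submodule ℝ (TangentSpace (𝓡 d) x)
  g : (x : M) → InnerProductSpace.Core ℝ (E x)
  exists_frame : ∀ x₀ : M, ∃ U ∈ 𝓝 x₀, ∃ (J : ℕ) (f : Fin J → (x : M) → E x),
    (∀ i, SmoothFieldOn (fun x => (f i x : TangentSpace (𝓡 d) x)) U) ∧
    ∀ x ∈ U, (∀ i j, (g x).inner (f i x) (f j x) = if i = j then 1 else 0) ∧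
      Submodule.span ℝ (range fun i => f i x) = ⊤

namespace SubRiemannianStructure

variable {d : ℕ} {M : Type*} [TopologicalSpace M] [ChartedSpace (EuclideanSpace ℝ (Fin d)) M]
  [IsManifold (𝓡 d) ∞ M] (S : SubRiemannianStructure d M)

/-- The fiber `E_x`, as an inner product space with the inner product `g_x`. -/
def Fiber (x : M) : Type := S.E x

instance (x : M) : AddCommGroup (S.Fiber x) := inferInstanceAs (AddCommGroup (S.E x))

instance (x : M) : Module ℝ (S.Fiber x) := inferInstanceAs (Module ℝ (S.E x))

/-- The inner product `g_x`, on `S.Fiber x`. -/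
abbrev fiberCore (x : M) : InnerProductSpace.Core ℝ (S.Fiber x) := S.g x

instance (x : M) : NormedAddCommGroup (S.Fiber x) :=
  (S.fiberCore x).toNormedAddCommGroup

instance (x : M) : InnerProductSpace ℝ (S.Fiber x) :=
  InnerProductSpace.ofCore (S.fiberCore x).toCore

instance (x : M) : FiniteDimensional ℝ (S.Fiber x) :=
  haveI : FiniteDimensional ℝ (TangentSpace (𝓡 d) x) :=
    inferInstanceAs (FiniteDimensional ℝ (EuclideanSpace ℝ (Fin d)))
  inferInstanceAs (FiniteDimensional ℝ (S.E x))

instance (x : M) : CompleteSpace (S.Fiber x) := FiniteDimensional.complete ℝ _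

instance (x : M) : MeasurableSpace (S.Fiber x) := borel _

instance (x : M) : BorelSpace (S.Fiber x) := ⟨rfl⟩

/-- The inclusion `E_x ⊆ T_x M`. -/
def incl (x : M) : S.Fiber x →ₗ[ℝ] TangentSpace (𝓡 d) x := (S.E x).subtype

/-- An element of `T_x M` that lies in `E_x`, as an element of the inner product space `E_x`. -/
def mkFiber {x : M} (v : TangentSpace (𝓡 d) x) (hv : v ∈ S.E x) : S.Fiber x := ⟨v, hv⟩

/-- A section of `E`, as a vector field. -/
def toField (X : (x : M) → S.Fiber x) (x : M) : TangentSpace (𝓡 d) x := S.incl x (X x)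

/-- The connection is compatible with `(E, g)`: it preserves sections of `E`, and `∇ g = 0`. -/
structure IsCompatible
    (cov : CovariantDerivative (𝓡 d) (EuclideanSpace ℝ (Fin d))
      (TangentSpace (𝓡 d) : M → Type _)) : Prop where
  mem : ∀ X : (x : M) → S.Fiber x, SmoothFieldOn (S.toField X) univ →
    ∀ (x : M) (v : TangentSpace (𝓡 d) x), cov (S.toField X) x v ∈ S.E x
  metric : ∀ (X Y : (x : M) → S.Fiber x) (hX : SmoothFieldOn (S.toField X) univ)
    (hY : SmoothFieldOn (S.toField Y) univ) (x : M) (v : TangentSpace (𝓡 d) x),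
    (mfderiv (𝓡 d) 𝓘(ℝ, ℝ) (fun y => ⟪X y, Y y⟫) x v : ℝ)
      = ⟪S.mkFiber (cov (S.toField X) x v) (mem X hX x v), Y x⟫
        + ⟪X x, S.mkFiber (cov (S.toField Y) x v) (mem Y hY x v)⟫

/-- `♯^g : T_x^* M → E_x`, determined by `α(v) = ⟪♯^g α, v⟫` for `v ∈ E_x`. -/
def sharp (x : M) (α : Module.Dual ℝ (TangentSpace (𝓡 d) x)) : S.Fiber x :=
  (InnerProductSpace.toDual ℝ (S.Fiber x)).symm
    (LinearMap.toContinuousLinearMap (α ∘ₗ S.incl x))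

/-- `v ∧ w ∈ ⋀² E_x`. -/
def wedge {x : M} (v w : S.Fiber x) : ⋀[ℝ]^2 (S.Fiber x) := exteriorPower.ιMulti ℝ 2 ![v, w]

/-- `κ` is the linear map `K(·, w₁) : ⋀² E_x → T_x^* M` given by
`K(v₁ ∧ v₂, w₁)(w₂) = ⟪R(w₁, w₂) v₁, v₂⟫`. -/
def IsK
    (cov : CovariantDerivative (𝓡 d) (EuclideanSpace ℝ (Fin d))
      (TangentSpace (𝓡 d) : M → Type _))
    (x : M) (w₁ : TangentSpace (𝓡 d) x)
    (κ : ⋀[ℝ]^2 (S.Fiber x) →ₗ[ℝ] Module.Dual ℝ (TangentSpace (𝓡 d) x)) : Prop :=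
  ∀ (v₁ v₂ : S.Fiber x) (w₂ : TangentSpace (𝓡 d) x),
    ∃ z : S.Fiber x, S.incl x z = curvature cov x w₁ w₂ (S.incl x v₁) ∧
      κ (S.wedge v₁ v₂) w₂ = ⟪z, v₂⟫

end SubRiemannianStructure

/-- The positive square root of a positive operator `A` on a finite-dimensional real inner product
space (it exists and is unique; for other `A` the value is irrelevant). -/
def posSqrt {V : Type*} [NormedAddCommGroup V] [InnerProductSpace ℝ V] (A : V →L[ℝ] V) :
    V →L[ℝ] V :=
  open Classical in
  if h : ∃ B : V →L[ℝ] V, B.IsPositive ∧ B ∘L B = A then h.choose else 0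

/-! ### Diffusions with drift and covariance, and their most probable paths -/

/-- The data of the process `dx_t = //_t Σ_t^{1/2} ∘ dB_t + u_t(x_t) dt`, `x_0 = o`, on `[0,T]`:
a sub-Riemannian structure `(E, g)`, a smooth connection compatible with it, a smooth curve `Σ_t` of
symmetric positive definite maps of `E_o`, and a smooth time-dependent vector field `u_t`. -/
structure DiffusionData (d : ℕ) (M : Type*) [TopologicalSpace M]
    [ChartedSpace (EuclideanSpace ℝ (Fin d)) M] [IsManifold (𝓡 d) ∞ M] (o : M) (T : ℝ) where
  S : SubRiemannianStructure d M
  conn : CovariantDerivative (𝓡 d) (EuclideanSpace ℝ (Fin d)) (TangentSpace (𝓡 d) : M → Type _)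
  conn_smooth : CovariantDerivative.ContMDiffCovariantDerivative conn ∞
  conn_compatible : S.IsCompatible conn
  Sig : ℝ → S.Fiber o →L[ℝ] S.Fiber o
  Sig_smooth : ContDiffOn ℝ ∞ Sig (Icc 0 T)
  Sig_symm : ∀ t ∈ Icc 0 T, ∀ v w, ⟪Sig t v, w⟫ = ⟪v, Sig t w⟫
  Sig_pos : ∀ t ∈ Icc 0 T, ∀ v, v ≠ 0 → 0 < ⟪Sig t v, v⟫
  u : ℝ → (x : M) → TangentSpace (𝓡 d) x
  u_smooth : ContMDiffOn (𝓘(ℝ, ℝ).prod (𝓡 d)) ((𝓡 d).prod (𝓡 d)) ∞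
    (fun p : ℝ × M => (⟨p.2, u p.1 p.2⟩ : TangentBundle (𝓡 d) M)) (Icc 0 T ×ˢ univ)

namespace DiffusionData

variable {d : ℕ} {M : Type*} [TopologicalSpace M] [ChartedSpace (EuclideanSpace ℝ (Fin d)) M]
  [IsManifold (𝓡 d) ∞ M] {o : M} {T : ℝ} (D : DiffusionData d M o T)

/-- The Cameron-Martin space of `E_o`: an absolutely continuous curve `ξ` in `E_o` with `ξ_0 = 0`
and square integrable derivative is represented by `dξ/dt ∈ L²([0,T]; E_o)`. -/
abbrev CameronMartin : Type := Lp (D.S.Fiber o) 2 (volume.restrict (Icc (0 : ℝ) T))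

/-- The Onsager-Machlup functional `½ ∫₀ᵀ |dξ/dt|² dt` of Brownian motion in `E_o`. -/
def OM (ξ : D.CameronMartin) : ℝ := 1 / 2 * ∫ t in (0 : ℝ)..T, ⟪ξ t, ξ t⟫

/-- `γ` is the absolutely continuous solution on `[0,T]` of
`dγ/dt = //_t Σ_t^{1/2} (dξ/dt) + u_t(γ_t)`, `γ_0 = o`. -/
def IsSolution (ξ : D.CameronMartin) (γ : ℝ → M) : Prop :=
  γ 0 = o ∧ ∃ P : (t : ℝ) → TangentSpace (𝓡 d) o ≃ₗ[ℝ] TangentSpace (𝓡 d) (γ t),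
    letI γ' : (t : ℝ) → TangentSpace (𝓡 d) (γ t) := fun t =>
      P t (D.S.incl o (posSqrt (D.Sig t) (ξ t))) + D.u t (γ t)
    IsACCurve T γ γ' ∧ IsParallelTransport D.conn T o γ γ' P

/-- `γ` is a most probable path: it is driven by some `ξ` that minimizes the Onsager-Machlup
functional among all curves that drive solutions from `o` to `γ_T`. -/
def IsMostProbablePath (γ : ℝ → M) : Prop :=
  ∃ ξ : D.CameronMartin, D.IsSolution ξ γ ∧
    ∀ (ξ₁ : D.CameronMartin) (γ₁ : ℝ → M), D.IsSolution ξ₁ γ₁ → γ₁ T = γ T → D.OM ξ ≤ D.OM ξ₁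

/-- The endpoint map `ξ ↦ γ_T` (the solution `γ` is unique; where none exists, the value is `o`). -/
def endpoint (ξ : D.CameronMartin) : M :=
  open Classical in
  if h : ∃ γ : ℝ → M, D.IsSolution ξ γ then h.choose T else o

/-- `ξ` is a regular point of the endpoint map. -/
def IsRegular (ξ : D.CameronMartin) : Prop :=
  Function.Surjective (mfderiv 𝓘(ℝ, D.CameronMartin) (𝓡 d) D.endpoint ξ)

/-- `γ` is singular: it is the solution for some `ξ` that is not a regular point. -/
def IsSingular (γ : ℝ → M) : Prop :=
  ∃ ξ : D.CameronMartin, D.IsSolution ξ γ ∧ ¬ D.IsRegular ξ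

/-- `(γ, lam, chi)` solves on `[0,T]`, with `γ_0 = o`, the equations
* `♯^g lam_t = Σ_t⁻¹ (dγ/dt - u_t(γ_t))`,
* `(D/dt) lam_t = - lam_t(∇ u_t) - lam_t(T(dγ/dt, ·)) + K(chi_t, dγ/dt)`,
* `(D/dt) chi_t = Σ_t ♯^g lam_t ∧ ♯^g lam_t`, `chi_T = 0`.

Here `P` is parallel transport along `γ`, `Q` is its restriction to `E`, the operator `Σ_t` acts on
`E_{γ_t}` as `Q_t Σ_t Q_t⁻¹`, and `D/dt` is the derivative after transport back to `o`. -/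
def SolvesMPP (γ : ℝ → M) (lam : (t : ℝ) → Module.Dual ℝ (TangentSpace (𝓡 d) (γ t)))
    (chi : (t : ℝ) → ⋀[ℝ]^2 (D.S.Fiber (γ t))) : Prop :=
  γ 0 = o ∧
  ∃ (γ' : (t : ℝ) → TangentSpace (𝓡 d) (γ t))
    (P : (t : ℝ) → TangentSpace (𝓡 d) o ≃ₗ[ℝ] TangentSpace (𝓡 d) (γ t))
    (Q : (t : ℝ) → D.S.Fiber o ≃ₗ[ℝ] D.S.Fiber (γ t))
    (κ : (t : ℝ) → ⋀[ℝ]^2 (D.S.Fiber (γ t)) →ₗ[ℝ] Module.Dual ℝ (TangentSpace (𝓡 d) (γ t))),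
    (∀ t ∈ Icc 0 T, HasMFDerivWithinAt 𝓘(ℝ, ℝ) (𝓡 d) γ (Icc 0 T) t
      ((1 : ℝ →L[ℝ] ℝ).smulRight (γ' t))) ∧
    IsParallelTransport D.conn T o γ γ' P ∧
    (∀ t ∈ Icc 0 T, ∀ v, D.S.incl (γ t) (Q t v) = P t (D.S.incl o v)) ∧
    (∀ t ∈ Icc 0 T, D.S.IsK D.conn (γ t) (γ' t) (κ t)) ∧
    (∀ t ∈ Icc 0 T,
      γ' t - D.u t (γ t)
        = D.S.incl (γ t) (Q t (D.Sig t ((Q t).symm (D.S.sharp (γ t) (lam t)))))) ∧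
    (∀ t ∈ Icc 0 T, ∀ v : TangentSpace (𝓡 d) o,
      HasDerivWithinAt (fun s => lam s (P s v))
        (- lam t (D.conn (D.u t) (γ t) (P t v))
          - lam t (D.conn.torsion (γ t) (γ' t) (P t v))
          + κ t (chi t) (P t v)) (Icc 0 T) t) ∧
    (∀ t ∈ Icc 0 T, ∀ φ : Module.Dual ℝ (⋀[ℝ]^2 (D.S.Fiber o)),
      HasDerivWithinAt (fun s => φ (exteriorPower.map 2 (Q s).symm.toLinearMap (chi s)))
        (φ (exteriorPower.map 2 (Q t).symm.toLinearMap
          (D.S.wedge (Q t (D.Sig t ((Q t).symm (D.S.sharp (γ t) (lam t)))))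
            (D.S.sharp (γ t) (lam t))))) (Icc 0 T) t) ∧
    chi T = 0

end DiffusionData

/-! ### Submersions -/

section Submersion

variable {d : ℕ} {M : Type*} [TopologicalSpace M] [ChartedSpace (EuclideanSpace ℝ (Fin d)) M]
  [IsManifold (𝓡 d) ∞ M]
  {e : ℕ} {N : Type*} [TopologicalSpace N] [ChartedSpace (EuclideanSpace ℝ (Fin e)) N]

/-- The vertical space `V_x = ker π_*`. -/
def vertical (e : ℕ) [ChartedSpace (EuclideanSpace ℝ (Fin e)) N] (π : M → N) (x : M) :
    Submodule ℝ (TangentSpace (𝓡 d) x) :=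
  LinearMap.ker (mfderiv (𝓡 d) (𝓡 e) π x).toLinearMap

/-- The space `H_x`, the orthogonal complement of `E_x ∩ V_x` in `E_x`. -/
def horizontal (e : ℕ) [ChartedSpace (EuclideanSpace ℝ (Fin e)) N]
    (S : SubRiemannianStructure d M) (π : M → N) (x : M) : Submodule ℝ (S.Fiber x) :=
  ((vertical e π x).comap (S.incl x))ᗮ

/-- The surjective submersion `π : M → N` is compatible with the data on `M` and on `N`. -/
structure IsCompatibleSubmersion [IsManifold (𝓡 e) ∞ N] {o : M} {T : ℝ}
    (π : M → N) (D : DiffusionData d M o T) (D' : DiffusionData e N (π o) T) : Prop where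
  smooth : ContMDiff (𝓡 d) (𝓡 e) ∞ π
  surjective : Function.Surjective π
  submersion : ∀ x, Function.Surjective (mfderiv (𝓡 d) (𝓡 e) π x)
  /-- `π_*` maps `E` onto the subbundle of `TN`. -/
  map_E : ∀ x, (D.S.E x).map (mfderiv (𝓡 d) (𝓡 e) π x).toLinearMap = D'.S.E (π x)
  /-- `π_*` is isometric on `H`. -/
  isometric : ∀ (x : M), ∀ v ∈ horizontal e D.S π x, ∀ w ∈ horizontal e D.S π x,
    ∀ v' w' : D'.S.Fiber (π x),
    D'.S.incl (π x) v' = mfderiv (𝓡 d) (𝓡 e) π x (D.S.incl x v) →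
    D'.S.incl (π x) w' = mfderiv (𝓡 d) (𝓡 e) π x (D.S.incl x w) → ⟪v, w⟫ = ⟪v', w'⟫
  /-- `Σ_t` respects the orthogonal decomposition of `E_o` into `H_o` and `E_o ∩ V_o`. -/
  Sig_orthogonal : ∀ t ∈ Icc 0 T, ∀ v ∈ horizontal e D.S π o, ∀ w : D.S.Fiber o,
    D.S.incl o w ∈ vertical e π o → ⟪D.Sig t v, w⟫ = 0 ∧ ⟪v, D.Sig t w⟫ = 0
  /-- The covariance on `N` is the one induced by that of `M`: `π_* Σ_t v = Σ'_t π_* v` on `H_o`. -/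
  Sig_map : ∀ t ∈ Icc 0 T, ∀ v ∈ horizontal e D.S π o, ∀ v' : D'.S.Fiber (π o),
    D'.S.incl (π o) v' = mfderiv (𝓡 d) (𝓡 e) π o (D.S.incl o v) →
    D'.S.incl (π o) (D'.Sig t v') = mfderiv (𝓡 d) (𝓡 e) π o (D.S.incl o (D.Sig t v))
  /-- The drifts are `π`-related. -/
  u_related : ∀ t ∈ Icc 0 T, ∀ x, mfderiv (𝓡 d) (𝓡 e) π x (D.u t x) = D'.u t (π x)
  /-- `H` is parallel. -/
  horizontal_parallel : ∀ X : (x : M) → D.S.Fiber x, SmoothFieldOn (D.S.toField X) univ →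
    (∀ x, X x ∈ horizontal e D.S π x) → ∀ (x : M) (v : TangentSpace (𝓡 d) x),
    ∃ a ∈ horizontal e D.S π x, D.S.incl x a = D.conn (D.S.toField X) x v
  /-- On `H`, the connection is the pull-back connection: if `X` is the horizontal lift `hY` of a
  smooth section `Y` of the subbundle of `TN`, then `∇_v X = h ∇'_{π_* v} Y`. -/
  pullback : ∀ Y : (y : N) → D'.S.Fiber y, SmoothFieldOn (D'.S.toField Y) univ →
    ∀ X : (x : M) → D.S.Fiber x, (∀ x, X x ∈ horizontal e D.S π x ∧
      mfderiv (𝓡 d) (𝓡 e) π x (D.S.incl x (X x)) = D'.S.incl (π x) (Y (π x))) →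
    ∀ (x : M) (v : TangentSpace (𝓡 d) x), ∃ a ∈ horizontal e D.S π x,
      D.S.incl x a = D.conn (D.S.toField X) x v ∧
      mfderiv (𝓡 d) (𝓡 e) π x (D.S.incl x a)
        = D'.conn (D'.S.toField Y) (π x) (mfderiv (𝓡 d) (𝓡 e) π x v)

end Submersion

end SubRiem

end

/-! The proof has two halves: a first-order necessary condition on N, obtained by optimal control,
and a pull-back of that condition to M.

On N the minimizing control ξ is a constrained critical point of half the squared L² norm.
Non-singularity makes the differential of the endpoint map onto, so there is a multiplier p with ⟪ξ,
η⟫ = p(dΠ η) for all η (`exists_multiplier`). The differential is computed in the parallel frame: a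
variation of point and frame is a pair (z₁, z₂) that solves a linear equation whose coefficients
`varOp` are torsion, ∇u and curvature. This rests on the implicit function theorem for the integral
equation (`exists_local_flow`), on a change of variables that absorbs the Christoffel symbols
(`Prim.toFrame`), and on continuation along the curve (`IsPath.hasVar`). The adjoint equation,
solved backwards from p, gives a costate ℓ. Pairing it with the variation turns the multiplier
identity into an identity of integrals, so ξ has a continuous representative (`exists_momentum`).
The values of ℓ on tangent vectors are the one-form on N; its values on frame variations carry the
two-vector, and they vanish at T because the endpoint does not see the frame.

On M the horizontal lift of the control drives a curve γ by completeness. The connection on H is a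
pull-back, so parallel transport commutes with horizontal lift, and the projection of γ solves the
equation of the given path. Off H the two connections are unrelated, so only the transport of the
subbundle of TN can be compared; hence the reduced system `IsRedPath` and its uniqueness theorem.

Finally lam is the pull-back of the one-form by π, and chi is the lift of the two-vector. Let B =
∇dπ be the second fundamental form (`secondForm`). The pull-back hypothesis says that B(v, w) = 0
for w in H (`secondForm_lift`). Differentiating π_* along γ produces B(γ', ·), and since γ' - u is
horizontal the same term is the exact defect between the torsion and drift terms on M and on N
(`fderiv_torsion_add`), so the two cancel. On H the curvatures are intertwined by π_*
(`mfderiv_curvature`), which matches the terms in K. That lam vanishes on vertical vectors is clear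
because it factors through π_*. -/

noncomputable section

namespace SubRiem

/-! ### Absolutely continuous curves -/

section Primitive

/-- A local-to-global principle on a compact interval. -/
theorem Icc_induction {a b : ℝ} {p : ℝ → Prop} (ha : p a)
    (h : ∀ t ∈ Icc a b, ∃ δ > 0, ∀ r ∈ Icc a b, ∀ s ∈ Icc a b, |r - t| < δ → |s - t| < δ →
      r ≤ s → p r → p s) : ∀ t ∈ Icc a b, p t := by
  by_contra! hcon
  obtain ⟨t, ht, hpt⟩ := hcon
  -- The set of s such that p holds on all of [a, s]. The hypothesis at its supremum c carries p
  -- past c, or up to b.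
  set A : Set ℝ := {s | s ∈ Icc a b ∧ ∀ r ∈ Icc a s, p r}
  have hab : a ≤ b := ht.1.trans ht.2
  have haA : a ∈ A := ⟨⟨le_rfl, hab⟩, fun r hr => by
    obtain rfl : r = a := le_antisymm hr.2 hr.1; exact ha⟩
  have hbdd : BddAbove A := ⟨b, fun s hs => hs.1.2⟩
  set c := sSup A
  have hac : a ≤ c := le_csSup hbdd haA
  have hcb : c ≤ b := csSup_le ⟨a, haA⟩ fun s hs => hs.1.2
  obtain ⟨δ, hδ, H⟩ := h c ⟨hac, hcb⟩
  obtain ⟨r, hrA, hr⟩ := exists_lt_of_lt_csSup ⟨a, haA⟩ (show c - δ < sSup A by simp [c, hδ])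
  have hrc : r ≤ c := le_csSup hbdd hrA
  have key : ∀ s ∈ Icc a b, s < c + δ → p s := by
    intro s hs hsc
    rcases le_total s r with hsr | hrs
    · exact hrA.2 s ⟨hs.1, hsr⟩
    · exact H r hrA.1 s hs (by rw [abs_lt]; constructor <;> linarith)
        (by rw [abs_lt]; constructor <;> linarith) hrs (hrA.2 r ⟨hrA.1.1, le_rfl⟩)
  by_cases hcb' : c + δ / 2 ≤ b
  · have : c + δ / 2 ∈ A := ⟨⟨by linarith, hcb'⟩, fun s hs =>
      key s ⟨hs.1, hs.2.trans hcb'⟩ (by linarith [hs.2])⟩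
    have := le_csSup hbdd this
    linarith
  · exact hpt (key t ht (by linarith [ht.2]))

/-- If `g` is locally controlled by an arbitrarily small multiple of an integrable function then
it is constant. -/
theorem eq_of_forall_norm_sub_le {E : Type*} [NormedAddCommGroup E] {g : ℝ → E} {k : ℝ → ℝ} {a b : ℝ}
    (hk : IntervalIntegrable k volume a b) (hk0 : ∀ t, 0 ≤ k t)
    (h : ∀ ε > 0, ∀ t ∈ Icc a b, ∃ δ > 0, ∀ r ∈ Icc a b, ∀ s ∈ Icc a b, |r - t| < δ →
      |s - t| < δ → r ≤ s → ‖g s - g r‖ ≤ ε * ∫ x in r..s, k x) :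
    ∀ t ∈ Icc a b, g t = g a := by
  have hint : ∀ r ∈ Icc a b, ∀ s ∈ Icc a b, IntervalIntegrable k volume r s := fun r hr s hs =>
    hk.mono_set (by rw [uIcc_of_le (hr.1.trans hr.2)]; exact uIcc_subset_Icc hr hs)
  -- For fixed ε the local bounds add up along [a, t]; afterwards ε tends to 0.
  have key : ∀ ε > 0, ∀ t ∈ Icc a b, ‖g t - g a‖ ≤ ε * ∫ x in a..t, k x := by
    intro ε hε
    refine Icc_induction (by simp) fun t ht => ?_
    obtain ⟨δ, hδ, H⟩ := h ε hε t ht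
    refine ⟨δ, hδ, fun r hr s hs hrt hst hrs hpr => ?_⟩
    have ha : a ∈ Icc a b := ⟨le_rfl, hr.1.trans hr.2⟩
    rw [← intervalIntegral.integral_add_adjacent_intervals (hint a ha r hr) (hint r hr s hs)]
    calc ‖g s - g a‖ = ‖(g r - g a) + (g s - g r)‖ := by congr 1; abel
      _ ≤ _ := (norm_add_le _ _).trans (by linarith [H r hr s hs hrt hst hrs])
  intro t ht
  rw [← sub_eq_zero, ← norm_le_zero_iff]
  set K := ∫ x in a..t, k x
  have hK : 0 ≤ K := intervalIntegral.integral_nonneg ht.1 fun x _ => hk0 x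
  refine le_of_forall_pos_le_add fun ε hε => ?_
  -- Division by K + 1 because the integral K may vanish.
  have := key (ε / (K + 1)) (by positivity) t ht
  refine this.trans ?_
  rw [zero_add, div_mul_eq_mul_div, div_le_iff₀ (by positivity)]
  nlinarith

variable {E F : Type*} [NormedAddCommGroup E] [NormedSpace ℝ E]
  [NormedAddCommGroup F] [NormedSpace ℝ F]

/-- On `[a, b]` the curve `y` is a primitive of the integrable function `y'`. -/
def Prim (y y' : ℝ → E) (a b : ℝ) : Prop :=
  IntervalIntegrable y' volume a b ∧ ∀ t ∈ Icc a b, y t - y a = ∫ s in a..t, y' s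

namespace Prim

variable {y y' z z' : ℝ → E} {a b c : ℝ}

theorem intervalIntegrable (h : Prim y y' a b) {s t : ℝ} (hs : s ∈ Icc a b) (ht : t ∈ Icc a b) :
    IntervalIntegrable y' volume s t :=
  h.1.mono_set (by
    rw [uIcc_of_le (hs.1.trans hs.2)]
    exact uIcc_subset_Icc hs ht)

theorem sub_eq (h : Prim y y' a b) {s t : ℝ} (hs : s ∈ Icc a b) (ht : t ∈ Icc a b) :
    y t - y s = ∫ r in s..t, y' r := by
  have ha : a ∈ Icc a b := ⟨le_rfl, hs.1.trans hs.2⟩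
  rw [← intervalIntegral.integral_interval_sub_left (h.intervalIntegrable ha ht)
    (h.intervalIntegrable ha hs), ← h.2 t ht, ← h.2 s hs]
  abel

theorem mono (h : Prim y y' a b) {s t : ℝ} (hs : s ∈ Icc a b) (ht : t ∈ Icc a b) :
    Prim y y' s t :=
  ⟨h.intervalIntegrable hs ht, fun _ hr => h.sub_eq hs ⟨hs.1.trans hr.1, hr.2.trans ht.2⟩⟩

theorem trans (h : Prim y y' a b) (h' : Prim y y' b c) (hab : a ≤ b) (hbc : b ≤ c) :
    Prim y y' a c := by
  refine ⟨h.1.trans h'.1, fun t ht => ?_⟩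
  rcases le_total t b with htb | hbt
  · exact h.2 t ⟨ht.1, htb⟩
  · rw [← intervalIntegral.integral_add_adjacent_intervals h.1
      (h'.intervalIntegrable ⟨le_rfl, hbc⟩ ⟨hbt, ht.2⟩), ← h.2 b ⟨hab, le_rfl⟩,
      ← h'.2 t ⟨hbt, ht.2⟩]
    abel

theorem continuousOn (h : Prim y y' a b) : ContinuousOn y (Icc a b) := by
  rcases le_or_gt a b with hab | hab
  · have : ContinuousOn (fun t => y a + ∫ s in a..t, y' s) (Icc a b) := by
      refine continuousOn_const.add ?_
      rw [← uIcc_of_le hab]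
      exact intervalIntegral.continuousOn_primitive_interval' h.1 left_mem_uIcc
    exact this.congr fun t ht => by simp [← h.2 t ht]
  · simp [Icc_eq_empty (not_le.2 hab)]

theorem congr (h : Prim y y' a b) (hz : ∀ t ∈ Icc a b, z t = y t) : Prim z y' a b :=
  ⟨h.1, fun t ht => by rw [hz t ht, hz a ⟨le_rfl, ht.1.trans ht.2⟩, h.2 t ht]⟩

theorem congr_deriv_ae (h : Prim y y' a b) (hab : a ≤ b)
    (hz : ∀ᵐ t, t ∈ Icc a b → y' t = z' t) : Prim y z' a b := by
  have hz' : ∀ t ∈ Icc a b, ∀ᵐ s, s ∈ uIoc a t → y' s = z' s := fun t ht => by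
    filter_upwards [hz] with s hs hst
    rw [uIoc_of_le ht.1] at hst
    exact hs ⟨hst.1.le, hst.2.trans ht.2⟩
  exact ⟨h.1.congr_ae ((ae_restrict_iff' measurableSet_uIoc).2 (hz' b ⟨hab, le_rfl⟩)),
    fun t ht => by rw [h.2 t ht, intervalIntegral.integral_congr_ae (hz' t ht)]⟩

theorem congr_deriv (h : Prim y y' a b) (hab : a ≤ b) (hz : ∀ t ∈ Icc a b, y' t = z' t) :
    Prim y z' a b :=
  h.congr_deriv_ae hab (Filter.Eventually.of_forall hz)

theorem const (x : E) (a b : ℝ) : Prim (fun _ => x) (fun _ => 0) a b :=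
  ⟨by simp, by simp⟩

theorem add (h : Prim y y' a b) (h' : Prim z z' a b) :
    Prim (fun t => y t + z t) (fun t => y' t + z' t) a b :=
  ⟨h.1.add h'.1, fun t ht => by
    have ha : a ∈ Icc a b := ⟨le_rfl, ht.1.trans ht.2⟩
    rw [intervalIntegral.integral_add (h.intervalIntegrable ha ht) (h'.intervalIntegrable ha ht),
      ← h.2 t ht, ← h'.2 t ht, add_sub_add_comm]⟩

theorem neg (h : Prim y y' a b) : Prim (fun t => - y t) (fun t => - y' t) a b :=
  ⟨h.1.neg, fun t ht => by
    rw [intervalIntegral.integral_neg, ← h.2 t ht, neg_sub, neg_sub_neg]⟩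

theorem sub (h : Prim y y' a b) (h' : Prim z z' a b) :
    Prim (fun t => y t - z t) (fun t => y' t - z' t) a b := by
  simpa only [sub_eq_add_neg] using h.add h'.neg

theorem norm_sub_le (h : Prim y y' a b) {s t : ℝ} (hs : s ∈ Icc a b) (ht : t ∈ Icc a b)
    (hst : s ≤ t) : ‖y t - y s‖ ≤ ∫ r in s..t, ‖y' r‖ := by
  rw [h.sub_eq hs ht]
  exact intervalIntegral.norm_integral_le_integral_norm hst

theorem intervalIntegral (h : IntervalIntegrable y' volume a b) (x : E) :
    Prim (fun t => x + ∫ s in a..t, y' s) y' a b :=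
  ⟨h, fun t _ => by simp⟩

theorem prodMk {w w' : ℝ → F} (h : Prim y y' a b) (h' : Prim w w' a b) [CompleteSpace E]
    [CompleteSpace F] :
    Prim (fun t => (y t, w t)) (fun t => (y' t, w' t)) a b := by
  have hi : IntervalIntegrable (fun t => (y' t, w' t)) volume a b :=
    ⟨h.1.1.prodMk h'.1.1, h.1.2.prodMk h'.1.2⟩
  refine ⟨hi, fun t ht => ?_⟩
  have hi' : IntervalIntegrable (fun t => (y' t, w' t)) volume a t := hi.mono_set (by
    rw [uIcc_of_le ht.1, uIcc_of_le (ht.1.trans ht.2)]; exact Icc_subset_Icc_right ht.2)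
  exact Prod.ext ((h.2 t ht).trans ((ContinuousLinearMap.fst ℝ E F).intervalIntegral_comp_comm hi'))
    ((h'.2 t ht).trans ((ContinuousLinearMap.snd ℝ E F).intervalIntegral_comp_comm hi'))

theorem clm [CompleteSpace E] [CompleteSpace F] (h : Prim y y' a b) (L : E →L[ℝ] F) :
    Prim (fun t => L (y t)) (fun t => L (y' t)) a b :=
  ⟨⟨L.integrable_comp h.1.1, L.integrable_comp h.1.2⟩, fun t ht => by
    rw [← map_sub, h.2 t ht, L.intervalIntegral_comp_comm
      (h.intervalIntegrable ⟨le_rfl, ht.1.trans ht.2⟩ ht)]⟩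

/-- The chain rule. -/
theorem comp [CompleteSpace E] [CompleteSpace F] (h : Prim y y' a b) (hab : a ≤ b) {Φ : E → F}
    {Φ' : ℝ → E →L[ℝ] F}
    (hΦ : ∀ t ∈ Icc a b, HasStrictFDerivAt Φ (Φ' t) (y t)) (hc : ContinuousOn Φ' (Icc a b)) :
    Prim (fun t => Φ (y t)) (fun t => Φ' t (y' t)) a b := by
  have hI : IntervalIntegrable (fun t => Φ' t (y' t)) volume a b := by
    rw [intervalIntegrable_iff_integrableOn_Icc_of_le hab]
    have h1 := (intervalIntegrable_iff_integrableOn_Icc_of_le hab).1 h.1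
    obtain ⟨C, hC⟩ := isCompact_Icc.exists_bound_of_continuousOn hc
    refine Integrable.mono' (h1.norm.const_mul C) ?_ ?_
    · exact (ContinuousLinearMap.apply ℝ F : E →L[ℝ] (E →L[ℝ] F) →L[ℝ] F).flip
        |>.aestronglyMeasurable_comp₂
          (hc.aestronglyMeasurable measurableSet_Icc) h1.aestronglyMeasurable
    · refine (ae_restrict_iff' measurableSet_Icc).2 (Filter.Eventually.of_forall fun t ht => ?_)
      exact ((Φ' t).le_opNorm _).trans (mul_le_mul_of_nonneg_right (hC t ht) (norm_nonneg _))
  refine ⟨hI, fun t ht => ?_⟩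
  have hIs : ∀ r ∈ Icc a b, ∀ s ∈ Icc a b,
      IntervalIntegrable (fun t => Φ' t (y' t)) volume r s := fun r hr s hs =>
    hI.mono_set (by rw [uIcc_of_le hab]; exact uIcc_subset_Icc hr hs)
  -- Since y' is merely integrable there is no pointwise derivative to use: Φ ∘ y minus the
  -- candidate primitive is shown to vary by at most ε times the integral of ‖y'‖, hence to be
  -- constant.
  have := eq_of_forall_norm_sub_le (g := fun t => Φ (y t) - ∫ s in a..t, Φ' s (y' s))
    (k := fun s => ‖y' s‖) h.1.norm (fun _ => norm_nonneg _) ?_ t ht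
  · simp only [intervalIntegral.integral_same, sub_zero] at this
    change Φ (y t) - Φ (y a) = _
    rw [← this]; abel
  intro ε hε t ht
  have hε' : (0 : ℝ) < ε / 2 := by positivity
  have h1 := (hΦ t ht).isLittleO.def hε'
  rw [nhds_prod_eq, Filter.Eventually, Filter.mem_prod_self_iff] at h1
  obtain ⟨U, hU, hUΦ⟩ := h1
  have h2 := h.continuousOn t ht hU
  have h3 := hc t ht (Metric.ball_mem_nhds _ hε')
  obtain ⟨δ, hδ, hball⟩ := Metric.mem_nhdsWithin_iff.1 (Filter.inter_mem h2 h3)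
  refine ⟨δ, hδ, fun r hr s hs hrt hst hrs => ?_⟩
  have hmem : ∀ x ∈ Icc r s, x ∈ Metric.ball t δ ∩ Icc a b := fun x hx =>
    ⟨by rw [Metric.mem_ball, Real.dist_eq, abs_lt]; rw [abs_lt] at hrt hst
        constructor <;> linarith [hx.1, hx.2], ⟨hr.1.trans hx.1, hx.2.trans hs.2⟩⟩
  have hy : ‖Φ (y s) - Φ (y r) - Φ' t (y s - y r)‖ ≤ ε / 2 * ‖y s - y r‖ :=
    hUΦ (mk_mem_prod (hball (hmem s ⟨hrs, le_rfl⟩)).1 (hball (hmem r ⟨le_rfl, hrs⟩)).1)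
  have hyn := h.norm_sub_le hr hs hrs
  have ha : a ∈ Icc a b := ⟨le_rfl, hab⟩
  -- The increment is the remainder of strict differentiability at t plus the oscillation of Φ' near
  -- t; each accounts for ε / 2.
  have e1 : (Φ (y s) - ∫ x in a..s, Φ' x (y' x)) - (Φ (y r) - ∫ x in a..r, Φ' x (y' x))
      = (Φ (y s) - Φ (y r) - Φ' t (y s - y r)) - ∫ x in r..s, (Φ' x - Φ' t) (y' x) := by
    have e2 : ∫ x in r..s, (Φ' x - Φ' t) (y' x)
        = (∫ x in r..s, Φ' x (y' x)) - Φ' t (y s - y r) := by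
      rw [h.sub_eq hr hs, ← (Φ' t).intervalIntegral_comp_comm (h.intervalIntegrable hr hs),
        ← intervalIntegral.integral_sub (hIs r hr s hs)
          ((h.mono hr hs).clm (Φ' t)).1]
      rfl
    rw [e2, ← intervalIntegral.integral_add_adjacent_intervals (hIs a ha r hr) (hIs r hr s hs)]
    abel
  have e3 : ‖∫ x in r..s, (Φ' x - Φ' t) (y' x)‖ ≤ ε / 2 * ∫ x in r..s, ‖y' x‖ := by
    rw [← intervalIntegral.integral_const_mul]
    refine intervalIntegral.norm_integral_le_of_norm_le hrs
      (Filter.Eventually.of_forall fun x hx => ?_)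
      ((h.intervalIntegrable hr hs).norm.const_mul _)
    have := (hball (hmem x ⟨hx.1.le, hx.2⟩)).2
    rw [mem_preimage, Metric.mem_ball, dist_eq_norm] at this
    exact ((Φ' x - Φ' t).le_opNorm _).trans (mul_le_mul_of_nonneg_right this.le (norm_nonneg _))
  change ‖(Φ (y s) - ∫ x in a..s, Φ' x (y' x)) - (Φ (y r) - ∫ x in a..r, Φ' x (y' x))‖ ≤ _
  rw [e1]
  refine (_root_.norm_sub_le _ _).trans ?_
  nlinarith

theorem reverse (h : Prim y y' a b) : Prim (fun t => y (-t)) (fun t => - y' (-t)) (-b) (-a) := by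
  refine ⟨((IntervalIntegrable.iff_comp_neg enorm_ne_top).1 h.1).symm.neg, fun t ht => ?_⟩
  have hab : -t ∈ Icc a b := ⟨by linarith [ht.2], by linarith [ht.1]⟩
  have := h.sub_eq hab ⟨hab.1.trans hab.2, le_rfl⟩
  rw [intervalIntegral.integral_neg, intervalIntegral.integral_comp_neg, neg_neg, ← this, neg_sub]
  simp

/-- Uniqueness for linear differential inequalities. -/
theorem eq_zero_of_norm_le (h : Prim y y' a b) {k : ℝ → ℝ} (hk : IntervalIntegrable k volume a b)
    (hk0 : ∀ t, 0 ≤ k t) (hle : ∀ᵐ t, t ∈ Icc a b → ‖y' t‖ ≤ k t * ‖y t‖) (ha : y a = 0) :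
    ∀ t ∈ Icc a b, y t = 0 := by
  refine Icc_induction ha fun t ht => ?_
  have hkc := (Prim.intervalIntegral hk 0).continuousOn t ht
  -- Two points at which the primitive of k is within 1/4 of its value at t enclose an integral of
  -- at most 1/2.
  obtain ⟨δ, hδ, hball⟩ := Metric.continuousWithinAt_iff.1 hkc (1 / 4) (by norm_num)
  refine ⟨δ, hδ, fun r hr s hs hrt hst hrs hyr => ?_⟩
  have hab : a ≤ b := ht.1.trans ht.2
  have hK := Prim.intervalIntegral hk 0
  -- At a maximum point x of ‖y‖ the integral bound gives ‖y x‖ ≤ ‖y x‖ / 2, so y vanishes on [r,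
  -- s].
  obtain ⟨x, hx, hmax⟩ := isCompact_Icc.exists_isMaxOn (nonempty_Icc.2 hrs)
    (h.mono hr hs).continuousOn.norm
  have hxab : x ∈ Icc a b := ⟨hr.1.trans hx.1, hx.2.trans hs.2⟩
  have hkr : ∫ u in r..x, k u ≤ 1 / 2 := by
    have hxt : |x - t| < δ := by
      rw [abs_lt] at hrt hst ⊢
      constructor <;> linarith [hx.1, hx.2]
    have h1 := hball hr (by rwa [Real.dist_eq])
    have h2 := hball hxab (by rwa [Real.dist_eq])
    rw [← hK.sub_eq hr hxab]
    rw [Real.dist_eq, abs_lt] at h1 h2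
    linarith [h1.1, h2.2]
  have h1 : ‖y x‖ ≤ ‖y x‖ * (1 / 2) := by
    calc ‖y x‖ = ‖∫ u in r..x, y' u‖ := by rw [← h.sub_eq hr hxab, hyr, sub_zero]
      _ ≤ ∫ u in r..x, ‖y x‖ * k u := by
        refine intervalIntegral.norm_integral_le_of_norm_le hx.1 ?_
          ((hK.intervalIntegrable hr hxab).const_mul _)
        filter_upwards [hle] with u hu hux
        have huab : u ∈ Icc a b := ⟨hr.1.trans hux.1.le, hux.2.trans hxab.2⟩
        refine (hu huab).trans ?_
        rw [mul_comm]
        exact mul_le_mul_of_nonneg_right (hmax ⟨hux.1.le, hux.2.trans hx.2⟩) (hk0 u)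
      _ = ‖y x‖ * ∫ u in r..x, k u := intervalIntegral.integral_const_mul _ _
      _ ≤ _ := mul_le_mul_of_nonneg_left hkr (norm_nonneg _)
  have h2 : ‖y s‖ ≤ ‖y x‖ := hmax ⟨hrs, le_rfl⟩
  rw [← norm_le_zero_iff]
  linarith

/-- The fundamental theorem of calculus. -/
theorem hasDerivWithinAt [CompleteSpace E] (h : Prim y y' a b) (hc : ContinuousOn y' (Icc a b))
    {t : ℝ} (ht : t ∈ Icc a b) : HasDerivWithinAt y (y' t) (Icc a b) t := by
  have hab : a ≤ b := ht.1.trans ht.2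
  -- A continuous extension to the whole line makes the two-sided theorem available at the endpoints
  -- too.
  set g : ℝ → E := IccExtend hab (domRestrict (Icc a b) y')
  have hg : Continuous g := (continuousOn_iff_continuous_domRestrict.1 hc).Icc_extend'
  have hgy : ∀ s ∈ Icc a b, g s = y' s := fun s hs => IccExtend_of_mem _ _ hs
  have h1 : HasDerivAt (fun t => y a + ∫ s in a..t, g s) (g t) t :=
    (intervalIntegral.integral_hasDerivAt_right (hg.intervalIntegrable _ _)
      hg.aestronglyMeasurable.stronglyMeasurableAtFilter hg.continuousAt).const_add _
  rw [hgy t ht] at h1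
  refine h1.hasDerivWithinAt.congr_of_mem (fun s hs => ?_) ht
  rw [← sub_eq_iff_eq_add', h.2 s hs]
  refine intervalIntegral.integral_congr fun u hu => (hgy u ?_).symm
  rw [uIcc_of_le hs.1] at hu
  exact ⟨hu.1, hu.2.trans hs.2⟩

end Prim
end Primitive

/-! ### Volterra operators and linear equations -/

section Volterra

variable {E F : Type*} [NormedAddCommGroup E] [NormedSpace ℝ E]
  [NormedAddCommGroup F] [NormedSpace ℝ F] {r s : ℝ}

/-- The primitive of an integrable function as a continuous function on `[r, s]`. -/
def primC {k : ℝ → E} (hk : IntervalIntegrable k volume r s) : C(Icc r s, E) where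
  toFun t := ∫ x in r..t, k x
  continuous_toFun := by
    have h := (Prim.intervalIntegral hk 0).continuousOn
    simp only [zero_add] at h
    exact continuousOn_iff_continuous_domRestrict.1 h

theorem norm_primC_le (hrs : r ≤ s) {k : ℝ → E} (hk : IntervalIntegrable k volume r s) :
    ‖primC hk‖ ≤ ∫ x in r..s, ‖k x‖ := by
  refine (ContinuousMap.norm_le _
    (intervalIntegral.integral_nonneg hrs fun _ _ => norm_nonneg _)).2 fun t => ?_
  refine (intervalIntegral.norm_integral_le_integral_norm t.2.1).trans ?_
  exact intervalIntegral.integral_mono_interval le_rfl t.2.1 t.2.2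
    (Filter.Eventually.of_forall fun _ => norm_nonneg _) hk.norm

theorem intervalIntegrable_clm_apply (hrs : r ≤ s) {k : ℝ → F →L[ℝ] E}
    (hk : IntervalIntegrable k volume r s) {z : ℝ → F} (hz : ContinuousOn z (Icc r s)) :
    IntervalIntegrable (fun x => k x (z x)) volume r s := by
  rw [intervalIntegrable_iff_integrableOn_Icc_of_le hrs] at hk ⊢
  obtain ⟨C, hC⟩ := isCompact_Icc.exists_bound_of_continuousOn hz
  refine Integrable.mono' (hk.norm.mul_const C) ?_ ?_
  · exact (ContinuousLinearMap.apply ℝ E : F →L[ℝ] (F →L[ℝ] E) →L[ℝ] E).flip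
      |>.aestronglyMeasurable_comp₂ hk.aestronglyMeasurable
        (hz.aestronglyMeasurable measurableSet_Icc)
  · refine (ae_restrict_iff' measurableSet_Icc).2 (Filter.Eventually.of_forall fun t ht => ?_)
    exact ((k t).le_opNorm _).trans (mul_le_mul_of_nonneg_left (hC t ht) (norm_nonneg _))

theorem intervalIntegrable_clm_projIcc (hrs : r ≤ s) {k : ℝ → F →L[ℝ] E}
    (hk : IntervalIntegrable k volume r s) (z : C(Icc r s, F)) :
    IntervalIntegrable (fun x => k x (z (projIcc r s hrs x))) volume r s :=
  intervalIntegrable_clm_apply hrs hk (z.continuous.comp continuous_projIcc).continuousOn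

/-- The Volterra operator `z ↦ ∫_r^t k(x) z(x) dx`. -/
def volterra (hrs : r ≤ s) {k : ℝ → F →L[ℝ] E} (hk : IntervalIntegrable k volume r s) :
    C(Icc r s, F) →L[ℝ] C(Icc r s, E) :=
  LinearMap.mkContinuous
    { toFun := fun z => primC (intervalIntegrable_clm_projIcc hrs hk z)
      map_add' := fun z w => by
        ext t
        have hsub : uIcc r t ⊆ uIcc r s := by
          rw [uIcc_of_le hrs, uIcc_of_le t.2.1]; exact Icc_subset_Icc_right t.2.2
        simp only [primC, ContinuousMap.coe_mk, ContinuousMap.add_apply, map_add]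
        exact intervalIntegral.integral_add
          ((intervalIntegrable_clm_projIcc hrs hk z).mono_set hsub)
          ((intervalIntegrable_clm_projIcc hrs hk w).mono_set hsub)
      map_smul' := fun c z => by
        ext t
        simp only [primC, ContinuousMap.coe_mk, ContinuousMap.smul_apply, map_smul,
          intervalIntegral.integral_smul, RingHom.id_apply]
        rfl }
    (∫ x in r..s, ‖k x‖) fun z => by
      refine (norm_primC_le hrs (intervalIntegrable_clm_projIcc hrs hk z)).trans ?_
      rw [mul_comm, ← intervalIntegral.integral_const_mul]
      refine intervalIntegral.integral_mono_on hrs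
        (intervalIntegrable_clm_projIcc hrs hk z).norm
        (hk.norm.const_mul _) fun x _ => ?_
      rw [mul_comm]
      exact ((k x).le_opNorm _).trans
        (mul_le_mul_of_nonneg_left (ContinuousMap.norm_coe_le_norm _ _) (norm_nonneg _))

theorem volterra_apply (hrs : r ≤ s) {k : ℝ → F →L[ℝ] E} (hk : IntervalIntegrable k volume r s)
    (z : C(Icc r s, F)) (t : Icc r s) :
    volterra hrs hk z t = ∫ x in r..t, k x (z (projIcc r s hrs x)) := rfl

theorem norm_volterra_le (hrs : r ≤ s) {k : ℝ → F →L[ℝ] E}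
    (hk : IntervalIntegrable k volume r s) : ‖volterra hrs hk‖ ≤ ∫ x in r..s, ‖k x‖ :=
  LinearMap.mkContinuous_norm_le _
    (intervalIntegral.integral_nonneg hrs fun _ _ => norm_nonneg _) _

/-- A curve on `[r, s]`, extended to the real line. -/
def extendCurve {E : Type*} [NormedAddCommGroup E] (hrs : r ≤ s) (z : C(Icc r s, E)) (t : ℝ) : E := z (projIcc r s hrs t)

theorem extendCurve_apply {E : Type*} [NormedAddCommGroup E] (hrs : r ≤ s) (z : C(Icc r s, E)) {t : ℝ} (ht : t ∈ Icc r s) :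
    extendCurve hrs z t = z ⟨t, ht⟩ := by rw [extendCurve, projIcc_of_mem _ ht]

theorem continuous_extendCurve {E : Type*} [NormedAddCommGroup E] (hrs : r ≤ s) (z : C(Icc r s, E)) :
    Continuous (extendCurve hrs z) := z.continuous.comp continuous_projIcc

/-- Local solvability of linear equations with integrable coefficients. -/
theorem exists_prim_linear_local [CompleteSpace E] (hrs : r ≤ s) {k : ℝ → E →L[ℝ] E}
    (hk : IntervalIntegrable k volume r s) (hsmall : ∫ x in r..s, ‖k x‖ < 1) (y₀ : E) :
    ∃ y : ℝ → E, y r = y₀ ∧ Prim y (fun t => k t (y t)) r s := by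
  -- The integral equation is z - Vz = y₀ with ‖V‖ < 1, solved by the Neumann series.
  have hn : ‖volterra hrs hk‖ < 1 := (norm_volterra_le hrs hk).trans_lt hsmall
  set u := Units.oneSub (volterra hrs hk) hn
  set z : C(Icc r s, E) := (↑u⁻¹ : C(Icc r s, E) →L[ℝ] C(Icc r s, E)) (ContinuousMap.const _ y₀)
  have hz : z - volterra hrs hk z = ContinuousMap.const _ y₀ := by
    have : (u * u⁻¹ : (C(Icc r s, E) →L[ℝ] C(Icc r s, E))ˣ).val (ContinuousMap.const _ y₀)
      = ContinuousMap.const _ y₀ := by simp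
    rw [Units.val_mul] at this
    exact this
  have hz' : ∀ t ∈ Icc r s, extendCurve hrs z t
      = y₀ + ∫ x in r..t, k x (extendCurve hrs z x) := by
    intro t ht
    have := DFunLike.congr_fun hz ⟨t, ht⟩
    rw [ContinuousMap.sub_apply, sub_eq_iff_eq_add, volterra_apply] at this
    rw [extendCurve_apply hrs z ht, this]
    rfl
  have h0 : extendCurve hrs z r = y₀ := by simpa using hz' r ⟨le_rfl, hrs⟩
  refine ⟨extendCurve hrs z, h0, intervalIntegrable_clm_apply hrs hk
    (continuous_extendCurve hrs z).continuousOn, fun t ht => ?_⟩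
  rw [hz' t ht, h0, add_sub_cancel_left]

/-- Gluing of two curves at `b`. -/
theorem Prim.glue {y y' z z' : ℝ → E} {a b c : ℝ} (h : Prim y y' a b) (h' : Prim z z' b c)
    (hab : a ≤ b) (hbc : b ≤ c) (hyz : y b = z b) :
    Prim (fun t => if t ≤ b then y t else z t) (fun t => if t ≤ b then y' t else z' t) a c := by
  refine Prim.trans (b := b) ?_ ?_ hab hbc
  · exact (h.congr fun t ht => if_pos ht.2).congr_deriv hab fun t ht => (if_pos ht.2).symm
  · refine (h'.congr fun t ht => ?_).congr_deriv_ae hbc ?_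
    · rcases ht.1.eq_or_lt with rfl | hlt
      · simpa using hyz
      · exact if_neg (not_le.2 hlt)
    -- At b itself the glued derivative takes its value from the left piece, which is harmless on a
    -- null set.
    · filter_upwards [Measure.ae_ne volume b] with t htb ht
      exact (if_neg (not_le.2 (lt_of_le_of_ne ht.1 htb.symm))).symm

/-- Existence for linear equations with integrable coefficients. -/
theorem exists_prim_linear [CompleteSpace E] {a b : ℝ} (hab : a ≤ b) {k : ℝ → E →L[ℝ] E}
    (hk : IntervalIntegrable k volume a b) (y₀ : E) :
    ∃ y : ℝ → E, y a = y₀ ∧ Prim y (fun t => k t (y t)) a b := by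
  have hK := Prim.intervalIntegral hk.norm 0
  refine Icc_induction (p := fun t => ∃ y : ℝ → E, y a = y₀ ∧ Prim y (fun t => k t (y t)) a t)
    ⟨fun _ => y₀, rfl, by simp, fun t ht => ?_⟩ (fun t ht => ?_) b ⟨hab, le_rfl⟩
  · obtain rfl : t = a := le_antisymm ht.2 ht.1
    simp
  obtain ⟨δ, hδ, hball⟩ := Metric.continuousWithinAt_iff.1 (hK.continuousOn t ht) (1 / 4)
    (by norm_num)
  refine ⟨δ, hδ, fun r hr s hs hrt hst hrs ⟨y, hya, hy⟩ => ?_⟩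
  obtain ⟨z, hzr, hz⟩ := exists_prim_linear_local hrs
    (hk.mono_set (by rw [uIcc_of_le hab]; exact uIcc_subset_Icc hr hs)) (by
      have h1 := hball hr (by rwa [Real.dist_eq])
      have h2 := hball hs (by rwa [Real.dist_eq])
      rw [← hK.sub_eq hr hs]
      rw [Real.dist_eq, abs_lt] at h1 h2
      linarith [h1.1, h2.2]) (y r)
  refine ⟨fun t => if t ≤ r then y t else z t, by simp [hr.1, hya],
    (hy.glue hz hr.1 hrs hzr.symm).congr_deriv (hr.1.trans hrs) fun t _ => ?_⟩
  dsimp only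
  split_ifs <;> rfl

/-- Time reversal turns a terminal value into an initial one. This form serves the adjoint equation,
whose datum is at T. -/
theorem exists_prim_linear' [CompleteSpace E] {a b : ℝ} (hab : a ≤ b) {k : ℝ → E →L[ℝ] E}
    (hk : IntervalIntegrable k volume a b) (y₀ : E) :
    ∃ y : ℝ → E, y b = y₀ ∧ Prim y (fun t => k t (y t)) a b := by
  obtain ⟨y, hy0, hy⟩ := exists_prim_linear (neg_le_neg hab) (k := fun t => - k (-t))
    ((IntervalIntegrable.iff_comp_neg enorm_ne_top).1 hk).symm.neg y₀
  refine ⟨fun t => y (-t), by simpa using hy0, ?_⟩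
  have := hy.reverse
  simp only [neg_neg, neg_apply] at this
  exact this

end Volterra

/-! ### Strict differentiability of solutions of control systems -/

section Controls

variable {U : Type*} [NormedAddCommGroup U] {T : ℝ}

/-- Square integrable controls on `[0, T]`. -/
abbrev Control (T : ℝ) (U : Type*) [NormedAddCommGroup U] : Type _ :=
  Lp U 2 (volume.restrict (Icc (0 : ℝ) T))

theorem Control.integrableOn (ξ : Control T U) : IntegrableOn ξ (Icc 0 T) :=
  (Lp.memLp ξ).integrable (by norm_num)

theorem Control.intervalIntegrable (ξ : Control T U) {r s : ℝ} (hr : r ∈ Icc 0 T)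
    (hs : s ∈ Icc 0 T) : IntervalIntegrable ξ volume r s := by
  have h := (intervalIntegrable_iff_integrableOn_Icc_of_le (hr.1.trans hr.2)).2 ξ.integrableOn
  exact h.mono_set (by rw [uIcc_of_le (hr.1.trans hr.2)]; exact uIcc_subset_Icc hr hs)

/-- Hölder's inequality on an interval of length T. It bounds the integral operator in the control
by T^(1/2) in `controlIntegral`. -/
theorem Control.integral_norm_le (ξ : Control T U) {r s : ℝ} (hr : r ∈ Icc 0 T)
    (hs : s ∈ Icc 0 T) (hrs : r ≤ s) :
    ∫ x in r..s, ‖ξ x‖ ≤ T ^ (1 / 2 : ℝ) * ‖ξ‖ := by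
  have hT : 0 ≤ T := hr.1.trans hr.2
  calc ∫ x in r..s, ‖ξ x‖ ≤ ∫ x in Icc 0 T, ‖ξ x‖ := by
        rw [intervalIntegral.integral_of_le hrs]
        exact setIntegral_mono_set ξ.integrableOn.norm
          (Filter.Eventually.of_forall fun _ => norm_nonneg _)
          (Ioc_subset_Icc_self.trans (Icc_subset_Icc hr.1 hs.2)).eventuallyLE
    _ = (eLpNorm ξ 1 (volume.restrict (Icc 0 T))).toReal := by
        rw [eLpNorm_one_eq_lintegral_enorm, integral_norm_eq_lintegral_enorm
          ξ.integrableOn.aestronglyMeasurable]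
    _ ≤ (eLpNorm ξ 2 (volume.restrict (Icc 0 T))
          * volume.restrict (Icc 0 T) univ ^ (1 / 2 : ℝ)).toReal := by
        refine ENNReal.toReal_mono (ENNReal.mul_ne_top (Lp.eLpNorm_ne_top ξ) ?_) ?_
        · exact ENNReal.rpow_ne_top_of_nonneg (by norm_num) (measure_ne_top _ _)
        · have := eLpNorm_le_eLpNorm_mul_rpow_measure_univ (p := 1) (q := 2) (by norm_num)
            (Lp.aestronglyMeasurable ξ)
          norm_num at this ⊢
          exact this
    _ = _ := by
        rw [ENNReal.toReal_mul, mul_comm, Lp.norm_def, ← ENNReal.toReal_rpow]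
        simp [hT]

theorem Control.coeFn_add_ae (ξ η : Control T U) :
    ∀ᵐ x, x ∈ Icc 0 T → (ξ + η : Control T U) x = ξ x + η x :=
  (ae_restrict_iff' measurableSet_Icc).1 (Lp.coeFn_add ξ η)

variable [NormedSpace ℝ U]

theorem Control.coeFn_smul_ae (c : ℝ) (ξ : Control T U) :
    ∀ᵐ x, x ∈ Icc 0 T → (c • ξ : Control T U) x = c • ξ x :=
  (ae_restrict_iff' measurableSet_Icc).1 (Lp.coeFn_smul c ξ)

variable {Y : Type*} [NormedAddCommGroup Y] [NormedSpace ℝ Y] {r s : ℝ}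

theorem Control.intervalIntegrable_clm (ξ : Control T U) (hr : r ∈ Icc 0 T) (hs : s ∈ Icc 0 T)
    (hrs : r ≤ s) {A : ℝ → U →L[ℝ] Y} (hA : ContinuousOn A (Icc r s)) :
    IntervalIntegrable (fun x => A x (ξ x)) volume r s := by
  have h := ξ.intervalIntegrable hr hs
  rw [intervalIntegrable_iff_integrableOn_Icc_of_le hrs] at h ⊢
  obtain ⟨C, hC⟩ := isCompact_Icc.exists_bound_of_continuousOn hA
  refine Integrable.mono' (h.norm.const_mul C) ?_ ?_
  · exact (ContinuousLinearMap.apply ℝ Y : U →L[ℝ] (U →L[ℝ] Y) →L[ℝ] Y).flip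
      |>.aestronglyMeasurable_comp₂ (hA.aestronglyMeasurable measurableSet_Icc)
        h.aestronglyMeasurable
  · refine (ae_restrict_iff' measurableSet_Icc).2 (Filter.Eventually.of_forall fun t ht => ?_)
    exact ((A t).le_opNorm _).trans (mul_le_mul_of_nonneg_right (hC t ht) (norm_nonneg _))

/-- The bilinear map `(A, ξ) ↦ ∫_r^t A(x) ξ(x) dx`. -/
def controlIntegral (hr : r ∈ Icc 0 T) (hs : s ∈ Icc 0 T) (hrs : r ≤ s) :
    C(Icc r s, U →L[ℝ] Y) →L[ℝ] Control T U →L[ℝ] C(Icc r s, Y) :=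
  have hI (A : C(Icc r s, U →L[ℝ] Y)) (ξ : Control T U) :
      IntervalIntegrable (fun x => extendCurve hrs A x (ξ x)) volume r s :=
    ξ.intervalIntegrable_clm hr hs hrs (continuous_extendCurve hrs A).continuousOn
  have hsub (t : Icc r s) : uIcc r t ⊆ uIcc r s := by
    rw [uIcc_of_le hrs, uIcc_of_le t.2.1]; exact Icc_subset_Icc_right t.2.2
  have hT (t : Icc r s) (x : ℝ) (hx : x ∈ uIoc r (t : ℝ)) : x ∈ Icc 0 T := by
    rw [uIoc_of_le t.2.1] at hx
    exact ⟨hr.1.trans hx.1.le, hx.2.trans (t.2.2.trans hs.2)⟩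
  LinearMap.mkContinuous₂
    (LinearMap.mk₂ ℝ (fun A ξ => primC (hI A ξ))
      (fun A B ξ => by
        ext t
        exact (intervalIntegral.integral_congr fun x _ => rfl).trans
          (intervalIntegral.integral_add ((hI A ξ).mono_set (hsub t))
            ((hI B ξ).mono_set (hsub t))))
      (fun c A ξ => by
        ext t
        exact (intervalIntegral.integral_congr fun x _ => rfl).trans
          (intervalIntegral.integral_smul c _))
      (fun A ξ η => by
        ext t
        refine (intervalIntegral.integral_congr_ae ?_).trans
          (intervalIntegral.integral_add ((hI A ξ).mono_set (hsub t))
            ((hI A η).mono_set (hsub t)))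
        filter_upwards [Control.coeFn_add_ae ξ η] with x hx hxt
        rw [hx (hT t x hxt), map_add])
      (fun c A ξ => by
        ext t
        refine (intervalIntegral.integral_congr_ae ?_).trans
          (intervalIntegral.integral_smul c _)
        filter_upwards [Control.coeFn_smul_ae c ξ] with x hx hxt
        rw [hx (hT t x hxt), map_smul]))
    (T ^ (1 / 2 : ℝ)) fun A ξ => by
      refine (norm_primC_le hrs (hI A ξ)).trans ?_
      calc ∫ x in r..s, ‖extendCurve hrs A x (ξ x)‖ ≤ ∫ x in r..s, ‖A‖ * ‖ξ x‖ := by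
            refine intervalIntegral.integral_mono_on hrs (hI A ξ).norm
              ((ξ.intervalIntegrable hr hs).norm.const_mul _) fun x _ => ?_
            exact (ContinuousLinearMap.le_opNorm _ _).trans
              (mul_le_mul_of_nonneg_right (ContinuousMap.norm_coe_le_norm _ _) (norm_nonneg _))
        _ = ‖A‖ * ∫ x in r..s, ‖ξ x‖ := intervalIntegral.integral_const_mul _ _
        _ ≤ ‖A‖ * (T ^ (1 / 2 : ℝ) * ‖ξ‖) :=
            mul_le_mul_of_nonneg_left (ξ.integral_norm_le hr hs hrs) (by positivity)
        _ = _ := by ring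

end Controls

/-! ### Superposition operators on spaces of continuous curves -/

section Nemytskii

variable {Y Z : Type*} [NormedAddCommGroup Y] [NormedSpace ℝ Y] [NormedAddCommGroup Z]
  [NormedSpace ℝ Z] {r s : ℝ}

/-- The radial retraction onto the closed ball of radius `ρ > 0` at `y₀`. -/
def ballRetract (y₀ : Y) (ρ : ℝ) (y : Y) : Y := y₀ + (ρ / max ρ ‖y - y₀‖) • (y - y₀)

theorem continuous_ballRetract (y₀ : Y) {ρ : ℝ} (hρ : 0 < ρ) :
    Continuous (ballRetract y₀ ρ) := by
  have h : ∀ y : Y, max ρ ‖y - y₀‖ ≠ 0 := fun y => (hρ.trans_le (le_max_left _ _)).ne'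
  unfold ballRetract
  fun_prop (disch := exact h _)

theorem ballRetract_mem (y₀ : Y) {ρ : ℝ} (hρ : 0 < ρ) (y : Y) :
    ballRetract y₀ ρ y ∈ Metric.closedBall y₀ ρ := by
  have h : 0 < max ρ ‖y - y₀‖ := hρ.trans_le (le_max_left _ _)
  rw [mem_closedBall_iff_norm, ballRetract, add_sub_cancel_left, norm_smul, Real.norm_eq_abs,
    abs_of_pos (by positivity), div_mul_eq_mul_div, div_le_iff₀ h]
  exact mul_le_mul_of_nonneg_left (le_max_right _ _) hρ.le

theorem ballRetract_of_mem {y₀ : Y} {ρ : ℝ} (hρ : 0 < ρ) {y : Y}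
    (hy : y ∈ Metric.closedBall y₀ ρ) : ballRetract y₀ ρ y = y := by
  rw [mem_closedBall_iff_norm] at hy
  rw [ballRetract, max_eq_left hy, div_self hρ.ne', one_smul, add_sub_cancel]

/-- The superposition operator `z ↦ f(t, z(t))` on curves in a closed ball. -/
def superposition (y₀ : Y) {ρ : ℝ} (hρ : 0 < ρ) {f : ℝ → Y → Z}
    (hf : ContinuousOn (fun p : ℝ × Y => f p.1 p.2) (Icc r s ×ˢ Metric.closedBall y₀ ρ))
    (z : C(Icc r s, Y)) : C(Icc r s, Z) where
  toFun t := f t (ballRetract y₀ ρ (z t))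
  continuous_toFun := by
    have := continuous_ballRetract y₀ hρ
    exact hf.comp_continuous (f := fun t : Icc r s => ((t : ℝ), ballRetract y₀ ρ (z t)))
      (by fun_prop) fun t => ⟨t.2, ballRetract_mem y₀ hρ _⟩

/-- Pointwise application of a curve of linear maps. -/
def applyCurve (A : C(Icc r s, Y →L[ℝ] Z)) : C(Icc r s, Y) →L[ℝ] C(Icc r s, Z) :=
  LinearMap.mkContinuous
    { toFun := fun z => ⟨fun t => A t (z t), by fun_prop⟩
      map_add' := fun z w => by ext t; simp
      map_smul' := fun c z => by ext t; simp } ‖A‖ fun z =>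
    (ContinuousMap.norm_le _ (by positivity)).2 fun t => ((A t).le_opNorm _).trans
      (mul_le_mul (A.norm_coe_le_norm t) (z.norm_coe_le_norm t) (norm_nonneg _) (by positivity))

theorem applyCurve_apply (A : C(Icc r s, Y →L[ℝ] Z)) (z : C(Icc r s, Y)) (t : Icc r s) :
    applyCurve A z t = A t (z t) := rfl

/-- On the compact set [r, s] × closed ball, f' is uniformly continuous, so the mean value
inequality on small balls holds with one ε for all times, which is an estimate in the supremum norm.
The retraction only makes `superposition` total; along curves close to z it is the identity. -/
theorem hasStrictFDerivAt_superposition [ProperSpace Y] (y₀ : Y) {ρ : ℝ} (hρ : 0 < ρ)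
    {f : ℝ → Y → Z} {f' : ℝ → Y → Y →L[ℝ] Z}
    (hf : ContinuousOn (fun p : ℝ × Y => f p.1 p.2) (Icc r s ×ˢ Metric.closedBall y₀ ρ))
    (hf' : ContinuousOn (fun p : ℝ × Y => f' p.1 p.2) (Icc r s ×ˢ Metric.closedBall y₀ ρ))
    (hff' : ∀ t ∈ Icc r s, ∀ y ∈ Metric.ball y₀ ρ, HasFDerivAt (f t) (f' t y) y)
    (z : C(Icc r s, Y)) (hz : ∀ t, z t ∈ Metric.ball y₀ ρ) (A : C(Icc r s, Y →L[ℝ] Z))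
    (hA : ∀ t : Icc r s, A t = f' t (z t)) :
    HasStrictFDerivAt (superposition y₀ hρ hf) (applyCurve A) z := by
  have huc : UniformContinuousOn (fun p : ℝ × Y => f' p.1 p.2)
      (Icc r s ×ˢ Metric.closedBall y₀ ρ) :=
    (isCompact_Icc.prod (isCompact_closedBall _ _)).uniformContinuousOn_of_continuous hf'
  -- The range of z is compact in the open ball, so a uniform tube around it stays inside.
  obtain ⟨δ₀, hδ₀, hthick⟩ := (isCompact_range z.continuous).exists_thickening_subset_open
    Metric.isOpen_ball (range_subset_iff.2 hz)
  have hball : ∀ t, Metric.ball (z t) δ₀ ⊆ Metric.ball y₀ ρ := fun t y hy =>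
    hthick (Metric.mem_thickening_iff.2 ⟨z t, mem_range_self t, hy⟩)
  refine .of_isLittleO (Asymptotics.IsLittleO.of_bound fun ε hε => ?_)
  obtain ⟨δ₁, hδ₁, huc⟩ := Metric.uniformContinuousOn_iff.1 huc ε hε
  have hmem : Metric.ball z (min δ₀ δ₁) ×ˢ Metric.ball z (min δ₀ δ₁) ∈ 𝓝 (z, z) :=
    prod_mem_nhds (Metric.ball_mem_nhds _ (lt_min hδ₀ hδ₁)) (Metric.ball_mem_nhds _
      (lt_min hδ₀ hδ₁))
  filter_upwards [hmem] with ⟨p, q⟩ ⟨hp, hq⟩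
  refine (ContinuousMap.norm_le _ (by positivity)).2 fun t => ?_
  have hpt : p t ∈ Metric.ball (z t) (min δ₀ δ₁) :=
    (ContinuousMap.dist_apply_le_dist t).trans_lt hp
  have hqt : q t ∈ Metric.ball (z t) (min δ₀ δ₁) :=
    (ContinuousMap.dist_apply_le_dist t).trans_lt hq
  have hsub : Metric.ball (z t) (min δ₀ δ₁) ⊆ Metric.ball y₀ ρ :=
    (Metric.ball_subset_ball (min_le_left _ _)).trans (hball t)
  have e : ∀ w : C(Icc r s, Y), w t ∈ Metric.ball (z t) (min δ₀ δ₁) →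
      superposition y₀ hρ hf w t = f t (w t) := fun w hw => by
    simp only [superposition, ContinuousMap.coe_mk]
    rw [ballRetract_of_mem hρ (Metric.ball_subset_closedBall (hsub hw))]
  have key := Convex.norm_image_sub_le_of_norm_hasFDerivWithin_le' (f := f t) (f' := f' t)
    (s := Metric.ball (z t) (min δ₀ δ₁)) (φ := f' t (z t)) (C := ε) (x := q t) (y := p t)
    (fun x hx => (hff' t t.2 x (hsub hx)).hasFDerivWithinAt)
    (fun x hx => by
      rw [← dist_eq_norm]
      refine (huc (t, x) ⟨t.2, Metric.ball_subset_closedBall (hsub hx)⟩ (t, z t)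
        ⟨t.2, Metric.ball_subset_closedBall (hz t)⟩ ?_).le
      rw [Prod.dist_eq, dist_self, max_eq_right dist_nonneg]
      exact lt_of_lt_of_le hx (min_le_right _ _)) (convex_ball _ _) hqt hpt
  simp only [ContinuousMap.sub_apply, applyCurve_apply, hA]
  rw [e p hpt, e q hqt]
  exact key.trans (mul_le_mul_of_nonneg_left ((p - q).norm_coe_le_norm t) hε.le)

end Nemytskii

theorem continuousOn_along {Y Z : Type*} [TopologicalSpace Y] [TopologicalSpace Z] {f : ℝ → Y → Z}
    {r s : ℝ} {K : Set Y} (hf : ContinuousOn (fun p : ℝ × Y => f p.1 p.2) (Icc r s ×ˢ K))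
    {y : ℝ → Y} (hy : ContinuousOn y (Icc r s)) (hyK : ∀ t ∈ Icc r s, y t ∈ K) :
    ContinuousOn (fun t => f t (y t)) (Icc r s) :=
  hf.comp (continuousOn_id.prodMk hy) fun t ht => ⟨ht, hyK t ht⟩

theorem continuous_extendCurve_apply {Y Z : Type*} [NormedAddCommGroup Y] [NormedSpace ℝ Y]
    [NormedAddCommGroup Z] [NormedSpace ℝ Z] {r s : ℝ} (hrs : r ≤ s) (A : C(Icc r s, Y →L[ℝ] Z))
    (h : C(Icc r s, Y)) : Continuous fun x => extendCurve hrs A x (extendCurve hrs h x) :=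
  (continuous_extendCurve hrs A).clm_apply (continuous_extendCurve hrs h)

theorem isInvertible_one_sub {Y : Type*} [NormedAddCommGroup Y] [NormedSpace ℝ Y]
    [CompleteSpace Y] {A : Y →L[ℝ] Y} (hA : ‖A‖ < 1) :
    (1 - A : Y →L[ℝ] Y).IsInvertible := by
  obtain ⟨v, hv⟩ := isUnit_one_sub_of_norm_lt_one hA
  exact ⟨ContinuousLinearEquiv.unitsEquiv ℝ _ v, hv⟩

/-! ### The local flow by the implicit function theorem -/

section LocalFlow

variable {Y U : Type*} [NormedAddCommGroup Y] [NormedSpace ℝ Y] [ProperSpace Y]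
  [CompleteSpace Y] [NormedAddCommGroup U] [NormedSpace ℝ U] [CompleteSpace U] {T r s : ℝ}

set_option maxHeartbeats 1600000 in
/-- Solutions of a control system on a short interval depend strictly differentiably on the
initial value and on the control. -/
theorem exists_local_flow (hr : r ∈ Icc 0 T) (hs : s ∈ Icc 0 T) (hrs : r ≤ s) (y₀ : Y) {ρ : ℝ}
    (hρ : 0 < ρ) {f₀ : ℝ → Y → Y} {f₁ : ℝ → Y → U →L[ℝ] Y} {f₀' : ℝ → Y → Y →L[ℝ] Y}
    {f₁' : ℝ → Y → Y →L[ℝ] U →L[ℝ] Y}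
    (hf₀ : ContinuousOn (fun p : ℝ × Y => f₀ p.1 p.2) (Icc r s ×ˢ Metric.closedBall y₀ ρ))
    (hf₁ : ContinuousOn (fun p : ℝ × Y => f₁ p.1 p.2) (Icc r s ×ˢ Metric.closedBall y₀ ρ))
    (hf₀' : ContinuousOn (fun p : ℝ × Y => f₀' p.1 p.2) (Icc r s ×ˢ Metric.closedBall y₀ ρ))
    (hf₁' : ContinuousOn (fun p : ℝ × Y => f₁' p.1 p.2) (Icc r s ×ˢ Metric.closedBall y₀ ρ))
    (hd₀ : ∀ t ∈ Icc r s, ∀ y ∈ Metric.ball y₀ ρ, HasFDerivAt (f₀ t) (f₀' t y) y)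
    (hd₁ : ∀ t ∈ Icc r s, ∀ y ∈ Metric.ball y₀ ρ, HasFDerivAt (f₁ t) (f₁' t y) y)
    (ξ : Control T U) {y : ℝ → Y}
    (hy : Prim y (fun t => f₀ t (y t) + f₁ t (y t) (ξ t)) r s)
    (hyb : ∀ t ∈ Icc r s, y t ∈ Metric.ball y₀ ρ)
    (hsmall : ∫ x in r..s, ‖f₀' x (y x) + (f₁' x (y x)).flip (ξ x)‖ < 1) :
    ∃ (Ψ : Y × Control T U → ℝ → Y) (L : ℝ → Y × Control T U →L[ℝ] Y),
      (∀ᶠ q in 𝓝 (y r, ξ), Ψ q r = q.1 ∧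
        Prim (Ψ q) (fun t => f₀ t (Ψ q t) + f₁ t (Ψ q t) (q.2 t)) r s ∧
        ∀ t ∈ Icc r s, Ψ q t ∈ Metric.ball y₀ ρ) ∧
      (∀ t ∈ Icc r s, Ψ (y r, ξ) t = y t) ∧
      (∀ t ∈ Icc r s, HasStrictFDerivAt (fun q => Ψ q t) (L t) (y r, ξ)) ∧
      ∀ q, L r q = q.1 ∧ Prim (fun t => L t q)
        (fun t => f₀' t (y t) (L t q) + f₁' t (y t) (L t q) (ξ t) + f₁ t (y t) (q.2 t)) r s := by
  obtain ⟨z, hz⟩ : ∃ z : C(Icc r s, Y), ∀ t, z t = y t :=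
    ⟨⟨fun t => y t, continuousOn_iff_continuous_domRestrict.1 hy.continuousOn⟩, fun _ => rfl⟩
  have hzb : ∀ t, z t ∈ Metric.ball y₀ ρ := fun t => by
    rw [hz]; exact hyb t t.2
  have hyK : ∀ t ∈ Icc r s, y t ∈ Metric.closedBall y₀ ρ := fun t ht =>
    Metric.ball_subset_closedBall (hyb t ht)
  have hyc := hy.continuousOn
  obtain ⟨A₀, hA₀⟩ : ∃ A₀ : C(Icc r s, Y →L[ℝ] Y), ∀ t, A₀ t = f₀' t (y t) :=
    ⟨⟨fun t => f₀' t (y t), continuousOn_iff_continuous_domRestrict.1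
      (continuousOn_along hf₀' hyc hyK)⟩, fun _ => rfl⟩
  obtain ⟨A₁, hA₁⟩ : ∃ A₁ : C(Icc r s, Y →L[ℝ] U →L[ℝ] Y), ∀ t, A₁ t = f₁' t (y t) :=
    ⟨⟨fun t => f₁' t (y t), continuousOn_iff_continuous_domRestrict.1
      (continuousOn_along hf₁' hyc hyK)⟩, fun _ => rfl⟩
  set S₀ := superposition y₀ hρ hf₀
  set S₁ := superposition y₀ hρ hf₁
  have hS₀ : HasStrictFDerivAt S₀ (applyCurve A₀) z :=
    hasStrictFDerivAt_superposition y₀ hρ hf₀ hf₀' hd₀ z hzb A₀ fun t => by rw [hz, hA₀]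
  have hS₁ : HasStrictFDerivAt S₁ (applyCurve A₁) z :=
    hasStrictFDerivAt_superposition y₀ hρ hf₁ hf₁' hd₁ z hzb A₁ fun t => by rw [hz, hA₁]
  set I : C(Icc r s, Y) →L[ℝ] C(Icc r s, Y) :=
    volterra hrs (k := fun _ => ContinuousLinearMap.id ℝ Y) (by simp)
  set B : C(Icc r s, U →L[ℝ] Y) →L[ℝ] Control T U →L[ℝ] C(Icc r s, Y) :=
    controlIntegral hr hs hrs
  -- The zeros of G are the solutions of the integral equation with initial value `p.1.1` and
  -- control `p.1.2`. The implicit function theorem is applied at the given solution.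
  set G : (Y × Control T U) × C(Icc r s, Y) → C(Icc r s, Y) := fun p =>
    p.2 - ContinuousLinearMap.const ℝ (Icc r s) p.1.1 - I (S₀ p.2) - B (S₁ p.2) p.1.2
  set u : (Y × Control T U) × C(Icc r s, Y) := ((y r, ξ), z)
  have hGd : ∃ G' : (Y × Control T U) × C(Icc r s, Y) →L[ℝ] C(Icc r s, Y),
      HasStrictFDerivAt G G' u ∧ ∀ q h, G' (q, h) = h - ContinuousLinearMap.const ℝ (Icc r s) q.1
        - I (applyCurve A₀ h) - (B (S₁ z) q.2 + B (applyCurve A₁ h) ξ) := by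
    have h2 : HasStrictFDerivAt (fun p : (Y × Control T U) × C(Icc r s, Y) => p.2)
      (ContinuousLinearMap.snd ℝ _ _) u := hasStrictFDerivAt_snd
    have h1 : HasStrictFDerivAt (fun p : (Y × Control T U) × C(Icc r s, Y) => p.1)
      (ContinuousLinearMap.fst ℝ _ _) u := hasStrictFDerivAt_fst
    have h3 := ((h2.sub ((ContinuousLinearMap.const ℝ (Icc r s)).hasStrictFDerivAt.comp u
      h1.fst)).sub (I.hasStrictFDerivAt.comp u (hS₀.comp u h2))).sub
      (B.hasStrictFDerivAt_of_bilinear (hS₁.comp u h2) h1.snd)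
    exact ⟨_, h3, fun q h => by simp; rfl⟩
  obtain ⟨G', hG', hG'a⟩ := hGd
  have hk : IntervalIntegrable (fun x => f₀' x (y x) + (f₁' x (y x)).flip (ξ x)) volume r s := by
    refine (ContinuousOn.intervalIntegrable_of_Icc hrs (continuousOn_along hf₀' hyc hyK)).add ?_
    refine ξ.intervalIntegrable_clm hr hs hrs (A := fun x => (f₁' x (y x)).flip) ?_
    exact (ContinuousLinearMap.flipₗᵢ ℝ Y U Y).continuous.comp_continuousOn (continuousOn_along hf₁' hyc hyK)
  -- In the direction of the curve the derivative is 1 minus the Volterra operator of the linearized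
  -- equation, invertible by `hsmall`.
  have hinv : (G' ∘L .inr ℝ _ _).IsInvertible := by
    have hn : ‖volterra hrs hk‖ < 1 := (norm_volterra_le hrs hk).trans_lt hsmall
    have e : G' ∘L .inr ℝ (Y × Control T U) C(Icc r s, Y) = 1 - volterra hrs hk := by
      ext h t
      rw [ContinuousLinearMap.comp_apply, ContinuousLinearMap.inr_apply, hG'a]
      have hI1 : IntervalIntegrable (fun x => extendCurve hrs A₀ x (extendCurve hrs h x))
          volume r t := (((continuous_extendCurve hrs A₀).clm_apply
            (continuous_extendCurve hrs h))).intervalIntegrable _ _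
      have hI2 : IntervalIntegrable (fun x => (extendCurve hrs A₁ x : Y →L[ℝ] U →L[ℝ] Y) (extendCurve hrs h x) (ξ x))
          volume r t := ξ.intervalIntegrable_clm hr ⟨hr.1.trans t.2.1, t.2.2.trans hs.2⟩ t.2.1
            (continuous_extendCurve_apply hrs A₁ h).continuousOn
      have hv : volterra hrs hk h t = (∫ x in r..t, extendCurve hrs A₀ x (extendCurve hrs h x))
          + ∫ x in r..t, (extendCurve hrs A₁ x : Y →L[ℝ] U →L[ℝ] Y) (extendCurve hrs h x) (ξ x) := by
        rw [← intervalIntegral.integral_add hI1 hI2, volterra_apply]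
        refine intervalIntegral.integral_congr fun x hx => ?_
        rw [uIcc_of_le t.2.1] at hx
        have hx' : x ∈ Icc r s := ⟨hx.1, hx.2.trans t.2.2⟩
        simp [extendCurve_apply hrs _ hx', projIcc_of_mem hrs hx', hA₀, hA₁]
      change h t - (0 : Y) - (∫ x in r..t, extendCurve hrs A₀ x (extendCurve hrs h x))
        - ((B (S₁ z) 0) t + ∫ x in r..t,
            (extendCurve hrs A₁ x : Y →L[ℝ] U →L[ℝ] Y) (extendCurve hrs h x) (ξ x))
        = h t - volterra hrs hk h t
      rw [hv, map_zero, ContinuousMap.zero_apply]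
      abel
    rw [e]
    exact isInvertible_one_sub hn
  have hGu : G u = 0 := by
    ext t
    have e1 := hy.2 t t.2
    have hI1 : IntervalIntegrable (fun x => f₀ x (y x)) volume r t :=
      ((continuousOn_along hf₀ hyc hyK).mono (Icc_subset_Icc_right t.2.2)).intervalIntegrable_of_Icc t.2.1
    have hI2 : IntervalIntegrable (fun x => f₁ x (y x) (ξ x)) volume r t :=
      ξ.intervalIntegrable_clm hr ⟨hr.1.trans t.2.1, t.2.2.trans hs.2⟩ t.2.1
        ((continuousOn_along hf₁ hyc hyK).mono (Icc_subset_Icc_right t.2.2))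
    rw [intervalIntegral.integral_add hI1 hI2] at e1
    have hS : ∀ x, ∀ hx : x ∈ Icc r s, S₀ z ⟨x, hx⟩ = f₀ x (y x) ∧ S₁ z ⟨x, hx⟩ = f₁ x (y x) :=
      fun x hx => by
        simp only [S₀, S₁, superposition, ContinuousMap.coe_mk, hz]
        rw [ballRetract_of_mem hρ (Metric.ball_subset_closedBall (hyb x hx))]
        exact ⟨rfl, rfl⟩
    have e2 : I (S₀ z) t = ∫ x in r..t, f₀ x (y x) := by
      refine intervalIntegral.integral_congr fun x hx => ?_
      rw [uIcc_of_le t.2.1] at hx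
      have hx' : x ∈ Icc r s := ⟨hx.1, hx.2.trans t.2.2⟩
      simp [projIcc_of_mem hrs hx', hS x hx']
    have e3 : B (S₁ z) ξ t = ∫ x in r..t, f₁ x (y x) (ξ x) := by
      refine intervalIntegral.integral_congr fun x hx => ?_
      rw [uIcc_of_le t.2.1] at hx
      have hx' : x ∈ Icc r s := ⟨hx.1, hx.2.trans t.2.2⟩
      simp [extendCurve_apply hrs _ hx', hS x hx']
    change z t - y r - I (S₀ z) t - B (S₁ z) ξ t = 0
    rw [hz]
    rw [e1, e2, e3]
    abel
  set Ψ₀ := hG'.implicitFunctionOfProdDomain hinv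
  have hΨd := hG'.hasStrictFDerivAt_implicitFunctionOfProdDomain hinv
  set L₀ := -(G' ∘L .inr ℝ _ _).inverse ∘L (G' ∘L .inl ℝ (Y × Control T U) C(Icc r s, Y))
  have hΨz : Ψ₀ (y r, ξ) = z :=
    (hG'.eventually_apply_eq_iff_implicitFunctionOfProdDomain hinv).self_of_nhds.1 rfl
  -- The derivative of the implicit function is characterized by this identity, which unfolds to the
  -- integrated variational equation.
  have hL₀ : ∀ q, G' (q, L₀ q) = 0 := by
    intro q
    have h1 : G' (q, L₀ q) = (G' ∘L .inl ℝ _ _) q + (G' ∘L .inr ℝ _ _) (L₀ q) := by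
      simp [← map_add]
    obtain ⟨e, he⟩ := hinv
    rw [h1]
    simp only [L₀, ← he, ContinuousLinearMap.inverse_equiv]
    simp
  have hev := (hG'.eventually_apply_implicitFunctionOfProdDomain hinv)
  -- Nearby implicit solutions stay in the open ball, where the retraction does nothing, so they
  -- solve the original equation.
  have hopen : ∀ᶠ q in 𝓝 (y r, ξ), ∀ t, Ψ₀ q t ∈ Metric.ball y₀ ρ := by
    obtain ⟨δ₀, hδ₀, hthick⟩ := (isCompact_range z.continuous).exists_thickening_subset_open
      Metric.isOpen_ball (range_subset_iff.2 hzb)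
    have ht := hG'.tendsto_implicitFunctionOfProdDomain hinv
    filter_upwards [ht (Metric.ball_mem_nhds _ hδ₀)] with q hq t
    exact hthick (Metric.mem_thickening_iff.2 ⟨z t, mem_range_self t,
      (ContinuousMap.dist_apply_le_dist t).trans_lt hq⟩)
  refine ⟨fun q => extendCurve hrs (Ψ₀ q), fun t => ContinuousMap.evalCLM ℝ (projIcc r s hrs t) ∘L L₀,
    ?_, ?_, ?_, ?_⟩
  · filter_upwards [hev, hopen] with q hq hqb
    rw [hGu] at hq
    set w := Ψ₀ q
    have hqb' : ∀ t ∈ Icc r s, extendCurve hrs w t ∈ Metric.ball y₀ ρ := fun t _ => hqb _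
    have hwK : ∀ t ∈ Icc r s, extendCurve hrs w t ∈ Metric.closedBall y₀ ρ := fun t ht =>
      Metric.ball_subset_closedBall (hqb' t ht)
    have hwcc := (continuous_extendCurve hrs w).continuousOn (s := Icc r s)
    have hS : ∀ x, ∀ hx : x ∈ Icc r s, S₀ w ⟨x, hx⟩ = f₀ x (extendCurve hrs w x) ∧
        S₁ w ⟨x, hx⟩ = f₁ x (extendCurve hrs w x) := fun x hx => by
      simp only [S₀, S₁, superposition, ContinuousMap.coe_mk]
      rw [extendCurve_apply hrs w hx, ballRetract_of_mem hρ (Metric.ball_subset_closedBall (hqb _))]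
      exact ⟨rfl, rfl⟩
    have hint : IntervalIntegrable (fun t => f₀ t (extendCurve hrs w t)
        + f₁ t (extendCurve hrs w t) (q.2 t)) volume r s :=
      ((continuousOn_along hf₀ hwcc hwK).intervalIntegrable_of_Icc hrs).add (q.2.intervalIntegrable_clm hr hs hrs (continuousOn_along hf₁ hwcc hwK))
    have heq : ∀ t ∈ Icc r s, extendCurve hrs w t = q.1 + ∫ x in r..t,
        (f₀ x (extendCurve hrs w x) + f₁ x (extendCurve hrs w x) (q.2 x)) := by
      intro t ht
      have h0 := DFunLike.congr_fun hq ⟨t, ht⟩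
      have hI1 : IntervalIntegrable (fun x => f₀ x (extendCurve hrs w x)) volume r t :=
        ((continuousOn_along hf₀ hwcc hwK).mono (Icc_subset_Icc_right ht.2)).intervalIntegrable_of_Icc ht.1
      have hI2 : IntervalIntegrable (fun x => f₁ x (extendCurve hrs w x) (q.2 x)) volume r t :=
        q.2.intervalIntegrable_clm hr ⟨hr.1.trans ht.1, ht.2.trans hs.2⟩ ht.1
          ((continuousOn_along hf₁ hwcc hwK).mono (Icc_subset_Icc_right ht.2))
      have e2 : I (S₀ w) ⟨t, ht⟩ = ∫ x in r..t, f₀ x (extendCurve hrs w x) := by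
        refine intervalIntegral.integral_congr fun x hx => ?_
        rw [uIcc_of_le ht.1] at hx
        have hx' : x ∈ Icc r s := ⟨hx.1, hx.2.trans ht.2⟩
        simp [projIcc_of_mem hrs hx', hS x hx']
      have e3 : B (S₁ w) q.2 ⟨t, ht⟩ = ∫ x in r..t, f₁ x (extendCurve hrs w x) (q.2 x) := by
        refine intervalIntegral.integral_congr fun x hx => ?_
        rw [uIcc_of_le ht.1] at hx
        have hx' : x ∈ Icc r s := ⟨hx.1, hx.2.trans ht.2⟩
        change extendCurve hrs (S₁ w) x (q.2 x) = _
        rw [extendCurve_apply hrs _ hx', (hS x hx').2]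
      change w ⟨t, ht⟩ - q.1 - I (S₀ w) ⟨t, ht⟩ - B (S₁ w) q.2 ⟨t, ht⟩ = 0 at h0
      rw [e2, e3] at h0
      rw [intervalIntegral.integral_add hI1 hI2, extendCurve_apply hrs w ht, ← sub_eq_zero, ← h0]
      abel
    have h0 : extendCurve hrs w r = q.1 := by simpa using heq r ⟨le_rfl, hrs⟩
    exact ⟨h0, ⟨hint, fun t ht => by rw [heq t ht, h0, add_sub_cancel_left]⟩, hqb'⟩
  · intro t ht
    change extendCurve hrs (Ψ₀ (y r, ξ)) t = y t
    rw [extendCurve_apply hrs _ ht, hΨz, hz]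
  · intro t ht
    exact (ContinuousMap.evalCLM ℝ (projIcc r s hrs t)).hasStrictFDerivAt.comp _ hΨd
  · intro q
    set h := L₀ q
    have hq := hL₀ q
    rw [hG'a] at hq
    have hint0 : ∀ t ∈ Icc r s, IntervalIntegrable (fun x => f₀' x (y x) (extendCurve hrs h x)
        + f₁' x (y x) (extendCurve hrs h x) (ξ x)) volume r t ∧
        IntervalIntegrable (fun x => f₁ x (y x) (q.2 x)) volume r t := fun t ht => by
      refine ⟨?_, ?_⟩
      · exact (intervalIntegrable_clm_apply hrs hk
          (continuous_extendCurve hrs h).continuousOn).mono_set (by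
            rw [uIcc_of_le hrs, uIcc_of_le ht.1]; exact Icc_subset_Icc_right ht.2)
      · exact q.2.intervalIntegrable_clm hr ⟨hr.1.trans ht.1, ht.2.trans hs.2⟩ ht.1
          ((continuousOn_along hf₁ hyc hyK).mono (Icc_subset_Icc_right ht.2))
    have heq : ∀ t ∈ Icc r s, extendCurve hrs h t = q.1 + ∫ x in r..t,
        (f₀' x (y x) (extendCurve hrs h x) + f₁' x (y x) (extendCurve hrs h x) (ξ x)
          + f₁ x (y x) (q.2 x)) := by
      intro t ht
      have h0 := DFunLike.congr_fun hq ⟨t, ht⟩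
      have hI1 : IntervalIntegrable (fun x => f₀' x (y x) (extendCurve hrs h x))
          volume r t := (((continuousOn_along hf₀' hyc hyK).clm_apply
            (continuous_extendCurve hrs h).continuousOn).mono
            (Icc_subset_Icc_right ht.2)).intervalIntegrable_of_Icc ht.1
      have hI2 : IntervalIntegrable (fun x => f₁' x (y x) (extendCurve hrs h x) (ξ x))
          volume r t := ξ.intervalIntegrable_clm hr ⟨hr.1.trans ht.1, ht.2.trans hs.2⟩ ht.1
            (((continuousOn_along hf₁' hyc hyK).clm_apply (continuous_extendCurve hrs h).continuousOn).mono
              (Icc_subset_Icc_right ht.2))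
      have e1 : I (applyCurve A₀ h) ⟨t, ht⟩ = ∫ x in r..t, f₀' x (y x) (extendCurve hrs h x) := by
        refine intervalIntegral.integral_congr fun x hx => ?_
        rw [uIcc_of_le ht.1] at hx
        have hx' : x ∈ Icc r s := ⟨hx.1, hx.2.trans ht.2⟩
        simp [projIcc_of_mem hrs hx', extendCurve_apply hrs _ hx', applyCurve_apply, hA₀]
      have e2 : B (applyCurve A₁ h) ξ ⟨t, ht⟩
          = ∫ x in r..t, f₁' x (y x) (extendCurve hrs h x) (ξ x) := by
        refine intervalIntegral.integral_congr fun x hx => ?_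
        rw [uIcc_of_le ht.1] at hx
        have hx' : x ∈ Icc r s := ⟨hx.1, hx.2.trans ht.2⟩
        simp [extendCurve_apply hrs _ hx', applyCurve_apply, hA₁]
      have e3 : B (S₁ z) q.2 ⟨t, ht⟩ = ∫ x in r..t, f₁ x (y x) (q.2 x) := by
        refine intervalIntegral.integral_congr fun x hx => ?_
        rw [uIcc_of_le ht.1] at hx
        have hx' : x ∈ Icc r s := ⟨hx.1, hx.2.trans ht.2⟩
        simp only [extendCurve_apply hrs _ hx', S₁, superposition, ContinuousMap.coe_mk, hz]
        rw [ballRetract_of_mem hρ (Metric.ball_subset_closedBall (hyb x hx'))]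
      change h ⟨t, ht⟩ - q.1 - I (applyCurve A₀ h) ⟨t, ht⟩ - (B (S₁ z) q.2 ⟨t, ht⟩
        + B (applyCurve A₁ h) ξ ⟨t, ht⟩) = 0 at h0
      rw [e1, e2, e3] at h0
      rw [intervalIntegral.integral_add (hint0 t ht).1 (hint0 t ht).2,
        intervalIntegral.integral_add hI1 hI2, extendCurve_apply hrs h ht, ← sub_eq_zero, ← h0]
      abel
    have h0 : extendCurve hrs h r = q.1 := by simpa using heq r ⟨le_rfl, hrs⟩
    have hs' := hint0 s ⟨hrs, le_rfl⟩
    exact ⟨h0, hs'.1.add hs'.2, fun t ht => by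
      change extendCurve hrs h t - extendCurve hrs h r = _
      rw [heq t ht, h0, add_sub_cancel_left]; rfl⟩

end LocalFlow

/-! ### Charts -/

section Charts

set_option linter.unusedSectionVars false

/-- Euclidean space. -/
abbrev Eu (d : ℕ) : Type := EuclideanSpace ℝ (Fin d)

variable {d : ℕ} {M : Type*} [TopologicalSpace M] [ChartedSpace (EuclideanSpace ℝ (Fin d)) M]
  [IsManifold (𝓡 d) ∞ M]

instance : IsManifold (𝓡 d) 1 M := IsManifold.of_le (n := ∞) (by simp)

/-- The identification of a tangent space with Euclidean space by the preferred chart. -/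
def toE (x : M) : TangentSpace (𝓡 d) x ≃L[ℝ] Eu d := ContinuousLinearEquiv.refl ℝ (Eu d)

/-- The derivative of the chart at `x₀`. -/
def toChart (x₀ x : M) : TangentSpace (𝓡 d) x →L[ℝ] Eu d :=
  (trivializationAt (Eu d) (TangentSpace (𝓡 d) : M → Type _) x₀).continuousLinearMapAt ℝ x

/-- The inverse of the derivative of the chart at `x₀`. -/
def fromChart (x₀ x : M) : Eu d →L[ℝ] TangentSpace (𝓡 d) x :=
  (trivializationAt (Eu d) (TangentSpace (𝓡 d) : M → Type _) x₀).symmL ℝ x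

/-- The point with given coordinates in the chart at `x₀`. -/
def ofChart (x₀ : M) (y : Eu d) : M := (extChartAt (𝓡 d) x₀).symm y

/-- The representation of a vector field in the chart at `x₀`. -/
def rep (x₀ : M) (X : (x : M) → TangentSpace (𝓡 d) x) (y : Eu d) : Eu d :=
  toChart x₀ (ofChart x₀ y) (X (ofChart x₀ y))

theorem isOpen_target (x₀ : M) : IsOpen (extChartAt (𝓡 d) x₀).target :=
  isOpen_extChartAt_target x₀

theorem ofChart_mem {x₀ : M} {y : Eu d} (hy : y ∈ (extChartAt (𝓡 d) x₀).target) :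
    ofChart x₀ y ∈ (chartAt (Eu d) x₀).source := by
  have h := (extChartAt (𝓡 d) x₀).map_target hy
  rwa [extChartAt_source] at h

theorem extChartAt_mem {x₀ x : M} (hx : x ∈ (chartAt (Eu d) x₀).source) :
    extChartAt (𝓡 d) x₀ x ∈ (extChartAt (𝓡 d) x₀).target :=
  (extChartAt (𝓡 d) x₀).map_source (by simpa using hx)

theorem extChartAt_ofChart {x₀ : M} {y : Eu d} (hy : y ∈ (extChartAt (𝓡 d) x₀).target) :
    extChartAt (𝓡 d) x₀ (ofChart x₀ y) = y := (extChartAt (𝓡 d) x₀).right_inv hy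

theorem ofChart_extChartAt {x₀ x : M} (hx : x ∈ (chartAt (Eu d) x₀).source) :
    ofChart x₀ (extChartAt (𝓡 d) x₀ x) = x := (extChartAt (𝓡 d) x₀).left_inv (by simpa using hx)

theorem toChart_fromChart {x₀ x : M} (hx : x ∈ (chartAt (Eu d) x₀).source) (v : Eu d) :
    toChart x₀ x (fromChart x₀ x v) = v :=
  (trivializationAt (Eu d) (TangentSpace (𝓡 d) : M → Type _) x₀).continuousLinearMapAt_symmL
    (by simpa using hx) v

theorem fromChart_toChart {x₀ x : M} (hx : x ∈ (chartAt (Eu d) x₀).source)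
    (v : TangentSpace (𝓡 d) x) : fromChart x₀ x (toChart x₀ x v) = v :=
  (trivializationAt (Eu d) (TangentSpace (𝓡 d) : M → Type _) x₀).symmL_continuousLinearMapAt
    (by simpa using hx) v

theorem toChart_eq_mfderiv {x₀ x : M} (hx : x ∈ (chartAt (Eu d) x₀).source)
    (v : TangentSpace (𝓡 d) x) :
    toChart x₀ x v = (mfderiv (𝓡 d) 𝓘(ℝ, Eu d) (extChartAt (𝓡 d) x₀) x v : Eu d) := by
  rw [toChart, TangentBundle.continuousLinearMapAt_trivializationAt hx]
  rfl

theorem toChart_eq_snd {x₀ x : M} (hx : x ∈ (chartAt (Eu d) x₀).source)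
    (v : TangentSpace (𝓡 d) x) :
    toChart x₀ x v
      = (trivializationAt (Eu d) (TangentSpace (𝓡 d) : M → Type _) x₀ ⟨x, v⟩).2 := by
  have := (trivializationAt (Eu d) (TangentSpace (𝓡 d) : M → Type _) x₀).coe_linearMapAt_of_mem
    (R := ℝ) (b := x) (by simpa using hx)
  exact congrFun this v

theorem contMDiffOn_ofChart (x₀ : M) :
    ContMDiffOn 𝓘(ℝ, Eu d) (𝓡 d) ∞ (ofChart x₀) (extChartAt (𝓡 d) x₀).target :=
  contMDiffOn_extChartAt_symm x₀

theorem isOpen_ofChart_preimage (x₀ : M) {U : Set M} (hU : IsOpen U) :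
    IsOpen ((extChartAt (𝓡 d) x₀).target ∩ ofChart x₀ ⁻¹' U) :=
  (contMDiffOn_ofChart x₀).continuousOn.isOpen_inter_preimage (isOpen_target x₀) hU

theorem isOpen_extChartAt_preimage'' (x₀ : M) {O : Set (Eu d)} (hO : IsOpen O) :
    IsOpen ((chartAt (Eu d) x₀).source ∩ extChartAt (𝓡 d) x₀ ⁻¹' O) := by
  simpa using isOpen_extChartAt_preimage' (I := 𝓡 d) x₀ hO

variable {F : Type*} [NormedAddCommGroup F] [NormedSpace ℝ F]

theorem contDiffOn_comp_ofChart {x₀ : M} {g : M → F} {U : Set M}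
    (hg : ContMDiffOn (𝓡 d) 𝓘(ℝ, F) ∞ g U) :
    ContDiffOn ℝ ∞ (fun y => g (ofChart x₀ y))
      ((extChartAt (𝓡 d) x₀).target ∩ ofChart x₀ ⁻¹' U) := by
  rw [← contMDiffOn_iff_contDiffOn]
  exact hg.comp ((contMDiffOn_ofChart x₀).mono inter_subset_left) fun y hy => hy.2

theorem contMDiffOn_comp_extChartAt {x₀ : M} {f : Eu d → F} {O : Set (Eu d)}
    (hf : ContDiffOn ℝ ∞ f O) :
    ContMDiffOn (𝓡 d) 𝓘(ℝ, F) ∞ (fun x => f (extChartAt (𝓡 d) x₀ x))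
      ((chartAt (Eu d) x₀).source ∩ extChartAt (𝓡 d) x₀ ⁻¹' O) := by
  rw [← contMDiffOn_iff_contDiffOn] at hf
  exact hf.comp ((contMDiffOn_extChartAt (x := x₀)).mono inter_subset_left) fun y hy => hy.2

theorem hasMFDerivAt_comp_extChartAt {x₀ x : M} (hx : x ∈ (chartAt (Eu d) x₀).source) {f : Eu d → F}
    {f' : Eu d →L[ℝ] F} (hf : HasFDerivAt f f' (extChartAt (𝓡 d) x₀ x)) :
    HasMFDerivAt (𝓡 d) 𝓘(ℝ, F) (fun x => f (extChartAt (𝓡 d) x₀ x)) x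
      (f' ∘L (mfderiv (𝓡 d) 𝓘(ℝ, Eu d) (extChartAt (𝓡 d) x₀) x)) :=
  hf.hasMFDerivAt.comp x (mdifferentiableAt_extChartAt hx).hasMFDerivAt

theorem eventuallyEq_comp_chart {x₀ x : M} (hx : x ∈ (chartAt (Eu d) x₀).source) (g : M → F) :
    (fun x => (fun y => g (ofChart x₀ y)) (extChartAt (𝓡 d) x₀ x)) =ᶠ[𝓝 x] g := by
  filter_upwards [(chartAt (Eu d) x₀).open_source.mem_nhds hx] with z hz
  simp only [ofChart_extChartAt hz]

theorem mdifferentiableAt_iff_rep {x₀ x : M} (hx : x ∈ (chartAt (Eu d) x₀).source) {g : M → F} :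
    MDifferentiableAt (𝓡 d) 𝓘(ℝ, F) g x ↔
      DifferentiableAt ℝ (fun y => g (ofChart x₀ y)) (extChartAt (𝓡 d) x₀ x) := by
  refine ⟨fun h => ?_, fun h => ?_⟩
  · rw [← mdifferentiableAt_iff_differentiableAt]
    have h1 : MDifferentiableAt 𝓘(ℝ, Eu d) (𝓡 d) (ofChart x₀) (extChartAt (𝓡 d) x₀ x) :=
      ((contMDiffOn_ofChart x₀).contMDiffAt
        ((isOpen_target x₀).mem_nhds (extChartAt_mem hx))).mdifferentiableAt (by simp)
    rw [← ofChart_extChartAt hx] at h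
    exact h.comp (extChartAt (𝓡 d) x₀ x) h1
  · exact (hasMFDerivAt_comp_extChartAt hx h.hasFDerivAt).mdifferentiableAt.congr_of_eventuallyEq
      (eventuallyEq_comp_chart hx g).symm

theorem mfderiv_eq_rep {x₀ x : M} (hx : x ∈ (chartAt (Eu d) x₀).source) {g : M → F}
    (hg : MDifferentiableAt (𝓡 d) 𝓘(ℝ, F) g x) (v : TangentSpace (𝓡 d) x) :
    (mfderiv (𝓡 d) 𝓘(ℝ, F) g x v : F)
      = fderiv ℝ (fun y => g (ofChart x₀ y)) (extChartAt (𝓡 d) x₀ x) (toChart x₀ x v) := by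
  have h := (hasMFDerivAt_comp_extChartAt hx
    ((mdifferentiableAt_iff_rep hx).1 hg).hasFDerivAt).congr_of_eventuallyEq
      (eventuallyEq_comp_chart hx g).symm
  rw [h.mfderiv, toChart_eq_mfderiv hx]
  rfl

theorem smoothFieldOn_iff {x₀ : M} {X : (x : M) → TangentSpace (𝓡 d) x} {U : Set M}
    (hU : IsOpen U) (hUs : U ⊆ (chartAt (Eu d) x₀).source) :
    SmoothFieldOn X U ↔ ContMDiffOn (𝓡 d) 𝓘(ℝ, Eu d) ∞ (fun x => toChart x₀ x (X x)) U := by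
  have h := Bundle.Trivialization.contMDiffOn_section_iff (IB := 𝓡 d) (n := ∞)
    (trivializationAt (Eu d) (TangentSpace (𝓡 d) : M → Type _) x₀) (s := X) hU (by simpa using hUs)
  refine h.trans (contMDiffOn_congr fun x hx => ?_)
  exact (toChart_eq_snd (hUs hx) _).symm

theorem SmoothFieldOn.contDiffOn_rep {x₀ : M} {X : (x : M) → TangentSpace (𝓡 d) x} {U : Set M}
    (hX : SmoothFieldOn X U) (hU : IsOpen U) :
    ContDiffOn ℝ ∞ (rep x₀ X) ((extChartAt (𝓡 d) x₀).target ∩ ofChart x₀ ⁻¹' U) := by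
  have h := (smoothFieldOn_iff (hU.inter (chartAt (Eu d) x₀).open_source) inter_subset_right).1
    (ContMDiffOn.mono hX inter_subset_left)
  exact (contDiffOn_comp_ofChart (x₀ := x₀) h).mono fun y hy => ⟨hy.1, hy.2, ofChart_mem hy.1⟩

theorem smoothFieldOn_of_rep {x₀ : M} {X : (x : M) → TangentSpace (𝓡 d) x} {O : Set (Eu d)}
    (hO : IsOpen O) (hX : ContDiffOn ℝ ∞ (rep x₀ X) O) :
    SmoothFieldOn X ((chartAt (Eu d) x₀).source ∩ extChartAt (𝓡 d) x₀ ⁻¹' O) := by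
  refine (smoothFieldOn_iff (isOpen_extChartAt_preimage'' x₀ hO) inter_subset_left).2
    ((contMDiffOn_comp_extChartAt hX).congr fun x hx => ?_)
  rw [rep, ofChart_extChartAt hx.1]

/-- Differentiability of a vector field at a point. -/
def FieldDiffAt (X : (x : M) → TangentSpace (𝓡 d) x) (x : M) : Prop :=
  MDifferentiableAt (𝓡 d) ((𝓡 d).prod (𝓡 d)) (fun x => (⟨x, X x⟩ : TangentBundle (𝓡 d) M)) x

theorem SmoothFieldOn.fieldDiffAt {X : (x : M) → TangentSpace (𝓡 d) x} {U : Set M} {x : M}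
    (hX : SmoothFieldOn X U) (hU : U ∈ 𝓝 x) : FieldDiffAt X x :=
  (ContMDiffOn.contMDiffAt hX hU).mdifferentiableAt (by simp)

theorem fieldDiffAt_iff {x₀ x : M} {X : (x : M) → TangentSpace (𝓡 d) x}
    (hx : x ∈ (chartAt (Eu d) x₀).source) :
    FieldDiffAt X x ↔ MDifferentiableAt (𝓡 d) 𝓘(ℝ, Eu d) (fun x => toChart x₀ x (X x)) x := by
  have h := Bundle.Trivialization.mdifferentiableAt_section_iff (𝓡 d)
    (trivializationAt (Eu d) (TangentSpace (𝓡 d) : M → Type _) x₀) X (b₀ := x) (by simpa using hx)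
  refine h.trans (Filter.EventuallyEq.mdifferentiableAt_iff ?_)
  filter_upwards [(chartAt (Eu d) x₀).open_source.mem_nhds hx] with z hz
  exact (toChart_eq_snd hz _).symm

theorem fieldDiffAt_iff_rep {x₀ x : M} {X : (x : M) → TangentSpace (𝓡 d) x}
    (hx : x ∈ (chartAt (Eu d) x₀).source) :
    FieldDiffAt X x ↔ DifferentiableAt ℝ (rep x₀ X) (extChartAt (𝓡 d) x₀ x) :=
  (fieldDiffAt_iff hx).trans (mdifferentiableAt_iff_rep hx)

variable [T2Space M]

theorem exists_bump {x₀ : M} {U : Set M} (hU : U ∈ 𝓝 x₀) :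
    ∃ ψ : M → ℝ, ContMDiff (𝓡 d) 𝓘(ℝ, ℝ) ∞ ψ ∧ tsupport ψ ⊆ U ∧ ∀ᶠ x in 𝓝 x₀, ψ x = 1 := by
  obtain ⟨f, hf, -⟩ := (SmoothBumpFunction.nhds_basis_support (I := 𝓡 d) hU).mem_iff.1
    Filter.univ_mem
  exact ⟨f, f.contMDiff, hf, f.eventuallyEq_one⟩

end Charts

/-! ### Connections in charts -/

section ChartModel

set_option linter.unusedSectionVars false

variable {d : ℕ} {M : Type*} [TopologicalSpace M] [ChartedSpace (EuclideanSpace ℝ (Fin d)) M]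
  [IsManifold (𝓡 d) ∞ M]

/-- An affine connection on `M`. -/
abbrev Connection (d : ℕ) (M : Type*) [TopologicalSpace M]
    [ChartedSpace (EuclideanSpace ℝ (Fin d)) M] [IsManifold (𝓡 d) ∞ M] :=
  CovariantDerivative (𝓡 d) (EuclideanSpace ℝ (Fin d)) (TangentSpace (𝓡 d) : M → Type _)

/-- A local description of a connection in the chart at `x₀`, together with global functions and
vector fields that extend the coordinates and the coordinate fields. -/
structure ChartModel (cov : Connection d M) (x₀ : M) where
  O : Set (Eu d)
  isOpen : IsOpen O
  mem : extChartAt (𝓡 d) x₀ x₀ ∈ O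
  subset : O ⊆ (extChartAt (𝓡 d) x₀).target
  Γ : Eu d → Eu d →L[ℝ] Eu d →L[ℝ] Eu d
  smooth : ContDiffOn ℝ ∞ Γ O
  cov_eq : ∀ y ∈ O, ∀ X : (x : M) → TangentSpace (𝓡 d) x, FieldDiffAt X (ofChart x₀ y) →
    ∀ v, toChart x₀ (ofChart x₀ y) (cov X (ofChart x₀ y) v)
      = fderiv ℝ (rep x₀ X) y (toChart x₀ _ v) + Γ y (toChart x₀ _ v) (rep x₀ X y)
  coord : M → Eu d
  coord_smooth : ContMDiff (𝓡 d) 𝓘(ℝ, Eu d) ∞ coord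
  coord_eq : ∀ y ∈ O, coord (ofChart x₀ y) = y
  field : Eu d → (x : M) → TangentSpace (𝓡 d) x
  field_smooth : ∀ w, SmoothFieldOn (field w) univ
  field_eq : ∀ w, ∀ y ∈ O, rep x₀ (field w) y = w

theorem cov_congr (cov : Connection d M) {X Y : (x : M) → TangentSpace (𝓡 d) x} {x : M}
    (hX : FieldDiffAt X x) (h : ∀ᶠ z in 𝓝 x, X z = Y z) : cov X x = cov Y x := by
  have hY : FieldDiffAt Y x := by
    refine MDifferentiableAt.congr_of_eventuallyEq hX ?_
    filter_upwards [h] with z hz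
    rw [hz]
  exact cov.isCovariantDerivativeOnUniv.congr_of_eventuallyEq hX hY Filter.univ_mem h

/-- The derivative of `g` in the direction of a tangent vector. -/
def dir {F : Type*} [NormedAddCommGroup F] [NormedSpace ℝ F] (g : M → F) (x : M)
    (v : TangentSpace (𝓡 d) x) : F := mfderiv (𝓡 d) 𝓘(ℝ, F) g x v

/-- Additivity and the Leibniz rule, by induction. Differentiability of the partial sum is part of
the statement because additivity needs it at each step. -/
theorem cov_sum_smul (cov : Connection d M) {ι : Type*} (s : Finset ι)
    {X : ι → (x : M) → TangentSpace (𝓡 d) x} {c : ι → M → ℝ} {x : M}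
    (hX : ∀ i, FieldDiffAt (X i) x) (hc : ∀ i, MDifferentiableAt (𝓡 d) 𝓘(ℝ, ℝ) (c i) x)
    (v : TangentSpace (𝓡 d) x) :
    FieldDiffAt (fun z => ∑ i ∈ s, c i z • X i z) x ∧
    cov (fun z => ∑ i ∈ s, c i z • X i z) x v
      = ∑ i ∈ s, (c i x • cov (X i) x v
        + dir (c i) x v • X i x) := by
  classical
  induction s using Finset.induction_on with
  | empty =>
    simp only [Finset.sum_empty]
    have h0 := cov.isCovariantDerivativeOnUniv.zero (x := x)
    refine ⟨(Bundle.mdifferentiable_zeroSection (F := Eu d) (IB := 𝓡 d) ℝ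
      (TangentSpace (𝓡 d) : M → Type _)) x, ?_⟩
    change cov.toFun 0 x v = 0
    rw [h0]; rfl
  | insert j s hj ih =>
    have hsm : FieldDiffAt (c j • X j) x := (hc j).smul_section (hX j)
    have e : (fun z => ∑ i ∈ insert j s, c i z • X i z)
        = (c j • X j) + fun z => ∑ i ∈ s, c i z • X i z := by
      funext z
      rw [Finset.sum_insert hj]; rfl
    rw [e]
    refine ⟨mdifferentiableAt_add_section hsm ih.1, ?_⟩
    have h1 := cov.isCovariantDerivativeOnUniv.add hsm ih.1
    have h2 := cov.isCovariantDerivativeOnUniv.leibniz (hX j) (hc j)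
    rw [h1, h2, Finset.sum_insert hj, ← ih.2]
    rfl

theorem ContMDiff.contDiffOn_cov {cov : Connection d M}
    (hcov : CovariantDerivative.ContMDiffCovariantDerivative cov ∞)
    {X : (x : M) → TangentSpace (𝓡 d) x} (hX : SmoothFieldOn X univ) (x₀ : M) :
    ContDiffOn ℝ ∞ (fun y => (toChart x₀ (ofChart x₀ y) ∘L cov X (ofChart x₀ y)
      ∘L fromChart x₀ (ofChart x₀ y) : Eu d →L[ℝ] Eu d)) (extChartAt (𝓡 d) x₀).target := by
  have h := hcov.contMDiff.contMDiff (σ := X) hX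
  have h' := (Bundle.Trivialization.contMDiffOn_section_iff (IB := 𝓡 d) (n := ∞)
    (trivializationAt (Eu d →L[ℝ] Eu d)
      (fun x : M => TangentSpace (𝓡 d) x →L[ℝ] TangentSpace (𝓡 d) x) x₀)
    (s := fun x => cov X x) (chartAt (Eu d) x₀).open_source
    (by simp)).1 (h.mono (subset_univ _))
  have h2 : ContMDiffOn (𝓡 d) 𝓘(ℝ, Eu d →L[ℝ] Eu d) ∞
      (fun x => (toChart x₀ x ∘L cov X x ∘L fromChart x₀ x : Eu d →L[ℝ] Eu d))
      (chartAt (Eu d) x₀).source := h'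
  exact (contDiffOn_comp_ofChart (x₀ := x₀) h2).mono fun y hy => ⟨hy, ofChart_mem hy⟩

variable [T2Space M]

/-- The columns of Γ are the covariant derivatives of the coordinate fields cut off by a bump
function; O is the part of the chart where the bump equals 1. Global fields and functions are kept
because parallel transport and absolute continuity are tested on global objects only. -/
theorem exists_chartModel {cov : Connection d M}
    (hcov : CovariantDerivative.ContMDiffCovariantDerivative cov ∞) (x₀ : M) :
    Nonempty (ChartModel cov x₀) := by
  obtain ⟨ψ, hψ, hψs, hψ1⟩ := exists_bump (d := d) ((chartAt (Eu d) x₀).open_source.mem_nhds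
    (mem_chart_source _ x₀))
  obtain ⟨W, hW1, hWo, hxW⟩ := eventually_nhds_iff.1 hψ1
  set O := (extChartAt (𝓡 d) x₀).target ∩ ofChart x₀ ⁻¹' W
  have hO : IsOpen O := isOpen_ofChart_preimage x₀ hWo
  have hxs := mem_chart_source (Eu d) x₀
  set fld : Eu d → (x : M) → TangentSpace (𝓡 d) x := fun w x => ψ x • fromChart x₀ x w
  have hfld : ∀ w, SmoothFieldOn (fld w) univ := by
    intro w
    refine contMDiffOn_univ.2 (ContMDiffOn.smul_section_of_tsupport hψ.contMDiffOn
      (chartAt (Eu d) x₀).open_source hψs ?_)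
    refine (smoothFieldOn_iff (chartAt (Eu d) x₀).open_source subset_rfl).2 ?_
    exact (contMDiffOn_const (c := w)).congr fun x hx => toChart_fromChart hx w
  have hfe : ∀ w, ∀ y ∈ O, rep x₀ (fld w) y = w := by
    intro w y hy
    simp only [rep, fld, map_smul]
    rw [toChart_fromChart (ofChart_mem hy.1), hW1 _ hy.2, one_smul]
  set A : Fin d → Eu d → Eu d →L[ℝ] Eu d := fun i y =>
    toChart x₀ (ofChart x₀ y) ∘L cov (fld (EuclideanSpace.single i 1)) (ofChart x₀ y)
      ∘L fromChart x₀ (ofChart x₀ y)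
  have hA : ∀ i, ContDiffOn ℝ ∞ (A i) O := fun i =>
    (ContMDiff.contDiffOn_cov hcov (hfld _) x₀).mono inter_subset_left
  set Γ : Eu d → Eu d →L[ℝ] Eu d →L[ℝ] Eu d := fun y => ∑ i,
    (ContinuousLinearMap.smulRightL ℝ (Eu d) (Eu d) (EuclideanSpace.proj i)) ∘L A i y
  have hΓ : ∀ y v w, Γ y v w = ∑ i, w i • A i y v := by
    intro y v w
    simp [Γ, _root_.sum_apply]
  refine ⟨⟨O, hO, ⟨extChartAt_mem hxs, by
    change ofChart x₀ _ ∈ W; rwa [ofChart_extChartAt hxs]⟩, inter_subset_left, Γ, ?_, ?_,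
    fun x => ψ x • extChartAt (𝓡 d) x₀ x, ?_, ?_, fld, hfld, hfe⟩⟩
  · exact ContDiffOn.sum fun i _ => contDiffOn_const.clm_comp (hA i)
  · intro y hy X hX
    have hxs : ofChart x₀ y ∈ (chartAt (Eu d) x₀).source := ofChart_mem hy.1
    set x := ofChart x₀ y
    intro v
    set c : Fin d → M → ℝ := fun i z => toChart x₀ z (X z) i
    have hXd := (fieldDiffAt_iff hxs).1 hX
    have hc : ∀ i, MDifferentiableAt (𝓡 d) 𝓘(ℝ, ℝ) (c i) x := fun i =>
      (EuclideanSpace.proj (𝕜 := ℝ) i).mdifferentiableAt.comp x hXd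
    -- Expansion of X in the coordinate fields near x; locality and the Leibniz rule then give the
    -- Christoffel formula.
    have hXe : ∀ᶠ z in 𝓝 x, X z = ∑ i, c i z • fld (EuclideanSpace.single i 1) z := by
      filter_upwards [hWo.mem_nhds hy.2, (chartAt (Eu d) x₀).open_source.mem_nhds hxs] with z hz hz'
      simp only [c, fld, hW1 z hz, one_smul]
      rw [← fromChart_toChart hz' (X z)]
      simp only [← map_smul, ← map_sum]
      congr 1
      rw [toChart_fromChart hz']
      ext j
      simp [Finset.sum_apply, Pi.single_apply]
    rw [cov_congr cov hX hXe, (cov_sum_smul cov _ (fun i => (hfld _).fieldDiffAt Filter.univ_mem)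
      hc v).2, map_sum, hΓ]
    have hd : ∀ i, dir (c i) x v
        = fderiv ℝ (rep x₀ X) y (toChart x₀ x v) i := by
      intro i
      have hdd : DifferentiableAt ℝ (rep x₀ X) y := by
        have := (mdifferentiableAt_iff_rep hxs).1 hXd
        rwa [extChartAt_ofChart hy.1] at this
      rw [dir, mfderiv_eq_rep hxs (hc i), extChartAt_ofChart hy.1]
      have := ((EuclideanSpace.proj (𝕜 := ℝ) i : Eu d →L[ℝ] ℝ).hasFDerivAt.comp y
        hdd.hasFDerivAt).fderiv
      exact congrArg (fun L : Eu d →L[ℝ] ℝ => L (toChart x₀ x v)) this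
    have hA' : ∀ i, toChart x₀ x (cov (fld (EuclideanSpace.single i 1)) x v)
        = A i y (toChart x₀ x v) := by
      intro i
      simp only [A, ContinuousLinearMap.comp_apply]
      rw [fromChart_toChart hxs]
    have hfx : ∀ i, toChart x₀ x (fld (EuclideanSpace.single i 1) x)
        = EuclideanSpace.single i 1 := fun i => hfe _ y hy
    simp only [map_add, map_smul, hA', hfx, hd, Finset.sum_add_distrib]
    rw [add_comm]
    congr 1
    ext j
    simp [Finset.sum_apply, Pi.single_apply]
  · exact contMDiff_of_tsupport fun x hx => by
      have hxs : x ∈ (chartAt (Eu d) x₀).source := hψs (tsupport_smul_subset_left _ _ hx)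
      exact hψ.contMDiffAt.smul (contMDiffAt_extChartAt' hxs)
  · intro y hy
    change ψ (ofChart x₀ y) • extChartAt (𝓡 d) x₀ (ofChart x₀ y) = y
    rw [hW1 _ hy.2, one_smul, extChartAt_ofChart hy.1]

/-- The curvature in coordinates. -/
def curvOp {E F : Type*} [NormedAddCommGroup E] [NormedSpace ℝ E] [NormedAddCommGroup F]
    [NormedSpace ℝ F] (Γ : E → E →L[ℝ] F →L[ℝ] F) (y a b : E) : F →L[ℝ] F :=
  fderiv ℝ Γ y a b - fderiv ℝ Γ y b a + Γ y a ∘L Γ y b - Γ y b ∘L Γ y a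

/-- Tensoriality of the curvature: the derivatives of X and Y cancel against the bracket term, and
the second derivatives of Z cancel by symmetry. The first conclusion is what allows the coordinate
formula for ∇ to be applied a second time. -/
theorem curvOp_eq {E : Type*} [NormedAddCommGroup E] [NormedSpace ℝ E]
    {Γ : E → E →L[ℝ] E →L[ℝ] E} {X Y Z : E → E} {y : E} (hΓ : DifferentiableAt ℝ Γ y)
    (hX : DifferentiableAt ℝ X y) (hY : DifferentiableAt ℝ Y y) (hZ : ContDiffAt ℝ ∞ Z y) :
    DifferentiableAt ℝ (fun z => fderiv ℝ Z z (Y z) + Γ z (Y z) (Z z)) y ∧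
    fderiv ℝ (fun z => fderiv ℝ Z z (Y z) + Γ z (Y z) (Z z)) y (X y)
      + Γ y (X y) (fderiv ℝ Z y (Y y) + Γ y (Y y) (Z y))
      - (fderiv ℝ (fun z => fderiv ℝ Z z (X z) + Γ z (X z) (Z z)) y (Y y)
      + Γ y (Y y) (fderiv ℝ Z y (X y) + Γ y (X y) (Z y)))
      - (fderiv ℝ Z y (fderiv ℝ Y y (X y) - fderiv ℝ X y (Y y))
        + Γ y (fderiv ℝ Y y (X y) - fderiv ℝ X y (Y y)) (Z y))
      = curvOp Γ y (X y) (Y y) (Z y) := by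
  have hZ1 : DifferentiableAt ℝ Z y := hZ.differentiableAt (by simp)
  have hZ2 : DifferentiableAt ℝ (fderiv ℝ Z) y :=
    (hZ.fderiv_right (m := 1) (by norm_cast)).differentiableAt (by simp)
  have key : ∀ W : E → E, DifferentiableAt ℝ W y →
      HasFDerivAt (fun z => fderiv ℝ Z z (W z) + Γ z (W z) (Z z))
        (((fderiv ℝ Z y) ∘L fderiv ℝ W y + (fderiv ℝ (fderiv ℝ Z) y).flip (W y))
          + ((Γ y (W y)) ∘L fderiv ℝ Z y
            + ((Γ y) ∘L fderiv ℝ W y + (fderiv ℝ Γ y).flip (W y)).flip (Z y))) y := fun W hW =>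
    (hZ2.hasFDerivAt.clm_apply hW.hasFDerivAt).add
      ((hΓ.hasFDerivAt.clm_apply hW.hasFDerivAt).clm_apply hZ1.hasFDerivAt)
  refine ⟨(key Y hY).differentiableAt, ?_⟩
  have hsymm : fderiv ℝ (fderiv ℝ Z) y (X y) (Y y) = fderiv ℝ (fderiv ℝ Z) y (Y y) (X y) :=
    (hZ.isSymmSndFDerivAt (by
      rw [minSmoothness_of_isRCLikeNormedField]; norm_cast)).eq _ _
  rw [(key X hX).fderiv, (key Y hY).fderiv]
  simp only [curvOp, add_apply, sub_apply, ContinuousLinearMap.comp_apply,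
    ContinuousLinearMap.flip_apply, map_add, map_sub, hsymm]
  abel

namespace ChartModel

variable {cov : Connection d M} {x₀ : M} (m : ChartModel cov x₀)

theorem ofChart_mem_source {y : Eu d} (hy : y ∈ m.O) : ofChart x₀ y ∈ (chartAt (Eu d) x₀).source :=
  ofChart_mem (m.subset hy)

theorem eventually_ofChart {y : Eu d} (hy : y ∈ m.O) {p : M → Prop}
    (h : ∀ᶠ x in 𝓝 (ofChart x₀ y), p x) : ∀ᶠ z in 𝓝 y, p (ofChart x₀ z) :=
  ((contMDiffOn_ofChart x₀).continuousOn.continuousAt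
    ((isOpen_target x₀).mem_nhds (m.subset hy))).eventually h

theorem fieldDiffAt_iff {y : Eu d} (hy : y ∈ m.O) {X : (x : M) → TangentSpace (𝓡 d) x} :
    FieldDiffAt X (ofChart x₀ y) ↔ DifferentiableAt ℝ (rep x₀ X) y := by
  rw [fieldDiffAt_iff_rep (m.ofChart_mem_source hy), extChartAt_ofChart (m.subset hy)]

theorem contDiffAt_rep {y : Eu d} (hy : y ∈ m.O) {X : (x : M) → TangentSpace (𝓡 d) x} {U : Set M}
    (hU : U ∈ 𝓝 (ofChart x₀ y)) (hX : SmoothFieldOn X U) : ContDiffAt ℝ ∞ (rep x₀ X) y := by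
  obtain ⟨V, hVU, hVo, hxV⟩ := mem_nhds_iff.1 hU
  exact (SmoothFieldOn.contDiffOn_rep (U := V) (ContMDiffOn.mono hX hVU) hVo).contDiffAt
    ((isOpen_ofChart_preimage x₀ hVo).mem_nhds ⟨m.subset hy, hxV⟩)

theorem mfderiv_ofChart {y : Eu d} (hy : y ∈ m.O) (w : Eu d) :
    mfderiv 𝓘(ℝ, Eu d) (𝓡 d) (ofChart x₀) y w = fromChart x₀ (ofChart x₀ y) w := by
  have hy' := m.subset hy
  have hx := m.ofChart_mem_source hy
  have h1 : MDifferentiableAt 𝓘(ℝ, Eu d) (𝓡 d) (ofChart x₀) y :=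
    ((contMDiffOn_ofChart x₀).contMDiffAt ((isOpen_target x₀).mem_nhds hy')).mdifferentiableAt
      (by simp)
  have h2 := mdifferentiableAt_extChartAt (I := 𝓡 d) hx
  have e1 : toChart x₀ (ofChart x₀ y)
      (mfderiv 𝓘(ℝ, Eu d) (𝓡 d) (ofChart x₀) y w) = w := by
    have h3 := h2.hasMFDerivAt.comp y h1.hasMFDerivAt
    have h4 : HasMFDerivAt 𝓘(ℝ, Eu d) 𝓘(ℝ, Eu d) (extChartAt (𝓡 d) x₀ ∘ ofChart x₀) y
        (ContinuousLinearMap.id ℝ (Eu d)) := by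
      refine (hasMFDerivAt_id y).congr_of_eventuallyEq ?_
      filter_upwards [(isOpen_target x₀).mem_nhds hy'] with z hz
      exact extChartAt_ofChart hz
    have h5 := hasMFDerivAt_unique h3 h4
    rw [toChart_eq_mfderiv hx]
    exact congrArg (fun L : Eu d →L[ℝ] Eu d => L w) h5
  rw [← fromChart_toChart hx (mfderiv 𝓘(ℝ, Eu d) (𝓡 d) (ofChart x₀) y w)]
  exact congrArg _ e1

theorem inverse_mfderiv_ofChart {y : Eu d} (hy : y ∈ m.O) (v : TangentSpace (𝓡 d) (ofChart x₀ y)) :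
    (mfderiv 𝓘(ℝ, Eu d) (𝓡 d) (ofChart x₀) y).inverse v = toChart x₀ (ofChart x₀ y) v := by
  have hx := m.ofChart_mem_source hy
  set A : Eu d →L[ℝ] TangentSpace (𝓡 d) (ofChart x₀ y) :=
    mfderiv 𝓘(ℝ, Eu d) (𝓡 d) (ofChart x₀) y
  have e2 : ∀ w, fromChart x₀ (ofChart x₀ y) w = A w := fun w => (m.mfderiv_ofChart hy w).symm
  have e1 : ∀ w : Eu d, toChart x₀ (ofChart x₀ y) (A w) = w := fun w => by
    rw [← e2, toChart_fromChart hx]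
  let e : Eu d ≃L[ℝ] TangentSpace (𝓡 d) (ofChart x₀ y) :=
    ContinuousLinearEquiv.equivOfInverse A (toChart x₀ (ofChart x₀ y)) e1 fun w => by
      rw [← e2, fromChart_toChart hx]
  change (e : Eu d →L[ℝ] TangentSpace (𝓡 d) (ofChart x₀ y)).inverse v = _
  rw [ContinuousLinearMap.inverse_equiv]
  rfl

/-- The bracket is natural under pull-back by the inverse chart, which reduces it to the flat one.
-/
theorem toChart_mlieBracket {y : Eu d} (hy : y ∈ m.O) {X Y : (x : M) → TangentSpace (𝓡 d) x}
    (hX : FieldDiffAt X (ofChart x₀ y)) (hY : FieldDiffAt Y (ofChart x₀ y)) :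
    toChart x₀ (ofChart x₀ y) (VectorField.mlieBracket (𝓡 d) X Y (ofChart x₀ y))
      = fderiv ℝ (rep x₀ Y) y (rep x₀ X y) - fderiv ℝ (rep x₀ X) y (rep x₀ Y y) := by
  have hf : ContMDiffAt 𝓘(ℝ, Eu d) (𝓡 d) ∞ (ofChart x₀) y :=
    (contMDiffOn_ofChart x₀).contMDiffAt ((isOpen_target x₀).mem_nhds (m.subset hy))
  have hm : IsManifold (𝓡 d) (minSmoothness ℝ 2) M := by
    rw [minSmoothness_of_isRCLikeNormedField]
    exact IsManifold.of_le (n := ∞) (by norm_cast)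
  have h := VectorField.mpullback_mlieBracket hX hY hf (by
    rw [minSmoothness_of_isRCLikeNormedField]; norm_cast)
  have e : ∀ Z : (x : M) → TangentSpace (𝓡 d) x,
      VectorField.mpullback 𝓘(ℝ, Eu d) (𝓡 d) (ofChart x₀) Z =ᶠ[𝓝 y] rep x₀ Z := by
    intro Z
    filter_upwards [m.isOpen.mem_nhds hy] with z hz
    exact m.inverse_mfderiv_ofChart hz _
  rw [← m.inverse_mfderiv_ofChart hy, ← VectorField.mpullback_apply, h,
    ← VectorField.mlieBracketWithin_univ, VectorField.mlieBracketWithin_eq_lieBracketWithin]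
  set A : Eu d → Eu d := VectorField.mpullback 𝓘(ℝ, Eu d) (𝓡 d) (ofChart x₀) X
  set B : Eu d → Eu d := VectorField.mpullback 𝓘(ℝ, Eu d) (𝓡 d) (ofChart x₀) Y
  change VectorField.lieBracketWithin ℝ A B univ y = _
  rw [VectorField.lieBracketWithin_univ, (e X).lieBracket_vectorField_eq (e Y)]
  rfl

theorem differentiableAt_Γ {y : Eu d} (hy : y ∈ m.O) : DifferentiableAt ℝ m.Γ y :=
  (m.smooth.contDiffAt (m.isOpen.mem_nhds hy)).differentiableAt (by simp)

theorem field_ofChart {y : Eu d} (hy : y ∈ m.O) (v : TangentSpace (𝓡 d) (ofChart x₀ y)) :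
    m.field (toChart x₀ _ v) (ofChart x₀ y) = v := by
  rw [← fromChart_toChart (m.ofChart_mem_source hy) (m.field _ _)]
  have := m.field_eq (toChart x₀ _ v) y hy
  rw [rep] at this
  rw [this, fromChart_toChart (m.ofChart_mem_source hy)]

theorem fderiv_rep_field {y : Eu d} (hy : y ∈ m.O) (w : Eu d) :
    fderiv ℝ (rep x₀ (m.field w)) y = 0 := by
  have : rep x₀ (m.field w) =ᶠ[𝓝 y] fun _ => w := by
    filter_upwards [m.isOpen.mem_nhds hy] with z hz using m.field_eq w z hz
  rw [this.fderiv_eq, fderiv_const_apply]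

theorem toChart_cov_field {y : Eu d} (hy : y ∈ m.O) (v : TangentSpace (𝓡 d) (ofChart x₀ y))
    (w : Eu d) : toChart x₀ (ofChart x₀ y) (cov (m.field w) (ofChart x₀ y) v)
      = m.Γ y (toChart x₀ _ v) w := by
  rw [m.cov_eq y hy _ ((m.field_smooth w).fieldDiffAt Filter.univ_mem), m.fderiv_rep_field hy,
    m.field_eq w y hy]
  simp

/-- The vectors are extended by coordinate fields, whose bracket vanishes. -/
theorem toChart_torsion {y : Eu d} (hy : y ∈ m.O) (v w : TangentSpace (𝓡 d) (ofChart x₀ y)) :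
    toChart x₀ (ofChart x₀ y) (cov.torsion (ofChart x₀ y) v w)
      = m.Γ y (toChart x₀ _ v) (toChart x₀ _ w) - m.Γ y (toChart x₀ _ w) (toChart x₀ _ v) := by
  have hd : ∀ a, FieldDiffAt (m.field a) (ofChart x₀ y) := fun a =>
    (m.field_smooth a).fieldDiffAt Filter.univ_mem
  have h := cov.torsion_apply (hd (toChart x₀ _ v)) (hd (toChart x₀ _ w))
  rw [m.field_ofChart hy, m.field_ofChart hy] at h
  rw [h, map_sub, map_sub, m.toChart_cov_field hy, m.toChart_cov_field hy,
    m.toChart_mlieBracket hy (hd _) (hd _), m.fderiv_rep_field hy, m.fderiv_rep_field hy]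
  simp

/-- The extensions in `curvature` are smooth only near the point. This suffices, since the
coordinate formula asks for differentiability at a point, and `curvOp_eq` then removes the
dependence on the extensions. -/
theorem toChart_curvature {y : Eu d} (hy : y ∈ m.O)
    (u v w : TangentSpace (𝓡 d) (ofChart x₀ y)) :
    toChart x₀ (ofChart x₀ y) (curvature cov (ofChart x₀ y) u v w)
      = curvOp m.Γ y (toChart x₀ _ u) (toChart x₀ _ v) (toChart x₀ _ w) := by
  have hext : ∀ a : TangentSpace (𝓡 d) (ofChart x₀ y), ∃ U, IsOpen U ∧ ofChart x₀ y ∈ U ∧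
      SmoothFieldOn (FiberBundle.extend (EuclideanSpace ℝ (Fin d)) a) U := by
    intro a
    obtain ⟨U, hU, h⟩ := FiberBundle.exists_contMDiffOn_extend (𝓡 d)
      (EuclideanSpace ℝ (Fin d)) (k := ∞) a
    obtain ⟨V, hVU, hVo, hV⟩ := mem_nhds_iff.1 hU
    exact ⟨V, hVo, hV, h.mono hVU⟩
  have hval : ∀ a : TangentSpace (𝓡 d) (ofChart x₀ y),
      FiberBundle.extend (EuclideanSpace ℝ (Fin d)) a (ofChart x₀ y) = a := fun a => by simp
  obtain ⟨U₁, hU₁, hx₁, hX⟩ := hext u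
  obtain ⟨U₂, hU₂, hx₂, hY⟩ := hext v
  obtain ⟨U₃, hU₃, hx₃, hZ⟩ := hext w
  rw [curvature]
  set X : (x : M) → TangentSpace (𝓡 d) x := FiberBundle.extend (EuclideanSpace ℝ (Fin d)) u
  set Y : (x : M) → TangentSpace (𝓡 d) x := FiberBundle.extend (EuclideanSpace ℝ (Fin d)) v
  set Z : (x : M) → TangentSpace (𝓡 d) x := FiberBundle.extend (EuclideanSpace ℝ (Fin d)) w
  have hXv : X (ofChart x₀ y) = u := hval u
  have hYv : Y (ofChart x₀ y) = v := hval v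
  have hZv : Z (ofChart x₀ y) = w := hval w
  have eX : rep x₀ X y = toChart x₀ _ u := by rw [rep, hXv]
  have eY : rep x₀ Y y = toChart x₀ _ v := by rw [rep, hYv]
  have eZ : rep x₀ Z y = toChart x₀ _ w := by rw [rep, hZv]
  have dX := (m.contDiffAt_rep hy (hU₁.mem_nhds hx₁) hX).differentiableAt (by simp)
  have dY := (m.contDiffAt_rep hy (hU₂.mem_nhds hx₂) hY).differentiableAt (by simp)
  have dZ := m.contDiffAt_rep hy (hU₃.mem_nhds hx₃) hZ
  have hrep : ∀ W : (x : M) → TangentSpace (𝓡 d) x,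
      rep x₀ (fun z => cov Z z (W z)) =ᶠ[𝓝 y]
        fun z => fderiv ℝ (rep x₀ Z) z (rep x₀ W z) + m.Γ z (rep x₀ W z) (rep x₀ Z z) := by
    intro W
    filter_upwards [m.isOpen.mem_nhds hy, m.eventually_ofChart hy (hU₃.mem_nhds hx₃)] with z hz hzU
    exact m.cov_eq z hz Z (hZ.fieldDiffAt (hU₃.mem_nhds hzU)) _
  have h1 := curvOp_eq (m.differentiableAt_Γ hy) dX dY dZ
  have h2 := curvOp_eq (m.differentiableAt_Γ hy) dY dX dZ
  have f1 : FieldDiffAt (fun z => cov Z z (Y z)) (ofChart x₀ y) :=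
    (m.fieldDiffAt_iff hy).2 (h1.1.congr_of_eventuallyEq (hrep Y))
  have f2 : FieldDiffAt (fun z => cov Z z (X z)) (ofChart x₀ y) :=
    (m.fieldDiffAt_iff hy).2 (h2.1.congr_of_eventuallyEq (hrep X))
  rw [map_sub, map_sub, m.cov_eq y hy _ f1, m.cov_eq y hy _ f2,
    m.cov_eq y hy Z (hZ.fieldDiffAt (hU₃.mem_nhds hx₃)),
    m.toChart_mlieBracket hy (hX.fieldDiffAt (hU₁.mem_nhds hx₁))
      (hY.fieldDiffAt (hU₂.mem_nhds hx₂)),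
    (hrep X).fderiv_eq, (hrep Y).fderiv_eq, (hrep X).self_of_nhds, (hrep Y).self_of_nhds,
    ← eX, ← eY, ← eZ, ← h1.2]

end ChartModel

end ChartModel

/-! ### Positive square roots -/

section PosSqrt

variable {V : Type*} [NormedAddCommGroup V] [InnerProductSpace ℝ V] [FiniteDimensional ℝ V]

/-- Square roots of the eigenvalues in an orthonormal eigenbasis. -/
theorem exists_posSqrt {A : V →L[ℝ] V} (hs : ∀ v w, ⟪A v, w⟫ = ⟪v, A w⟫)
    (hp : ∀ v, 0 ≤ ⟪A v, v⟫) : ∃ B : V →L[ℝ] V, B.IsPositive ∧ B ∘L B = A := by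
  have hsym : (A : V →ₗ[ℝ] V).IsSymmetric := hs
  set n := Module.finrank ℝ V
  set b := hsym.eigenvectorBasis (n := n) rfl
  set l := hsym.eigenvalues (n := n) rfl
  have hAb : ∀ i, A (b i) = l i • b i := fun i =>
    hsym.apply_eigenvectorBasis (n := n) rfl i
  have hl : ∀ i, 0 ≤ l i := by
    intro i
    have := hp (b i)
    rwa [hAb, inner_smul_left, real_inner_self_eq_norm_sq, b.norm_eq_one, one_pow, mul_one] at this
  set B : V →L[ℝ] V := ∑ i, Real.sqrt (l i) • (innerSL ℝ (b i)).smulRight (b i)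
  have hB : ∀ v, B v = ∑ i, Real.sqrt (l i) • ⟪b i, v⟫ • b i := fun v => by simp [B]
  have hBb : ∀ i, B (b i) = Real.sqrt (l i) • b i := by
    intro i
    rw [hB, Finset.sum_eq_single i]
    · rw [real_inner_self_eq_norm_sq, b.norm_eq_one, one_pow, one_smul]
    · intro j _ hj
      rw [b.inner_eq_zero hj, zero_smul, smul_zero]
    · simp
  have hBs : ∀ v w, ⟪B v, w⟫ = ∑ i, Real.sqrt (l i) * (⟪b i, v⟫ * ⟪b i, w⟫) := fun v w => by
    rw [hB, sum_inner]
    exact Finset.sum_congr rfl fun i _ => by rw [inner_smul_left, inner_smul_left]; rfl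
  refine ⟨B, ⟨fun v w => ?_, fun v => ?_⟩, ?_⟩
  · change ⟪B v, w⟫ = ⟪v, B w⟫
    rw [hBs, real_inner_comm, hBs]
    exact Finset.sum_congr rfl fun i _ => by ring
  · change 0 ≤ ⟪B v, v⟫
    rw [hBs]
    exact Finset.sum_nonneg fun i _ => mul_nonneg (Real.sqrt_nonneg _) (mul_self_nonneg _)
  · refine ContinuousLinearMap.coe_inj.1 (b.toBasis.ext fun i => ?_)
    simp only [OrthonormalBasis.coe_toBasis, ContinuousLinearMap.coe_coe,
      ContinuousLinearMap.comp_apply]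
    rw [hBb, map_smul, hBb, hAb, smul_smul, Real.mul_self_sqrt (hl i)]

theorem posSqrt_spec {A : V →L[ℝ] V} (hs : ∀ v w, ⟪A v, w⟫ = ⟪v, A w⟫)
    (hp : ∀ v, 0 ≤ ⟪A v, v⟫) : (posSqrt A).IsPositive ∧ posSqrt A ∘L posSqrt A = A := by
  have h := exists_posSqrt hs hp
  rw [posSqrt, dif_pos h]
  exact h.choose_spec

/-- For a unit eigenvector e of A - B with eigenvalue l, the form of A² - B² at e is l(⟪Ae, e⟫ +
⟪Be, e⟫), and |l| is at most the sum of these two nonnegative numbers. So l² ≤ ‖A² - B²‖: the square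
root is Hölder continuous, with no lower bound on A or B. -/
theorem norm_sub_sq_le {A B : V →L[ℝ] V} (hA : A.IsPositive) (hB : B.IsPositive) :
    ‖A - B‖ ^ 2 ≤ ‖A ∘L A - B ∘L B‖ := by
  set C := A - B
  have hAs : ∀ v w, ⟪A v, w⟫ = ⟪v, A w⟫ := hA.1
  have hBs : ∀ v w, ⟪B v, w⟫ = ⟪v, B w⟫ := hB.1
  have hAp : ∀ v, 0 ≤ ⟪A v, v⟫ := hA.2
  have hBp : ∀ v, 0 ≤ ⟪B v, v⟫ := hB.2
  have hCs : ∀ v w, ⟪C v, w⟫ = ⟪v, C w⟫ := fun v w => by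
    simp only [C, sub_apply, inner_sub_left, inner_sub_right, hAs, hBs]
  have hsym : (C : V →ₗ[ℝ] V).IsSymmetric := hCs
  set n := Module.finrank ℝ V
  set b := hsym.eigenvectorBasis (n := n) rfl
  set l := hsym.eigenvalues (n := n) rfl
  set K := ‖A ∘L A - B ∘L B‖
  have hCb : ∀ i, C (b i) = l i • b i := fun i =>
    hsym.apply_eigenvectorBasis (n := n) rfl i
  have hl : ∀ i, l i ^ 2 ≤ K := by
    intro i
    set e := b i
    have he : ‖e‖ = 1 := b.norm_eq_one i
    have h1 : |⟪(A ∘L A - B ∘L B) e, e⟫| ≤ K := by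
      refine (abs_real_inner_le_norm _ _).trans ?_
      rw [he, mul_one]
      simpa [he] using (A ∘L A - B ∘L B).le_opNorm e
    have hAe : A e = B e + l i • e := by rw [← hCb]; simp [C, e]
    have hee : ⟪e, e⟫ = 1 := by rw [real_inner_self_eq_norm_sq, he, one_pow]
    have h2 : ⟪(A ∘L A - B ∘L B) e, e⟫ = l i * (⟪A e, e⟫ + ⟪B e, e⟫) := by
      simp only [sub_apply, ContinuousLinearMap.comp_apply, inner_sub_left, hAs (A e), hBs (B e)]
      rw [hAe]
      simp only [inner_add_left, inner_add_right, inner_smul_left, inner_smul_right,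
        real_inner_comm e (B e), hee]
      simp; ring
    have h3 : ⟪A e, e⟫ - ⟪B e, e⟫ = l i := by
      rw [hAe, inner_add_left, inner_smul_left, hee]; simp
    rw [h2, abs_mul] at h1
    have h4 : |l i| ≤ |⟪A e, e⟫ + ⟪B e, e⟫| := by
      rw [abs_of_nonneg (add_nonneg (hAp e) (hBp e)), abs_le]
      constructor <;> linarith [hAp e, hBp e]
    calc l i ^ 2 = |l i| * |l i| := by rw [← sq_abs, sq]
      _ ≤ |l i| * |⟪A e, e⟫ + ⟪B e, e⟫| := mul_le_mul_of_nonneg_left h4 (abs_nonneg _)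
      _ ≤ K := h1
  have hK : 0 ≤ K := norm_nonneg _
  have h5 : ‖C‖ ≤ Real.sqrt K := by
    refine C.opNorm_le_bound (Real.sqrt_nonneg _) fun v => ?_
    refine le_of_sq_le_sq ?_ (by positivity)
    rw [mul_pow, Real.sq_sqrt hK, ← b.sum_sq_norm_inner_right, ← b.sum_sq_norm_inner_right,
      Finset.mul_sum]
    refine Finset.sum_le_sum fun i _ => ?_
    rw [← hCs, hCb, inner_smul_left, norm_mul, mul_pow]
    refine mul_le_mul_of_nonneg_right ?_ (by positivity)
    simpa using hl i
  calc ‖C‖ ^ 2 ≤ Real.sqrt K ^ 2 := by gcongr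
    _ = K := Real.sq_sqrt hK

theorem continuousOn_posSqrt {A : ℝ → V →L[ℝ] V} {K : Set ℝ} (hA : ContinuousOn A K)
    (hs : ∀ t ∈ K, ∀ v w, ⟪A t v, w⟫ = ⟪v, A t w⟫) (hp : ∀ t ∈ K, ∀ v, 0 ≤ ⟪A t v, v⟫) :
    ContinuousOn (fun t => posSqrt (A t)) K := by
  intro t ht
  rw [Metric.continuousWithinAt_iff]
  intro ε hε
  -- Closeness ε² of the operators gives closeness ε of their roots.
  obtain ⟨δ, hδ, h⟩ := Metric.continuousWithinAt_iff.1 (hA t ht) (ε ^ 2) (by positivity)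
  refine ⟨δ, hδ, fun s hsK hst => ?_⟩
  have h1 := norm_sub_sq_le (posSqrt_spec (hs s hsK) (hp s hsK)).1
    (posSqrt_spec (hs t ht) (hp t ht)).1
  rw [(posSqrt_spec (hs s hsK) (hp s hsK)).2, (posSqrt_spec (hs t ht) (hp t ht)).2,
    ← dist_eq_norm, ← dist_eq_norm] at h1
  exact lt_of_pow_lt_pow_left₀ 2 hε.le (h1.trans_lt (h hsK hst))

end PosSqrt

/-! ### Solutions as curves in the frame bundle -/

section PrimMore

set_option linter.unusedSectionVars false

variable {E F : Type*} [NormedAddCommGroup E] [NormedSpace ℝ E] [NormedAddCommGroup F]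
  [NormedSpace ℝ F] [CompleteSpace E] [CompleteSpace F] {a b : ℝ}

theorem Prim.clm_apply {L L' : ℝ → E →L[ℝ] F} {y y' : ℝ → E} (hL : Prim L L' a b)
    (hy : Prim y y' a b) (hab : a ≤ b) :
    Prim (fun t => L t (y t)) (fun t => L' t (y t) + L t (y' t)) a b := by
  have h := (hL.prodMk hy).comp hab (Φ := fun p : (E →L[ℝ] F) × E => p.1 p.2)
    (Φ' := fun t => (isBoundedBilinearMap_apply (𝕜 := ℝ) (E := E) (F := F)).deriv (L t, y t))
    (fun t _ => isBoundedBilinearMap_apply.hasStrictFDerivAt _)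
    ((isBoundedBilinearMap_apply (𝕜 := ℝ)).isBoundedLinearMap_deriv.continuous.comp_continuousOn
      (hL.continuousOn.prodMk hy.continuousOn))
  exact h.congr_deriv hab fun t _ => by
    simp [IsBoundedBilinearMap.deriv_apply, add_comm]

theorem Prim.finset_sum {ι : Type*} (s : Finset ι) {y y' : ι → ℝ → E}
    (h : ∀ i ∈ s, Prim (y i) (y' i) a b) :
    Prim (fun t => ∑ i ∈ s, y i t) (fun t => ∑ i ∈ s, y' i t) a b := by
  classical
  induction s using Finset.induction_on with
  | empty => simpa using Prim.const (0 : E) a b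
  | insert j s hj ih =>
    simp only [Finset.sum_insert hj]
    exact (h j (Finset.mem_insert_self _ _)).add
      (ih fun i hi => h i (Finset.mem_insert_of_mem hi))

theorem Prim.of_coord {n : ℕ} {y y' : ℝ → Eu n}
    (h : ∀ i, Prim (fun t => y t i) (fun t => y' t i) a b) : Prim y y' a b := by
  have h1 := Prim.finset_sum Finset.univ fun i _ =>
    (h i).clm ((ContinuousLinearMap.toSpanSingleton ℝ (EuclideanSpace.single i (1 : ℝ))))
  have e : ∀ z : Eu n, ∑ i, z i • (EuclideanSpace.single i (1 : ℝ) : Eu n) = z := fun z => by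
    ext j; simp [Finset.sum_apply, Pi.single_apply]
  simpa [ContinuousLinearMap.toSpanSingleton_apply, e] using h1

theorem clm_eq_sum {n : ℕ} (L : Eu n →L[ℝ] F) :
    ∑ i, (EuclideanSpace.proj (𝕜 := ℝ) i : Eu n →L[ℝ] ℝ).smulRight
      (L (EuclideanSpace.single i 1)) = L := by
  ext z
  conv_rhs => rw [← show ∑ i, z i • (EuclideanSpace.single i (1 : ℝ) : Eu n) = z by
    ext j; simp [Finset.sum_apply, Pi.single_apply]]
  simp

theorem Prim.of_columns {n : ℕ} {L L' : ℝ → Eu n →L[ℝ] F}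
    (h : ∀ i, Prim (fun t => L t (EuclideanSpace.single i 1))
      (fun t => L' t (EuclideanSpace.single i 1)) a b) : Prim L L' a b := by
  have h1 := Prim.finset_sum Finset.univ fun i _ => (h i).clm
    (ContinuousLinearMap.smulRightL ℝ (Eu n) F (EuclideanSpace.proj i))
  simpa [clm_eq_sum] using h1

theorem Prim.inverse {A B A' : ℝ → E →L[ℝ] E} (hA : Prim A A' a b) (hab : a ≤ b)
    (h1 : ∀ t ∈ Icc a b, A t ∘L B t = .id ℝ E) (h2 : ∀ t ∈ Icc a b, B t ∘L A t = .id ℝ E) :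
    Prim B (fun t => -(B t ∘L A' t ∘L B t)) a b := by
  set v : ℝ → E →L[ℝ] E := fun t => Ring.inverse (A t)
  have hv : ∀ t ∈ Icc a b, Ring.inverse (A t) = B t := fun t ht => by
    let u : (E →L[ℝ] E)ˣ := ⟨A t, B t, h1 t ht, h2 t ht⟩
    exact Ring.inverse_unit u
  have hd : ∀ t ∈ Icc a b, HasStrictFDerivAt (Ring.inverse (M₀ := E →L[ℝ] E))
      (-ContinuousLinearMap.mulLeftRight ℝ (E →L[ℝ] E) (B t) (B t)) (A t) := fun t ht => by
    let u : (E →L[ℝ] E)ˣ := ⟨A t, B t, h1 t ht, h2 t ht⟩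
    exact hasStrictFDerivAt_ringInverse u
  have hBc : ContinuousOn B (Icc a b) := fun t ht => by
    refine ContinuousWithinAt.congr ?_ (fun s hs => (hv s hs).symm) (hv t ht).symm
    exact ((hd t ht).continuousAt).comp_continuousWithinAt (hA.continuousOn t ht)
  have h3 := hA.comp hab hd (by fun_prop)
  refine (h3.congr fun t ht => (hv t ht).symm).congr_deriv hab fun t _ => ?_
  simp [ContinuousLinearMap.mulLeftRight_apply, mul_assoc]
  rfl

end PrimMore

section ControlSystem

variable {E W U : Type*} [NormedAddCommGroup E] [NormedSpace ℝ E] [NormedAddCommGroup W]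
  [NormedSpace ℝ W] [NormedAddCommGroup U] [NormedSpace ℝ U]

/-- The drift of the system `x' = v_t(x) + A b_t ζ`, `A' = - Γ(x') A`. -/
def sysDrift (W : Type*) [NormedAddCommGroup W] [NormedSpace ℝ W]
    (Γ : E → E →L[ℝ] E →L[ℝ] E) (v : ℝ → E → E) (t : ℝ) (y : E × (W →L[ℝ] E)) :
    E × (W →L[ℝ] E) := (v t y.1, -(Γ y.1 (v t y.1) ∘L y.2))

/-- The control term of the system `x' = v_t(x) + A b_t ζ`, `A' = - Γ(x') A`. -/
def sysCtrl (Γ : E → E →L[ℝ] E →L[ℝ] E) (β : U →L[ℝ] W) (y : E × (W →L[ℝ] E)) :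
    U →L[ℝ] E × (W →L[ℝ] E) :=
  (ContinuousLinearMap.inl ℝ E (W →L[ℝ] E)) ∘L (y.2 ∘L β)
    - (ContinuousLinearMap.inr ℝ E (W →L[ℝ] E)) ∘L
      ((ContinuousLinearMap.compL ℝ W E E).flip y.2 ∘L (Γ y.1 ∘L (y.2 ∘L β)))

theorem sysCtrl_apply (Γ : E → E →L[ℝ] E →L[ℝ] E) (β : U →L[ℝ] W) (y : E × (W →L[ℝ] E)) (ζ : U) :
    sysCtrl Γ β y ζ = (y.2 (β ζ), -(Γ y.1 (y.2 (β ζ)) ∘L y.2)) := by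
  simp [sysCtrl]

theorem sys_apply (Γ : E → E →L[ℝ] E →L[ℝ] E) (v : ℝ → E → E) (β : U →L[ℝ] W) (t : ℝ)
    (y : E × (W →L[ℝ] E)) (ζ : U) : sysDrift W Γ v t y + sysCtrl Γ β y ζ
      = (y.2 (β ζ) + v t y.1, -(Γ y.1 (y.2 (β ζ) + v t y.1) ∘L y.2)) := by
  rw [sysCtrl_apply, sysDrift]
  ext1
  · exact add_comm _ _
  · simp only [Prod.snd_add, map_add, ContinuousLinearMap.add_comp]
    abel

end ControlSystem

namespace DiffusionData

set_option linter.unusedSectionVars false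

variable {d : ℕ} {M : Type*} [TopologicalSpace M] [ChartedSpace (EuclideanSpace ℝ (Fin d)) M]
  [IsManifold (𝓡 d) ∞ M] {o : M} {T : ℝ} (D : DiffusionData d M o T)

/-- The inclusion `E_x ⊆ T_x M`, in the preferred chart. -/
def inclE (x : M) : D.S.Fiber x →L[ℝ] Eu d :=
  LinearMap.toContinuousLinearMap ((toE x).toLinearMap ∘ₗ D.S.incl x)

/-- The map `Σ_t^{1/2} : E_o → T_o M`, in the preferred chart. -/
def diffusion (t : ℝ) : D.S.Fiber o →L[ℝ] Eu d := D.inclE o ∘L posSqrt (D.Sig t)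

/-- The velocity of a solution. -/
def vel (ξ : ℝ → D.S.Fiber o) (γ : ℝ → M) (P : ℝ → Eu d ≃L[ℝ] Eu d) (t : ℝ) :
    TangentSpace (𝓡 d) (γ t) :=
  (toE (γ t)).symm (P t (D.diffusion t (ξ t))) + D.u t (γ t)

/-- `γ` is a solution on `[a,b]` with control `ξ` and parallel transport `P`. -/
structure IsPath (ξ : ℝ → D.S.Fiber o) (γ : ℝ → M) (P : ℝ → Eu d ≃L[ℝ] Eu d) (a b : ℝ) :
    Prop where
  continuousOn : ContinuousOn γ (Icc a b)
  comp : ∀ f : M → ℝ, ContMDiff (𝓡 d) 𝓘(ℝ, ℝ) ∞ f →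
    Prim (fun t => f (γ t)) (fun t => dir f (γ t) (D.vel ξ γ P t)) a b
  field : ∀ X : (x : M) → TangentSpace (𝓡 d) x, SmoothFieldOn X univ →
    Prim (fun t => (P t).symm (toE _ (X (γ t))))
      (fun t => (P t).symm (toE _ (D.conn X (γ t) (D.vel ξ γ P t)))) a b

/-- A frame at `x`, in the chart at `x₀`. -/
def frameRep (x₀ x : M) (p : Eu d →L[ℝ] Eu d) : Eu d →L[ℝ] Eu d :=
  toChart x₀ x ∘L (toE x).symm.toContinuousLinearMap ∘L p

end DiffusionData

section ChartPaths

set_option linter.unusedSectionVars false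

variable {d : ℕ} {M : Type*} [TopologicalSpace M] [ChartedSpace (EuclideanSpace ℝ (Fin d)) M]
  [IsManifold (𝓡 d) ∞ M] [T2Space M]

namespace ChartModel

variable {cov : Connection d M} {x₀ : M} (m : ChartModel cov x₀)

/-- The domain of the chart model. -/
def dom : Set M := (chartAt (Eu d) x₀).source ∩ extChartAt (𝓡 d) x₀ ⁻¹' m.O

theorem isOpen_dom : IsOpen m.dom := isOpen_extChartAt_preimage'' x₀ m.isOpen

theorem mem_dom : x₀ ∈ m.dom := ⟨mem_chart_source _ x₀, m.mem⟩

theorem ofChart_mem_dom {y : Eu d} (hy : y ∈ m.O) : ofChart x₀ y ∈ m.dom :=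
  ⟨m.ofChart_mem_source hy, by
    change extChartAt (𝓡 d) x₀ (ofChart x₀ y) ∈ m.O
    rwa [extChartAt_ofChart (m.subset hy)]⟩

theorem coord_of_mem {x : M} (hx : x ∈ m.dom) : m.coord x = extChartAt (𝓡 d) x₀ x := by
  have := m.coord_eq _ hx.2
  rwa [ofChart_extChartAt hx.1] at this

theorem coord_mem {x : M} (hx : x ∈ m.dom) : m.coord x ∈ m.O := by
  rw [m.coord_of_mem hx]; exact hx.2

theorem ofChart_coord {x : M} (hx : x ∈ m.dom) : ofChart x₀ (m.coord x) = x := by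
  rw [m.coord_of_mem hx, ofChart_extChartAt hx.1]

theorem toChart_field {x : M} (hx : x ∈ m.dom) (w : Eu d) : toChart x₀ x (m.field w x) = w := by
  have := m.field_eq w _ (m.coord_mem hx)
  rwa [rep, m.ofChart_coord hx] at this

theorem dir_coord {x : M} (hx : x ∈ m.dom) (v : TangentSpace (𝓡 d) x) :
    dir m.coord x v = toChart x₀ x v := by
  have h : m.coord =ᶠ[𝓝 x] extChartAt (𝓡 d) x₀ := by
    filter_upwards [m.isOpen_dom.mem_nhds hx] with z hz using m.coord_of_mem hz
  rw [toChart_eq_mfderiv hx.1, dir, h.mfderiv_eq]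
  rfl

theorem dir_eq {x : M} (hx : x ∈ m.dom) {F : Type*} [NormedAddCommGroup F] [NormedSpace ℝ F]
    {f : M → F} (hf : MDifferentiableAt (𝓡 d) 𝓘(ℝ, F) f x) (v : TangentSpace (𝓡 d) x) :
    dir f x v = fderiv ℝ (fun y => f (ofChart x₀ y)) (m.coord x) (toChart x₀ x v) := by
  rw [dir, mfderiv_eq_rep hx.1 hf, m.coord_of_mem hx]

theorem cov_eq' {x : M} (hx : x ∈ m.dom) {X : (x : M) → TangentSpace (𝓡 d) x}
    (hX : FieldDiffAt X x) (v : TangentSpace (𝓡 d) x) :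
    toChart x₀ x (cov X x v) = fderiv ℝ (rep x₀ X) (m.coord x) (toChart x₀ x v)
      + m.Γ (m.coord x) (toChart x₀ x v) (toChart x₀ x (X x)) := by
  have h := m.ofChart_coord hx
  have := m.cov_eq _ (m.coord_mem hx) X (by rwa [h])
  rw [rep] at this
  rw [h] at this
  exact this v

theorem differentiableAt_rep {x : M} (hx : x ∈ m.dom) {X : (x : M) → TangentSpace (𝓡 d) x} :
    FieldDiffAt X x ↔ DifferentiableAt ℝ (rep x₀ X) (m.coord x) := by
  rw [← m.fieldDiffAt_iff (m.coord_mem hx), m.ofChart_coord hx]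

theorem contDiffOn_rep {X : (x : M) → TangentSpace (𝓡 d) x} (hX : SmoothFieldOn X univ) :
    ContDiffOn ℝ ∞ (rep x₀ X) m.O :=
  (hX.contDiffOn_rep isOpen_univ).mono fun _ hy => ⟨m.subset hy, trivial⟩

theorem contDiffOn_comp {F : Type*} [NormedAddCommGroup F] [NormedSpace ℝ F] {f : M → F}
    (hf : ContMDiff (𝓡 d) 𝓘(ℝ, F) ∞ f) : ContDiffOn ℝ ∞ (fun y => f (ofChart x₀ y)) m.O :=
  (contDiffOn_comp_ofChart (U := univ) hf.contMDiffOn).mono fun _ hy => ⟨m.subset hy, trivial⟩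

theorem torsion_eq' {x : M} (hx : x ∈ m.dom) (v w : TangentSpace (𝓡 d) x) :
    toChart x₀ x (cov.torsion x v w) = m.Γ (m.coord x) (toChart x₀ x v) (toChart x₀ x w)
      - m.Γ (m.coord x) (toChart x₀ x w) (toChart x₀ x v) := by
  have h := m.ofChart_coord hx
  have := m.toChart_torsion (m.coord_mem hx)
  rw [h] at this
  exact this v w

theorem curvature_eq' {x : M} (hx : x ∈ m.dom) (u v w : TangentSpace (𝓡 d) x) :
    toChart x₀ x (curvature cov x u v w) = curvOp m.Γ (m.coord x) (toChart x₀ x u)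
      (toChart x₀ x v) (toChart x₀ x w) := by
  have h := m.ofChart_coord hx
  have := m.toChart_curvature (m.coord_mem hx)
  rw [h] at this
  exact this u v w

end ChartModel

end ChartPaths

namespace DiffusionData

set_option linter.unusedSectionVars false

variable {d : ℕ} {M : Type*} [TopologicalSpace M] [ChartedSpace (EuclideanSpace ℝ (Fin d)) M]
  [IsManifold (𝓡 d) ∞ M] [T2Space M] {o : M} {T : ℝ} (D : DiffusionData d M o T)

/-- The inverse of `frameRep`. -/
def frameCorep (x₀ x : M) (p : Eu d →L[ℝ] Eu d) : Eu d →L[ℝ] Eu d :=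
  p ∘L (toE x).toContinuousLinearMap ∘L fromChart x₀ x

theorem frameRep_comp_frameCorep {x₀ x : M} (hx : x ∈ (chartAt (Eu d) x₀).source)
    (p : Eu d ≃L[ℝ] Eu d) : frameRep x₀ x p ∘L frameCorep x₀ x p.symm = .id ℝ (Eu d) := by
  ext1 v
  simp [frameRep, frameCorep, toChart_fromChart hx]

theorem frameCorep_comp_frameRep {x₀ x : M} (hx : x ∈ (chartAt (Eu d) x₀).source)
    (p : Eu d ≃L[ℝ] Eu d) : frameCorep x₀ x p.symm ∘L frameRep x₀ x p = .id ℝ (Eu d) := by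
  ext1 v
  simp [frameRep, frameCorep, fromChart_toChart hx]

theorem symm_toE_eq {x₀ x : M} (hx : x ∈ (chartAt (Eu d) x₀).source) (p : Eu d ≃L[ℝ] Eu d)
    (v : TangentSpace (𝓡 d) x) : p.symm (toE x v) = frameCorep x₀ x p.symm (toChart x₀ x v) := by
  simp [frameCorep, fromChart_toChart hx]

/-- The control system that describes solutions in a chart. -/
def chartField {x₀ : M} (m : ChartModel D.conn x₀) (ξ : ℝ → D.S.Fiber o) (t : ℝ)
    (y : Eu d × (Eu d →L[ℝ] Eu d)) : Eu d × (Eu d →L[ℝ] Eu d) :=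
  sysDrift (Eu d) m.Γ (fun t => rep x₀ (D.u t)) t y + sysCtrl m.Γ (D.diffusion t) y (ξ t)

/-- A point and a frame, in a chart. -/
def chartState {x₀ : M} (m : ChartModel D.conn x₀) (x : M) (p : Eu d →L[ℝ] Eu d) :
    Eu d × (Eu d →L[ℝ] Eu d) := (m.coord x, frameRep x₀ x p)

variable {D} {ξ : ℝ → D.S.Fiber o} {γ : ℝ → M} {P : ℝ → Eu d ≃L[ℝ] Eu d} {a b : ℝ}

theorem toChart_vel {x₀ : M} (m : ChartModel D.conn x₀) {t : ℝ} (ht : γ t ∈ m.dom) :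
    toChart x₀ (γ t) (D.vel ξ γ P t) = frameRep x₀ (γ t) (P t) (D.diffusion t (ξ t))
      + rep x₀ (D.u t) (m.coord (γ t)) := by
  have h := m.ofChart_coord ht
  rw [rep, h, vel, map_add]
  simp [frameRep]

theorem chartField_eq {x₀ : M} (m : ChartModel D.conn x₀) {t : ℝ} (ht : γ t ∈ m.dom) :
    D.chartField m ξ t (D.chartState m (γ t) (P t)) = (toChart x₀ (γ t) (D.vel ξ γ P t),
      -(m.Γ (m.coord (γ t)) (toChart x₀ (γ t) (D.vel ξ γ P t)) ∘L frameRep x₀ (γ t) (P t))) := by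
  rw [chartField, sys_apply, toChart_vel m ht]
  rfl

theorem IsPath.mono {r s : ℝ} (h : D.IsPath ξ γ P a b) (har : a ≤ r) (hrs : r ≤ s) (hsb : s ≤ b) :
    D.IsPath ξ γ P r s :=
  have hr : r ∈ Icc a b := ⟨har, hrs.trans hsb⟩
  have hs : s ∈ Icc a b := ⟨har.trans hrs, hsb⟩
  ⟨h.continuousOn.mono (Icc_subset_Icc har hsb), fun f hf => (h.comp f hf).mono hr hs,
    fun X hX => (h.field X hX).mono hr hs⟩

theorem IsPath.prim_coord (h : D.IsPath ξ γ P a b) {n : ℕ} {f : M → Eu n}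
    (hf : ContMDiff (𝓡 d) 𝓘(ℝ, Eu n) ∞ f) (hab : a ≤ b) :
    Prim (fun t => f (γ t)) (fun t => dir f (γ t) (D.vel ξ γ P t)) a b := by
  refine Prim.of_coord fun i => ?_
  have hfi : ContMDiff (𝓡 d) 𝓘(ℝ, ℝ) ∞ (fun x => f x i) :=
    (EuclideanSpace.proj (𝕜 := ℝ) i : Eu n →L[ℝ] ℝ).contMDiff.comp hf
  refine (h.comp _ hfi).congr_deriv hab fun t _ => ?_
  have hd : MDifferentiableAt (𝓡 d) 𝓘(ℝ, Eu n) f (γ t) := hf.contMDiffAt.mdifferentiableAt (by simp)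
  have := ((EuclideanSpace.proj (𝕜 := ℝ) i : Eu n →L[ℝ] ℝ).hasMFDerivAt.comp (γ t)
    hd.hasMFDerivAt).mfderiv
  exact congrArg (fun L : TangentSpace (𝓡 d) (γ t) →L[ℝ] ℝ => L (D.vel ξ γ P t)) this

/-- Tested on the coordinate fields, whose representatives are constant, parallel transport gives
the columns of the inverse frame. The equation of the frame itself follows by inversion. -/
theorem IsPath.prim_frameCorep (h : D.IsPath ξ γ P a b) (hab : a ≤ b) {x₀ : M}
    (m : ChartModel D.conn x₀) (hγ : ∀ t ∈ Icc a b, γ t ∈ m.dom) :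
    Prim (fun t => frameCorep x₀ (γ t) (P t).symm)
      (fun t => frameCorep x₀ (γ t) (P t).symm ∘L
        m.Γ (m.coord (γ t)) (toChart x₀ (γ t) (D.vel ξ γ P t))) a b := by
  refine Prim.of_columns fun i => ?_
  have h1 := h.field _ (m.field_smooth (EuclideanSpace.single i 1))
  have h2 := h1.congr (z := fun t => frameCorep x₀ (γ t) (P t).symm (EuclideanSpace.single i 1))
    fun t ht => by rw [symm_toE_eq (hγ t ht).1, m.toChart_field (hγ t ht)]
  refine h2.congr_deriv hab fun t ht => ?_
  rw [symm_toE_eq (hγ t ht).1, m.cov_eq' (hγ t ht)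
    ((m.field_smooth _).fieldDiffAt Filter.univ_mem), m.toChart_field (hγ t ht),
    m.fderiv_rep_field (m.coord_mem (hγ t ht)), zero_apply, zero_add]
  rfl

theorem IsPath.prim_frameRep (h : D.IsPath ξ γ P a b) (hab : a ≤ b) {x₀ : M}
    (m : ChartModel D.conn x₀) (hγ : ∀ t ∈ Icc a b, γ t ∈ m.dom) :
    Prim (fun t => frameRep x₀ (γ t) (P t)) (fun t =>
      -(m.Γ (m.coord (γ t)) (toChart x₀ (γ t) (D.vel ξ γ P t)) ∘L frameRep x₀ (γ t) (P t)))
      a b := by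
  have e1 : ∀ t ∈ Icc a b, frameCorep (d := d) x₀ (γ t) ((P t).symm : Eu d →L[ℝ] Eu d)
      ∘L frameRep x₀ (γ t) (P t : Eu d →L[ℝ] Eu d) = .id ℝ (Eu d) :=
    fun t ht => frameCorep_comp_frameRep (hγ t ht).1 (P t)
  have e2 : ∀ t ∈ Icc a b, frameRep (d := d) x₀ (γ t) (P t : Eu d →L[ℝ] Eu d)
      ∘L frameCorep x₀ (γ t) ((P t).symm : Eu d →L[ℝ] Eu d) = .id ℝ (Eu d) :=
    fun t ht => frameRep_comp_frameCorep (hγ t ht).1 (P t)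
  have h3 := (h.prim_frameCorep hab m hγ).inverse hab e1 e2
  refine h3.congr_deriv hab fun t ht => ?_
  have e := frameRep_comp_frameCorep (hγ t ht).1 (P t)
  have : ∀ A B C G : Eu d →L[ℝ] Eu d, A ∘L B = .id ℝ _ → -(A ∘L (B ∘L G) ∘L C) = -(G ∘L C) :=
    fun A B C G h => by
      rw [ContinuousLinearMap.comp_assoc, ← ContinuousLinearMap.comp_assoc A B, h,
        ContinuousLinearMap.id_comp]
  exact this _ _ _ _ e

theorem IsPath.chart (h : D.IsPath ξ γ P a b) (hab : a ≤ b) {x₀ : M} (m : ChartModel D.conn x₀)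
    (hγ : ∀ t ∈ Icc a b, γ t ∈ m.dom) :
    Prim (fun t => D.chartState m (γ t) (P t))
      (fun t => D.chartField m ξ t (D.chartState m (γ t) (P t))) a b := by
  have h1 := (h.prim_coord m.coord_smooth hab).congr_deriv hab
    fun t ht => m.dir_coord (hγ t ht) _
  refine (h1.prodMk (h.prim_frameRep hab m hγ)).congr_deriv hab fun t ht => ?_
  rw [chartField_eq m (hγ t ht)]

/-- The converse of `IsPath.chart`, which turns solutions produced by the flow in a chart into
curves on the manifold. For a vector field, the derivative of the inverse frame supplies the
Christoffel term of ∇X. -/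
theorem IsPath.of_chart (hab : a ≤ b) {x₀ : M} (m : ChartModel D.conn x₀)
    (hγ : ∀ t ∈ Icc a b, γ t ∈ m.dom) (h : Prim (fun t => D.chartState m (γ t) (P t))
      (fun t => D.chartField m ξ t (D.chartState m (γ t) (P t))) a b) : D.IsPath ξ γ P a b := by
  have hx : Prim (fun t => m.coord (γ t)) (fun t => toChart x₀ (γ t) (D.vel ξ γ P t)) a b :=
    (h.clm (ContinuousLinearMap.fst ℝ _ _)).congr_deriv hab fun t ht => by
      rw [chartField_eq m (hγ t ht)]; rfl
  have hA : Prim (fun t => frameRep x₀ (γ t) (P t))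
      (fun t => -(m.Γ (m.coord (γ t)) (toChart x₀ (γ t) (D.vel ξ γ P t))
        ∘L frameRep x₀ (γ t) (P t))) a b :=
    (h.clm (ContinuousLinearMap.snd ℝ _ _)).congr_deriv hab fun t ht => by
      rw [chartField_eq m (hγ t ht)]; rfl
  have hO : ∀ t ∈ Icc a b, m.coord (γ t) ∈ m.O := fun t ht => m.coord_mem (hγ t ht)
  have hcomp : ∀ {F : Type} [NormedAddCommGroup F] [NormedSpace ℝ F] [CompleteSpace F] {g : Eu d → F},
      ContDiffOn ℝ ∞ g m.O → Prim (fun t => g (m.coord (γ t)))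
        (fun t => fderiv ℝ g (m.coord (γ t)) (toChart x₀ (γ t) (D.vel ξ γ P t))) a b := by
    intro F _ _ _ g hg
    refine hx.comp hab (fun t ht => ?_) ?_
    · exact (hg.contDiffAt (m.isOpen.mem_nhds (hO t ht))).hasStrictFDerivAt (by simp)
    · exact (hg.continuousOn_fderiv_of_isOpen m.isOpen (by simp)).comp hx.continuousOn hO
  refine ⟨?_, fun f hf => ?_, fun X hX => ?_⟩
  · refine (((contMDiffOn_ofChart x₀).continuousOn.mono m.subset).comp hx.continuousOn hO).congr
      fun t ht => (m.ofChart_coord (hγ t ht)).symm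
  · refine ((hcomp (m.contDiffOn_comp hf)).congr fun t ht => ?_).congr_deriv hab fun t ht => ?_
    · rw [m.ofChart_coord (hγ t ht)]
    · rw [m.dir_eq (hγ t ht) (hf.contMDiffAt.mdifferentiableAt (by simp))]
  · have e1 : ∀ t ∈ Icc a b, frameCorep (d := d) x₀ (γ t) ((P t).symm : Eu d →L[ℝ] Eu d)
      ∘L frameRep x₀ (γ t) (P t : Eu d →L[ℝ] Eu d) = .id ℝ (Eu d) := fun t ht => frameCorep_comp_frameRep (hγ t ht).1 (P t)
    have e2 : ∀ t ∈ Icc a b, frameRep (d := d) x₀ (γ t) (P t : Eu d →L[ℝ] Eu d)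
      ∘L frameCorep x₀ (γ t) ((P t).symm : Eu d →L[ℝ] Eu d) = .id ℝ (Eu d) := fun t ht => frameRep_comp_frameCorep (hγ t ht).1 (P t)
    have h3 := hA.inverse hab e2 e1
    have h4 := h3.clm_apply (hcomp (m.contDiffOn_rep hX)) hab
    have h5 := h4.congr (z := fun t => (P t).symm (toE _ (X (γ t)))) fun t ht => by
      rw [symm_toE_eq (hγ t ht).1, rep, m.ofChart_coord (hγ t ht)]
    refine h5.congr_deriv hab fun t ht => ?_
    have e := congrArg (fun L => L (rep x₀ X (m.coord (γ t))))
      (frameRep_comp_frameCorep (hγ t ht).1 (P t))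
    have e' : rep x₀ X (m.coord (γ t)) = toChart x₀ (γ t) (X (γ t)) := by
      rw [rep, m.ofChart_coord (hγ t ht)]
    rw [symm_toE_eq (hγ t ht).1, m.cov_eq' (hγ t ht) (hX.fieldDiffAt Filter.univ_mem), map_add,
      ← e', add_comm]
    congr 1
    have key : ∀ (A B G : Eu d →L[ℝ] Eu d) (w : Eu d), (A ∘L B) w = w →
        (-(B ∘L (-(G ∘L A)) ∘L B)) w = B (G w) := fun A B G w hw => by
      have hw' : A (B w) = w := hw
      simp [hw']
    exact key _ _ _ _ e

end DiffusionData

/-! ### Linearization and uniqueness of the chart system -/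

section SystemDerivative

variable {E W U : Type*} [NormedAddCommGroup E] [NormedSpace ℝ E] [NormedAddCommGroup W]
  [NormedSpace ℝ W] [NormedAddCommGroup U] [NormedSpace ℝ U]

/-- The derivative of the system `x' = v_t(x) + A b_t ζ`, `A' = - Γ(x') A`. -/
def sysLin (Γ : E → E →L[ℝ] E →L[ℝ] E) (v : E → E) (v' : E →L[ℝ] E) (β : U →L[ℝ] W)
    (y : E × (W →L[ℝ] E)) (ζ : U) (h : E × (W →L[ℝ] E)) : E × (W →L[ℝ] E) :=
  (v' h.1 + h.2 (β ζ), -(fderiv ℝ Γ y.1 h.1 (y.2 (β ζ) + v y.1) ∘L y.2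
    + Γ y.1 (v' h.1 + h.2 (β ζ)) ∘L y.2 + Γ y.1 (y.2 (β ζ) + v y.1) ∘L h.2))

theorem hasFDerivAt_sys {Γ : E → E →L[ℝ] E →L[ℝ] E} {v : ℝ → E → E} {v' : E →L[ℝ] E}
    {β : U →L[ℝ] W} {t : ℝ} {y : E × (W →L[ℝ] E)} (hΓ : DifferentiableAt ℝ Γ y.1)
    (hv : HasFDerivAt (v t) v' y.1) (ζ : U) :
    ∃ L : (E × (W →L[ℝ] E)) →L[ℝ] E × (W →L[ℝ] E),
      HasFDerivAt (fun y => sysDrift W Γ v t y + sysCtrl Γ β y ζ) L y ∧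
      ∀ h, L h = sysLin Γ (v t) v' β y ζ h := by
  have h1 : HasFDerivAt (fun y : E × (W →L[ℝ] E) => y.1) (.fst ℝ _ _) y := hasFDerivAt_fst
  have h2 : HasFDerivAt (fun y : E × (W →L[ℝ] E) => y.2) (.snd ℝ _ _) y := hasFDerivAt_snd
  have hv1 : HasFDerivAt (fun y : E × (W →L[ℝ] E) => v t y.1) (v' ∘L .fst ℝ _ _) y := hv.comp y h1
  have hΓ1 : HasFDerivAt (fun y : E × (W →L[ℝ] E) => Γ y.1) (fderiv ℝ Γ y.1 ∘L .fst ℝ _ _) y :=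
    HasFDerivAt.comp (g := Γ) (f := fun y : E × (W →L[ℝ] E) => y.1) y hΓ.hasFDerivAt h1
  have hw : HasFDerivAt (fun y : E × (W →L[ℝ] E) => y.2 (β ζ) + v t y.1) _ y :=
    (h2.clm_apply (hasFDerivAt_const (β ζ) y)).add hv1
  have hG0 : HasFDerivAt (fun y : E × (W →L[ℝ] E) => Γ y.1 (y.2 (β ζ) + v t y.1)) _ y :=
    hΓ1.clm_apply hw
  have hG := hG0.clm_comp h2
  simp only [sys_apply]
  refine ⟨_, hw.prodMk hG.neg, fun h => ?_⟩
  simp [sysLin]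
  constructor
  · abel
  · abel

/-- Separates the smooth dependence H on the state from the coefficients c, which need only be
continuous in time. This matters because Σ^{1/2} enters with continuity in t only. -/
theorem exists_deriv_comp {Y Z F : Type*} [NormedAddCommGroup Y] [NormedSpace ℝ Y]
    [NormedAddCommGroup Z] [NormedSpace ℝ Z] [NormedAddCommGroup F] [NormedSpace ℝ F] {K : Set ℝ}
    {Ω : Set Y} (hΩ : IsOpen Ω) {H : Y × Z → F} (hH : ContDiffOn ℝ ∞ H (Ω ×ˢ univ)) {c : ℝ → Y → Z}
    {c' : ℝ → Y → Y →L[ℝ] Z} (hc : ContinuousOn (fun p : ℝ × Y => c p.1 p.2) (K ×ˢ Ω))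
    (hc' : ContinuousOn (fun p : ℝ × Y => c' p.1 p.2) (K ×ˢ Ω))
    (hd : ∀ t ∈ K, ∀ y ∈ Ω, HasFDerivAt (c t) (c' t y) y) :
    ContinuousOn (fun p : ℝ × Y => H (p.2, c p.1 p.2)) (K ×ˢ Ω) ∧
    ∃ f' : ℝ → Y → Y →L[ℝ] F, ContinuousOn (fun p : ℝ × Y => f' p.1 p.2) (K ×ˢ Ω) ∧
      ∀ t ∈ K, ∀ y ∈ Ω, HasFDerivAt (fun y => H (y, c t y)) (f' t y) y := by
  have hHo : IsOpen (Ω ×ˢ (univ : Set Z)) := hΩ.prod isOpen_univ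
  refine ⟨hH.continuousOn.comp (continuousOn_snd.prodMk hc) fun p hp => ⟨hp.2, trivial⟩,
    fun t y => fderiv ℝ H (y, c t y) ∘L ((ContinuousLinearMap.id ℝ Y).prod (c' t y)), ?_,
    fun t ht y hy => ?_⟩
  · refine ContinuousOn.clm_comp ?_ ?_
    · exact (hH.continuousOn_fderiv_of_isOpen hHo (by simp)).comp (continuousOn_snd.prodMk hc)
        fun p hp => ⟨hp.2, trivial⟩
    · exact (ContinuousLinearMap.prodₗᵢ ℝ).continuous.comp_continuousOn
        (continuousOn_const.prodMk hc')
  · exact HasFDerivAt.comp (g := H) (f := fun y => (y, c t y)) y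
      ((hH.contDiffAt (hHo.mem_nhds ⟨hy, trivial⟩)).differentiableAt (by simp)).hasFDerivAt
      ((hasFDerivAt_id y).prodMk (hd t ht y hy))

theorem contDiffOn_sysDrift {O : Set E} {Γ : E → E →L[ℝ] E →L[ℝ] E} (hΓ : ContDiffOn ℝ ∞ Γ O) :
    ContDiffOn ℝ ∞ (fun p : (E × (W →L[ℝ] E)) × E => (p.2, -(Γ p.1.1 p.2 ∘L p.1.2)))
      ((O ×ˢ univ) ×ˢ univ) := by
  have h1 : ContDiffOn ℝ ∞ (fun p : (E × (W →L[ℝ] E)) × E => Γ p.1.1)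
      ((O ×ˢ univ) ×ˢ univ) := hΓ.comp (by fun_prop) fun p hp => hp.1.1
  exact ContDiffOn.prodMk (by fun_prop) (ContDiffOn.neg
    ((h1.clm_apply (by fun_prop)).clm_comp (by fun_prop)))

theorem contDiffOn_sysCtrl {O : Set E} {Γ : E → E →L[ℝ] E →L[ℝ] E} (hΓ : ContDiffOn ℝ ∞ Γ O) :
    ContDiffOn ℝ ∞ (fun p : (E × (W →L[ℝ] E)) × (U →L[ℝ] W) => sysCtrl Γ p.2 p.1)
      ((O ×ˢ univ) ×ˢ univ) := by
  have h1 : ContDiffOn ℝ ∞ (fun p : (E × (W →L[ℝ] E)) × (U →L[ℝ] W) => Γ p.1.1)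
      ((O ×ˢ univ) ×ˢ univ) := hΓ.comp (by fun_prop) fun p hp => hp.1.1
  have h2 : ContDiffOn ℝ ∞ (fun p : (E × (W →L[ℝ] E)) × (U →L[ℝ] W) => p.1.2 ∘L p.2)
      ((O ×ˢ univ) ×ˢ univ) := ContDiffOn.clm_comp (by fun_prop) (by fun_prop)
  exact (contDiffOn_const.clm_comp h2).sub (contDiffOn_const.clm_comp
    (ContDiffOn.clm_comp (by fun_prop) (h1.clm_comp h2)))

/-- The regularity required by `exists_local_flow` and `eq_of_prim_control`. The last clause
identifies the abstract derivatives with `sysLin` by uniqueness of the Fréchet derivative. -/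
theorem exists_sysDeriv {T : ℝ} {O : Set E} (hO : IsOpen O) {Γ : E → E →L[ℝ] E →L[ℝ] E}
    (hΓ : ContDiffOn ℝ ∞ Γ O) {v : ℝ → E → E} {v' : ℝ → E → E →L[ℝ] E}
    (hvc : ContinuousOn (fun p : ℝ × E => v p.1 p.2) (Icc 0 T ×ˢ O))
    (hvc' : ContinuousOn (fun p : ℝ × E => v' p.1 p.2) (Icc 0 T ×ˢ O))
    (hv : ∀ t ∈ Icc 0 T, ∀ x ∈ O, HasFDerivAt (v t) (v' t x) x) {β : ℝ → U →L[ℝ] W}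
    (hβ : ContinuousOn β (Icc 0 T)) :
    ContinuousOn (fun p : ℝ × (E × (W →L[ℝ] E)) => sysDrift W Γ v p.1 p.2)
        (Icc 0 T ×ˢ (O ×ˢ univ)) ∧
    ContinuousOn (fun p : ℝ × (E × (W →L[ℝ] E)) => sysCtrl Γ (β p.1) p.2)
        (Icc 0 T ×ˢ (O ×ˢ univ)) ∧
    ∃ (f₀' : ℝ → E × (W →L[ℝ] E) → (E × (W →L[ℝ] E)) →L[ℝ] E × (W →L[ℝ] E))
      (f₁' : ℝ → E × (W →L[ℝ] E) → (E × (W →L[ℝ] E)) →L[ℝ] U →L[ℝ] E × (W →L[ℝ] E)),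
      ContinuousOn (fun p : ℝ × (E × (W →L[ℝ] E)) => f₀' p.1 p.2) (Icc 0 T ×ˢ (O ×ˢ univ)) ∧
      ContinuousOn (fun p : ℝ × (E × (W →L[ℝ] E)) => f₁' p.1 p.2) (Icc 0 T ×ˢ (O ×ˢ univ)) ∧
      (∀ t ∈ Icc 0 T, ∀ y ∈ O ×ˢ univ, HasFDerivAt (sysDrift W Γ v t) (f₀' t y) y) ∧
      (∀ t ∈ Icc 0 T, ∀ y ∈ O ×ˢ univ, HasFDerivAt (sysCtrl Γ (β t)) (f₁' t y) y) ∧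
      ∀ t ∈ Icc 0 T, ∀ y ∈ O ×ˢ univ, ∀ h ζ,
        f₀' t y h + f₁' t y h ζ = sysLin Γ (v t) (v' t y.1) (β t) y ζ h := by
  have hΩ : IsOpen (O ×ˢ (univ : Set (W →L[ℝ] E))) := hO.prod isOpen_univ
  have hp₁ : ContinuousOn (fun p : ℝ × (E × (W →L[ℝ] E)) => (p.1, p.2.1))
    (Icc 0 T ×ˢ (O ×ˢ univ)) := by fun_prop
  have hpm : MapsTo (fun p : ℝ × (E × (W →L[ℝ] E)) => (p.1, p.2.1)) (Icc 0 T ×ˢ (O ×ˢ univ))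
      (Icc 0 T ×ˢ O) := fun p hp => ⟨hp.1, hp.2.1⟩
  have hp₂ : MapsTo (fun p : ℝ × (E × (W →L[ℝ] E)) => p.1) (Icc 0 T ×ˢ (O ×ˢ univ))
      (Icc 0 T) := fun p hp => hp.1
  obtain ⟨c₀, f₀', k₀, d₀⟩ := exists_deriv_comp (K := Icc 0 T) hΩ (contDiffOn_sysDrift (W := W) hΓ)
    (c := fun t y => v t y.1) (c' := fun t y => v' t y.1 ∘L .fst ℝ _ _) (hvc.comp hp₁ hpm)
    ((hvc'.comp hp₁ hpm).clm_comp continuousOn_const)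
    fun t ht y hy => (hv t ht _ hy.1).comp y (hasFDerivAt_fst (p := y))
  obtain ⟨c₁, f₁', k₁, d₁⟩ := exists_deriv_comp (K := Icc 0 T) hΩ (contDiffOn_sysCtrl (W := W) (U := U) hΓ)
    (c := fun t _ => β t) (c' := fun t y => 0) (hβ.comp continuousOn_fst hp₂)
    continuousOn_const fun t ht y hy => hasFDerivAt_const (β t) y
  refine ⟨c₀, c₁, f₀', f₁', k₀, k₁, d₀, d₁, fun t ht y hy h ζ => ?_⟩
  obtain ⟨L, hL, hLe⟩ := hasFDerivAt_sys (W := W) (β := β t) (t := t) (y := y)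
    ((hΓ.contDiffAt (hO.mem_nhds hy.1)).differentiableAt (by simp)) (hv t ht _ hy.1) ζ
  have h3 := ((d₁ t ht y hy).clm_apply (hasFDerivAt_const ζ y))
  have h4 := ((d₀ t ht y hy).add h3).unique hL
  rw [← hLe, ← h4]
  simp

/-- Uniqueness for control systems. -/
theorem eq_of_prim_control [ProperSpace E] {T r s : ℝ} {Ω : Set E} (hΩ : IsOpen Ω)
    (hr : r ∈ Icc 0 T) (hs : s ∈ Icc 0 T) {f₀ : ℝ → E → E} {f₁ : ℝ → E → U →L[ℝ] E}
    {f₀' : ℝ → E → E →L[ℝ] E} {f₁' : ℝ → E → E →L[ℝ] U →L[ℝ] E}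
    (hf₀' : ContinuousOn (fun p : ℝ × E => f₀' p.1 p.2) (Icc 0 T ×ˢ Ω))
    (hf₁' : ContinuousOn (fun p : ℝ × E => f₁' p.1 p.2) (Icc 0 T ×ˢ Ω))
    (hd₀ : ∀ t ∈ Icc 0 T, ∀ y ∈ Ω, HasFDerivAt (f₀ t) (f₀' t y) y)
    (hd₁ : ∀ t ∈ Icc 0 T, ∀ y ∈ Ω, HasFDerivAt (f₁ t) (f₁' t y) y)
    (ξ : Control T U) {y z : ℝ → E}
    (hy : Prim y (fun t => f₀ t (y t) + f₁ t (y t) (ξ t)) r s)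
    (hz : Prim z (fun t => f₀ t (z t) + f₁ t (z t) (ξ t)) r s)
    (hyΩ : ∀ t ∈ Icc r s, y t ∈ Ω) (hyz : y r = z r) :
    ∀ t ∈ Icc r s, y t = z t := by
  refine Icc_induction hyz fun t ht => ?_
  have hsub : Icc r s ⊆ Icc 0 T := Icc_subset_Icc hr.1 hs.2
  -- If the curves meet at t, both stay near t in a ball on which the fields are Lipschitz, and the
  -- linear inequality for y - z applies.
  by_cases htz : y t = z t
  · obtain ⟨ρ, hρ, hρΩ⟩ := Metric.nhds_basis_closedBall.mem_iff.1 (hΩ.mem_nhds (hyΩ t ht))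
    have hK : IsCompact (Icc 0 T ×ˢ Metric.closedBall (y t) ρ) :=
      isCompact_Icc.prod (isCompact_closedBall _ _)
    obtain ⟨C₀, hC₀⟩ := hK.exists_bound_of_continuousOn
      (hf₀'.mono (prod_mono subset_rfl hρΩ))
    obtain ⟨C₁, hC₁⟩ := hK.exists_bound_of_continuousOn
      (E := E →L[ℝ] U →L[ℝ] E) (hf₁'.mono (prod_mono subset_rfl hρΩ))
    have hT0 : (t, y t) ∈ Icc 0 T ×ˢ Metric.closedBall (y t) ρ :=
      ⟨hsub ht, Metric.mem_closedBall_self hρ.le⟩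
    have hC₀0 : 0 ≤ C₀ := (norm_nonneg _).trans (hC₀ _ hT0)
    have hC₁0 : 0 ≤ C₁ := (norm_nonneg _).trans (hC₁ _ hT0)
    obtain ⟨δ₁, hδ₁, h1⟩ := Metric.continuousWithinAt_iff.1 (hy.continuousOn t ht) ρ hρ
    obtain ⟨δ₂, hδ₂, h2⟩ := Metric.continuousWithinAt_iff.1 (hz.continuousOn t ht) ρ hρ
    refine ⟨min δ₁ δ₂, lt_min hδ₁ hδ₂, fun a ha b hb hat hbt hab hya => ?_⟩
    have hya' : ∀ x ∈ Icc a b, |x - t| < min δ₁ δ₂ := fun x hx => by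
      rw [abs_lt] at hat hbt ⊢
      constructor <;> linarith [hx.1, hx.2]
    have habs : ∀ x ∈ Icc a b, x ∈ Icc r s := fun x hx => ⟨ha.1.trans hx.1, hx.2.trans hb.2⟩
    have hyb : ∀ x ∈ Icc a b, y x ∈ Metric.closedBall (y t) ρ := fun x hx =>
      Metric.ball_subset_closedBall (h1 (habs x hx)
        (by rw [Real.dist_eq]; exact (hya' x hx).trans_le (min_le_left _ _)))
    have hzb : ∀ x ∈ Icc a b, z x ∈ Metric.closedBall (y t) ρ := fun x hx => by
      rw [htz]
      exact Metric.ball_subset_closedBall (h2 (habs x hx)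
        (by rw [Real.dist_eq]; exact (hya' x hx).trans_le (min_le_right _ _)))
    have hcv : Convex ℝ (Metric.closedBall (y t) ρ) := convex_closedBall _ _
    have hint : IntervalIntegrable (fun x => C₀ + C₁ * ‖ξ x‖) volume a b :=
      (intervalIntegrable_const).add
        ((ξ.intervalIntegrable (hsub ha) (hsub hb)).norm.const_mul _)
    have := ((hy.mono ha hb).sub (hz.mono ha hb)).eq_zero_of_norm_le hint
      (fun x => by positivity) (.of_forall fun x hx => ?_) (by rw [hya, sub_self]) b ⟨hab, le_rfl⟩
    · exact sub_eq_zero.1 this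
    · have hx0 := hsub (habs x hx)
      have e0 := hcv.norm_image_sub_le_of_norm_hasFDerivWithin_le (f := f₀ x) (f' := f₀' x)
        (fun w hw => (hd₀ x hx0 w (hρΩ hw)).hasFDerivWithinAt)
        (fun w hw => hC₀ (x, w) ⟨hx0, hw⟩) (hzb x hx) (hyb x hx)
      have e1 := hcv.norm_image_sub_le_of_norm_hasFDerivWithin_le (f := f₁ x) (f' := f₁' x)
        (fun w hw => (hd₁ x hx0 w (hρΩ hw)).hasFDerivWithinAt)
        (fun w hw => hC₁ (x, w) ⟨hx0, hw⟩) (hzb x hx) (hyb x hx)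
      calc _ = ‖(f₀ x (y x) - f₀ x (z x)) + (f₁ x (y x) - f₁ x (z x)) (ξ x)‖ := by
            congr 1; simp only [sub_apply]; abel
        _ ≤ C₀ * ‖y x - z x‖ + C₁ * ‖y x - z x‖ * ‖ξ x‖ := by
            refine (norm_add_le _ _).trans (add_le_add e0 ?_)
            exact (ContinuousLinearMap.le_opNorm _ _).trans (by gcongr)
        _ = _ := by ring
  -- If they differ at t they differ nearby, so the premise of the propagation step never holds
  -- there.
  · have h1 : ContinuousWithinAt (fun x => y x - z x) (Icc r s) t :=
      (hy.continuousOn t ht).sub (hz.continuousOn t ht)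
    obtain ⟨δ, hδ, h2⟩ := Metric.continuousWithinAt_iff.1 h1 ‖y t - z t‖
      (norm_pos_iff.2 (sub_ne_zero.2 htz))
    refine ⟨δ, hδ, fun a ha b hb hat hbt hab hya => ?_⟩
    have := h2 ha (by rwa [Real.dist_eq])
    rw [hya, sub_self, dist_zero_left] at this
    exact absurd this (lt_irrefl _)

end SystemDerivative

theorem exists_delta_of_mem_nhds {X : Type*} [TopologicalSpace X] {γ : ℝ → X} {a b t : ℝ}
    (h : ContinuousOn γ (Icc a b)) (ht : t ∈ Icc a b) {U : Set X} (hU : U ∈ 𝓝 (γ t)) :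
    ∃ δ > 0, ∀ s ∈ Icc a b, |s - t| < δ → γ s ∈ U := by
  obtain ⟨δ, hδ, H⟩ := Metric.mem_nhdsWithin_iff.1 (h t ht hU)
  exact ⟨δ, hδ, fun s hs hst => H ⟨by rwa [Metric.mem_ball, Real.dist_eq], hs⟩⟩

theorem abs_sub_lt_of_mem_Icc {r s t x δ : ℝ} (hr : |r - t| < δ) (hs : |s - t| < δ)
    (hx : x ∈ Icc r s) : |x - t| < δ := by
  rw [abs_lt] at hr hs ⊢
  constructor <;> linarith [hx.1, hx.2]

/-! ### Regularity of the coefficients, and uniqueness of solutions -/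

namespace DiffusionData

set_option linter.unusedSectionVars false

variable {d : ℕ} {M : Type*} [TopologicalSpace M] [ChartedSpace (EuclideanSpace ℝ (Fin d)) M]
  [IsManifold (𝓡 d) ∞ M] {o : M} {T : ℝ} (D : DiffusionData d M o T)

theorem contDiffOn_rep_u (x₀ : M) :
    ContDiffOn ℝ ∞ (fun p : ℝ × Eu d => rep x₀ (D.u p.1) p.2)
      (Icc 0 T ×ˢ (extChartAt (𝓡 d) x₀).target) := by
  set e := trivializationAt (Eu d) (TangentSpace (𝓡 d) : M → Type _) x₀
  have h1 : ContMDiffOn 𝓘(ℝ, ℝ × Eu d) (𝓘(ℝ, ℝ).prod (𝓡 d)) ∞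
      (fun p : ℝ × Eu d => (p.1, ofChart x₀ p.2)) (Icc 0 T ×ˢ (extChartAt (𝓡 d) x₀).target) := by
    refine ContMDiffOn.prodMk contDiff_fst.contMDiff.contMDiffOn ?_
    exact (contMDiffOn_ofChart x₀).comp contDiff_snd.contMDiff.contMDiffOn fun p hp => hp.2
  have h2 := D.u_smooth.comp h1 fun p hp => ⟨hp.1, trivial⟩
  have h3 := (Bundle.Trivialization.contMDiffOn (IB := 𝓡 d) (n := ∞) e).comp h2 fun p hp => by
    simp only [Set.mem_preimage, Function.comp]
    rw [e.mem_source]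
    exact ofChart_mem hp.2
  have h4 := contMDiff_snd.comp_contMDiffOn h3
  rw [← contMDiffOn_iff_contDiffOn]
  refine h4.congr fun p hp => ?_
  exact toChart_eq_snd (ofChart_mem hp.2) _

/-- The spatial derivative of the drift, in a chart. -/
def driftDeriv (x₀ : M) (t : ℝ) (y : Eu d) : Eu d →L[ℝ] Eu d := fderiv ℝ (rep x₀ (D.u t)) y

variable {D}

theorem hasFDerivAt_rep_u {x₀ : M} {t : ℝ} (ht : t ∈ Icc 0 T) {y : Eu d}
    (hy : y ∈ (extChartAt (𝓡 d) x₀).target) :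
    HasFDerivAt (rep x₀ (D.u t)) (fderivWithin ℝ (fun p : ℝ × Eu d => rep x₀ (D.u p.1) p.2)
      (Icc 0 T ×ˢ (extChartAt (𝓡 d) x₀).target) (t, y) ∘L .inr ℝ _ _) y := by
  have h := ((D.contDiffOn_rep_u x₀).differentiableOn (by simp) (t, y) ⟨ht, hy⟩).hasFDerivWithinAt
  have hm : MapsTo (fun z : Eu d => (t, z)) (extChartAt (𝓡 d) x₀).target
    (Icc 0 T ×ˢ (extChartAt (𝓡 d) x₀).target) := fun z hz => ⟨ht, hz⟩
  have h2 := h.comp y (hasFDerivAt_prodMk_right t y).hasFDerivWithinAt hm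
  exact h2.hasFDerivAt ((isOpen_target x₀).mem_nhds hy)

theorem hasFDerivAt_driftDeriv {x₀ : M} {t : ℝ} (ht : t ∈ Icc 0 T) {y : Eu d}
    (hy : y ∈ (extChartAt (𝓡 d) x₀).target) :
    HasFDerivAt (rep x₀ (D.u t)) (D.driftDeriv x₀ t y) y :=
  (hasFDerivAt_rep_u ht hy).differentiableAt.hasFDerivAt

/-- The drift is smooth on [0, T] × M only in the sense of within-derivatives; since T > 0 these are
unique and continuous, and their spatial part is the derivative sought. -/
theorem continuousOn_driftDeriv (hT : 0 < T) (x₀ : M) :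
    ContinuousOn (fun p : ℝ × Eu d => D.driftDeriv x₀ p.1 p.2)
      (Icc 0 T ×ˢ (extChartAt (𝓡 d) x₀).target) := by
  have h := (D.contDiffOn_rep_u x₀).continuousOn_fderivWithin
    ((uniqueDiffOn_Icc hT).prod (isOpen_target x₀).uniqueDiffOn) (by simp)
  refine (h.clm_comp (continuousOn_const (c := ContinuousLinearMap.inr ℝ ℝ (Eu d)))).congr
    fun p hp => (hasFDerivAt_rep_u hp.1 hp.2).fderiv

theorem fieldDiffAt_u [T2Space M] {t : ℝ} (ht : t ∈ Icc 0 T) (x : M) :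
    FieldDiffAt (D.u t) x := by
  obtain ⟨m⟩ := exists_chartModel D.conn_smooth x
  rw [m.differentiableAt_rep m.mem_dom]
  exact (hasFDerivAt_driftDeriv ht (m.subset (m.coord_mem m.mem_dom))).differentiableAt

theorem Sig_nonneg {t : ℝ} (ht : t ∈ Icc 0 T) (v : D.S.Fiber o) : 0 ≤ ⟪D.Sig t v, v⟫ := by
  rcases eq_or_ne v 0 with rfl | hv
  · simp
  · exact (D.Sig_pos t ht v hv).le

variable (D) in
theorem continuousOn_posSqrt_Sig : ContinuousOn (fun t => posSqrt (D.Sig t)) (Icc 0 T) :=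
  continuousOn_posSqrt D.Sig_smooth.continuousOn (fun _ ht => D.Sig_symm _ ht)
    fun _ ht => Sig_nonneg ht

variable (D) in
theorem continuousOn_diffusion : ContinuousOn D.diffusion (Icc 0 T) :=
  continuousOn_const.clm_comp D.continuousOn_posSqrt_Sig

theorem posSqrt_Sig_spec {t : ℝ} (ht : t ∈ Icc 0 T) : (posSqrt (D.Sig t)).IsPositive ∧
    posSqrt (D.Sig t) ∘L posSqrt (D.Sig t) = D.Sig t :=
  posSqrt_spec (D.Sig_symm t ht) fun _ => Sig_nonneg ht _

variable {ξ : ℝ → D.S.Fiber o} {γ : ℝ → M} {P : ℝ → Eu d ≃L[ℝ] Eu d} {a b c : ℝ}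

theorem IsPath.trans (h : D.IsPath ξ γ P a b) (h' : D.IsPath ξ γ P b c) (hab : a ≤ b)
    (hbc : b ≤ c) : D.IsPath ξ γ P a c where
  continuousOn := by
    rw [← Icc_union_Icc_eq_Icc hab hbc]
    exact h.continuousOn.union_of_isClosed h'.continuousOn isClosed_Icc isClosed_Icc
  comp f hf := (h.comp f hf).trans (h'.comp f hf) hab hbc
  field X hX := (h.field X hX).trans (h'.field X hX) hab hbc

theorem IsPath.congr {γ₂ : ℝ → M} {P₂ : ℝ → Eu d ≃L[ℝ] Eu d} (h : D.IsPath ξ γ P a b) (hab : a ≤ b)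
    (hγ : ∀ t ∈ Icc a b, γ₂ t = γ t ∧ P₂ t = P t) : D.IsPath ξ γ₂ P₂ a b where
  continuousOn := h.continuousOn.congr fun t ht => (hγ t ht).1
  comp f hf := ((h.comp f hf).congr fun t ht => by rw [(hγ t ht).1]).congr_deriv hab
    fun t ht => by unfold vel; rw [(hγ t ht).1, (hγ t ht).2]
  field X hX := ((h.field X hX).congr fun t ht => by rw [(hγ t ht).1, (hγ t ht).2]).congr_deriv hab
    fun t ht => by unfold vel; rw [(hγ t ht).1, (hγ t ht).2]

theorem toE_eq_of_eq (X : (x : M) → TangentSpace (𝓡 d) x) {x y : M} (h : x = y) :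
    toE x (X x) = toE y (X y) := by rw [h]

theorem IsPath.isParallelTransport (h : D.IsPath ξ γ P 0 T) (h0 : γ 0 = o ∧ P 0 = .refl ℝ _) :
    IsParallelTransport D.conn T o γ (D.vel ξ γ P) fun t =>
      ((toE o).toLinearEquiv.trans (P t).toLinearEquiv).trans (toE (γ t)).symm.toLinearEquiv := by
  intro X hX l
  have h1 := (h.field X hX).clm (LinearMap.toContinuousLinearMap (l ∘ₗ (toE o).symm.toLinearMap))
  refine ⟨h1.1, fun t ht => ?_⟩
  refine Eq.trans ?_ (h1.2 t ht)
  congr 1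
  have : (P 0).symm (toE (γ 0) (X (γ 0))) = toE o (X o) := by
    rw [h0.2, toE_eq_of_eq X h0.1]; rfl
  change l (X o) = l ((toE o).symm ((P 0).symm (toE (γ 0) (X (γ 0)))))
  rw [this]
  rfl

/-- Functionals on T_oM are replaced by vector-valued primitives. That the frame starts at the
identity is not part of `IsSolution`; it is forced by the tested identity at time 0. -/
theorem isSolution_iff [T2Space M] (hT : 0 < T) {ξ : D.CameronMartin} {γ : ℝ → M} :
    D.IsSolution ξ γ ↔ γ 0 = o ∧ ∃ P : ℝ → Eu d ≃L[ℝ] Eu d,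
      D.IsPath ξ γ P 0 T ∧ P 0 = .refl ℝ _ := by
  have h0 : (0 : ℝ) ∈ Icc 0 T := ⟨le_rfl, hT.le⟩
  refine and_congr_right fun hγ0 => ⟨?_, ?_⟩
  · rintro ⟨P, hAC, hP⟩
    let p : ℝ → Eu d ≃L[ℝ] Eu d := fun t =>
      (((toE o).symm.toLinearEquiv.trans (P t)).trans (toE (γ t)).toLinearEquiv).toContinuousLinearEquiv
    have hfield : ∀ X : (x : M) → TangentSpace (𝓡 d) x, SmoothFieldOn X univ →
        (p 0).symm (toE _ (X (γ 0))) = toE o (X o) ∧ Prim (fun t => (p t).symm (toE _ (X (γ t))))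
      (fun t => (p t).symm (toE _ (D.conn X (γ t) (D.vel ξ γ p t)))) 0 T := by
      intro X hX
      have hl : ∀ i, Prim (fun t => (p t).symm (toE _ (X (γ t))) i)
          (fun t => (p t).symm (toE _ (D.conn X (γ t) (D.vel ξ γ p t))) i) 0 T ∧
          (p 0).symm (toE _ (X (γ 0))) i = toE o (X o) i := by
        intro i
        have h1 := hP X hX (((EuclideanSpace.proj (𝕜 := ℝ) i : Eu d →L[ℝ] ℝ).toLinearMap) ∘ₗ
          (toE o).toLinearMap)
        have e0 := h1.2 0 h0
        rw [intervalIntegral.integral_same, sub_eq_zero] at e0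
        refine ⟨⟨h1.1, fun t ht => ?_⟩, e0⟩
        have e1 := h1.2 t ht
        rw [← e0] at e1
        exact e1
      exact ⟨by ext i; exact (hl i).2, Prim.of_coord fun i => (hl i).1⟩
    refine ⟨p, ⟨hAC.1, fun f hf => ?_, fun X hX => (hfield X hX).2⟩, ?_⟩
    · exact hAC.2 f hf
    · obtain ⟨m⟩ := exists_chartModel D.conn_smooth o
      -- Every vector at o is the value of some coordinate field, and at time 0 the transport fixes
      -- the values of fields.
      have : ∀ v, (p 0).symm v = v := fun v => by
        have h1 := (hfield _ (m.field_smooth (toChart o o ((toE o).symm v)))).1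
        have h2 : m.field (toChart o o ((toE o).symm v)) o = (toE o).symm v := by
          rw [← fromChart_toChart (mem_chart_source _ o) (m.field _ o),
            m.toChart_field m.mem_dom, fromChart_toChart (mem_chart_source _ o)]
        rw [toE_eq_of_eq _ hγ0, h2] at h1
        simpa using h1
      ext1
      funext v
      have := this ((p 0) v)
      rw [ContinuousLinearEquiv.symm_apply_apply] at this
      exact this.symm
  · rintro ⟨p, hp, hp0⟩
    exact ⟨fun t => ((toE o).toLinearEquiv.trans (p t).toLinearEquiv).trans
      (toE (γ t)).symm.toLinearEquiv, ⟨hp.continuousOn, fun f hf => hp.comp f hf⟩,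
      hp.isParallelTransport ⟨hγ0, hp0⟩⟩

/-- The map `E_o → T_x M` given by a frame, in the chart at `x₀`. -/
def redRep {W : Type*} [NormedAddCommGroup W] [NormedSpace ℝ W] (x₀ x : M)
    (F : W →L[ℝ] Eu d) : W →L[ℝ] Eu d :=
  toChart x₀ x ∘L (toE x).symm.toContinuousLinearMap ∘L F

variable (D) in
/-- The system for a curve and the parallel transport of `E_o` along it, in a chart. -/
def redField {x₀ : M} (m : ChartModel D.conn x₀) (ξ : ℝ → D.S.Fiber o) (t : ℝ)
    (y : Eu d × (D.S.Fiber o →L[ℝ] Eu d)) : Eu d × (D.S.Fiber o →L[ℝ] Eu d) :=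
  sysDrift (D.S.Fiber o) m.Γ (fun t => rep x₀ (D.u t)) t y + sysCtrl m.Γ (posSqrt (D.Sig t)) y (ξ t)

variable (D) in
/-- `γ` is a solution on `[a,b]` and `F` the parallel transport of `E_o` along it. -/
structure IsRedPath (ξ : ℝ → D.S.Fiber o) (γ : ℝ → M) (F : ℝ → D.S.Fiber o →L[ℝ] Eu d) (a b : ℝ) :
    Prop where
  continuousOn : ContinuousOn γ (Icc a b)
  chart : ∀ (x₀ : M) (m : ChartModel D.conn x₀) (r s : ℝ), a ≤ r → r ≤ s → s ≤ b →
    (∀ t ∈ Icc r s, γ t ∈ m.dom) → Prim (fun t => (m.coord (γ t), redRep x₀ (γ t) (F t)))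
      (fun t => D.redField m ξ t (m.coord (γ t), redRep x₀ (γ t) (F t))) r s

/-- The frame equation acts by composition on the left, so it restricts to E_o, and the control
enters only through that restriction. -/
theorem IsPath.isRedPath [T2Space M] (h : D.IsPath ξ γ P a b) :
    D.IsRedPath ξ γ (fun t => (P t : Eu d →L[ℝ] Eu d) ∘L D.inclE o) a b := by
  refine ⟨h.continuousOn, fun x₀ m r s hr hrs hs hγ => ?_⟩
  have h1 := ((h.mono hr hrs hs).chart hrs m hγ).clm
    ((ContinuousLinearMap.id ℝ (Eu d)).prodMap
      ((ContinuousLinearMap.compL ℝ (D.S.Fiber o) (Eu d) (Eu d)).flip (D.inclE o)))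
  refine h1.congr_deriv hrs fun t ht => ?_
  rw [chartField, redField, sys_apply, sys_apply]
  rfl

/-- Uniqueness for the curve together with the transport of E alone. This is the version that
applies to projections from M, where a full frame on N is not available. -/
theorem IsRedPath.unique [T2Space M] (hT : 0 < T) {ξ : D.CameronMartin} {γ₁ γ₂ : ℝ → M}
    {F₁ F₂ : ℝ → D.S.Fiber o →L[ℝ] Eu d} (h₁ : D.IsRedPath ξ γ₁ F₁ 0 T)
    (h₂ : D.IsRedPath ξ γ₂ F₂ 0 T) (h : γ₁ 0 = γ₂ 0 ∧ F₁ 0 = F₂ 0) :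
    ∀ t ∈ Icc 0 T, γ₁ t = γ₂ t ∧ F₁ t = F₂ t := by
  refine Icc_induction h fun t ht => ?_
  by_cases htz : γ₁ t = γ₂ t
  · obtain ⟨m⟩ := exists_chartModel D.conn_smooth (γ₁ t)
    have hU : m.dom ∈ 𝓝 (γ₁ t) := m.isOpen_dom.mem_nhds m.mem_dom
    obtain ⟨δ₁, hδ₁, H₁⟩ := exists_delta_of_mem_nhds h₁.continuousOn ht hU
    obtain ⟨δ₂, hδ₂, H₂⟩ := exists_delta_of_mem_nhds h₂.continuousOn ht (by rwa [← htz])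
    refine ⟨min δ₁ δ₂, lt_min hδ₁ hδ₂, fun r hr s hs hrt hst hrs hrr => ?_⟩
    have hsub : ∀ x ∈ Icc r s, x ∈ Icc 0 T ∧ |x - t| < min δ₁ δ₂ := fun x hx =>
      ⟨⟨hr.1.trans hx.1, hx.2.trans hs.2⟩, abs_sub_lt_of_mem_Icc hrt hst hx⟩
    have hd₁ : ∀ x ∈ Icc r s, γ₁ x ∈ m.dom := fun x hx =>
      H₁ x (hsub x hx).1 ((hsub x hx).2.trans_le (min_le_left _ _))
    have hd₂ : ∀ x ∈ Icc r s, γ₂ x ∈ m.dom := fun x hx =>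
      H₂ x (hsub x hx).1 ((hsub x hx).2.trans_le (min_le_right _ _))
    have hOt : Icc 0 T ×ˢ m.O ⊆ Icc 0 T ×ˢ (extChartAt (𝓡 d) (γ₁ t)).target :=
      prod_mono subset_rfl m.subset
    obtain ⟨-, -, f₀', f₁', c₀, c₁, g₀, g₁, -⟩ := exists_sysDeriv (W := D.S.Fiber o) m.isOpen m.smooth
      ((D.contDiffOn_rep_u (γ₁ t)).continuousOn.mono hOt)
      ((continuousOn_driftDeriv hT (γ₁ t)).mono hOt)
      (fun t ht x hx => hasFDerivAt_driftDeriv ht (m.subset hx)) D.continuousOn_posSqrt_Sig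
    have key := eq_of_prim_control (m.isOpen.prod isOpen_univ) hr hs c₀ c₁ g₀ g₁ ξ
      (h₁.chart _ m r s hr.1 hrs hs.2 hd₁) (h₂.chart _ m r s hr.1 hrs hs.2 hd₂)
      (fun x hx => ⟨m.coord_mem (hd₁ x hx), trivial⟩) (by rw [hrr.1, hrr.2]) s ⟨hrs, le_rfl⟩
    have k1 : γ₁ s = γ₂ s := by
      rw [← m.ofChart_coord (hd₁ s ⟨hrs, le_rfl⟩), ← m.ofChart_coord (hd₂ s ⟨hrs, le_rfl⟩)]
      exact congrArg (fun p : Eu d × (D.S.Fiber o →L[ℝ] Eu d) => ofChart (γ₁ t) p.1) key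
    refine ⟨k1, ?_⟩
    have k2 : redRep (γ₁ t) (γ₁ s) (F₁ s) = redRep (γ₁ t) (γ₂ s) (F₂ s) := congrArg Prod.snd key
    rw [k1] at k2
    ext1 w
    have k3 : toChart (γ₁ t) (γ₂ s) ((toE (γ₂ s)).symm (F₁ s w))
      = toChart (γ₁ t) (γ₂ s) ((toE (γ₂ s)).symm (F₂ s w)) := congrArg (fun L => L w) k2
    have k4 := congrArg (fromChart (γ₁ t) (γ₂ s)) k3
    rw [fromChart_toChart (hd₂ s ⟨hrs, le_rfl⟩).1, fromChart_toChart (hd₂ s ⟨hrs, le_rfl⟩).1] at k4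
    exact (toE (γ₂ s)).symm.injective k4
  -- Different positions at t are separated by disjoint open sets, so the curves cannot agree at a
  -- time near t.
  · obtain ⟨U, V, hU, hV, h1, h2, hUV⟩ := t2_separation htz
    obtain ⟨δ₁, hδ₁, H₁⟩ := exists_delta_of_mem_nhds h₁.continuousOn ht (hU.mem_nhds h1)
    obtain ⟨δ₂, hδ₂, H₂⟩ := exists_delta_of_mem_nhds h₂.continuousOn ht (hV.mem_nhds h2)
    refine ⟨min δ₁ δ₂, lt_min hδ₁ hδ₂, fun r hr s hs hrt hst hrs hrr => ?_⟩
    exact absurd (hrr.1 ▸ H₁ r hr (hrt.trans_le (min_le_left _ _)))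
      (disjoint_right.1 hUV (H₂ r hr (hrt.trans_le (min_le_right _ _))))

theorem isSolution_unique [T2Space M] (hT : 0 < T) {ξ : D.CameronMartin} {γ₁ γ₂ : ℝ → M}
    (h₁ : D.IsSolution ξ γ₁) (h₂ : D.IsSolution ξ γ₂) : ∀ t ∈ Icc 0 T, γ₁ t = γ₂ t := by
  obtain ⟨e₁, P₁, p₁, i₁⟩ := (isSolution_iff hT).1 h₁
  obtain ⟨e₂, P₂, p₂, i₂⟩ := (isSolution_iff hT).1 h₂
  exact fun t ht => (p₁.isRedPath.unique hT p₂.isRedPath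
    ⟨e₁.trans e₂.symm, by simp only [i₁, i₂]⟩ t ht).1

theorem endpoint_eq [T2Space M] (hT : 0 < T) {ξ : D.CameronMartin} {γ : ℝ → M}
    (h : D.IsSolution ξ γ) : D.endpoint ξ = γ T := by
  have hex : ∃ γ : ℝ → M, D.IsSolution ξ γ := ⟨γ, h⟩
  rw [endpoint, dif_pos hex]
  exact isSolution_unique hT hex.choose_spec h T ⟨hT.le, le_rfl⟩

end DiffusionData

/-! ### The variational equation -/

section Integrability

variable {E F : Type*} [NormedAddCommGroup E] [NormedSpace ℝ E] [NormedAddCommGroup F]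
  [NormedSpace ℝ F] {r s : ℝ}

theorem intervalIntegrable_continuousOn_clm_apply (hrs : r ≤ s) {C : ℝ → E →L[ℝ] F}
    (hC : ContinuousOn C (Icc r s)) {v : ℝ → E} (hv : IntervalIntegrable v volume r s) :
    IntervalIntegrable (fun x => C x (v x)) volume r s := by
  rw [intervalIntegrable_iff_integrableOn_Icc_of_le hrs] at hv ⊢
  obtain ⟨K, hK⟩ := isCompact_Icc.exists_bound_of_continuousOn hC
  refine Integrable.mono' (hv.norm.const_mul K) ?_ ?_
  · exact (ContinuousLinearMap.apply ℝ F : E →L[ℝ] (E →L[ℝ] F) →L[ℝ] F).flip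
      |>.aestronglyMeasurable_comp₂ (hC.aestronglyMeasurable measurableSet_Icc)
        hv.aestronglyMeasurable
  · refine (ae_restrict_iff' measurableSet_Icc).2 (Filter.Eventually.of_forall fun t ht => ?_)
    exact ((C t).le_opNorm _).trans (mul_le_mul_of_nonneg_right (hK t ht) (norm_nonneg _))

theorem intervalIntegrable_clm_of_apply [FiniteDimensional ℝ E] {k : ℝ → E →L[ℝ] F}
    (hk : ∀ z, IntervalIntegrable (fun t => k t z) volume r s) :
    IntervalIntegrable k volume r s := by
  let b := Module.finBasis ℝ E
  have e : k = fun t => ∑ i, (ContinuousLinearMap.smulRightL ℝ E F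
      (LinearMap.toContinuousLinearMap (b.coord i))) (k t (b i)) := by
    funext t
    ext z
    have := congrArg (k t) (b.sum_repr z)
    rw [map_sum] at this
    simpa using this.symm
  rw [e]
  have := IntervalIntegrable.sum (μ := volume) (a := r) (b := s) Finset.univ (f := fun i t =>
    (ContinuousLinearMap.smulRightL ℝ E F (LinearMap.toContinuousLinearMap (b.coord i)))
      (k t (b i))) fun i _ => ⟨ContinuousLinearMap.integrable_comp _ (hk (b i)).1,
      ContinuousLinearMap.integrable_comp _ (hk (b i)).2⟩
  simpa [Finset.sum_fn] using this

end Integrability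

/-! ### The curvature tensor as a linear map -/

section Curvature

/-- The curvature in coordinates, as a linear map in the second argument. -/
def curvOpRight {E : Type*} [NormedAddCommGroup E] [NormedSpace ℝ E]
    (Γ : E → E →L[ℝ] E →L[ℝ] E) (y a : E) : E →L[ℝ] E →L[ℝ] E :=
  fderiv ℝ Γ y a - (fderiv ℝ Γ y).flip a + ContinuousLinearMap.compL ℝ E E E (Γ y a) ∘L Γ y
    - (ContinuousLinearMap.compL ℝ E E E).flip (Γ y a) ∘L Γ y

theorem curvOpRight_apply {E : Type*} [NormedAddCommGroup E] [NormedSpace ℝ E]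
    (Γ : E → E →L[ℝ] E →L[ℝ] E) (y a b : E) : curvOpRight Γ y a b = curvOp Γ y a b := by
  simp [curvOpRight, curvOp]

variable {d : ℕ} {M : Type*} [TopologicalSpace M] [ChartedSpace (EuclideanSpace ℝ (Fin d)) M]
  [IsManifold (𝓡 d) ∞ M] [T2Space M]

/-- The curvature tensor `R(a, ·)`, in the preferred chart. -/
def curvL {cov : Connection d M} (hcov : CovariantDerivative.ContMDiffCovariantDerivative cov ∞)
    (x : M) (a : Eu d) : Eu d →L[ℝ] Eu d →L[ℝ] Eu d :=
  let m := (exists_chartModel hcov x).some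
  let tc : Eu d →L[ℝ] Eu d := toChart x x ∘L (toE x).symm.toContinuousLinearMap
  let fc : Eu d →L[ℝ] Eu d := (toE x).toContinuousLinearMap ∘L fromChart x x
  ContinuousLinearMap.compL ℝ _ _ _ fc ∘L (ContinuousLinearMap.compL ℝ _ _ _).flip tc ∘L
    curvOpRight m.Γ (m.coord x) (tc a) ∘L tc

theorem curvL_apply {cov : Connection d M}
    (hcov : CovariantDerivative.ContMDiffCovariantDerivative cov ∞) (x : M)
    (a b c : TangentSpace (𝓡 d) x) :
    curvL hcov x (toE x a) (toE x b) (toE x c) = toE x (curvature cov x a b c) := by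
  have h := (exists_chartModel hcov x).some.curvature_eq' (exists_chartModel hcov x).some.mem_dom
    a b c
  have h2 := fromChart_toChart (mem_chart_source _ x) (curvature cov x a b c)
  rw [h] at h2
  rw [← h2]
  simp [curvL, curvOpRight_apply]

end Curvature

/-! ### Variations expressed in the moving frame -/

section Gauge

set_option linter.unusedSectionVars false

variable {E : Type*} [NormedAddCommGroup E] [NormedSpace ℝ E] [CompleteSpace E]

theorem Prim.clm_comp {A B A' B' : ℝ → E →L[ℝ] E} {r s : ℝ} (hA : Prim A A' r s)
    (hB : Prim B B' r s) (hrs : r ≤ s) :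
    Prim (fun t => A t ∘L B t) (fun t => A' t ∘L B t + A t ∘L B' t) r s :=
  (hA.clm (ContinuousLinearMap.compL ℝ E E E)).clm_apply hB hrs

/-- A curve in the frame bundle with the infinitesimal variation `(w, B)` in a chart, expressed in
the moving frame. -/
def toFrame (J p : E →L[ℝ] E) (G : E →L[ℝ] E →L[ℝ] E) (y : E × (E →L[ℝ] E)) : E × (E →L[ℝ] E) :=
  (J y.1, J ∘L (y.2 + G y.1 ∘L p))

/-- Adding Γ(w)p to B replaces the coordinate variation of the frame by its covariant variation.
After this change of variables every remaining term is tensorial: the torsion Γ(v)w - Γ(w)v, the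
covariant derivative of the drift along w, and the curvature, which appears when the derivative of Γ
along the curve meets the linearization of the frame equation. -/
theorem Prim.toFrame {r s : ℝ} (hrs : r ≤ s) {Γ : E → E →L[ℝ] E →L[ℝ] E} {x v u c e : ℝ → E}
    {u' : ℝ → E →L[ℝ] E} {p J : ℝ → E →L[ℝ] E} {y : ℝ → E × (E →L[ℝ] E)}
    (hp : Prim p (fun t => -(Γ (x t) (v t) ∘L p t)) r s)
    (hJ : Prim J (fun t => J t ∘L Γ (x t) (v t)) r s)
    (hΓ : Prim (fun t => Γ (x t)) (fun t => fderiv ℝ Γ (x t) (v t)) r s)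
    (eJ : ∀ t ∈ Icc r s, ∀ w, J t (p t w) = w)
    (ev : ∀ t ∈ Icc r s, v t = p t (c t) + u t)
    (hy : Prim y (fun t => (u' t (y t).1 + (y t).2 (c t) + p t (e t),
      -(fderiv ℝ Γ (x t) (y t).1 (v t) ∘L p t + Γ (x t) (u' t (y t).1 + (y t).2 (c t)) ∘L p t
        + Γ (x t) (v t) ∘L (y t).2) - Γ (x t) (p t (e t)) ∘L p t)) r s) :
    Prim (fun t => SubRiem.toFrame (J t) (p t) (Γ (x t)) (y t)) (fun t =>
      ((SubRiem.toFrame (J t) (p t) (Γ (x t)) (y t)).2 (c t) + J t (Γ (x t) (v t) (y t).1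
        - Γ (x t) (y t).1 (v t) + (u' t (y t).1 + Γ (x t) (y t).1 (u t))) + e t,
        J t ∘L curvOp Γ (x t) (v t) (y t).1 ∘L p t)) r s := by
  have hw := hy.clm (ContinuousLinearMap.fst ℝ E (E →L[ℝ] E))
  have hB := hy.clm (ContinuousLinearMap.snd ℝ E (E →L[ℝ] E))
  have h1 := hJ.clm_apply hw hrs
  have h2 := hJ.clm_comp (hB.add ((hΓ.clm_apply hw hrs).clm_comp hp hrs)) hrs
  refine (h1.prodMk h2).congr_deriv hrs fun t ht => ?_
  dsimp only [ContinuousLinearMap.coe_fst', ContinuousLinearMap.coe_snd', SubRiem.toFrame]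
  generalize (y t).1 = w
  generalize (y t).2 = B
  ext1
  -- The velocity splits into its driven part, which belongs to the covariant variation of the
  -- frame, and the drift, which completes ∇u.
  · have : Γ (x t) w (v t) = Γ (x t) w (p t (c t)) + Γ (x t) w (u t) := by
      rw [ev t ht, map_add]
    simp only [ContinuousLinearMap.comp_apply, add_apply, map_add, map_sub, eJ t ht, this]
    abel
  · ext1 a
    simp only [ContinuousLinearMap.comp_apply, add_apply, neg_apply, sub_apply,
      map_add, map_sub, map_neg, curvOp]
    abel

theorem intervalIntegrable_variation {r s : ℝ} (hrs : r ≤ s) {Γ : E → E →L[ℝ] E →L[ℝ] E}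
    {O : Set E} (hO : IsOpen O) (hΓ : ContDiffOn ℝ ∞ Γ O) {x v u c : ℝ → E} {u' p J : ℝ → E →L[ℝ] E}
    (cx : ContinuousOn x (Icc r s)) (hxO : ∀ t ∈ Icc r s, x t ∈ O) (cu : ContinuousOn u (Icc r s))
    (cu' : ContinuousOn u' (Icc r s)) (cp : ContinuousOn p (Icc r s))
    (cJ : ContinuousOn J (Icc r s)) (iv : IntervalIntegrable v volume r s)
    (ic : IntervalIntegrable c volume r s) (z : E × (E →L[ℝ] E)) :
    IntervalIntegrable (fun t => (z.2 (c t) + J t (Γ (x t) (v t) (p t z.1)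
        - Γ (x t) (p t z.1) (v t) + (u' t (p t z.1) + Γ (x t) (p t z.1) (u t))),
        J t ∘L curvOp Γ (x t) (v t) (p t z.1) ∘L p t)) volume r s := by
  have cΓ : ContinuousOn (fun t => Γ (x t)) (Icc r s) := hΓ.continuousOn.comp cx hxO
  have cΓ' : ContinuousOn (fun t => fderiv ℝ Γ (x t)) (Icc r s) :=
    (hΓ.continuousOn_fderiv_of_isOpen hO (by simp)).comp cx hxO
  have cw : ContinuousOn (fun t => p t z.1) (Icc r s) := cp.clm_apply continuousOn_const
  have cΓw : ContinuousOn (fun t => Γ (x t) (p t z.1)) (Icc r s) := cΓ.clm_apply cw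
  have iΓv := intervalIntegrable_continuousOn_clm_apply hrs cΓ iv
  let C := ContinuousLinearMap.compL ℝ E E E
  have icont : ∀ {g : ℝ → E}, ContinuousOn g (Icc r s) → IntervalIntegrable g volume r s :=
    fun hg => by
      rw [← uIcc_of_le hrs] at hg
      exact hg.intervalIntegrable
  have i1 := (intervalIntegrable_continuousOn_clm_apply hrs (C := fun _ => z.2)
    continuousOn_const ic).add (intervalIntegrable_continuousOn_clm_apply hrs cJ
      (((intervalIntegrable_clm_apply hrs iΓv cw).sub
        (intervalIntegrable_continuousOn_clm_apply hrs cΓw iv)).add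
        (icont ((cu'.clm_apply cw).add (cΓw.clm_apply cu)))))
  have i2 := ((intervalIntegrable_clm_apply hrs
      (intervalIntegrable_continuousOn_clm_apply hrs cΓ' iv) cw).sub
      (intervalIntegrable_continuousOn_clm_apply hrs (cΓ'.clm_apply cw) iv)).add
      (intervalIntegrable_continuousOn_clm_apply hrs (C := fun t => C.flip (Γ (x t) (p t z.1)))
        (C.flip.continuous.comp_continuousOn cΓw) iΓv) |>.sub
      (intervalIntegrable_continuousOn_clm_apply hrs (C := fun t => C (Γ (x t) (p t z.1)))
        (C.continuous.comp_continuousOn cΓw) iΓv)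
  have i3 := intervalIntegrable_continuousOn_clm_apply hrs (C := fun t => C (J t))
    (C.continuous.comp_continuousOn cJ) (intervalIntegrable_continuousOn_clm_apply hrs
      (C := fun t => C.flip (p t)) (C.flip.continuous.comp_continuousOn cp) i2)
  exact ⟨i1.1.prodMk i3.1, i1.2.prodMk i3.2⟩

end Gauge

namespace DiffusionData

set_option linter.unusedSectionVars false

variable {d : ℕ} {M : Type*} [TopologicalSpace M] [ChartedSpace (EuclideanSpace ℝ (Fin d)) M]
  [IsManifold (𝓡 d) ∞ M] [T2Space M] {o : M} {T : ℝ} (D : DiffusionData d M o T)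

/-- The coefficients of the variational equation along a solution. -/
def varOp (ξ : ℝ → D.S.Fiber o) (γ : ℝ → M) (P : ℝ → Eu d ≃L[ℝ] Eu d) (t : ℝ) :
    Eu d × (Eu d →L[ℝ] Eu d) →L[ℝ] Eu d × (Eu d →L[ℝ] Eu d) :=
  (ContinuousLinearMap.apply ℝ (Eu d) (D.diffusion t (ξ t)) ∘L .snd ℝ _ _
    + ((P t).symm : Eu d →L[ℝ] Eu d) ∘L (toE (γ t)).toContinuousLinearMap ∘L
      (D.conn.torsion (γ t) (D.vel ξ γ P t) + D.conn (D.u t) (γ t)) ∘L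
      (toE (γ t)).symm.toContinuousLinearMap ∘L (P t : Eu d →L[ℝ] Eu d) ∘L .fst ℝ _ _).prod
  (ContinuousLinearMap.compL ℝ _ _ _ ((P t).symm : Eu d →L[ℝ] Eu d) ∘L
    (ContinuousLinearMap.compL ℝ _ _ _).flip (P t : Eu d →L[ℝ] Eu d) ∘L
    curvL D.conn_smooth (γ t) (toE _ (D.vel ξ γ P t)) ∘L (P t : Eu d →L[ℝ] Eu d) ∘L .fst ℝ _ _)

variable {D} {ξ : ℝ → D.S.Fiber o} {γ : ℝ → M} {P : ℝ → Eu d ≃L[ℝ] Eu d} {r s : ℝ}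

theorem varOp_fst (t : ℝ) (z : Eu d × (Eu d →L[ℝ] Eu d)) :
    (D.varOp ξ γ P t z).1 = z.2 (D.diffusion t (ξ t)) + (P t).symm (toE (γ t)
      (D.conn.torsion (γ t) (D.vel ξ γ P t) ((toE (γ t)).symm (P t z.1))
        + D.conn (D.u t) (γ t) ((toE (γ t)).symm (P t z.1)))) := rfl

theorem varOp_snd (t : ℝ) (z : Eu d × (Eu d →L[ℝ] Eu d)) (w : Eu d) :
    (D.varOp ξ γ P t z).2 w = (P t).symm (toE (γ t) (curvature D.conn (γ t) (D.vel ξ γ P t)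
      ((toE (γ t)).symm (P t z.1)) ((toE (γ t)).symm (P t w)))) := by
  rw [← curvL_apply D.conn_smooth]
  simp only [ContinuousLinearEquiv.apply_symm_apply]
  rfl

/-- Matches the intrinsic coefficients with the expression produced by `Prim.toFrame`. -/
theorem varOp_chart {t : ℝ} (ht : t ∈ Icc 0 T) {x₀ : M} (m : ChartModel D.conn x₀)
    (hγ : γ t ∈ m.dom) (z : Eu d × (Eu d →L[ℝ] Eu d)) {x v w : Eu d} {p J : Eu d →L[ℝ] Eu d}
    (hx : m.coord (γ t) = x) (hv : toChart x₀ (γ t) (D.vel ξ γ P t) = v)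
    (hp : frameRep x₀ (γ t) (P t) = p) (hJ : frameCorep x₀ (γ t) (P t).symm = J)
    (hw : p z.1 = w) :
    D.varOp ξ γ P t z = (z.2 (D.diffusion t (ξ t)) + J (m.Γ x v w - m.Γ x w v
        + (D.driftDeriv x₀ t x w + m.Γ x w (rep x₀ (D.u t) x))), J ∘L curvOp m.Γ x v w ∘L p) := by
  have hu : toChart x₀ (γ t) (D.u t (γ t)) = rep x₀ (D.u t) x := by
    rw [rep, ← hx, m.ofChart_coord hγ]
  have hp' : ∀ v, toChart x₀ (γ t) ((toE (γ t)).symm (P t v)) = p v := fun v => by rw [← hp]; rfl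
  ext1
  · rw [varOp_fst, symm_toE_eq hγ.1, map_add, m.torsion_eq' hγ,
      m.cov_eq' hγ (fieldDiffAt_u ht _), hv, hu, hp', hw, hx, hJ]
    rfl
  · ext1 y
    rw [varOp_snd, symm_toE_eq hγ.1, m.curvature_eq' hγ, hv, hp', hp', hw, hx, hJ]
    rfl

theorem IsPath.intervalIntegrable_varOp_chart (hT : 0 < T) {ξ : D.CameronMartin}
    (hp : D.IsPath ξ γ P r s) (hr : r ∈ Icc 0 T) (hs : s ∈ Icc 0 T) (hrs : r ≤ s) {x₀ : M}
    (m : ChartModel D.conn x₀) (hγ : ∀ x ∈ Icc r s, γ x ∈ m.dom)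
    (z : Eu d × (Eu d →L[ℝ] Eu d)) :
    IntervalIntegrable (fun t => D.varOp ξ γ P t z) volume r s := by
  have hsub : ∀ x ∈ Icc r s, x ∈ Icc 0 T := fun x hx => ⟨hr.1.trans hx.1, hx.2.trans hs.2⟩
  have cx := (hp.prim_coord m.coord_smooth hrs).congr_deriv hrs fun t ht => m.dir_coord (hγ t ht) _
  have hO : ∀ t ∈ Icc r s, m.coord (γ t) ∈ m.O := fun t ht => m.coord_mem (hγ t ht)
  have hm : MapsTo (fun t => (t, m.coord (γ t))) (Icc r s) (Icc 0 T ×ˢ (extChartAt (𝓡 d) x₀).target) :=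
    fun t ht => ⟨hsub t ht, m.subset (hO t ht)⟩
  have i3 := intervalIntegrable_variation hrs m.isOpen m.smooth cx.continuousOn hO
    ((D.contDiffOn_rep_u x₀).continuousOn.comp (continuousOn_id.prodMk cx.continuousOn) hm)
    ((continuousOn_driftDeriv (D := D) hT x₀).comp (continuousOn_id.prodMk cx.continuousOn) hm)
    (hp.prim_frameRep hrs m hγ).continuousOn (hp.prim_frameCorep hrs m hγ).continuousOn cx.1
    (Control.intervalIntegrable_clm ξ hr hs hrs (D.continuousOn_diffusion.mono (Icc_subset_Icc hr.1 hs.2))) z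
  refine (intervalIntegrable_congr fun t ht => ?_).2 i3
  rw [uIoc_of_le hrs] at ht
  exact varOp_chart (hsub t ⟨ht.1.le, ht.2⟩) m (hγ t ⟨ht.1.le, ht.2⟩) z rfl rfl rfl rfl rfl

theorem IsPath.intervalIntegrable_varOp (hT : 0 < T) {ξ : D.CameronMartin}
    (h : D.IsPath ξ γ P 0 T) (z : Eu d × (Eu d →L[ℝ] Eu d)) :
    IntervalIntegrable (fun t => D.varOp ξ γ P t z) volume 0 T := by
  refine Icc_induction (p := fun t => IntervalIntegrable (fun t => D.varOp ξ γ P t z) volume 0 t)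
    (by simp) (fun t ht => ?_) T ⟨hT.le, le_rfl⟩
  obtain ⟨m⟩ := exists_chartModel D.conn_smooth (γ t)
  obtain ⟨δ, hδ, H⟩ := exists_delta_of_mem_nhds h.continuousOn ht (m.isOpen_dom.mem_nhds m.mem_dom)
  refine ⟨δ, hδ, fun r hr s hs hrt hst hrs hrr => hrr.trans ?_⟩
  exact (h.mono hr.1 hrs hs.2).intervalIntegrable_varOp_chart hT hr hs hrs m (fun x hx =>
    H x ⟨hr.1.trans hx.1, hx.2.trans hs.2⟩ (abs_sub_lt_of_mem_Icc hrt hst hx)) z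

/-- The linearized chart system becomes an equation in which no chart occurs. Hence variations
computed in successive charts can be glued. -/
theorem IsPath.gauge (h : D.IsPath ξ γ P r s) (hr : 0 ≤ r) (hrs : r ≤ s) (hs : s ≤ T)
    {x₀ : M} (m : ChartModel D.conn x₀) (hγ : ∀ t ∈ Icc r s, γ t ∈ m.dom) {η : ℝ → D.S.Fiber o}
    {y : ℝ → Eu d × (Eu d →L[ℝ] Eu d)}
    (hy : Prim y (fun t => sysLin m.Γ (rep x₀ (D.u t)) (D.driftDeriv x₀ t (m.coord (γ t)))
      (D.diffusion t) (D.chartState m (γ t) (P t)) (ξ t) (y t)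
      + sysCtrl m.Γ (D.diffusion t) (D.chartState m (γ t) (P t)) (η t)) r s)
    {z : ℝ → Eu d × (Eu d →L[ℝ] Eu d)} (hz : ∀ t ∈ Icc r s, z t = toFrame
      (frameCorep x₀ (γ t) (P t).symm) (frameRep x₀ (γ t) (P t)) (m.Γ (m.coord (γ t))) (y t)) :
    Prim z (fun t => D.varOp ξ γ P t (z t) + (D.diffusion t (η t), 0)) r s := by
  have hx := (h.prim_coord m.coord_smooth hrs).congr_deriv hrs fun t ht => m.dir_coord (hγ t ht) _
  have hp := h.prim_frameRep hrs m hγ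
  have hJ := h.prim_frameCorep hrs m hγ
  have hO : ∀ t ∈ Icc r s, m.coord (γ t) ∈ m.O := fun t ht => m.coord_mem (hγ t ht)
  have hΓ : Prim (fun t => m.Γ (m.coord (γ t)))
      (fun t => fderiv ℝ m.Γ (m.coord (γ t)) (toChart x₀ (γ t) (D.vel ξ γ P t))) r s :=
    hx.comp hrs (fun t ht => (m.smooth.contDiffAt (m.isOpen.mem_nhds (hO t ht))).hasStrictFDerivAt
      (by simp)) ((m.smooth.continuousOn_fderiv_of_isOpen m.isOpen (by simp)).comp hx.continuousOn hO)
  have eJ : ∀ t ∈ Icc r s, ∀ w, frameCorep (d := d) x₀ (γ t) ((P t).symm : Eu d →L[ℝ] Eu d)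
      (frameRep (d := d) x₀ (γ t) (P t : Eu d →L[ℝ] Eu d) w) = w := fun t ht w =>
    congrArg (fun L => L w) (frameCorep_comp_frameRep (hγ t ht).1 (P t))
  have ep : ∀ t ∈ Icc r s, ∀ w, frameRep (d := d) x₀ (γ t) (P t : Eu d →L[ℝ] Eu d)
      (frameCorep (d := d) x₀ (γ t) ((P t).symm : Eu d →L[ℝ] Eu d) w) = w := fun t ht w =>
    congrArg (fun L => L w) (frameRep_comp_frameCorep (hγ t ht).1 (P t))
  have ev : ∀ t ∈ Icc r s, toChart x₀ (γ t) (D.vel ξ γ P t) = frameRep x₀ (γ t) (P t)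
      (D.diffusion t (ξ t)) + rep x₀ (D.u t) (m.coord (γ t)) := fun t ht =>
    toChart_vel m (hγ t ht)
  have key := Prim.toFrame hrs hp hJ hΓ eJ ev (hy.congr_deriv hrs fun t ht => by
    rw [sysCtrl_apply, sysLin]
    unfold chartState
    dsimp only
    rw [← ev t ht, Prod.mk_add_mk, sub_eq_add_neg])
  refine (key.congr hz).congr_deriv hrs fun t ht => ?_
  have e1 : frameRep x₀ (γ t) (P t) (z t).1 = (y t).1 := by
    rw [hz t ht]; exact ep t ht _
  rw [varOp_chart ⟨hr.trans ht.1, ht.2.trans hs⟩ m (hγ t ht) (z t) rfl rfl rfl rfl e1,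
    Prod.mk_add_mk, add_zero, hz t ht]

end DiffusionData

/-! ### Strict derivatives of frame-valued maps -/

section StrictInverse

variable {X E : Type*} [NormedAddCommGroup X] [NormedSpace ℝ X] [NormedAddCommGroup E]
  [NormedSpace ℝ E]

/-- An explicit preimage under `toFrame`, by which a chart derivative is recovered from the
variation in the moving frame. -/
theorem toFrame_eq {J p : E →L[ℝ] E} (eJ : ∀ w, J (p w) = w) (G : E →L[ℝ] E →L[ℝ] E) (w : E)
    (A : E →L[ℝ] E) : toFrame J p G (p w, -(p ∘L (J ∘L G (p w) - A ∘L J) ∘L p)) = (w, A) := by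
  ext1
  · exact eJ w
  · ext1 c
    have : ∀ c, J (p c) = c := eJ
    simp [toFrame, this]

theorem toFrame_snd_apply {J p : E →L[ℝ] E} (ep : ∀ w, p (J w) = w) (G : E →L[ℝ] E →L[ℝ] E)
    (y : E × (E →L[ℝ] E)) (c : E) :
    (toFrame J p G y).2 (J c) = J (y.2 (J c)) + J (G y.1 c) := by
  simp [toFrame, ep]

theorem exists_hasStrictFDerivAt_inverse [CompleteSpace E] {A B : X → E →L[ℝ] E} {x : X}
    {A' : X →L[ℝ] E →L[ℝ] E} (hA : HasStrictFDerivAt A A' x)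
    (h : ∀ᶠ y in 𝓝 x, A y ∘L B y = .id ℝ E ∧ B y ∘L A y = .id ℝ E) :
    ∃ B' : X →L[ℝ] E →L[ℝ] E, HasStrictFDerivAt B B' x ∧
      ∀ η, B' η = -(B x ∘L A' η ∘L B x) := by
  have hB : ∀ᶠ y in 𝓝 x, Ring.inverse (A y) = B y := h.mono fun y hy => by
    let u : (E →L[ℝ] E)ˣ := ⟨A y, B y, hy.1, hy.2⟩
    exact Ring.inverse_unit u
  have hx := h.self_of_nhds
  have hd : HasStrictFDerivAt (Ring.inverse (M₀ := E →L[ℝ] E))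
      (-ContinuousLinearMap.mulLeftRight ℝ (E →L[ℝ] E) (B x) (B x)) (A x) := by
    let u : (E →L[ℝ] E)ˣ := ⟨A x, B x, hx.1, hx.2⟩
    exact hasStrictFDerivAt_ringInverse u
  refine ⟨_, (hd.comp x hA).congr_of_eventuallyEq hB, fun η => ?_⟩
  simp [ContinuousLinearMap.mulLeftRight_apply, mul_assoc]
  rfl

theorem exists_hasStrictFDerivAt_of_columns [CompleteSpace E] {n : ℕ} {A : X → Eu n →L[ℝ] E} {x : X}
    {A' : X → Eu n →L[ℝ] E} (h : ∀ i, ∃ L : X →L[ℝ] E,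
      HasStrictFDerivAt (fun y => A y (EuclideanSpace.single i 1)) L x ∧
        ∀ η, L η = A' η (EuclideanSpace.single i 1)) :
    ∃ L : X →L[ℝ] Eu n →L[ℝ] E, HasStrictFDerivAt A L x ∧ ∀ η, L η = A' η := by
  choose L hL hLA using h
  let S : Fin n → E →L[ℝ] Eu n →L[ℝ] E := fun i =>
    ContinuousLinearMap.smulRightL ℝ (Eu n) E (EuclideanSpace.proj i)
  have h1 : HasStrictFDerivAt (fun y => ∑ i, S i (A y (EuclideanSpace.single i 1)))
      (∑ i, S i ∘L L i) x := HasStrictFDerivAt.fun_sum fun i _ =>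
    (S i).hasStrictFDerivAt.comp x (hL i)
  refine ⟨_, h1.congr_of_eventuallyEq (.of_forall fun y => clm_eq_sum (A y)), fun η => ?_⟩
  rw [← clm_eq_sum (A' η)]
  simp [S, hLA]

/-- Vector fields give derivatives of the columns of the inverse frame J only; the derivative of the
frame p comes from inversion, and `toFrame_eq` identifies the result. -/
theorem exists_hasStrictFDerivAt_frame {n : ℕ} {y : X → Eu n} {J p : X → Eu n →L[ℝ] Eu n} {ξ₀ : X}
    {G : Eu n →L[ℝ] Eu n →L[ℝ] Eu n} {z : X → Eu n × (Eu n →L[ℝ] Eu n)} {L₁ : X →L[ℝ] Eu n}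
    (hy : HasStrictFDerivAt y L₁ ξ₀) (e₁ : ∀ η, L₁ η = p ξ₀ (z η).1)
    (hJ : ∀ i, ∃ L : X →L[ℝ] Eu n,
      HasStrictFDerivAt (fun ξ => J ξ (EuclideanSpace.single i 1)) L ξ₀ ∧
      ∀ η, L η = (J ξ₀ ∘L G (p ξ₀ (z η).1) - (z η).2 ∘L J ξ₀) (EuclideanSpace.single i 1))
    (h : ∀ᶠ ξ in 𝓝 ξ₀, J ξ ∘L p ξ = .id ℝ (Eu n) ∧ p ξ ∘L J ξ = .id ℝ (Eu n)) :
    ∃ L : X →L[ℝ] Eu n × (Eu n →L[ℝ] Eu n), HasStrictFDerivAt (fun ξ => (y ξ, p ξ)) L ξ₀ ∧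
      ∀ η, z η = toFrame (J ξ₀) (p ξ₀) G (L η) := by
  obtain ⟨L₂, hL₂, e₂⟩ := exists_hasStrictFDerivAt_of_columns hJ
  obtain ⟨L₃, hL₃, e₃⟩ := exists_hasStrictFDerivAt_inverse (X := X) (E := Eu n) (A := J) (B := p)
    (A' := L₂) hL₂ h
  refine ⟨_, hy.prodMk hL₃, fun η => ?_⟩
  rw [ContinuousLinearMap.prod_apply, e₃, e₁, e₂]
  exact (toFrame_eq (fun w => congrArg (fun L => L w) h.self_of_nhds.1) _ _ _).symm

end StrictInverse

theorem exists_Icc_subset {T t δ : ℝ} (ht : t ∈ Icc 0 T) (hδ : 0 < δ) :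
    ∃ a b, t ∈ Icc a b ∧ 0 ≤ a ∧ a ≤ b ∧ b ≤ T ∧ (∀ x ∈ Icc a b, |x - t| < δ) ∧
      ∀ x ∈ Icc 0 T, |x - t| < δ / 2 → x ∈ Icc a b := by
  refine ⟨max 0 (t - δ / 2), min T (t + δ / 2), ⟨?_, ?_⟩, le_max_left _ _, ?_, min_le_left _ _,
    fun x hx => ?_, fun x hx hxt => ?_⟩
  · exact max_le ht.1 (by linarith)
  · exact le_min ht.2 (by linarith)
  · exact (max_le ht.1 (by linarith)).trans (le_min ht.2 (by linarith))
  · rw [abs_lt]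
    constructor
    · linarith [(le_max_right _ _).trans hx.1]
    · linarith [hx.2.trans (min_le_right _ _)]
  · rw [abs_lt] at hxt
    exact ⟨max_le hx.1 (by linarith [hxt.1]), le_min hx.2 (by linarith [hxt.2])⟩

/-! ### Strictly differentiable families of points and frames -/

namespace DiffusionData

set_option linter.unusedSectionVars false

variable {d : ℕ} {M : Type*} [TopologicalSpace M] [ChartedSpace (EuclideanSpace ℝ (Fin d)) M]
  [IsManifold (𝓡 d) ∞ M] [T2Space M] {o : M} {T : ℝ} (D : DiffusionData d M o T)
  {X : Type*} [NormedAddCommGroup X] [NormedSpace ℝ X]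

/-- The family `(Φ, Q)` of points with frames is strictly differentiable at `ξ₀`, with the
derivative `z` in the moving frame. -/
structure IsVar (Φ : X → M) (Q : X → Eu d ≃L[ℝ] Eu d) (ξ₀ : X)
    (z : X → Eu d × (Eu d →L[ℝ] Eu d)) : Prop where
  continuousAt : ContinuousAt Φ ξ₀
  comp : ∀ (n : ℕ) (f : M → Eu n), ContMDiff (𝓡 d) 𝓘(ℝ, Eu n) ∞ f →
    ∃ L : X →L[ℝ] Eu n, HasStrictFDerivAt (fun ξ => f (Φ ξ)) L ξ₀ ∧
      ∀ η, L η = dir f (Φ ξ₀) ((toE (Φ ξ₀)).symm (Q ξ₀ (z η).1))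
  field : ∀ Y : (x : M) → TangentSpace (𝓡 d) x, SmoothFieldOn Y univ →
    ∃ L : X →L[ℝ] Eu d, HasStrictFDerivAt (fun ξ => (Q ξ).symm (toE _ (Y (Φ ξ)))) L ξ₀ ∧
      ∀ η, L η = (Q ξ₀).symm (toE _ (D.conn Y (Φ ξ₀) ((toE (Φ ξ₀)).symm (Q ξ₀ (z η).1))))
        - (z η).2 ((Q ξ₀).symm (toE _ (Y (Φ ξ₀))))

variable {D} {Φ : X → M} {Q : X → Eu d ≃L[ℝ] Eu d} {ξ₀ : X}
  {z : X → Eu d × (Eu d →L[ℝ] Eu d)} {x₀ : M} (m : ChartModel D.conn x₀)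

variable (D) in
theorem isVar_const (x : M) (p : Eu d ≃L[ℝ] Eu d) (ξ₀ : X) :
    D.IsVar (fun _ => x) (fun _ => p) ξ₀ (fun _ => 0) where
  continuousAt := continuousAt_const
  comp n f _ := ⟨0, hasStrictFDerivAt_const _ _, fun η => by simp [dir]; rfl⟩
  field Y _ := ⟨0, hasStrictFDerivAt_const _ _, fun η => by simp⟩

/-- The global coordinates of the model give the point, the coordinate fields the inverse frame.
Together with `IsVar.of_chart` this makes the notion independent of the chart, so the chart may
change between two steps of the continuation. -/
theorem IsVar.chart (h : D.IsVar Φ Q ξ₀ z) (hx : Φ ξ₀ ∈ m.dom) :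
    ∃ L : X →L[ℝ] Eu d × (Eu d →L[ℝ] Eu d),
      HasStrictFDerivAt (fun ξ => D.chartState m (Φ ξ) (Q ξ)) L ξ₀ ∧
      ∀ η, z η = toFrame (frameCorep x₀ (Φ ξ₀) (Q ξ₀).symm) (frameRep x₀ (Φ ξ₀) (Q ξ₀))
        (m.Γ (m.coord (Φ ξ₀))) (L η) := by
  obtain ⟨L₁, hL₁, e₁⟩ := h.comp d m.coord m.coord_smooth
  have hdom : ∀ᶠ ξ in 𝓝 ξ₀, Φ ξ ∈ m.dom := h.continuousAt (m.isOpen_dom.mem_nhds hx)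
  have e₁' : ∀ η, L₁ η = frameRep x₀ (Φ ξ₀) (Q ξ₀ : Eu d →L[ℝ] Eu d) (z η).1 := fun η =>
    (e₁ η).trans (m.dir_coord hx _)
  have hcol : ∀ i, ∃ L : X →L[ℝ] Eu d, HasStrictFDerivAt (fun ξ => frameCorep x₀ (Φ ξ)
      ((Q ξ).symm : Eu d →L[ℝ] Eu d) (EuclideanSpace.single i 1)) L ξ₀ ∧
      ∀ η, L η = (frameCorep x₀ (Φ ξ₀) ((Q ξ₀).symm : Eu d →L[ℝ] Eu d) ∘L
        m.Γ (m.coord (Φ ξ₀)) (frameRep x₀ (Φ ξ₀) (Q ξ₀ : Eu d →L[ℝ] Eu d) (z η).1)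
        - (z η).2 ∘L frameCorep x₀ (Φ ξ₀) ((Q ξ₀).symm : Eu d →L[ℝ] Eu d))
          (EuclideanSpace.single i 1) := fun i => by
    obtain ⟨L, hL, e⟩ := h.field _ (m.field_smooth (EuclideanSpace.single i 1))
    have hev : (fun ξ => (Q ξ).symm (toE _ (m.field (EuclideanSpace.single i 1) (Φ ξ))))
        =ᶠ[𝓝 ξ₀] fun ξ => frameCorep x₀ (Φ ξ) ((Q ξ).symm : Eu d →L[ℝ] Eu d)
          (EuclideanSpace.single i 1) := by
      filter_upwards [hdom] with ξ hξ
      rw [symm_toE_eq hξ.1, m.toChart_field hξ]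
    refine ⟨L, hL.congr_of_eventuallyEq hev, fun η => ?_⟩
    rw [e, symm_toE_eq hx.1, symm_toE_eq hx.1, m.toChart_field hx,
      m.cov_eq' hx ((m.field_smooth _).fieldDiffAt Filter.univ_mem), m.toChart_field hx,
      m.fderiv_rep_field (m.coord_mem hx), zero_apply, zero_add]
    rfl
  have hinv : ∀ᶠ ξ in 𝓝 ξ₀, frameCorep (d := d) x₀ (Φ ξ) ((Q ξ).symm : Eu d →L[ℝ] Eu d)
      ∘L frameRep x₀ (Φ ξ) (Q ξ : Eu d →L[ℝ] Eu d) = .id ℝ (Eu d) ∧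
      frameRep (d := d) x₀ (Φ ξ) (Q ξ : Eu d →L[ℝ] Eu d)
      ∘L frameCorep x₀ (Φ ξ) ((Q ξ).symm : Eu d →L[ℝ] Eu d) = .id ℝ (Eu d) := by
    filter_upwards [hdom] with ξ hξ
    exact ⟨frameCorep_comp_frameRep hξ.1 (Q ξ), frameRep_comp_frameCorep hξ.1 (Q ξ)⟩
  exact exists_hasStrictFDerivAt_frame (y := fun ξ => m.coord (Φ ξ))
    (J := fun ξ => frameCorep x₀ (Φ ξ) ((Q ξ).symm : Eu d →L[ℝ] Eu d))
    (p := fun ξ => frameRep x₀ (Φ ξ) (Q ξ : Eu d →L[ℝ] Eu d))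
    (G := m.Γ (m.coord (Φ ξ₀))) hL₁ e₁' hcol hinv

set_option maxHeartbeats 400000 in
theorem IsVar.of_chart (hdom : ∀ᶠ ξ in 𝓝 ξ₀, Φ ξ ∈ m.dom)
    {L : X →L[ℝ] Eu d × (Eu d →L[ℝ] Eu d)}
    (hL : HasStrictFDerivAt (fun ξ => D.chartState m (Φ ξ) (Q ξ)) L ξ₀)
    (hz : ∀ η, z η = toFrame (frameCorep x₀ (Φ ξ₀) (Q ξ₀).symm) (frameRep x₀ (Φ ξ₀) (Q ξ₀))
        (m.Γ (m.coord (Φ ξ₀))) (L η)) : D.IsVar Φ Q ξ₀ z := by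
  have hx := hdom.self_of_nhds
  have hO := m.coord_mem hx
  have hc : HasStrictFDerivAt (fun ξ => m.coord (Φ ξ)) (.fst ℝ _ _ ∘L L) ξ₀ := hL.fst
  have hA : HasStrictFDerivAt (fun ξ => frameRep x₀ (Φ ξ) (Q ξ)) (.snd ℝ _ _ ∘L L) ξ₀ := hL.snd
  have ep : ∀ w, frameRep (d := d) x₀ (Φ ξ₀) (Q ξ₀ : Eu d →L[ℝ] Eu d)
      (frameCorep (d := d) x₀ (Φ ξ₀) ((Q ξ₀).symm : Eu d →L[ℝ] Eu d) w) = w := fun w =>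
    congrArg (fun L => L w) (frameRep_comp_frameCorep hx.1 (Q ξ₀))
  have ez : ∀ η, toChart x₀ (Φ ξ₀) ((toE (Φ ξ₀)).symm (Q ξ₀ (z η).1)) = (L η).1 := fun η => by
    rw [hz]; exact ep _
  obtain ⟨J', hJ', eJ'⟩ := exists_hasStrictFDerivAt_inverse (X := X) (E := Eu d)
    (A := fun ξ => frameRep x₀ (Φ ξ) (Q ξ)) (A' := .snd ℝ _ _ ∘L L) hA
    (B := fun ξ => frameCorep x₀ (Φ ξ) (Q ξ).symm) (hdom.mono fun ξ hξ =>
      ⟨frameRep_comp_frameCorep hξ.1 (Q ξ), frameCorep_comp_frameRep hξ.1 (Q ξ)⟩)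
  refine ⟨?_, fun n f hf => ?_, fun Y hY => ?_⟩
  · have h1 : ContinuousAt (fun ξ => ofChart x₀ (m.coord (Φ ξ))) ξ₀ :=
      ContinuousAt.comp (g := ofChart x₀) (f := fun ξ => m.coord (Φ ξ))
        ((contMDiffOn_ofChart x₀).continuousOn.continuousAt
          ((isOpen_target x₀).mem_nhds (m.subset hO))) hc.continuousAt
    exact h1.congr (hdom.mono fun ξ hξ => m.ofChart_coord hξ)
  · have h1 := ((m.contDiffOn_comp hf).contDiffAt (m.isOpen.mem_nhds hO)).hasStrictFDerivAt
      (by simp)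
    refine ⟨_, (h1.comp ξ₀ hc).congr_of_eventuallyEq (hdom.mono fun ξ hξ => ?_), fun η => ?_⟩
    · exact congrArg f (m.ofChart_coord hξ)
    · rw [m.dir_eq hx (hf.contMDiffAt.mdifferentiableAt (by simp)), ez]
      rfl
  · have h1 := ((m.contDiffOn_rep hY).contDiffAt (m.isOpen.mem_nhds hO)).hasStrictFDerivAt
      (by simp)
    have hYc : HasStrictFDerivAt (fun ξ => rep x₀ Y (m.coord (Φ ξ))) _ ξ₀ := h1.comp ξ₀ hc
    have h2 := hJ'.clm_apply hYc
    have hev : (fun ξ => frameCorep x₀ (Φ ξ) ((Q ξ).symm : Eu d →L[ℝ] Eu d)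
        (rep x₀ Y (m.coord (Φ ξ)))) =ᶠ[𝓝 ξ₀] fun ξ => (Q ξ).symm (toE _ (Y (Φ ξ))) := by
      filter_upwards [hdom] with ξ hξ
      rw [symm_toE_eq hξ.1, rep, m.ofChart_coord hξ]
    refine ⟨_, h2.congr_of_eventuallyEq hev, fun η => ?_⟩
    · have e2 : toChart x₀ (Φ ξ₀) (Y (Φ ξ₀)) = rep x₀ Y (m.coord (Φ ξ₀)) := by
        rw [rep, m.ofChart_coord hx]
      rw [symm_toE_eq hx.1, symm_toE_eq hx.1,
        m.cov_eq' hx (hY.fieldDiffAt Filter.univ_mem), ez, e2, hz]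
      rw [toFrame_snd_apply ep, add_apply, ContinuousLinearMap.flip_apply, eJ', map_add]
      simp only [ContinuousLinearMap.comp_apply, neg_apply, ContinuousLinearMap.coe_fst',
        ContinuousLinearMap.coe_snd']
      abel

variable {m}

theorem chartState_injective {x y : M} {p q : Eu d ≃L[ℝ] Eu d} (hx : x ∈ m.dom) (hy : y ∈ m.dom)
    (h : D.chartState m x p = D.chartState m y q) : x = y ∧ p = q := by
  have h1 : m.coord x = m.coord y := congrArg Prod.fst h
  have hxy : x = y := by rw [← m.ofChart_coord hx, ← m.ofChart_coord hy, h1]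
  subst hxy
  refine ⟨rfl, ?_⟩
  ext1
  funext w
  have h2 : toChart x₀ x ((toE x).symm (p w)) = toChart x₀ x ((toE x).symm (q w)) :=
    congrArg (fun s : Eu d × (Eu d →L[ℝ] Eu d) => s.2 w) h
  have h3 := congrArg (fromChart x₀ x) h2
  rw [fromChart_toChart hx.1, fromChart_toChart hx.1] at h3
  exact (toE x).symm.injective h3

variable (m) in
-- The flow takes values in a vector space; its values come from points with frames as long as the
-- linear component is invertible, an open condition.
theorem exists_chartState_eq (y : Eu d × (Eu d →L[ℝ] Eu d)) (h : y.1 ∈ m.O ∧ IsUnit y.2) :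
    ∃ s : M × (Eu d ≃L[ℝ] Eu d), s.1 ∈ m.dom ∧ D.chartState m s.1 s.2 = y := by
  obtain ⟨hy, u, hu⟩ := h
  have hx := m.ofChart_mem_dom hy
  let c : Eu d ≃L[ℝ] Eu d := ContinuousLinearEquiv.equivOfInverse
    (toChart x₀ (ofChart x₀ y.1) ∘L (toE (ofChart x₀ y.1)).symm.toContinuousLinearMap)
    ((toE (ofChart x₀ y.1)).toContinuousLinearMap ∘L fromChart x₀ (ofChart x₀ y.1))
    (fun v => by simp [fromChart_toChart hx.1]) (fun v => by simp [toChart_fromChart hx.1])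
  refine ⟨⟨ofChart x₀ y.1, (ContinuousLinearEquiv.unitsEquiv ℝ (Eu d) u).trans c.symm⟩, hx, ?_⟩
  ext1
  · exact m.coord_eq _ hy
  · ext1 w
    change c (c.symm (ContinuousLinearEquiv.unitsEquiv ℝ (Eu d) u w)) = y.2 w
    rw [c.apply_symm_apply, ContinuousLinearEquiv.unitsEquiv_apply, hu]

end DiffusionData

theorem intervalIntegrable_norm_add_flip {Y U : Type*} [NormedAddCommGroup Y] [NormedSpace ℝ Y]
    [NormedAddCommGroup U] [NormedSpace ℝ U] {a b : ℝ} (hab : a ≤ b) {A : ℝ → Y →L[ℝ] Y}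
    {B : ℝ → Y →L[ℝ] U →L[ℝ] Y} {ξ : ℝ → U} (hA : ContinuousOn A (Icc a b))
    (hB : ContinuousOn B (Icc a b)) (hξ : IntervalIntegrable ξ volume a b) :
    IntervalIntegrable (fun x => ‖A x + (B x).flip (ξ x)‖) volume a b := by
  have h1 : IntervalIntegrable A volume a b := by
    rw [← uIcc_of_le hab] at hA
    exact hA.intervalIntegrable
  have h2 := intervalIntegrable_continuousOn_clm_apply hab (C := fun x => (B x).flip)
    ((ContinuousLinearMap.flipₗᵢ ℝ Y U Y).continuous.comp_continuousOn hB) hξ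
  exact (h1.add h2).norm

/-! ### Differentiability of solutions in the control, by continuation -/

namespace DiffusionData

set_option linter.unusedSectionVars false

variable {d : ℕ} {M : Type*} [TopologicalSpace M] [ChartedSpace (EuclideanSpace ℝ (Fin d)) M]
  [IsManifold (𝓡 d) ∞ M] [T2Space M] {o : M} {T : ℝ} (D : DiffusionData d M o T)

/-- Near `ξ₀` the solutions exist until `t` and depend strictly differentiably on the control. -/
def HasVar (ξ₀ : D.CameronMartin) (γ : ℝ → M) (P : ℝ → Eu d ≃L[ℝ] Eu d) (t : ℝ) : Prop :=
  ∃ (Φ : D.CameronMartin → M) (Q : D.CameronMartin → Eu d ≃L[ℝ] Eu d)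
    (z : ℝ → D.CameronMartin → Eu d × (Eu d →L[ℝ] Eu d)),
    (∀ᶠ ξ : D.CameronMartin in 𝓝 ξ₀, ∃ (γ₁ : ℝ → M) (P₁ : ℝ → Eu d ≃L[ℝ] Eu d),
      D.IsPath ξ γ₁ P₁ 0 t ∧ (γ₁ 0 = γ 0 ∧ P₁ 0 = P 0) ∧ γ₁ t = Φ ξ ∧ P₁ t = Q ξ) ∧
    (Φ ξ₀ = γ t ∧ Q ξ₀ = P t) ∧ D.IsVar Φ Q ξ₀ (z t) ∧
    ∀ η : D.CameronMartin, z 0 η = 0 ∧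
      Prim (fun s => z s η) (fun s => D.varOp ξ₀ γ P s (z s η) + (D.diffusion s (η s), 0)) 0 t

variable {D} {ξ₀ : D.CameronMartin} {γ : ℝ → M} {P : ℝ → Eu d ≃L[ℝ] Eu d}

theorem hasVar_zero : D.HasVar ξ₀ γ P 0 := by
  refine ⟨fun _ => γ 0, fun _ => P 0, fun _ _ => 0, .of_forall fun ξ => ⟨fun _ => γ 0, fun _ => P 0,
    ⟨continuousOn_const, fun f _ => ⟨by simp, fun t ht => ?_⟩, fun f _ => ⟨by simp, fun t ht => ?_⟩⟩,
    ⟨rfl, rfl⟩, rfl, rfl⟩, ⟨rfl, rfl⟩, D.isVar_const _ _ _, fun η => ⟨rfl, by simp, fun t ht => ?_⟩⟩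
  all_goals
    obtain rfl : t = 0 := le_antisymm ht.2 ht.1
    simp

theorem IsPath.glue {ξ : ℝ → D.S.Fiber o} {γ γ' : ℝ → M} {P P' : ℝ → Eu d ≃L[ℝ] Eu d} {a b c : ℝ}
    (h : D.IsPath ξ γ P a b) (h' : D.IsPath ξ γ' P' b c) (hab : a ≤ b) (hbc : b ≤ c)
    (e : γ b = γ' b ∧ P b = P' b) : D.IsPath ξ (fun t => if t ≤ b then γ t else γ' t)
      (fun t => if t ≤ b then P t else P' t) a c := by
  refine (h.congr hab fun t ht => ?_).trans (h'.congr hbc fun t ht => ?_) hab hbc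
  · simp [ht.2]
  · rcases ht.1.eq_or_lt with rfl | hlt
    · simpa using e
    · simp [hlt]

variable {x₀ : M} {m : ChartModel D.conn x₀} {r s : ℝ}

theorem exists_path_of_prim {ξ : ℝ → D.S.Fiber o} (hrs : r ≤ s)
    {y : ℝ → Eu d × (Eu d →L[ℝ] Eu d)} (hy : Prim y (fun t => D.chartField m ξ t (y t)) r s)
    {st : Eu d × (Eu d →L[ℝ] Eu d) → M × (Eu d ≃L[ℝ] Eu d)}
    (hst : ∀ t ∈ Icc r s, (st (y t)).1 ∈ m.dom ∧ D.chartState m (st (y t)).1 (st (y t)).2 = y t) :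
    D.IsPath ξ (fun t => (st (y t)).1) (fun t => (st (y t)).2) r s := by
  refine IsPath.of_chart hrs m (fun t ht => (hst t ht).1) ?_
  exact (hy.congr fun t ht => (hst t ht).2).congr_deriv hrs fun t ht => by
    rw [(hst t ht).2]

-- The state at s is the local flow applied to the state at r and the control, so its strict
-- derivative comes from the chain rule. In the moving frame this derivative solves the variational
-- equation on [r, s] and starts where the variation on [0, r] ends, so the two are glued.
set_option maxHeartbeats 1000000 in
theorem HasVar.step (h : D.HasVar ξ₀ γ P r) (hγ0 : D.IsPath ξ₀ γ P r s) (hr : r ∈ Icc 0 T)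
    (hs : s ∈ Icc 0 T) (hrs : r ≤ s) (hγ : ∀ t ∈ Icc r s, γ t ∈ m.dom)
    {f₀' : ℝ → Eu d × (Eu d →L[ℝ] Eu d) →
      (Eu d × (Eu d →L[ℝ] Eu d)) →L[ℝ] Eu d × (Eu d →L[ℝ] Eu d)}
    {f₁' : ℝ → Eu d × (Eu d →L[ℝ] Eu d) →
      (Eu d × (Eu d →L[ℝ] Eu d)) →L[ℝ] D.S.Fiber o →L[ℝ] Eu d × (Eu d →L[ℝ] Eu d)}
    {y₀ : Eu d × (Eu d →L[ℝ] Eu d)} {ρ : ℝ}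
    (hb : ∀ t ∈ Icc r s, D.chartState m (γ t) (P t) ∈ Metric.ball y₀ ρ)
    (hlin : ∀ t ∈ Icc r s, ∀ h ζ, f₀' t (D.chartState m (γ t) (P t)) h
        + f₁' t (D.chartState m (γ t) (P t)) h ζ
      = sysLin m.Γ (rep x₀ (D.u t)) (D.driftDeriv x₀ t (m.coord (γ t))) (D.diffusion t)
        (D.chartState m (γ t) (P t)) ζ h)
    {st : Eu d × (Eu d →L[ℝ] Eu d) → M × (Eu d ≃L[ℝ] Eu d)}
    (hst : ∀ y ∈ Metric.ball y₀ ρ, (st y).1 ∈ m.dom ∧ D.chartState m (st y).1 (st y).2 = y)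
    (hflow : ∃ (Ψ : (Eu d × (Eu d →L[ℝ] Eu d)) × Control T (D.S.Fiber o) →
        ℝ → Eu d × (Eu d →L[ℝ] Eu d))
      (L : ℝ → (Eu d × (Eu d →L[ℝ] Eu d)) × Control T (D.S.Fiber o) →L[ℝ]
        Eu d × (Eu d →L[ℝ] Eu d)),
      (∀ᶠ q in 𝓝 (D.chartState m (γ r) (P r), ξ₀), Ψ q r = q.1 ∧
        Prim (Ψ q) (fun t => D.chartField m q.2 t (Ψ q t)) r s ∧
        ∀ t ∈ Icc r s, Ψ q t ∈ Metric.ball y₀ ρ) ∧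
      (∀ t ∈ Icc r s, Ψ (D.chartState m (γ r) (P r), ξ₀) t = D.chartState m (γ t) (P t)) ∧
      (∀ t ∈ Icc r s, HasStrictFDerivAt (fun q => Ψ q t) (L t) (D.chartState m (γ r) (P r), ξ₀)) ∧
      ∀ q, L r q = q.1 ∧ Prim (fun t => L t q)
        (fun t => f₀' t (D.chartState m (γ t) (P t)) (L t q)
          + f₁' t (D.chartState m (γ t) (P t)) (L t q) (ξ₀ t)
          + sysCtrl m.Γ (D.diffusion t) (D.chartState m (γ t) (P t)) (q.2 t)) r s) :
    D.HasVar ξ₀ γ P s := by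
  have hrr : r ∈ Icc r s := ⟨le_rfl, hrs⟩
  have hss : s ∈ Icc r s := ⟨hrs, le_rfl⟩
  obtain ⟨Φ, Q, z, hsol, hbase, hvar, hz⟩ := h
  obtain ⟨Ψ, L, hΨ, hΨ0, hΨd, hL⟩ := hflow
  obtain ⟨A, hA, hzA⟩ := hvar.chart m (by rw [hbase.1]; exact hγ r hrr)
  rw [hbase.1, hbase.2] at hzA
  have hq0 : (D.chartState m (Φ ξ₀) (Q ξ₀), ξ₀) = (D.chartState m (γ r) (P r), ξ₀) := by
    rw [hbase.1, hbase.2]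
  have hqd : HasStrictFDerivAt (fun ξ => (D.chartState m (Φ ξ) (Q ξ), ξ))
      (A.prod (.id ℝ _)) ξ₀ := hA.prodMk (hasStrictFDerivAt_id ξ₀)
  have hqc : Filter.Tendsto (fun ξ => (D.chartState m (Φ ξ) (Q ξ), ξ)) (𝓝 ξ₀)
      (𝓝 (D.chartState m (γ r) (P r), ξ₀)) := by
    rw [← hq0]; exact hqd.continuousAt
  have hdom : ∀ᶠ ξ in 𝓝 ξ₀, Φ ξ ∈ m.dom := hvar.continuousAt
    (by rw [hbase.1]; exact m.isOpen_dom.mem_nhds (hγ r hrr))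
  have hev := hqc.eventually hΨ
  let Y : D.CameronMartin → ℝ → Eu d × (Eu d →L[ℝ] Eu d) := fun ξ =>
    Ψ (D.chartState m (Φ ξ) (Q ξ), ξ)
  have hY0 : ∀ t ∈ Icc r s, Y ξ₀ t = D.chartState m (γ t) (P t) := fun t ht => by
    rw [← hΨ0 t ht, ← hq0]
  have hYs : HasStrictFDerivAt (fun ξ => Y ξ s) (L s ∘L A.prod (.id ℝ _)) ξ₀ :=
    HasStrictFDerivAt.comp (g := fun q => Ψ q s) (f := fun ξ => (D.chartState m (Φ ξ) (Q ξ), ξ)) ξ₀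
      (by rw [hq0]; exact hΨd s hss) hqd
  -- The choice `st` of points and frames returns the given solution at the base control, since
  -- chart states determine point and frame.
  have hst0 : st (Y ξ₀ s) = (γ s, P s) := by
    obtain ⟨h1, h2⟩ := hst (Y ξ₀ s) (by rw [hY0 s hss]; exact hb s hss)
    rw [hY0 s hss] at h1 h2 ⊢
    obtain ⟨h3, h4⟩ := chartState_injective h1 (hγ s hss) h2
    exact Prod.ext h3 h4
  refine ⟨fun ξ => (st (Y ξ s)).1, fun ξ => (st (Y ξ s)).2,
    fun t η => if t ≤ r then z t η else toFrame (frameCorep x₀ (γ t) (P t).symm)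
      (frameRep x₀ (γ t) (P t)) (m.Γ (m.coord (γ t))) (L t (A η, η)), ?_, by simp [hst0], ?_, ?_⟩
  · filter_upwards [hsol, hdom, hev] with ξ hξ hξd hξΨ
    obtain ⟨γ₁, P₁, hp, h0, hγr, hPr⟩ := hξ
    have hp2 := exists_path_of_prim (st := st) hrs hξΨ.2.1 fun t ht => hst _ (hξΨ.2.2 t ht)
    have hstr : γ₁ r = (st (Y ξ r)).1 ∧ P₁ r = (st (Y ξ r)).2 := by
      obtain ⟨h1, h2⟩ := hst (Y ξ r) (hξΨ.2.2 r hrr)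
      have h3 : Y ξ r = D.chartState m (Φ ξ) (Q ξ) := hξΨ.1
      rw [h3] at h1 h2 ⊢
      obtain ⟨h4, h5⟩ := chartState_injective h1 hξd h2
      exact ⟨hγr.trans h4.symm, hPr.trans h5.symm⟩
    refine ⟨_, _, hp.glue hp2 hr.1 hrs hstr, by simpa [hr.1] using h0, ?_⟩
    rcases hrs.eq_or_lt with rfl | hlt
    · simpa using hstr
    · simp [hlt, Y]
  · have hYdom : ∀ᶠ ξ in 𝓝 ξ₀, (st (Y ξ s)).1 ∈ m.dom := hev.mono fun ξ hξ =>
      (hst _ (hξ.2.2 s hss)).1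
    have hYst : (fun ξ => Y ξ s) =ᶠ[𝓝 ξ₀] fun ξ => D.chartState m (st (Y ξ s)).1 (st (Y ξ s)).2 :=
      hev.mono fun ξ hξ => (hst _ (hξ.2.2 s hss)).2.symm
    refine IsVar.of_chart m hYdom (hYs.congr_of_eventuallyEq hYst) fun η => ?_
    rw [hst0]
    dsimp only
    rcases hrs.eq_or_lt with rfl | hlt
    · rw [if_pos le_rfl, hzA]
      congr 1
      exact ((hL (A η, η)).1).symm
    · rw [if_neg (not_le.2 hlt)]
      rfl
  · intro η
    have h1 := (hL (A η, η)).2.congr_deriv hrs fun t ht => by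
      rw [hlin t ht]
    have h2 := hγ0.gauge hr.1 hrs hs.2 m hγ h1 (z := fun t => toFrame
      (frameCorep x₀ (γ t) (P t).symm) (frameRep x₀ (γ t) (P t)) (m.Γ (m.coord (γ t)))
      (L t (A η, η))) fun t ht => rfl
    have h3 := (hz η).2.glue h2 hr.1 hrs (by rw [hzA, (hL (A η, η)).1])
    refine ⟨by simpa [hr.1] using (hz η).1, h3.congr_deriv hs.1 fun t ht => ?_⟩
    dsimp only
    split_ifs <;> rfl

/-- Continuation along the curve. Around each time a chart is fixed, a ball of chart states with
invertible frames, and an interval so short that the linearized coefficients integrate to less than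
1. -/
theorem IsPath.hasVar (hT : 0 < T) (h : D.IsPath ξ₀ γ P 0 T) : D.HasVar ξ₀ γ P T := by
  refine Icc_induction (p := D.HasVar ξ₀ γ P) hasVar_zero (fun t ht => ?_) T ⟨hT.le, le_rfl⟩
  obtain ⟨m⟩ := exists_chartModel D.conn_smooth (γ t)
  obtain ⟨δ, hδ, H⟩ := exists_delta_of_mem_nhds h.continuousOn ht (m.isOpen_dom.mem_nhds m.mem_dom)
  obtain ⟨a, b, htab, ha, hab, hb, hδab, hnhd⟩ := exists_Icc_subset ht hδ
  have hsub : ∀ x ∈ Icc a b, x ∈ Icc 0 T := fun x hx => ⟨ha.trans hx.1, hx.2.trans hb⟩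
  have hγ : ∀ x ∈ Icc a b, γ x ∈ m.dom := fun x hx => H x (hsub x hx) (hδab x hx)
  have hy := (h.mono ha hab hb).chart hab m hγ
  have hOt : Icc 0 T ×ˢ m.O ⊆ Icc 0 T ×ˢ (extChartAt (𝓡 d) (γ t)).target :=
    prod_mono subset_rfl m.subset
  obtain ⟨c₀, c₁, f₀', f₁', c₀', c₁', g₀, g₁, hlin⟩ := exists_sysDeriv (W := Eu d) m.isOpen m.smooth
    ((D.contDiffOn_rep_u (γ t)).continuousOn.mono hOt)
    ((continuousOn_driftDeriv hT (γ t)).mono hOt)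
    (fun t ht x hx => hasFDerivAt_driftDeriv ht (m.subset hx)) D.continuousOn_diffusion
  -- Invertible operators form an open set, so a closed ball of chart states with invertible frames
  -- exists around the state at t.
  have hGL : IsOpen (m.O ×ˢ {A : Eu d →L[ℝ] Eu d | IsUnit A}) := m.isOpen.prod Units.isOpen
  have hmem : ∀ x ∈ Icc a b, D.chartState m (γ x) (P x) ∈ m.O ×ˢ {A : Eu d →L[ℝ] Eu d | IsUnit A} :=
    fun x hx => ⟨m.coord_mem (hγ x hx),
      ⟨⟨_, _, frameRep_comp_frameCorep (hγ x hx).1 (P x), frameCorep_comp_frameRep (hγ x hx).1 (P x)⟩,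
        rfl⟩⟩
  obtain ⟨ρ, hρ, hρs⟩ := Metric.nhds_basis_closedBall.mem_iff.1 (hGL.mem_nhds (hmem t htab))
  have hsubΩ : Icc 0 T ×ˢ Metric.closedBall (D.chartState m (γ t) (P t)) ρ ⊆
      Icc 0 T ×ˢ (m.O ×ˢ univ) := prod_mono subset_rfl
    (hρs.trans (prod_mono subset_rfl (subset_univ _)))
  -- A total choice of point and frame; its value at states that do not come from any frame is
  -- irrelevant.
  have hst : ∀ y, ∃ st : M × (Eu d ≃L[ℝ] Eu d), y.1 ∈ m.O ∧ IsUnit y.2 →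
      st.1 ∈ m.dom ∧ D.chartState m st.1 st.2 = y := fun y => by
    by_cases h : y.1 ∈ m.O ∧ IsUnit y.2
    · obtain ⟨st, hst⟩ := exists_chartState_eq m y h
      exact ⟨st, fun _ => hst⟩
    · exact ⟨(γ t, P t), fun h' => absurd h' h⟩
  choose st hst using hst
  obtain ⟨δ₁, hδ₁, H₁⟩ := exists_delta_of_mem_nhds hy.continuousOn htab (Metric.ball_mem_nhds _ hρ)
  have hyc := hy.continuousOn
  have hmaps : MapsTo (fun x => (x, D.chartState m (γ x) (P x))) (Icc a b)
      (Icc 0 T ×ˢ (m.O ×ˢ univ)) := fun x hx => ⟨hsub x hx, (hmem x hx).1, trivial⟩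
  have hkap := intervalIntegrable_norm_add_flip hab
    (c₀'.comp (continuousOn_id.prodMk hyc) hmaps) (c₁'.comp (continuousOn_id.prodMk hyc) hmaps)
    (Control.intervalIntegrable ξ₀ (hsub a ⟨le_rfl, hab⟩) (hsub b ⟨hab, le_rfl⟩))
  have hK := Prim.intervalIntegral hkap 0
  -- Values of the primitive within 1/2 of that at t bound the integral between two times by 1.
  obtain ⟨δ₂, hδ₂, H₂⟩ := exists_delta_of_mem_nhds hK.continuousOn htab
    (Metric.ball_mem_nhds _ (show (0 : ℝ) < 1 / 2 by norm_num))
  refine ⟨min (δ / 2) (min δ₁ δ₂), lt_min (by linarith) (lt_min hδ₁ hδ₂),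
    fun r hr s hs hrt hst' hrs hrr => ?_⟩
  have hrab := hnhd r hr (hrt.trans_le (min_le_left _ _))
  have hsab := hnhd s hs (hst'.trans_le (min_le_left _ _))
  have hab' : ∀ x ∈ Icc r s, x ∈ Icc a b := fun x hx => ⟨hrab.1.trans hx.1, hx.2.trans hsab.2⟩
  have hball : ∀ x ∈ Icc r s, D.chartState m (γ x) (P x) ∈
      Metric.ball (D.chartState m (γ t) (P t)) ρ := fun x hx =>
    H₁ x (hab' x hx) ((abs_sub_lt_of_mem_Icc hrt hst' hx).trans_le
      ((min_le_right _ _).trans (min_le_left _ _)))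
  have hrs0 : Icc r s ×ˢ Metric.closedBall (D.chartState m (γ t) (P t)) ρ ⊆
      Icc 0 T ×ˢ (m.O ×ˢ univ) := (prod_mono (Icc_subset_Icc hr.1 hs.2) subset_rfl).trans hsubΩ
  have hbΩ : Metric.ball (D.chartState m (γ t) (P t)) ρ ⊆ m.O ×ˢ univ := fun y hy =>
    ⟨(hρs (Metric.ball_subset_closedBall hy)).1, trivial⟩
  have hsmall : ∫ x in r..s, ‖f₀' x (D.chartState m (γ x) (P x))
      + (f₁' x (D.chartState m (γ x) (P x))).flip (ξ₀ x)‖ < 1 := by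
    have e := hK.sub_eq hrab hsab
    have h1 := H₂ r hrab (hrt.trans_le ((min_le_right _ _).trans (min_le_right _ _)))
    have h2 := H₂ s hsab (hst'.trans_le ((min_le_right _ _).trans (min_le_right _ _)))
    rw [Metric.mem_ball, Real.dist_eq, abs_lt] at h1 h2
    refine lt_of_eq_of_lt e.symm ?_
    linarith [h1.1, h2.2]
  have hflow := exists_local_flow hr hs hrs (D.chartState m (γ t) (P t)) hρ (c₀.mono hrs0)
    (c₁.mono hrs0) (c₀'.mono hrs0) (c₁'.mono hrs0)
    (fun x hx y hy => g₀ x ⟨hr.1.trans hx.1, hx.2.trans hs.2⟩ y (hbΩ hy))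
    (fun x hx y hy => g₁ x ⟨hr.1.trans hx.1, hx.2.trans hs.2⟩ y (hbΩ hy)) ξ₀
    (hy.mono hrab hsab) hball hsmall
  exact hrr.step (m := m) (st := st) (h.mono hr.1 hrs hs.2) hr hs hrs (fun x hx => hγ x (hab' x hx)) hball
    (fun x hx => hlin x (hsub x (hab' x hx)) _ ⟨(hmem x (hab' x hx)).1, trivial⟩)
    (fun y hy => hst y (hρs (Metric.ball_subset_closedBall hy))) hflow

end DiffusionData

/-! ### The adjoint equation and minimizing controls -/

/-- With ℓ' = -ℓ ∘ k, the pairing of ℓ with a solution of z' = kz + g has derivative ℓ(g). So a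
functional of the terminal value of z becomes the integral of ℓ against the forcing. -/
theorem exists_adjoint {V : Type*} [NormedAddCommGroup V] [NormedSpace ℝ V]
    [FiniteDimensional ℝ V] {a b : ℝ} (hab : a ≤ b) {k : ℝ → V →L[ℝ] V}
    (hk : ∀ z, IntervalIntegrable (fun t => k t z) volume a b) (p : V →L[ℝ] ℝ) :
    ∃ ℓ : ℝ → V →L[ℝ] ℝ, ℓ b = p ∧ (∀ z, Prim (fun t => ℓ t z) (fun t => - ℓ t (k t z)) a b) ∧
      (∀ z g : ℝ → V, Prim z (fun t => k t (z t) + g t) a b →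
        Prim (fun t => ℓ t (z t)) (fun t => ℓ t (g t)) a b) ∧
      ∀ w : ℝ → V, ContinuousOn w (Icc a b) → ContinuousOn (fun t => ℓ t (w t)) (Icc a b) := by
  obtain ⟨ℓ, hℓb, hℓ⟩ := exists_prim_linear' hab (E := V →L[ℝ] ℝ)
    (k := fun t => - (ContinuousLinearMap.compL ℝ V V ℝ).flip (k t))
    (intervalIntegrable_clm_of_apply fun l => intervalIntegrable_clm_of_apply fun z =>
      (⟨ContinuousLinearMap.integrable_comp (-l) (hk z).1,
        ContinuousLinearMap.integrable_comp (-l) (hk z).2⟩ :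
        IntervalIntegrable (fun t => (-l) (k t z)) volume a b)) p
  have key : ∀ z z' : ℝ → V, Prim z z' a b →
      Prim (fun t => ℓ t (z t)) (fun t => - ℓ t (k t (z t)) + ℓ t (z' t)) a b := fun z z' hz =>
    (hℓ.clm_apply hz hab).congr_deriv hab fun t _ => by simp
  refine ⟨ℓ, hℓb, fun z => ?_, fun z g hz => ?_, fun w hw => hℓ.continuousOn.clm_apply hw⟩
  · exact (key _ _ (Prim.const z _ _)).congr_deriv hab fun t _ => by simp
  · exact (key _ _ hz).congr_deriv hab fun t _ => by simp

namespace DiffusionData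

set_option linter.unusedSectionVars false

variable {d : ℕ} {M : Type*} [TopologicalSpace M] [ChartedSpace (EuclideanSpace ℝ (Fin d)) M]
  [IsManifold (𝓡 d) ∞ M] [T2Space M] {o : M} {T : ℝ} {D : DiffusionData d M o T}

theorem OM_eq (hT : 0 < T) (ξ : D.CameronMartin) : D.OM ξ = 1 / 2 * ‖ξ‖ ^ 2 := by
  rw [OM, intervalIntegral.integral_of_le hT.le, ← integral_Icc_eq_integral_Ioc,
    ← real_inner_self_eq_norm_sq, L2.inner_def]

theorem hasStrictFDerivAt_OM (hT : 0 < T) (ξ : D.CameronMartin) :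
    HasStrictFDerivAt D.OM (innerSL ℝ ξ) ξ := by
  have e : D.OM = fun ξ => 1 / 2 * ‖ξ‖ ^ 2 := funext (OM_eq hT)
  rw [e]
  have h := (hasStrictFDerivAt_norm_sq ξ).const_mul (1 / 2)
  have e2 : (1 / 2 : ℝ) • 2 • innerSL ℝ ξ = innerSL ℝ ξ := by
    ext η
    simp
  exact e2 ▸ h

/-- The Lagrange multiplier rule for half the squared norm under the endpoint constraint.
Surjectivity of the endpoint differential excludes the abnormal case, in which the multiplier of the
energy vanishes. -/
theorem exists_multiplier (hT : 0 < T) {γ : ℝ → M} (hγ : D.IsMostProbablePath γ)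
    (hreg : ¬ D.IsSingular γ) :
    ∃ (ξ : D.CameronMartin) (P : ℝ → Eu d ≃L[ℝ] Eu d)
      (z : ℝ → D.CameronMartin → Eu d × (Eu d →L[ℝ] Eu d)) (p : Eu d →L[ℝ] ℝ),
      D.IsPath ξ γ P 0 T ∧ (γ 0 = o ∧ P 0 = .refl ℝ _) ∧
      (∀ η : D.CameronMartin, z 0 η = 0 ∧ Prim (fun s => z s η)
        (fun s => D.varOp ξ γ P s (z s η) + (D.diffusion s (η s), 0)) 0 T) ∧
      ∀ η : D.CameronMartin, ⟪ξ, η⟫ = p (z T η).1 := by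
  obtain ⟨ξ, hsol, hmin⟩ := hγ
  have hR : D.IsRegular ξ := by
    by_contra h
    exact hreg ⟨ξ, hsol, h⟩
  obtain ⟨h0, P, hP, hP0⟩ := (isSolution_iff hT).1 hsol
  obtain ⟨Φ, Q, z, hev, ⟨hΦ, hQ⟩, hvar, hz⟩ := hP.hasVar hT
  -- Solutions exist for all controls near ξ and are unique, so the endpoint map is locally the
  -- differentiable family Φ; no completeness on this manifold is used.
  have hend : D.endpoint =ᶠ[𝓝 ξ] Φ := by
    filter_upwards [hev] with ξ₁ h₁
    obtain ⟨γ₁, P₁, hp, ⟨i1, i2⟩, e1, -⟩ := h₁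
    rw [endpoint_eq hT ((isSolution_iff hT).2 ⟨i1.trans h0, P₁, hp, i2.trans hP0⟩), e1]
  obtain ⟨m⟩ := exists_chartModel D.conn_smooth (γ T)
  have hmdom : Φ ξ ∈ m.dom := by rw [hΦ]; exact m.mem_dom
  obtain ⟨L, hL, hLη⟩ := hvar.comp d m.coord m.coord_smooth
  have hLs : Function.Surjective L := by
    unfold IsRegular at hR
    by_cases hd : MDifferentiableAt 𝓘(ℝ, D.CameronMartin) (𝓡 d) D.endpoint ξ
    · have h1 : MDifferentiableAt (𝓡 d) 𝓘(ℝ, Eu d) m.coord (D.endpoint ξ) :=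
        m.coord_smooth.mdifferentiable (by simp) _
      have h2 := mfderiv_comp ξ h1 hd
      have h3 : mfderiv 𝓘(ℝ, D.CameronMartin) 𝓘(ℝ, Eu d) (m.coord ∘ D.endpoint) ξ = L := by
        rw [mfderiv_eq_fderiv]
        refine (hL.hasFDerivAt.congr_of_eventuallyEq ?_).fderiv
        filter_upwards [hend] with ξ₁ h
        simp [h]
      rw [h3] at h2
      intro w
      have hdom : D.endpoint ξ ∈ m.dom := by rw [hend.eq_of_nhds]; exact hmdom
      obtain ⟨η, hη⟩ := hR (fromChart (γ T) (D.endpoint ξ) w)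
      refine ⟨η, ?_⟩
      rw [h2]
      change mfderiv (𝓡 d) 𝓘(ℝ, Eu d) m.coord (D.endpoint ξ) (mfderiv 𝓘(ℝ, D.CameronMartin) (𝓡 d) D.endpoint ξ η) = w
      rw [hη]
      change dir m.coord (D.endpoint ξ) _ = w
      rw [m.dir_coord hdom]
      exact toChart_fromChart hdom.1 w
    -- The default derivative 0 is onto only if the tangent space is trivial, and then there is
    -- nothing to prove.
    · rw [mfderiv_zero_of_not_mdifferentiableAt hd] at hR
      intro w
      obtain ⟨η, hη⟩ := hR ((toE _).symm w)
      refine ⟨0, ?_⟩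
      have : (toE (D.endpoint ξ)).symm w = 0 := hη.symm
      rw [map_zero]
      exact ((toE (D.endpoint ξ)).symm.map_eq_zero_iff.1 this).symm
  -- The coordinates are injective on the domain of the chart, so near ξ the level set consists of
  -- controls with the same endpoint and global minimality applies.
  have hloc : IsLocalExtrOn D.OM {ξ₁ | m.coord (Φ ξ₁) = m.coord (Φ ξ)} ξ := by
    left
    have hnb := hvar.continuousAt.eventually_mem (m.isOpen_dom.mem_nhds hmdom)
    filter_upwards [mem_nhdsWithin_of_mem_nhds hnb, mem_nhdsWithin_of_mem_nhds hev,
      self_mem_nhdsWithin] with ξ₁ h1 h2 h3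
    obtain ⟨γ₁, P₁, hp, ⟨i1, i2⟩, e1, -⟩ := h2
    refine hmin ξ₁ γ₁ ((isSolution_iff hT).2 ⟨i1.trans h0, P₁, hp, i2.trans hP0⟩) ?_
    rw [e1, ← hΦ, ← m.ofChart_coord h1, ← m.ofChart_coord hmdom]
    exact congrArg _ h3
  obtain ⟨Λ, Λ₀, hne, hΛ⟩ := hloc.exists_linear_map_of_hasStrictFDerivAt hL
    (hasStrictFDerivAt_OM hT ξ)
  -- If the energy had multiplier 0, the other multiplier would vanish on the range of L, which is
  -- everything.
  have hΛ₀ : Λ₀ ≠ 0 := by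
    rintro rfl
    refine hne (Prod.ext (LinearMap.ext fun w => ?_) rfl)
    obtain ⟨η, rfl⟩ := hLs w
    simpa using hΛ η
  let dc : Eu d →L[ℝ] Eu d := mfderiv (𝓡 d) 𝓘(ℝ, Eu d) m.coord (γ T) ∘L
    (toE (γ T)).symm.toContinuousLinearMap ∘L (P T : Eu d →L[ℝ] Eu d)
  refine ⟨ξ, P, z, (-Λ₀⁻¹) • (LinearMap.toContinuousLinearMap Λ ∘L dc), hP, ⟨h0, hP0⟩, hz,
    fun η => ?_⟩
  have e1 : L η = dc (z T η).1 := by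
    rw [hLη η, hΦ, hQ]; rfl
  have e2 := hΛ η
  rw [e1] at e2
  have e3 : Λ₀ * ⟪ξ, η⟫ = - Λ (dc (z T η).1) := by
    simpa using eq_neg_of_add_eq_zero_right e2
  change _ = -Λ₀⁻¹ * Λ (dc (z T η).1)
  field_simp
  linarith

theorem IsPath.congr_control {ξ c : ℝ → D.S.Fiber o} {γ : ℝ → M} {P : ℝ → Eu d ≃L[ℝ] Eu d}
    {a b : ℝ} (h : D.IsPath ξ γ P a b) (hab : a ≤ b) (hc : ∀ᵐ t, t ∈ Icc a b → ξ t = c t) :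
    D.IsPath c γ P a b where
  continuousOn := h.continuousOn
  comp f hf := (h.comp f hf).congr_deriv_ae hab <| by
    filter_upwards [hc] with t ht hab'
    unfold vel
    rw [ht hab']
  field X hX := (h.field X hX).congr_deriv_ae hab <| by
    filter_upwards [hc] with t ht hab'
    unfold vel
    rw [ht hab']

/-- The multiplier identity becomes ⟪ξ, η⟫ = ∫ ℓ_t(Σ_t^{1/2} η_t, 0) dt for all η, so ξ agrees
almost everywhere with the continuous Riesz representative c, which replaces it from here on. The
terminal functional factors through the variation of the point, hence ℓ_T vanishes on frame
variations; this becomes chi_T = 0. -/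
theorem exists_momentum (hT : 0 < T) {γ : ℝ → M} (hγ : D.IsMostProbablePath γ)
    (hreg : ¬ D.IsSingular γ) :
    ∃ (P : ℝ → Eu d ≃L[ℝ] Eu d) (ℓ : ℝ → (Eu d × (Eu d →L[ℝ] Eu d)) →L[ℝ] ℝ)
      (ξ : D.CameronMartin) (c : ℝ → D.S.Fiber o), (∀ᵐ t, t ∈ Icc 0 T → ξ t = c t) ∧
      ContinuousOn c (Icc 0 T) ∧ D.IsPath c γ P 0 T ∧ (γ 0 = o ∧ P 0 = .refl ℝ _) ∧
      (∀ t ∈ Icc 0 T, ∀ w, ⟪c t, w⟫ = ℓ t (D.diffusion t w, 0)) ∧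
      (∀ z, Prim (fun t => ℓ t z) (fun t => - ℓ t (D.varOp c γ P t z)) 0 T) ∧
      ∀ A, ℓ T (0, A) = 0 := by
  obtain ⟨ξ, P, z, p, hP, h0, hz, hp⟩ := exists_multiplier hT hγ hreg
  obtain ⟨ℓ, hℓT, hℓ, hpair, hcont⟩ := exists_adjoint hT.le (hP.intervalIntegrable_varOp hT)
    (p ∘L ContinuousLinearMap.fst ℝ (Eu d) (Eu d →L[ℝ] Eu d))
  let c : ℝ → D.S.Fiber o := fun t => (InnerProductSpace.toDual ℝ (D.S.Fiber o)).symm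
    (ℓ t ∘L ContinuousLinearMap.inl ℝ (Eu d) (Eu d →L[ℝ] Eu d) ∘L D.diffusion t)
  have hcw : ∀ t w, ⟪c t, w⟫ = ℓ t (D.diffusion t w, 0) := fun t w => by simp [c]
  have hc : ContinuousOn c (Icc 0 T) := by
    refine (LinearIsometryEquiv.continuous _).comp_continuousOn ?_
    refine continuousOn_clm_apply.2 fun w => ?_
    exact hcont (fun t => (D.diffusion t w, 0))
      ((D.continuousOn_diffusion.clm_apply continuousOn_const).prodMk continuousOn_const)
  have hmem : MemLp c 2 (volume.restrict (Icc 0 T)) := by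
    obtain ⟨K, hK⟩ := isCompact_Icc.exists_bound_of_continuousOn hc
    exact MemLp.of_bound (hc.aestronglyMeasurable measurableSet_Icc) K
      ((ae_restrict_iff' measurableSet_Icc).2 (.of_forall hK))
  -- Both sides have the same L² inner product with every η.
  have hξ : ξ = hmem.toLp c := by
    refine ext_inner_right ℝ fun η => ?_
    have h1 := (hpair _ _ (hz η).2).2 T ⟨hT.le, le_rfl⟩
    rw [hp η, L2.inner_def]
    have h2 : ℓ T (z T η) = p (z T η).1 := by rw [hℓT]; rfl
    simp only [(hz η).1, map_zero, sub_zero] at h1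
    rw [← h2, h1, intervalIntegral.integral_of_le hT.le, ← integral_Icc_eq_integral_Ioc]
    refine integral_congr_ae ?_
    filter_upwards [hmem.coeFn_toLp] with t ht
    rw [ht, hcw]
  have hae : ∀ᵐ t, t ∈ Icc 0 T → ξ t = c t := by
    rw [hξ]
    exact (ae_restrict_iff' measurableSet_Icc).1 hmem.coeFn_toLp
  refine ⟨P, ℓ, ξ, c, hae, hc, hP.congr_control hT.le hae, h0, fun t _ w => hcw t w, fun z => ?_,
    fun A => ?_⟩
  · refine (hℓ z).congr_deriv_ae hT.le ?_
    filter_upwards [hae] with t ht h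
    unfold varOp vel
    rw [ht h]
  · rw [hℓT]
    simp

end DiffusionData

/-! ### Frames and curvature of compatible connections -/

section Fields

set_option linter.unusedSectionVars false

variable {d : ℕ} {M : Type*} [TopologicalSpace M] [ChartedSpace (EuclideanSpace ℝ (Fin d)) M]
  [IsManifold (𝓡 d) ∞ M] [T2Space M] {cov : Connection d M}

theorem SmoothFieldOn.of_forall {X : (x : M) → TangentSpace (𝓡 d) x}
    (h : ∀ x, ∃ U ∈ 𝓝 x, SmoothFieldOn X U) : SmoothFieldOn X univ := by
  intro x _
  obtain ⟨U, hU, hX⟩ := h x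
  exact (ContMDiffOn.contMDiffAt hX hU).contMDiffWithinAt

theorem smoothFieldOn_cov (hcov : CovariantDerivative.ContMDiffCovariantDerivative cov ∞)
    {X Z : (x : M) → TangentSpace (𝓡 d) x} (hX : SmoothFieldOn X univ)
    (hZ : SmoothFieldOn Z univ) : SmoothFieldOn (fun x => cov Z x (X x)) univ := by
  refine .of_forall fun x₀ => ?_
  obtain ⟨m⟩ := exists_chartModel hcov x₀
  refine ⟨m.dom, m.isOpen_dom.mem_nhds m.mem_dom, smoothFieldOn_of_rep m.isOpen ?_⟩
  have hZ' := m.contDiffOn_rep hZ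
  have hX' := m.contDiffOn_rep hX
  refine ContDiffOn.congr (((hZ'.fderiv_of_isOpen m.isOpen (m := ∞) le_rfl).clm_apply hX').add
    ((m.smooth.clm_apply hX').clm_apply hZ')) fun y hy => ?_
  exact m.cov_eq y hy Z (hZ.fieldDiffAt Filter.univ_mem) _

theorem smoothFieldOn_sum_smul {ι : Type*} (s : Finset ι) {X : ι → (x : M) → TangentSpace (𝓡 d) x}
    {c : ι → M → ℝ} {U : Set M} (hX : ∀ i, SmoothFieldOn (X i) U)
    (hc : ∀ i, ContMDiffOn (𝓡 d) 𝓘(ℝ, ℝ) ∞ (c i) U) :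
    SmoothFieldOn (fun x => ∑ i ∈ s, c i x • X i x) U :=
  ContMDiffOn.sum_section fun i _ => (hc i).smul_section (hX i)

theorem toChart_injective {x₀ x : M} (hx : x ∈ (chartAt (Eu d) x₀).source) :
    Function.Injective (toChart (d := d) x₀ x) :=
  fun v w h => by rw [← fromChart_toChart hx v, h, fromChart_toChart hx]

theorem ChartModel.field_coord {x₀ x : M} (m : ChartModel cov x₀) (hx : x ∈ m.dom)
    (v : TangentSpace (𝓡 d) x) : m.field (toChart x₀ x v) x = v :=
  toChart_injective hx.1 (m.toChart_field hx _)

theorem ChartModel.rep_cov {x₀ x : M} (m : ChartModel cov x₀) (hx : x ∈ m.dom)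
    {X Z : (x : M) → TangentSpace (𝓡 d) x} (hZ : SmoothFieldOn Z univ) :
    rep x₀ (fun z => cov Z z (X z)) =ᶠ[𝓝 (m.coord x)] fun z => fderiv ℝ (rep x₀ Z) z (rep x₀ X z)
      + m.Γ z (rep x₀ X z) (rep x₀ Z z) := by
  filter_upwards [m.isOpen.mem_nhds (m.coord_mem hx)] with z hz
  exact m.cov_eq z hz Z (hZ.fieldDiffAt Filter.univ_mem) _

/-- Coordinate fields commute, so the bracket term disappears. The field Z is arbitrary here, in
particular it may be a section of E, which the extension chosen in `curvature` need not be. -/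
theorem ChartModel.curvature_eq_cov_field
    (hcov : CovariantDerivative.ContMDiffCovariantDerivative cov ∞) {x₀ x : M}
    (m : ChartModel cov x₀) (hx : x ∈ m.dom) {Z : (x : M) → TangentSpace (𝓡 d) x}
    (hZ : SmoothFieldOn Z univ) (u v : TangentSpace (𝓡 d) x) :
    curvature cov x u v (Z x)
      = cov (fun z => cov Z z (m.field (toChart x₀ x v) z)) x u
        - cov (fun z => cov Z z (m.field (toChart x₀ x u) z)) x v := by
  have hs : ∀ w, FieldDiffAt (fun z => cov Z z (m.field w z)) x := fun w =>
    (smoothFieldOn_cov hcov (m.field_smooth w) hZ).fieldDiffAt Filter.univ_mem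
  have hf : ∀ w, SmoothFieldOn (m.field w) univ := m.field_smooth
  have hc := m.coord_mem hx
  have hd : ∀ w, DifferentiableAt ℝ (rep x₀ (m.field w)) (m.coord x) := fun w =>
    (m.differentiableAt_rep hx).1 ((hf w).fieldDiffAt Filter.univ_mem)
  have h := (curvOp_eq (m.differentiableAt_Γ hc) (hd (toChart x₀ x u)) (hd (toChart x₀ x v))
    ((m.contDiffOn_rep hZ).contDiffAt (m.isOpen.mem_nhds hc))).2
  simp only [m.fderiv_rep_field hc, m.field_eq _ _ hc] at h
  apply toChart_injective hx.1
  rw [m.curvature_eq' hx, map_sub, m.cov_eq' hx (hs _), m.cov_eq' hx (hs _),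
    (m.rep_cov hx hZ).fderiv_eq, (m.rep_cov hx hZ).fderiv_eq,
    m.cov_eq' hx (hZ.fieldDiffAt Filter.univ_mem), m.cov_eq' hx (hZ.fieldDiffAt Filter.univ_mem),
    m.toChart_field hx, m.toChart_field hx]
  have e : toChart x₀ x (Z x) = rep x₀ Z (m.coord x) := by rw [rep, m.ofChart_coord hx]
  rw [e, ← h]
  simp

end Fields

/-- An orthonormal frame of `E` over a neighbourhood of `x₀`, made of global sections. -/
structure LocalFrame {d : ℕ} {M : Type*} [TopologicalSpace M]
    [ChartedSpace (EuclideanSpace ℝ (Fin d)) M] [IsManifold (𝓡 d) ∞ M]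
    (S : SubRiemannianStructure d M) (x₀ : M) where
  rank : ℕ
  map : (x : M) → Eu rank →ₗ[ℝ] S.Fiber x
  W : Set M
  isOpen : IsOpen W
  mem : x₀ ∈ W
  smooth : ∀ z, SmoothFieldOn (S.toField fun x => map x z) univ
  inner_map : ∀ x ∈ W, ∀ z w, ⟪map x z, map x w⟫ = ⟪z, w⟫
  surjective : ∀ x ∈ W, Function.Surjective (map x)

section Frames

set_option linter.unusedSectionVars false

variable {d : ℕ} {M : Type*} [TopologicalSpace M] [ChartedSpace (EuclideanSpace ℝ (Fin d)) M]
  [IsManifold (𝓡 d) ∞ M] [T2Space M]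

/-- A local orthonormal frame is multiplied by a bump function and is unchanged on W. Global
sections are required because compatibility of the connection is stated for those. -/
theorem exists_localFrame (S : SubRiemannianStructure d M) (x₀ : M) :
    Nonempty (LocalFrame S x₀) := by
  obtain ⟨U, hU, J, f, hf, hfU⟩ := S.exists_frame x₀
  obtain ⟨V, hVU, hVo, hxV⟩ := mem_nhds_iff.1 hU
  obtain ⟨ψ, hψ, hψV, hψ1⟩ := exists_bump (d := d) (hVo.mem_nhds hxV)
  obtain ⟨W, hW1, hWo, hxW⟩ := eventually_nhds_iff.1 (hψ1.and (hVo.mem_nhds hxV))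
  let e : Fin J → (x : M) → S.Fiber x := fun i x => ψ x • (f i x : S.Fiber x)
  let b : (x : M) → Eu J →ₗ[ℝ] S.Fiber x := fun x =>
    ∑ i, (EuclideanSpace.proj (𝕜 := ℝ) i : Eu J →L[ℝ] ℝ).toLinearMap.smulRight (e i x)
  have hb : ∀ x z, b x z = ∑ i, z i • e i x := fun x z => by simp [b, LinearMap.sum_apply]
  have hes : ∀ i, SmoothFieldOn (S.toField (e i)) univ := fun i =>
    contMDiffOn_univ.2 (ContMDiffOn.smul_section_of_tsupport hψ.contMDiffOn hVo hψV
      (ContMDiffOn.mono (hf i) hVU))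
  have heW : ∀ x ∈ W, ∀ i, e i x = (f i x : S.Fiber x) := fun x hx i => by
    simp only [e, (hW1 x hx).1]
    exact one_smul ℝ (f i x : S.E x)
  refine ⟨⟨J, b, W, hWo, hxW, fun z => ?_, fun x hx z w => ?_, fun x hx v => ?_⟩⟩
  · have h := smoothFieldOn_sum_smul (U := univ) Finset.univ hes
      (c := fun i _ => z i) fun i => contMDiffOn_const
    convert h using 2 with x
    rw [SubRiemannianStructure.toField, hb, map_sum]
    simp only [map_smul]
    rfl
  · have h1 := (hfU x (hVU (hW1 x hx).2)).1
    have h2 : ∀ i j, ⟪e i x, e j x⟫ = if i = j then (1 : ℝ) else 0 := fun i j => by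
      rw [heW x hx, heW x hx]; exact h1 i j
    rw [hb, hb, sum_inner]
    simp only [inner_sum, inner_smul_left, inner_smul_right, h2]
    simp [PiLp.inner_apply, mul_comm]
  · have h1 := (hfU x (hVU (hW1 x hx).2)).2
    have h2 : v ∈ Submodule.span ℝ (M := S.E x) (range fun i => f i x) :=
      h1.symm ▸ Submodule.mem_top (R := ℝ) (x := v)
    obtain ⟨c, hc⟩ := (Submodule.mem_span_range_iff_exists_fun (M := S.E x) ℝ).1 h2
    refine ⟨WithLp.toLp 2 c, ?_⟩
    rw [hb, ← hc]
    exact Finset.sum_congr rfl fun i _ => by rw [heW x hx]; rfl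

end Frames

/-! ### The curvature preserves E and is skew there -/

section CurvatureOnSubbundle

set_option linter.unusedSectionVars false

variable {d : ℕ} {M : Type*} [TopologicalSpace M] [ChartedSpace (EuclideanSpace ℝ (Fin d)) M]
  [IsManifold (𝓡 d) ∞ M] [T2Space M] {cov : Connection d M} {S : SubRiemannianStructure d M}

theorem incl_injective (x : M) : Function.Injective (S.incl x) := Subtype.val_injective

/-- The covariant derivative of a section of `E` along a vector field. -/
def covSection (hS : S.IsCompatible cov) {Z : (x : M) → S.Fiber x}
    (hZ : SmoothFieldOn (S.toField Z) univ) (X : (x : M) → TangentSpace (𝓡 d) x) (x : M) :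
    S.Fiber x := S.mkFiber (cov (S.toField Z) x (X x)) (hS.mem Z hZ x (X x))

theorem inner_add_inner_eq_zero (hS : S.IsCompatible cov) {Y Z : (x : M) → S.Fiber x}
    (hY : SmoothFieldOn (S.toField Y) univ) (hZ : SmoothFieldOn (S.toField Z) univ) {x : M} {c : ℝ}
    (h : ∀ᶠ y in 𝓝 x, ⟪Y y, Z y⟫ = c) (X : (x : M) → TangentSpace (𝓡 d) x) :
    ⟪covSection hS hY X x, Z x⟫ + ⟪Y x, covSection hS hZ X x⟫ = 0 := by
  have h1 := hS.metric Y Z hY hZ x (X x)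
  have h2 : (fun y => ⟪Y y, Z y⟫) =ᶠ[𝓝 x] fun _ => c := h
  rw [h2.mfderiv_eq, mfderiv_const] at h1
  exact h1.symm

theorem LocalFrame.covSection_skew (hS : S.IsCompatible cov) {x₀ x : M} (F : LocalFrame S x₀)
    (hx : x ∈ F.W) (z w : Eu F.rank) (X : (x : M) → TangentSpace (𝓡 d) x) :
    ⟪covSection hS (F.smooth z) X x, F.map x w⟫ + ⟪F.map x z, covSection hS (F.smooth w) X x⟫
      = 0 :=
  inner_add_inner_eq_zero hS (F.smooth z) (F.smooth w) (c := ⟪z, w⟫)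
    (Filter.mem_of_superset (F.isOpen.mem_nhds hx) fun y hy => F.inner_map y hy z w) X

/-- Extend v by a section Z of constant length near x and take commuting fields A, B, so that R(A,
B)Z = ∇_A∇_B Z - ∇_B∇_A Z lies in E. Differentiating ⟪∇_B Z, Z⟫ = 0 along A gives ⟪∇_A∇_B Z, Z⟫ =
-⟪∇_B Z, ∇_A Z⟫, which is symmetric in A and B, so the difference is orthogonal to Z. -/
theorem exists_curvature_mem (hcov : CovariantDerivative.ContMDiffCovariantDerivative cov ∞)
    (hS : S.IsCompatible cov) (x : M) (a b : TangentSpace (𝓡 d) x) (v : S.Fiber x) :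
    ∃ r : S.Fiber x, S.incl x r = curvature cov x a b (S.incl x v) ∧ ⟪r, v⟫ = 0 := by
  obtain ⟨m⟩ := exists_chartModel hcov x
  obtain ⟨F⟩ := exists_localFrame S x
  obtain ⟨z, rfl⟩ := F.surjective x F.mem v
  have hx := m.mem_dom
  let A := m.field (toChart x x a)
  let B := m.field (toChart x x b)
  have hA : A x = a := m.field_coord hx a
  have hB : B x = b := m.field_coord hx b
  have hZ := F.smooth z
  have hZA : SmoothFieldOn (S.toField (covSection hS hZ A)) univ :=
    smoothFieldOn_cov hcov (m.field_smooth _) hZ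
  have hZB : SmoothFieldOn (S.toField (covSection hS hZ B)) univ :=
    smoothFieldOn_cov hcov (m.field_smooth _) hZ
  refine ⟨covSection hS hZB A x - covSection hS hZA B x, ?_, ?_⟩
  · have h := m.curvature_eq_cov_field hcov hx hZ a b
    change _ = curvature cov x a b (S.toField (fun x => F.map x z) x)
    rw [h, map_sub]
    change cov (fun x => cov _ x (B x)) x (A x) - cov (fun x => cov _ x (A x)) x (B x) = _
    rw [hA, hB]
  · have key : ∀ X : (x : M) → TangentSpace (𝓡 d) x, ∀ᶠ y in 𝓝 x,
        ⟪covSection hS hZ X y, F.map y z⟫ = 0 := fun X => by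
      filter_upwards [F.isOpen.mem_nhds F.mem] with y hy
      have h := F.covSection_skew hS hy z z X
      rw [real_inner_comm (F.map y z)] at h
      linarith [real_inner_comm (F.map y z) (covSection hS hZ X y)]
    have h1 := inner_add_inner_eq_zero hS hZA hZ (key A) B
    have h2 := inner_add_inner_eq_zero hS hZB hZ (key B) A
    rw [real_inner_comm] at h2
    rw [inner_sub_left]
    have h3 := real_inner_comm (covSection hS hZ B x) (covSection hS hZ A x)
    have h4 := real_inner_comm (F.map x z) (covSection hS hZB A x)
    linarith

theorem exists_curvature_fiber (hcov : CovariantDerivative.ContMDiffCovariantDerivative cov ∞)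
    (hS : S.IsCompatible cov) (x : M) (a : TangentSpace (𝓡 d) x) :
    ∃ ρ : TangentSpace (𝓡 d) x →ₗ[ℝ] S.Fiber x →ₗ[ℝ] S.Fiber x,
      ∀ b v, S.incl x (ρ b v) = curvature cov x a b (S.incl x v) ∧ ⟪ρ b v, v⟫ = 0 := by
  choose r hr hr0 using exists_curvature_mem hcov hS x a
  have h : ∀ b v, toE x (S.incl x (r b v)) = curvL hcov x (toE x a) (toE x b)
      (toE x (S.incl x v)) := fun b v => by rw [hr, curvL_apply]
  have inj : Function.Injective fun v => toE x (S.incl x v) :=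
    (toE x).injective.comp (incl_injective x)
  refine ⟨LinearMap.mk₂ ℝ r (fun b b' v => inj ?_) (fun c b v => inj ?_) (fun b v v' => inj ?_)
    (fun c b v => inj ?_), fun b v => ⟨hr b v, hr0 b v⟩⟩ <;>
  simp only [h, map_add, map_smul, add_apply, smul_apply]

/-- Skewness of the curvature on E makes the form alternating, and the universal property of the
exterior square gives the linear map. -/
theorem exists_isK (hcov : CovariantDerivative.ContMDiffCovariantDerivative cov ∞)
    (hS : S.IsCompatible cov) (x : M) (a : TangentSpace (𝓡 d) x) :
    ∃ κ : ⋀[ℝ]^2 (S.Fiber x) →ₗ[ℝ] Module.Dual ℝ (TangentSpace (𝓡 d) x), S.IsK cov x a κ := by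
  obtain ⟨ρ, hρ⟩ := exists_curvature_fiber hcov hS x a
  let φ : S.Fiber x [⋀^Fin 2]→ₗ[ℝ] Module.Dual ℝ (TangentSpace (𝓡 d) x) :=
    { toFun := fun v => (innerₗ (S.Fiber x) (v 1)) ∘ₗ ρ.flip (v 0)
      map_update_add' := fun v i y z => by
        ext b
        fin_cases i <;> simp [inner_add_right]
      map_update_smul' := fun v i c y => by
        ext b
        fin_cases i <;> simp
      map_eq_zero_of_eq' := fun v i j hij hne => by
        have h01 : v 0 = v 1 := by
          fin_cases i <;> fin_cases j <;> simp_all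
        ext b
        have := (hρ b (v 1)).2
        rw [real_inner_comm] at this
        simpa [h01] using this }
  refine ⟨exteriorPower.alternatingMapLinearEquiv φ, fun v₁ v₂ w₂ => ⟨ρ w₂ v₁, (hρ w₂ v₁).1, ?_⟩⟩
  rw [SubRiemannianStructure.wedge, exteriorPower.alternatingMapLinearEquiv_apply_ιMulti]
  exact real_inner_comm _ _

end CurvatureOnSubbundle

/-! ### Parallel transport of orthonormal frames -/

section Transport

variable {U V : Type*} [NormedAddCommGroup U] [InnerProductSpace ℝ U] [FiniteDimensional ℝ U]
  [NormedAddCommGroup V] [InnerProductSpace ℝ V] [FiniteDimensional ℝ V]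

theorem Prim.eq_left {E : Type*} [NormedAddCommGroup E] [NormedSpace ℝ E] {y : ℝ → E} {a b : ℝ}
    (h : Prim y (fun _ => 0) a b) {t : ℝ} (ht : t ∈ Icc a b) : y t = y a := by
  have := h.2 t ht
  simpa [sub_eq_zero] using this

/-- A left inverse of an injective linear map, depending smoothly on it. -/
def leftInv (ε : U →L[ℝ] V) : V →L[ℝ] U :=
  Ring.inverse (ContinuousLinearMap.adjoint ε ∘L ε) ∘L ContinuousLinearMap.adjoint ε

theorem isUnit_adjoint_comp {ε : U →L[ℝ] V} (hε : Function.Injective ε) :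
    IsUnit (ContinuousLinearMap.adjoint ε ∘L ε) := by
  have hi : Function.Injective (ContinuousLinearMap.adjoint ε ∘L ε) := by
    refine (injective_iff_map_eq_zero _).2 fun z hz => ?_
    have h1 : ⟪ε z, ε z⟫ = 0 := by
      rw [← ContinuousLinearMap.adjoint_inner_right]
      change ⟪z, (ContinuousLinearMap.adjoint ε ∘L ε) z⟫ = 0
      rw [hz, inner_zero_right]
    exact (injective_iff_map_eq_zero _).1 hε z (inner_self_eq_zero.1 h1)
  exact ⟨ContinuousLinearEquiv.toUnit (LinearEquiv.ofInjectiveEndo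
    (ContinuousLinearMap.adjoint ε ∘L ε).toLinearMap hi).toContinuousLinearEquiv, by ext z; rfl⟩

theorem leftInv_apply {ε : U →L[ℝ] V} (hε : Function.Injective ε) (z : U) :
    leftInv ε (ε z) = z :=
  congrArg (fun L : U →L[ℝ] U => L z) (Ring.inverse_mul_cancel _ (isUnit_adjoint_comp hε))

theorem contDiffAt_leftInv {ε : U →L[ℝ] V} (hε : Function.Injective ε) :
    ContDiffAt ℝ ∞ (leftInv : (U →L[ℝ] V) → V →L[ℝ] U) ε := by
  let ad : (U →L[ℝ] V) → V →L[ℝ] U := ContinuousLinearMap.adjoint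
  have had : ContDiff ℝ ∞ ad := (ContinuousLinearMap.adjoint (𝕜 := ℝ) (E := U) (F := V)).contDiff
  have h1 : ContDiff ℝ ∞ fun ε => ad ε ∘L ε := had.clm_comp contDiff_id
  obtain ⟨u, hu⟩ := isUnit_adjoint_comp hε
  have h2 : ContDiffAt ℝ ∞ Ring.inverse (ad ε ∘L ε) := by
    have := contDiffAt_ringInverse (n := ∞) ℝ u
    rwa [hu] at this
  exact (ContDiffAt.comp (g := Ring.inverse) (f := fun ε => ad ε ∘L ε) ε h2 h1.contDiffAt).clm_comp
    had.contDiffAt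

theorem exists_prim_linear_of_clm {Y W : Type*} [NormedAddCommGroup Y] [NormedSpace ℝ Y]
    [NormedAddCommGroup W] [NormedSpace ℝ W] [CompleteSpace W] {a b : ℝ} (hab : a ≤ b)
    (Λ : Y →L[ℝ] W →L[ℝ] W) {k : ℝ → Y} (hk : IntervalIntegrable k volume a b) (y₀ : W) :
    ∃ y : ℝ → W, y a = y₀ ∧ Prim y (fun t => Λ (k t) (y t)) a b :=
  exists_prim_linear hab ⟨Λ.integrable_comp hk.1, Λ.integrable_comp hk.2⟩ y₀

/-- The coefficients of a parallel section in the frame ε solve A' = -θA. Skewness of θ makes A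
isometric, and the product rule makes ε A constant. The lemma is applied with ε the frame
transported back by the inverse of P. -/
theorem exists_frame_transport {ε ε' : ℝ → U →L[ℝ] V} {r s : ℝ} (hrs : r ≤ s)
    (hε : Prim ε ε' r s) (hinj : ∀ t ∈ Icc r s, Function.Injective (ε t)) {θ : ℝ → U → U}
    (hθ : ∀ t ∈ Icc r s, ∀ z, ε' t z = ε t (θ t z))
    (hskew : ∀ t ∈ Icc r s, ∀ z w, ⟪θ t z, w⟫ + ⟪z, θ t w⟫ = 0) :
    ∃ A : ℝ → U →L[ℝ] U, (∀ z, A r z = z) ∧ (∀ z, Prim (fun t => A t z)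
      (fun t => - θ t (A t z)) r s) ∧ (∀ t ∈ Icc r s, ∀ z w, ⟪A t z, A t w⟫ = ⟪z, w⟫) ∧
      ∀ t ∈ Icc r s, ∀ z, ε t (A t z) = ε r z := by
  -- The matrix θ is given only pointwise; composing ε' with a continuous left inverse of ε recovers
  -- it as an integrable function.
  let κ : ℝ → V →L[ℝ] U := fun t => leftInv (ε t)
  have hκ : ContinuousOn κ (Icc r s) := fun t ht =>
    (contDiffAt_leftInv (hinj t ht)).continuousAt.comp_continuousWithinAt (hε.continuousOn t ht)
  have hκε : ∀ t ∈ Icc r s, ∀ z, κ t (ε t z) = z := fun t ht => leftInv_apply (hinj t ht)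
  have hκθ : ∀ t ∈ Icc r s, ∀ z, (κ t ∘L ε' t) z = θ t z := fun t ht z => by
    rw [ContinuousLinearMap.comp_apply, hθ t ht, hκε t ht]
  have hint : IntervalIntegrable (fun t => κ t ∘L ε' t) volume r s :=
    intervalIntegrable_continuousOn_clm_apply hrs
      (C := fun t => ContinuousLinearMap.compL ℝ U V U (κ t))
      ((ContinuousLinearMap.compL ℝ U V U).continuous.comp_continuousOn hκ) hε.1
  obtain ⟨A, hA0, hA⟩ := exists_prim_linear_of_clm hrs (ContinuousLinearMap.compL ℝ U U U) hint.neg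
    (.id ℝ U)
  have hAz : ∀ z, Prim (fun t => A t z) (fun t => - θ t (A t z)) r s := fun z =>
    (hA.clm (ContinuousLinearMap.apply ℝ U z)).congr_deriv hrs fun t ht => by
      rw [← hκθ t ht]
      simp
  refine ⟨A, fun z => by rw [hA0]; rfl, hAz, fun t ht z w => ?_, fun t ht z => ?_⟩
  · have h := ((hAz z).clm (innerSL ℝ)).clm_apply (hAz w) hrs
    have h0 := (h.congr_deriv hrs (z' := fun _ => 0) fun t ht => by
      have := hskew t ht (A t z) (A t w)
      change ⟪-θ t (A t z), A t w⟫ + ⟪A t z, -θ t (A t w)⟫ = 0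
      rw [inner_neg_left, inner_neg_right]
      linarith).eq_left ht
    change ⟪A t z, A t w⟫ = ⟪A r z, A r w⟫ at h0
    rw [h0, hA0]
    rfl
  · have h := hε.clm_apply (hAz z) hrs
    have h0 := (h.congr_deriv hrs (z' := fun _ => 0) fun t ht => by
      rw [hθ t ht, map_neg, add_neg_cancel]).eq_left ht
    simpa [hA0] using h0

end Transport

/-! ### The connection matrix of an orthonormal frame, and transport of E -/

section FrameConnection

set_option linter.unusedSectionVars false

variable {d : ℕ} {M : Type*} [TopologicalSpace M] [ChartedSpace (EuclideanSpace ℝ (Fin d)) M]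
  [IsManifold (𝓡 d) ∞ M] [T2Space M] {cov : Connection d M} {S : SubRiemannianStructure d M}

theorem LocalFrame.exists_omega (hS : S.IsCompatible cov) {x₀ : M} (F : LocalFrame S x₀) :
    ∃ θ : (x : M) → TangentSpace (𝓡 d) x → Eu F.rank → Eu F.rank, ∀ x ∈ F.W, ∀ v z,
      cov (S.toField fun x => F.map x z) x v = S.incl x (F.map x (θ x v z)) ∧
      ∀ w, ⟪θ x v z, w⟫ + ⟪z, θ x v w⟫ = 0 := by
  have h : ∀ (x : M) (v : TangentSpace (𝓡 d) x) (z : Eu F.rank), ∃ w : Eu F.rank, x ∈ F.W →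
      S.incl x (F.map x w) = cov (S.toField fun x => F.map x z) x v := fun x v z => by
    by_cases hx : x ∈ F.W
    · obtain ⟨w, hw⟩ := F.surjective x hx (S.mkFiber _ (hS.mem _ (F.smooth z) x v))
      exact ⟨w, fun _ => by rw [hw]; rfl⟩
    · exact ⟨0, fun h => absurd h hx⟩
  choose θ hθ using h
  refine ⟨θ, fun x hx v z => ⟨(hθ x v z hx).symm, fun w => ?_⟩⟩
  -- Any field with value v at x will do, since only this value enters; no smoothness is required of
  -- it.
  let X : (y : M) → TangentSpace (𝓡 d) y := fun y => (toE y).symm (toE x v)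
  have hX : ∀ z, covSection hS (F.smooth z) X x = F.map x (θ x v z) := fun z =>
    incl_injective x (hθ x v z hx).symm
  have := F.covSection_skew hS hx z w X
  rwa [hX, hX, F.inner_map x hx, F.inner_map x hx] at this

theorem LocalFrame.injective {x₀ x : M} (F : LocalFrame S x₀) (hx : x ∈ F.W) :
    Function.Injective (F.map x) := by
  refine (injective_iff_map_eq_zero _).2 fun z hz => ?_
  have := F.inner_map x hx z z
  rw [hz, inner_zero_left] at this
  exact inner_self_eq_zero.1 this.symm

/-- The isometry `ℝ^k ≃ E_x` given by a frame. -/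
def LocalFrame.equiv {x₀ x : M} (F : LocalFrame S x₀) (hx : x ∈ F.W) :
    Eu F.rank ≃ₗᵢ[ℝ] S.Fiber x :=
  .ofSurjective ((F.map x).isometryOfInner (F.inner_map x hx)) (F.surjective x hx)

theorem LocalFrame.equiv_apply {x₀ x : M} (F : LocalFrame S x₀) (hx : x ∈ F.W) (z : Eu F.rank) :
    F.equiv hx z = F.map x z := rfl

theorem cov_linear (cov : Connection d M) {J : ℕ} {X : (x : M) → Eu J →ₗ[ℝ] S.Fiber x}
    (hX : ∀ z, SmoothFieldOn (S.toField fun x => X x z) univ) (x : M) (v : TangentSpace (𝓡 d) x)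
    (z : Eu J) : cov (S.toField fun x => X x z) x v
      = ∑ i, z i • cov (S.toField fun x => X x (EuclideanSpace.single i 1)) x v := by
  have h := (cov_sum_smul cov Finset.univ
    (X := fun i => S.toField fun x => X x (EuclideanSpace.single i 1)) (c := fun i _ => z i) (x := x)
    (fun i => (hX _).fieldDiffAt Filter.univ_mem) (fun i => mdifferentiableAt_const) v).2
  have e : (S.toField fun x => X x z)
      = fun y => ∑ i, z i • S.toField (fun x => X x (EuclideanSpace.single i 1)) y := by
    funext y
    simp only [SubRiemannianStructure.toField]
    rw [← LinearMap.comp_apply]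
    conv_lhs => rw [← (EuclideanSpace.basisFun (Fin J) ℝ).sum_repr z, map_sum]
    simp
  rw [e, h]
  refine Finset.sum_congr rfl fun i _ => ?_
  have h0 : dir (d := d) (fun _ : M => z i) x v = 0 := by rw [dir, mfderiv_const]; rfl
  rw [h0]
  exact (congrArg (_ + ·) (zero_smul ℝ
    (S.toField (fun x => X x (EuclideanSpace.single i 1)) x))).trans (add_zero _)

end FrameConnection

namespace DiffusionData

set_option linter.unusedSectionVars false

variable {d : ℕ} {M : Type*} [TopologicalSpace M] [ChartedSpace (EuclideanSpace ℝ (Fin d)) M]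
  [IsManifold (𝓡 d) ∞ M] [T2Space M] {o : M} {T : ℝ} {D : DiffusionData d M o T}
  {ξ : ℝ → D.S.Fiber o} {γ : ℝ → M} {P : ℝ → Eu d ≃L[ℝ] Eu d} {r s : ℝ}

theorem inclE_injective (x : M) : Function.Injective (D.inclE x) :=
  (toE x).injective.comp (incl_injective x)

/-- Stated for any injective family of sections with a skew connection matrix, since it is used both
for frames of E and for horizontal lifts of frames from N, which need not span E. -/
theorem IsPath.exists_transport (h : D.IsPath ξ γ P r s) (hrs : r ≤ s) {J : ℕ}
    {X : (x : M) → Eu J →ₗ[ℝ] D.S.Fiber x}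
    (hX : ∀ z, SmoothFieldOn (D.S.toField fun x => X x z) univ)
    {θ : (x : M) → TangentSpace (𝓡 d) x → Eu J → Eu J}
    (hinj : ∀ t ∈ Icc r s, Function.Injective (X (γ t)))
    (hθ : ∀ t ∈ Icc r s, ∀ v z, D.conn (D.S.toField fun x => X x z) (γ t) v
        = D.S.incl (γ t) (X (γ t) (θ (γ t) v z)) ∧
      ∀ w, ⟪θ (γ t) v z, w⟫ + ⟪z, θ (γ t) v w⟫ = 0) :
    ∃ A : ℝ → Eu J →L[ℝ] Eu J, (∀ z, A r z = z) ∧ (∀ z, Prim (fun t => A t z)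
      (fun t => - θ (γ t) (D.vel ξ γ P t) (A t z)) r s) ∧
      (∀ t ∈ Icc r s, ∀ z w, ⟪A t z, A t w⟫ = ⟪z, w⟫) ∧
      ∀ t ∈ Icc r s, ∀ z, (P t).symm (D.inclE (γ t) (X (γ t) (A t z)))
        = (P r).symm (D.inclE (γ r) (X (γ r) z)) := by
  let ε : ℝ → Eu J →L[ℝ] Eu d := fun t => LinearMap.toContinuousLinearMap
    ((P t).symm.toLinearMap ∘ₗ (D.inclE (γ t)).toLinearMap ∘ₗ X (γ t))
  let ε' : ℝ → Eu J →L[ℝ] Eu d := fun t => ∑ i, (EuclideanSpace.proj (𝕜 := ℝ) i).smulRight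
    ((P t).symm (toE _ (D.conn (D.S.toField fun x => X x (EuclideanSpace.single i 1)) (γ t)
      (D.vel ξ γ P t))))
  have hε'z : ∀ t z, ε' t z = (P t).symm (toE _ (D.conn (D.S.toField fun x => X x z) (γ t)
      (D.vel ξ γ P t))) := fun t z => by
    rw [cov_linear D.conn hX]
    simp [ε']
  have hε : Prim ε ε' r s := Prim.of_columns fun i => by
    have := h.field _ (hX (EuclideanSpace.single i 1))
    simp only [hε'z]
    exact this
  exact exists_frame_transport hrs hε
    (fun t ht => (P t).symm.injective.comp ((inclE_injective _).comp (hinj t ht)))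
    (θ := fun t z => θ (γ t) (D.vel ξ γ P t) z)
    (fun t ht z => by rw [hε'z, (hθ t ht _ z).1]; rfl) fun t ht z w => (hθ t ht _ z).2 w

theorem exists_fiber_equiv {S : SubRiemannianStructure d M} {x y : M} (h : x = y) :
    ∃ Q : S.Fiber x ≃ₗᵢ[ℝ] S.Fiber y, ∀ v, toE y (S.incl y (Q v)) = toE x (S.incl x v) := by
  subst h
  exact ⟨.refl ℝ _, fun v => rfl⟩

/-- On each short interval the transport is a rotation of frame coefficients between two orthonormal
frames; the isometries compose along the curve. -/
theorem IsPath.exists_fiber_transport (h : D.IsPath ξ γ P 0 T)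
    (h0 : γ 0 = o ∧ P 0 = .refl ℝ _) : ∀ t ∈ Icc 0 T, ∃ Q : D.S.Fiber o ≃ₗᵢ[ℝ] D.S.Fiber (γ t),
      ∀ v, D.inclE (γ t) (Q v) = P t (D.inclE o v) := by
  refine Icc_induction (p := fun t => ∃ Q : D.S.Fiber o ≃ₗᵢ[ℝ] D.S.Fiber (γ t),
      ∀ v, D.inclE (γ t) (Q v) = P t (D.inclE o v)) ?_ fun t ht => ?_
  · obtain ⟨Q, hQ⟩ := exists_fiber_equiv (S := D.S) h0.1.symm
    exact ⟨Q, fun v => by rw [h0.2]; exact hQ v⟩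
  · obtain ⟨F⟩ := exists_localFrame D.S (γ t)
    obtain ⟨δ, hδ, H⟩ := exists_delta_of_mem_nhds h.continuousOn ht (F.isOpen.mem_nhds F.mem)
    refine ⟨δ, hδ, fun r hr s hs hrt hst hrs => ?_⟩
    rintro ⟨Q, hQ⟩
    have hW : ∀ x ∈ Icc r s, γ x ∈ F.W := fun x hx =>
      H x ⟨hr.1.trans hx.1, hx.2.trans hs.2⟩ (abs_sub_lt_of_mem_Icc hrt hst hx)
    obtain ⟨θ, hθ⟩ := F.exists_omega D.conn_compatible
    obtain ⟨A, -, -, hAi, hA⟩ := (h.mono hr.1 hrs hs.2).exists_transport hrs F.smooth (θ := θ)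
      (fun x hx => F.injective (hW x hx)) fun x hx => hθ _ (hW x hx)
    let a : Eu F.rank ≃ₗᵢ[ℝ] Eu F.rank :=
      ((A s).toLinearMap.isometryOfInner (hAi s ⟨hrs, le_rfl⟩)).toLinearIsometryEquiv rfl
    refine ⟨((Q.trans (F.equiv (hW r ⟨le_rfl, hrs⟩)).symm).trans a).trans
      (F.equiv (hW s ⟨hrs, le_rfl⟩)), fun v => ?_⟩
    have h1 := hA s ⟨hrs, le_rfl⟩ ((F.equiv (hW r ⟨le_rfl, hrs⟩)).symm (Q v))
    rw [← F.equiv_apply (hW r ⟨le_rfl, hrs⟩), LinearIsometryEquiv.apply_symm_apply, hQ,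
      ContinuousLinearEquiv.symm_apply_apply, ContinuousLinearEquiv.symm_apply_eq] at h1
    exact h1

end DiffusionData

/-! ### Horizontal lifts -/

namespace IsCompatibleSubmersion

set_option linter.unusedSectionVars false

variable {d e : ℕ} {M N : Type*}
    [TopologicalSpace M] [ChartedSpace (EuclideanSpace ℝ (Fin d)) M] [IsManifold (𝓡 d) ∞ M]
    [T2Space M]
    [TopologicalSpace N] [ChartedSpace (EuclideanSpace ℝ (Fin e)) N] [IsManifold (𝓡 e) ∞ N]
    [T2Space N]
    {T : ℝ} {o : M} {π : M → N}
    {D : DiffusionData d M o T} {D' : DiffusionData e N (π o) T}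
    (hπ : IsCompatibleSubmersion π D D')

/-- The differential of `π`, as a map `E_x → E'_{π(x)}`. -/
def proj (_ : IsCompatibleSubmersion π D D') (x : M) : D.S.Fiber x →ₗ[ℝ] D'.S.Fiber (π x) :=
  (((mfderiv (𝓡 d) (𝓡 e) π x).toLinearMap ∘ₗ D.S.incl x).codRestrict (D'.S.E (π x)) fun v => by
    have hπ : IsCompatibleSubmersion π D D' := by assumption
    rw [← hπ.map_E x]
    exact Submodule.mem_map_of_mem (Subtype.property (p := (· ∈ D.S.E x)) v))

theorem incl_proj (x : M) (v : D.S.Fiber x) :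
    D'.S.incl (π x) (hπ.proj x v) = mfderiv (𝓡 d) (𝓡 e) π x (D.S.incl x v) := rfl

theorem proj_surjective (x : M) : Function.Surjective (hπ.proj x) := fun w => by
  have h : D'.S.incl (π x) w ∈ D'.S.E (π x) := Subtype.property (p := (· ∈ D'.S.E (π x))) w
  rw [← hπ.map_E x] at h
  obtain ⟨v, hv, hvw⟩ := h
  exact ⟨D.S.mkFiber v hv, incl_injective _ hvw⟩

theorem horizontal_eq (x : M) :
    horizontal e D.S π x = (LinearMap.ker (hπ.proj x))ᗮ := by
  rw [horizontal]
  congr 1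
  ext v
  rw [LinearMap.mem_ker, Submodule.mem_comap]
  change mfderiv (𝓡 d) (𝓡 e) π x (D.S.incl x v) = 0 ↔ _
  rw [← hπ.incl_proj, map_eq_zero_iff _ (incl_injective _)]

theorem inner_proj {x : M} {v w : D.S.Fiber x} (hv : v ∈ horizontal e D.S π x)
    (hw : w ∈ horizontal e D.S π x) : ⟪hπ.proj x v, hπ.proj x w⟫ = ⟪v, w⟫ :=
  (hπ.isometric x v hv w hw _ _ (hπ.incl_proj x v) (hπ.incl_proj x w)).symm

/-- The horizontal lift `E'_{π(x)} → E_x`. -/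
def lift (x : M) : D'.S.Fiber (π x) →ₗ[ℝ] D.S.Fiber x := LinearMap.adjoint (hπ.proj x)

theorem inner_lift_left (x : M) (w : D'.S.Fiber (π x)) (v : D.S.Fiber x) :
    ⟪hπ.lift x w, v⟫ = ⟪w, hπ.proj x v⟫ := LinearMap.adjoint_inner_left _ _ _

theorem lift_mem (x : M) (w : D'.S.Fiber (π x)) : hπ.lift x w ∈ horizontal e D.S π x := by
  rw [hπ.horizontal_eq, Submodule.mem_orthogonal']
  intro v hv
  rw [hπ.inner_lift_left, LinearMap.mem_ker.1 hv, inner_zero_right]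

/-- Why the adjoint is the horizontal lift: π_* kills the orthogonal complement of H in E and is
isometric on H. -/
theorem lift_proj {x : M} {v : D.S.Fiber x} (hv : v ∈ horizontal e D.S π x) :
    hπ.lift x (hπ.proj x v) = v := by
  refine ext_inner_right ℝ fun w => ?_
  rw [hπ.inner_lift_left]
  obtain ⟨a, ha, b, hb, rfl⟩ := (LinearMap.ker (hπ.proj x)).exists_add_mem_mem_orthogonal w
  rw [map_add, LinearMap.mem_ker.1 ha, zero_add]
  have hv' := hv
  rw [hπ.horizontal_eq] at hv'
  rw [inner_add_right, (Submodule.mem_orthogonal' _ _).1 hv' a ha, zero_add]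
  exact hπ.inner_proj hv (by rwa [hπ.horizontal_eq])

theorem proj_lift (x : M) (w : D'.S.Fiber (π x)) : hπ.proj x (hπ.lift x w) = w := by
  obtain ⟨v, rfl⟩ := hπ.proj_surjective x w
  obtain ⟨a, ha, b, hb, rfl⟩ := (LinearMap.ker (hπ.proj x)).exists_add_mem_mem_orthogonal v
  rw [map_add, LinearMap.mem_ker.1 ha, zero_add, hπ.lift_proj (by rwa [hπ.horizontal_eq])]

end IsCompatibleSubmersion

/-! ### Smooth maps and families of sections in charts -/

section MapCharts

set_option linter.unusedSectionVars false

variable {d e : ℕ} {M N : Type*}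
    [TopologicalSpace M] [ChartedSpace (EuclideanSpace ℝ (Fin d)) M] [IsManifold (𝓡 d) ∞ M]
    [T2Space M]
    [TopologicalSpace N] [ChartedSpace (EuclideanSpace ℝ (Fin e)) N] [IsManifold (𝓡 e) ∞ N]
    [T2Space N] {cov : Connection d M} {cov' : Connection e N} {x₀ : M} {y₀ : N}

/-- A map between manifolds in charts. -/
def mapRep (m' : ChartModel cov' y₀) (x₀ : M) (π : M → N) (y : Eu d) : Eu e :=
  m'.coord (π (ofChart x₀ y))

variable (m : ChartModel cov x₀) (m' : ChartModel cov' y₀) {π : M → N}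

theorem contDiffOn_mapRep (hπ : ContMDiff (𝓡 d) (𝓡 e) ∞ π) :
    ContDiffOn ℝ ∞ (mapRep m' x₀ π) m.O :=
  m.contDiffOn_comp (m'.coord_smooth.comp hπ)

theorem mapRep_coord {x : M} (hx : x ∈ m.dom) : mapRep m' x₀ π (m.coord x) = m'.coord (π x) := by
  rw [mapRep, m.ofChart_coord hx]

theorem toChart_mfderiv (hπ : ContMDiff (𝓡 d) (𝓡 e) ∞ π) {x : M} (hx : x ∈ m.dom)
    (hx' : π x ∈ m'.dom) (v : TangentSpace (𝓡 d) x) :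
    toChart y₀ (π x) (mfderiv (𝓡 d) (𝓡 e) π x v)
      = fderiv ℝ (mapRep m' x₀ π) (m.coord x) (toChart x₀ x v) := by
  have h1 : MDifferentiableAt (𝓡 d) (𝓡 e) π x := hπ.mdifferentiable (by simp) x
  have h2 : MDifferentiableAt (𝓡 e) 𝓘(ℝ, Eu e) m'.coord (π x) :=
    m'.coord_smooth.mdifferentiable (by simp) _
  have h4 := m.dir_eq hx (f := fun x => m'.coord (π x)) (h2.comp x h1) v
  rw [← m'.dir_coord hx']
  refine Eq.trans ?_ h4
  have h3 := mfderiv_comp x h2 h1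
  exact (congrArg (fun L : TangentSpace (𝓡 d) x →L[ℝ] Eu e => L v) h3).symm

end MapCharts

section FrameMatrix

set_option linter.unusedSectionVars false

variable {d : ℕ} {M : Type*} [TopologicalSpace M] [ChartedSpace (EuclideanSpace ℝ (Fin d)) M]
  [IsManifold (𝓡 d) ∞ M] [T2Space M] {S : SubRiemannianStructure d M}

/-- A family of sections of `E`, in the chart at `x₀`. -/
def frameMat (x₀ : M) {J : ℕ} (X : (x : M) → Eu J →ₗ[ℝ] S.Fiber x) (y : Eu d) : Eu J →L[ℝ] Eu d :=
  LinearMap.toContinuousLinearMap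
    ((toChart x₀ (ofChart x₀ y)).toLinearMap ∘ₗ S.incl (ofChart x₀ y) ∘ₗ X (ofChart x₀ y))

theorem frameMat_apply (x₀ : M) {J : ℕ} (X : (x : M) → Eu J →ₗ[ℝ] S.Fiber x) (y : Eu d)
    (z : Eu J) : frameMat x₀ X y z = rep x₀ (S.toField fun x => X x z) y := rfl

variable {cov : Connection d M} {x₀ : M} (m : ChartModel cov x₀)

theorem frameMat_coord {J : ℕ} (X : (x : M) → Eu J →ₗ[ℝ] S.Fiber x) {x : M} (hx : x ∈ m.dom)
    (z : Eu J) : frameMat x₀ X (m.coord x) z = toChart x₀ x (S.incl x (X x z)) := by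
  rw [frameMat_apply, rep, m.ofChart_coord hx]
  rfl

theorem contDiffOn_frameMat {J : ℕ} {X : (x : M) → Eu J →ₗ[ℝ] S.Fiber x}
    (hX : ∀ z, SmoothFieldOn (S.toField fun x => X x z) univ) :
    ContDiffOn ℝ ∞ (frameMat x₀ X) m.O :=
  contDiffOn_clm_apply.2 fun z => m.contDiffOn_rep (hX z)

variable {x₁ x : M} (F : LocalFrame S x₁)

theorem frameMat_injective (hx : x ∈ m.dom) (hxF : x ∈ F.W) :
    Function.Injective (frameMat x₀ F.map (m.coord x)) := by
  have h : ⇑(frameMat x₀ F.map (m.coord x)) = toChart x₀ x ∘ S.incl x ∘ F.map x :=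
    funext fun z => frameMat_coord m F.map hx z
  rw [h]
  exact (toChart_injective hx.1).comp ((incl_injective x).comp (F.injective hxF))

/-- The metric written through the smooth left inverse of a frame matrix; this is how smoothness of
inner products is obtained in coordinates. -/
theorem inner_eq_leftInv (hx : x ∈ m.dom) (hxF : x ∈ F.W) (v w : S.Fiber x) :
    ⟪v, w⟫ = ⟪leftInv (frameMat x₀ F.map (m.coord x)) (toChart x₀ x (S.incl x v)),
      leftInv (frameMat x₀ F.map (m.coord x)) (toChart x₀ x (S.incl x w))⟫ := by
  obtain ⟨z, rfl⟩ := F.surjective x hxF v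
  obtain ⟨z', rfl⟩ := F.surjective x hxF w
  rw [← frameMat_coord m F.map hx, ← frameMat_coord m F.map hx,
    leftInv_apply (frameMat_injective m F hx hxF), leftInv_apply (frameMat_injective m F hx hxF),
    F.inner_map x hxF]

theorem LocalFrame.sum_inner_smul (hxF : x ∈ F.W) (v : S.Fiber x) :
    v = ∑ i, ⟪F.map x (EuclideanSpace.single i 1), v⟫ • F.map x (EuclideanSpace.single i 1) := by
  have h := ((EuclideanSpace.basisFun (Fin F.rank) ℝ).map (F.equiv hxF)).sum_repr' v
  simpa [LocalFrame.equiv_apply] using h.symm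

end FrameMatrix

namespace IsCompatibleSubmersion

set_option linter.unusedSectionVars false

variable {d e : ℕ} {M N : Type*}
    [TopologicalSpace M] [ChartedSpace (EuclideanSpace ℝ (Fin d)) M] [IsManifold (𝓡 d) ∞ M]
    [T2Space M]
    [TopologicalSpace N] [ChartedSpace (EuclideanSpace ℝ (Fin e)) N] [IsManifold (𝓡 e) ∞ N]
    [T2Space N]
    {T : ℝ} {o : M} {π : M → N}
    {D : DiffusionData d M o T} {D' : DiffusionData e N (π o) T}
    (hπ : IsCompatibleSubmersion π D D')

/-- In an orthonormal frame f_i of E the coefficients of the lift are ⟪f_i, hY⟫ = ⟪π_* f_i, Y⟫ by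
adjointness, and these are smooth functions. -/
theorem smoothFieldOn_lift {Y : (y : N) → D'.S.Fiber y} (hY : SmoothFieldOn (D'.S.toField Y) univ) :
    SmoothFieldOn (D.S.toField fun x => hπ.lift x (Y (π x))) univ := by
  refine .of_forall fun x₀ => ?_
  obtain ⟨m⟩ := exists_chartModel D.conn_smooth x₀
  obtain ⟨m'⟩ := exists_chartModel D'.conn_smooth (π x₀)
  obtain ⟨F⟩ := exists_localFrame D.S x₀
  obtain ⟨F'⟩ := exists_localFrame D'.S (π x₀)
  let V : Set M := F.W ∩ π ⁻¹' (m'.dom ∩ F'.W)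
  have hV : IsOpen V :=
    F.isOpen.inter ((m'.isOpen_dom.inter F'.isOpen).preimage hπ.smooth.continuous)
  have hxV : x₀ ∈ V := ⟨F.mem, m'.mem_dom, F'.mem⟩
  let O₁ : Set (Eu d) := m.O ∩ ((extChartAt (𝓡 d) x₀).target ∩ ofChart x₀ ⁻¹' V)
  have hO₁ : IsOpen O₁ := m.isOpen.inter (isOpen_ofChart_preimage x₀ hV)
  have hxO : x₀ ∈ (chartAt (Eu d) x₀).source ∩ extChartAt (𝓡 d) x₀ ⁻¹' O₁ := by
    have h := mem_chart_source (Eu d) x₀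
    refine ⟨h, m.mem, extChartAt_mem h, ?_⟩
    change ofChart x₀ (extChartAt (𝓡 d) x₀ x₀) ∈ V
    rwa [ofChart_extChartAt h]
  refine ⟨_, (isOpen_extChartAt_preimage'' x₀ hO₁).mem_nhds hxO, smoothFieldOn_of_rep hO₁ ?_⟩
  let p : Eu d → Eu e := mapRep m' x₀ π
  let κ : Eu d → Eu e →L[ℝ] Eu F'.rank := fun y => leftInv (frameMat (π x₀) F'.map (p y))
  let f : Fin F.rank → Eu d → Eu d := fun i =>
    rep x₀ (D.S.toField fun x => F.map x (EuclideanSpace.single i 1))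
  have hp : ContDiffOn ℝ ∞ p m.O := contDiffOn_mapRep m m' hπ.smooth
  have hpx : ∀ y ∈ O₁, p y ∈ m'.O := fun y hy => m'.coord_mem hy.2.2.2.1
  have hκ : ContDiffOn ℝ ∞ κ O₁ := fun y hy => by
    have h1 := contDiffAt_leftInv (frameMat_injective m' F' hy.2.2.2.1 hy.2.2.2.2)
    have h2 : ContDiffWithinAt ℝ ∞ (fun y => frameMat (π x₀) F'.map (p y)) O₁ y :=
      ((contDiffOn_frameMat m' F'.smooth).comp (hp.mono inter_subset_left) hpx) y hy
    exact ContDiffAt.comp_contDiffWithinAt (g := leftInv)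
      (f := fun y => frameMat (π x₀) F'.map (p y)) y h1 h2
  have hf : ∀ i, ContDiffOn ℝ ∞ (f i) O₁ := fun i =>
    (m.contDiffOn_rep (F.smooth _)).mono inter_subset_left
  have hYp : ContDiffOn ℝ ∞ (fun y => rep (π x₀) (D'.S.toField Y) (p y)) O₁ :=
    (m'.contDiffOn_rep hY).comp (hp.mono inter_subset_left) hpx
  have hdp : ContDiffOn ℝ ∞ (fderiv ℝ p) O₁ :=
    (hp.fderiv_of_isOpen m.isOpen (m := ∞) le_rfl).mono inter_subset_left
  have key : ContDiffOn ℝ ∞ (fun y => ∑ i, ⟪κ y (fderiv ℝ p y (f i y)),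
      κ y (rep (π x₀) (D'.S.toField Y) (p y))⟫ • f i y) O₁ :=
    ContDiffOn.sum fun i _ => ((hκ.clm_apply (hdp.clm_apply (hf i))).inner ℝ
      (hκ.clm_apply hYp)).smul (hf i)
  refine key.congr fun y hy => ?_
  have hx : ofChart x₀ y ∈ m.dom := m.ofChart_mem_dom hy.1
  have hxF : ofChart x₀ y ∈ F.W := hy.2.2.1
  have hx' : π (ofChart x₀ y) ∈ m'.dom := hy.2.2.2.1
  have hxF' : π (ofChart x₀ y) ∈ F'.W := hy.2.2.2.2
  have hc : m.coord (ofChart x₀ y) = y := m.coord_eq y hy.1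
  have hYr : rep (π x₀) (D'.S.toField Y) (p y)
      = toChart (π x₀) (π (ofChart x₀ y)) (D'.S.incl _ (Y (π (ofChart x₀ y)))) := by
    change toChart _ (ofChart _ (m'.coord _)) (D'.S.toField Y (ofChart _ (m'.coord _))) = _
    rw [m'.ofChart_coord hx']
    rfl
  change toChart x₀ _ (D.S.incl _ (hπ.lift _ (Y _))) = _
  rw [F.sum_inner_smul hxF (hπ.lift _ (Y _)), map_sum, map_sum]
  refine Finset.sum_congr rfl fun i _ => ?_
  rw [map_smul, map_smul, real_inner_comm, hπ.inner_lift_left, real_inner_comm,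
    inner_eq_leftInv m' F' hx' hxF', hπ.incl_proj, toChart_mfderiv m m' hπ.smooth hx hx', hc, hYr]
  rfl

theorem cov_lift {Y : (y : N) → D'.S.Fiber y} (hY : SmoothFieldOn (D'.S.toField Y) univ)
    (x : M) (v : TangentSpace (𝓡 d) x) {w : D'.S.Fiber (π x)}
    (hw : D'.conn (D'.S.toField Y) (π x) (mfderiv (𝓡 d) (𝓡 e) π x v) = D'.S.incl (π x) w) :
    D.conn (D.S.toField fun x => hπ.lift x (Y (π x))) x v = D.S.incl x (hπ.lift x w) := by
  obtain ⟨a, ha, ha1, ha2⟩ := hπ.pullback Y hY (fun x => hπ.lift x (Y (π x)))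
    (fun x => ⟨hπ.lift_mem x _, by rw [← hπ.incl_proj, hπ.proj_lift]⟩) x v
  rw [← ha1, ← hπ.lift_proj ha]
  congr 2
  apply incl_injective
  rw [hπ.incl_proj, ha2, hw]

/-- Orthogonality to vertical vectors shows that Σ_t preserves H_o; there the induced map is the
covariance on N. -/
theorem Sig_lift {t : ℝ} (ht : t ∈ Icc 0 T) (w : D'.S.Fiber (π o)) :
    D.Sig t (hπ.lift o w) = hπ.lift o (D'.Sig t w) := by
  have h1 : D.Sig t (hπ.lift o w) ∈ horizontal e D.S π o := by
    rw [horizontal, Submodule.mem_orthogonal']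
    exact fun v hv => (hπ.Sig_orthogonal t ht _ (hπ.lift_mem o w) v hv).1
  rw [← hπ.lift_proj h1]
  congr 1
  apply incl_injective
  rw [hπ.incl_proj, ← hπ.Sig_map t ht _ (hπ.lift_mem o w) w]
  rw [← hπ.incl_proj, hπ.proj_lift]

end IsCompatibleSubmersion

/-- For s > 0 the vector Bv - sv satisfies Bx = -sx, and positivity of B forces it to vanish. -/
theorem eq_smul_of_comp_self_apply {V : Type*} [NormedAddCommGroup V] [InnerProductSpace ℝ V]
    {B : V →L[ℝ] V} (hB : B.IsPositive) {s : ℝ} (hs : 0 ≤ s) {v : V} (h : B (B v) = s • s • v) :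
    B v = s • v := by
  have hsym : ∀ v w, ⟪B v, w⟫ = ⟪v, B w⟫ := hB.1
  have hpos : ∀ v, 0 ≤ ⟪B v, v⟫ := hB.2
  rcases hs.eq_or_lt with rfl | hs
  · rw [zero_smul, ← inner_self_eq_zero (𝕜 := ℝ), hsym, h, zero_smul, inner_zero_right]
  · have h1 : B (B v - s • v) = -s • (B v - s • v) := by
      rw [map_sub, map_smul, h, neg_smul, smul_sub]
      abel
    have h2 := hpos (B v - s • v)
    rw [h1, real_inner_smul_left, real_inner_self_eq_norm_sq] at h2
    have h3 : ‖B v - s • v‖ ^ 2 ≤ 0 := by nlinarith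
    have h4 : ‖B v - s • v‖ = 0 := pow_eq_zero_iff two_ne_zero |>.1 (le_antisymm h3 (sq_nonneg _))
    exact sub_eq_zero.1 (norm_eq_zero.1 h4)

/-- A map that intertwines squares of positive operators intertwines the operators, checked on an
eigenbasis of C. It carries Σ^{1/2} through the horizontal lift. -/
theorem comp_eq_of_comp_self {V W : Type*} [NormedAddCommGroup V] [InnerProductSpace ℝ V]
    [NormedAddCommGroup W] [InnerProductSpace ℝ W] [FiniteDimensional ℝ W]
    {B : V →L[ℝ] V} {C : W →L[ℝ] W} (hB : B.IsPositive) (hC : C.IsPositive) {j : W →ₗ[ℝ] V}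
    (h : ∀ w, B (B (j w)) = j (C (C w))) (w : W) : B (j w) = j (C w) := by
  have hsym : (C : W →ₗ[ℝ] W).IsSymmetric := hC.1
  let b := hsym.eigenvectorBasis (n := Module.finrank ℝ W) rfl
  let l := hsym.eigenvalues (n := Module.finrank ℝ W) rfl
  have hCb : ∀ i, C (b i) = l i • b i := fun i => hsym.apply_eigenvectorBasis rfl i
  have hl : ∀ i, 0 ≤ l i := fun i => by
    have h1 : 0 ≤ ⟪C (b i), b i⟫ := hC.2 (b i)
    rwa [hCb, inner_smul_left, real_inner_self_eq_norm_sq, b.norm_eq_one, one_pow, mul_one] at h1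
  have key : (B : V →ₗ[ℝ] V) ∘ₗ j = j ∘ₗ (C : W →ₗ[ℝ] W) := b.toBasis.ext fun i => by
    simp only [OrthonormalBasis.coe_toBasis, LinearMap.comp_apply, ContinuousLinearMap.coe_coe]
    rw [hCb, map_smul]
    refine eq_smul_of_comp_self_apply hB (hl i) ?_
    rw [h, hCb, map_smul, hCb, map_smul, map_smul]
  exact congrArg (fun L : W →ₗ[ℝ] V => L w) key

theorem IsCompatibleSubmersion.posSqrt_lift {d e : ℕ} {M N : Type*}
    [TopologicalSpace M] [ChartedSpace (EuclideanSpace ℝ (Fin d)) M] [IsManifold (𝓡 d) ∞ M]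
    [TopologicalSpace N] [ChartedSpace (EuclideanSpace ℝ (Fin e)) N] [IsManifold (𝓡 e) ∞ N]
    [T2Space M] [T2Space N]
    {T : ℝ} {o : M} {π : M → N} {D : DiffusionData d M o T} {D' : DiffusionData e N (π o) T}
    (hπ : IsCompatibleSubmersion π D D') {t : ℝ} (ht : t ∈ Icc 0 T) (w : D'.S.Fiber (π o)) :
    posSqrt (D.Sig t) (hπ.lift o w) = hπ.lift o (posSqrt (D'.Sig t) w) := by
  refine comp_eq_of_comp_self (DiffusionData.posSqrt_Sig_spec (D := D) ht).1
    (DiffusionData.posSqrt_Sig_spec (D := D') ht).1 (fun w => ?_) w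
  change (posSqrt (D.Sig t) ∘L posSqrt (D.Sig t)) _
    = hπ.lift o ((posSqrt (D'.Sig t) ∘L posSqrt (D'.Sig t)) w)
  rw [(DiffusionData.posSqrt_Sig_spec (D := D) ht).2, (DiffusionData.posSqrt_Sig_spec (D := D') ht).2,
    hπ.Sig_lift ht]

/-! ### Projecting solutions -/

theorem Prim.of_apply {W F : Type*} [NormedAddCommGroup W] [NormedSpace ℝ W]
    [FiniteDimensional ℝ W] [NormedAddCommGroup F] [NormedSpace ℝ F] [CompleteSpace F]
    {L L' : ℝ → W →L[ℝ] F} {a b : ℝ} (h : ∀ w, Prim (fun t => L t w) (fun t => L' t w) a b) :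
    Prim L L' a b := by
  let B := Module.finBasis ℝ W
  have h1 := Prim.finset_sum Finset.univ fun i _ => (h (B i)).clm
    (ContinuousLinearMap.smulRightL ℝ W F (LinearMap.toContinuousLinearMap (B.coord i)))
  have e : ∀ L : W →L[ℝ] F, ∑ i, ContinuousLinearMap.smulRightL ℝ W F
      (LinearMap.toContinuousLinearMap (B.coord i)) (L (B i)) = L := fun L => by
    ext w
    have := congrArg L (B.sum_repr w)
    rw [map_sum] at this
    simpa using this
  simpa only [e] using h1

namespace IsCompatibleSubmersion

set_option linter.unusedSectionVars false

variable {d e : ℕ} {M N : Type*}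
    [TopologicalSpace M] [ChartedSpace (EuclideanSpace ℝ (Fin d)) M] [IsManifold (𝓡 d) ∞ M]
    [T2Space M]
    [TopologicalSpace N] [ChartedSpace (EuclideanSpace ℝ (Fin e)) N] [IsManifold (𝓡 e) ∞ N]
    [T2Space N]
    {T : ℝ} {o : M} {π : M → N}
    {D : DiffusionData d M o T} {D' : DiffusionData e N (π o) T}
    (hπ : IsCompatibleSubmersion π D D')

/-- The differential of `π`, in the preferred charts. -/
def diffE (π : M → N) (x : M) : Eu d →L[ℝ] Eu e :=
  (toE (π x)).toContinuousLinearMap ∘L mfderiv (𝓡 d) (𝓡 e) π x ∘L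
    (toE x).symm.toContinuousLinearMap

theorem diffE_inclE (x : M) (v : D.S.Fiber x) :
    diffE π x (D.inclE x v) = D'.inclE (π x) (hπ.proj x v) := rfl

variable {c : ℝ → D'.S.Fiber (π o)} {γ : ℝ → M} {P : ℝ → Eu d ≃L[ℝ] Eu d} {r s : ℝ}

/-- The velocity of a horizontally driven curve projects to the velocity of its projection. -/
theorem mfderiv_vel {t : ℝ} (ht : t ∈ Icc 0 T) :
    mfderiv (𝓡 d) (𝓡 e) π (γ t) (D.vel (fun t => hπ.lift o (c t)) γ P t)
      = (toE (π (γ t))).symm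
          (diffE π (γ t) (P t (D.inclE o (hπ.lift o (posSqrt (D'.Sig t) (c t))))))
        + D'.u t (π (γ t)) := by
  rw [DiffusionData.vel, map_add, hπ.u_related t ht]
  congr 1
  change mfderiv (𝓡 d) (𝓡 e) π (γ t) ((toE (γ t)).symm
    (P t (D.inclE o (posSqrt (D.Sig t) (hπ.lift o (c t)))))) = _
  rw [hπ.posSqrt_lift ht]
  rfl

theorem lift_injective (x : M) : Function.Injective (hπ.lift x) := fun v w h => by
  rw [← hπ.proj_lift x v, h, hπ.proj_lift]

/-- By the pull-back hypothesis the horizontal lift of a frame on N has the connection matrix of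
that frame along the projected velocity. So transport on M of a lifted vector is the lift of
transport along the projected curve. -/
theorem exists_lift_transport_local {ξ : ℝ → D.S.Fiber o} (h : D.IsPath ξ γ P r s) (hrs : r ≤ s)
    {y₀ : N} (F : LocalFrame D'.S y₀) (hW : ∀ t ∈ Icc r s, π (γ t) ∈ F.W)
    {θ : (y : N) → TangentSpace (𝓡 e) y → Eu F.rank → Eu F.rank}
    (hθ : ∀ y ∈ F.W, ∀ v z, D'.conn (D'.S.toField fun y => F.map y z) y v
        = D'.S.incl y (F.map y (θ y v z)) ∧ ∀ w, ⟪θ y v z, w⟫ + ⟪z, θ y v w⟫ = 0)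
    {G : D'.S.Fiber (π o) ≃ₗᵢ[ℝ] D'.S.Fiber (π (γ r))}
    (hG : ∀ w, D.inclE (γ r) (hπ.lift (γ r) (G w)) = P r (D.inclE o (hπ.lift o w))) :
    ∃ (A : ℝ → Eu F.rank →L[ℝ] Eu F.rank) (b : D'.S.Fiber (π o) ≃ₗᵢ[ℝ] Eu F.rank),
      (∀ z, Prim (fun t => A t z) (fun t => - θ (π (γ t))
        (mfderiv (𝓡 d) (𝓡 e) π (γ t) (D.vel ξ γ P t)) (A t z)) r s) ∧
      (∀ t ∈ Icc r s, ∀ z w, ⟪A t z, A t w⟫ = ⟪z, w⟫) ∧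
      ∀ t ∈ Icc r s, ∀ w, P t (D.inclE o (hπ.lift o w))
        = D.inclE (γ t) (hπ.lift (γ t) (F.map (π (γ t)) (A t (b w)))) := by
  have hr : r ∈ Icc r s := ⟨le_rfl, hrs⟩
  let X : (x : M) → Eu F.rank →ₗ[ℝ] D.S.Fiber x := fun x => hπ.lift x ∘ₗ F.map (π x)
  have hX : ∀ z, SmoothFieldOn (D.S.toField fun x => X x z) univ := fun z =>
    hπ.smoothFieldOn_lift (Y := fun y => F.map y z) (F.smooth z)
  have hXi : ∀ t ∈ Icc r s, Function.Injective (X (γ t)) := fun t ht =>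
    (hπ.lift_injective _).comp (F.injective (hW t ht))
  have hXθ : ∀ t ∈ Icc r s, ∀ v z, D.conn (D.S.toField fun x => X x z) (γ t) v
      = D.S.incl (γ t) (X (γ t) (θ (π (γ t)) (mfderiv (𝓡 d) (𝓡 e) π (γ t) v) z)) :=
    fun t ht v z => hπ.cov_lift (Y := fun y => F.map y z) (F.smooth z) (γ t) v
      (hθ _ (hW t ht) _ z).1
  obtain ⟨A, -, hA1, hA2, hA⟩ := h.exists_transport hrs hX
    (θ := fun x v z => θ (π x) (mfderiv (𝓡 d) (𝓡 e) π x v) z) hXi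
    fun t ht v z => ⟨hXθ t ht v z, (hθ _ (hW t ht) _ z).2⟩
  refine ⟨A, G.trans (F.equiv (hW r hr)).symm, hA1, hA2, fun t ht w => ?_⟩
  have h1 := hA t ht ((F.equiv (hW r hr)).symm (G w))
  change (P t).symm (D.inclE (γ t) (hπ.lift (γ t) (F.map (π (γ t)) _)))
    = (P r).symm (D.inclE (γ r) (hπ.lift (γ r) (F.map (π (γ r)) _))) at h1
  rw [← F.equiv_apply (hW r hr), LinearIsometryEquiv.apply_symm_apply, hG,
    ContinuousLinearEquiv.symm_apply_apply, ContinuousLinearEquiv.symm_apply_eq] at h1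
  exact h1.symm

theorem exists_lift_equiv {x y : M} (h : x = y) :
    ∃ G : D'.S.Fiber (π x) ≃ₗᵢ[ℝ] D'.S.Fiber (π y),
      ∀ w, D.inclE y (hπ.lift y (G w)) = D.inclE x (hπ.lift x w) := by
  subst h
  exact ⟨.refl ℝ _, fun w => rfl⟩

theorem exists_lift_transport {ξ : ℝ → D.S.Fiber o} (h : D.IsPath ξ γ P 0 T)
    (h0 : γ 0 = o ∧ P 0 = .refl ℝ _) : ∀ t ∈ Icc 0 T,
      ∃ G : D'.S.Fiber (π o) ≃ₗᵢ[ℝ] D'.S.Fiber (π (γ t)),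
      ∀ w, D.inclE (γ t) (hπ.lift (γ t) (G w)) = P t (D.inclE o (hπ.lift o w)) := by
  refine Icc_induction (p := fun t => ∃ G : D'.S.Fiber (π o) ≃ₗᵢ[ℝ] D'.S.Fiber (π (γ t)),
      ∀ w, D.inclE (γ t) (hπ.lift (γ t) (G w)) = P t (D.inclE o (hπ.lift o w))) ?_ fun t ht => ?_
  · rw [h0.2]
    exact hπ.exists_lift_equiv h0.1.symm
  · obtain ⟨F⟩ := exists_localFrame D'.S (π (γ t))
    obtain ⟨δ, hδ, H⟩ := exists_delta_of_mem_nhds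
      (hπ.smooth.continuous.comp_continuousOn h.continuousOn) ht (F.isOpen.mem_nhds F.mem)
    refine ⟨δ, hδ, fun r hr s hs hrt hst hrs => ?_⟩
    rintro ⟨G, hG⟩
    have hW : ∀ x ∈ Icc r s, π (γ x) ∈ F.W := fun x hx =>
      H x ⟨hr.1.trans hx.1, hx.2.trans hs.2⟩ (abs_sub_lt_of_mem_Icc hrt hst hx)
    obtain ⟨θ, hθ⟩ := F.exists_omega D'.conn_compatible
    obtain ⟨A, b, -, hAi, hA⟩ := hπ.exists_lift_transport_local (h.mono hr.1 hrs hs.2) hrs F hW hθ hG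
    let a : Eu F.rank ≃ₗᵢ[ℝ] Eu F.rank :=
      ((A s).toLinearMap.isometryOfInner (hAi s ⟨hrs, le_rfl⟩)).toLinearIsometryEquiv rfl
    exact ⟨(b.trans a).trans (F.equiv (hW s ⟨hrs, le_rfl⟩)),
      fun w => (hA s ⟨hrs, le_rfl⟩ w).symm⟩

/-- The differential of `π` along the horizontal part of a parallel transport. -/
def projTransport (hπ : IsCompatibleSubmersion π D D') (γ : ℝ → M) (P : ℝ → Eu d ≃L[ℝ] Eu d)
    (t : ℝ) : D'.S.Fiber (π o) →L[ℝ] Eu e :=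
  diffE π (γ t) ∘L (P t : Eu d →L[ℝ] Eu d) ∘L D.inclE o ∘L
    LinearMap.toContinuousLinearMap (hπ.lift o)

/-- The projected curve and the projected transport of lifted vectors satisfy the reduced system
with control c. Uniqueness then identifies them with the given path. -/
theorem isRedPath_projTransport (h : D.IsPath (fun t => hπ.lift o (c t)) γ P 0 T)
    (h0 : γ 0 = o ∧ P 0 = .refl ℝ _) :
    D'.IsRedPath c (fun t => π (γ t)) (hπ.projTransport γ P) 0 T := by
  have hcont : ContinuousOn (fun t => π (γ t)) (Icc 0 T) :=
    hπ.smooth.continuous.comp_continuousOn h.continuousOn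
  refine ⟨hcont, fun x₀ m r s hr hrs hs hγ => ?_⟩
  -- The orthonormal frames used below are local, so even inside one chart the equation is assembled
  -- from short intervals.
  refine Icc_induction (p := fun t => Prim
      (fun t => (m.coord (π (γ t)), DiffusionData.redRep x₀ (π (γ t)) (hπ.projTransport γ P t)))
      (fun t => D'.redField m c t (m.coord (π (γ t)),
        DiffusionData.redRep x₀ (π (γ t)) (hπ.projTransport γ P t))) r t) ?_ (fun t ht => ?_) s ⟨hrs, le_rfl⟩
  · exact ⟨by simp, fun t ht => by
      obtain rfl : t = r := le_antisymm ht.2 ht.1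
      simp⟩
  · obtain ⟨F⟩ := exists_localFrame D'.S (π (γ t))
    obtain ⟨δ, hδ, H⟩ := exists_delta_of_mem_nhds (hcont.mono (Icc_subset_Icc hr hs)) ht
      (F.isOpen.mem_nhds F.mem)
    refine ⟨δ, hδ, fun r₁ hr₁ s₁ hs₁ hrt hst hrs₁ hp => hp.trans ?_ hr₁.1 hrs₁⟩
    have hsub : ∀ x ∈ Icc r₁ s₁, x ∈ Icc r s := fun x hx => ⟨hr₁.1.trans hx.1, hx.2.trans hs₁.2⟩
    have hW : ∀ x ∈ Icc r₁ s₁, π (γ x) ∈ F.W := fun x hx =>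
      H x (hsub x hx) (abs_sub_lt_of_mem_Icc hrt hst hx)
    have hm : ∀ x ∈ Icc r₁ s₁, π (γ x) ∈ m.dom := fun x hx => hγ x (hsub x hx)
    have hr₁0 : 0 ≤ r₁ := hr.trans hr₁.1
    have hs₁T : s₁ ≤ T := hs₁.2.trans hs
    obtain ⟨G, hG⟩ := hπ.exists_lift_transport h h0 r₁ ⟨hr₁0, hrs₁.trans hs₁T⟩
    obtain ⟨θ, hθ⟩ := F.exists_omega D'.conn_compatible
    have h1 := h.mono hr₁0 hrs₁ hs₁T
    obtain ⟨A, b, hA1, -, hA⟩ := hπ.exists_lift_transport_local h1 hrs₁ F hW hθ hG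
    let V : (t : ℝ) → TangentSpace (𝓡 e) (π (γ t)) := fun t =>
      mfderiv (𝓡 d) (𝓡 e) π (γ t) (D.vel (fun t => hπ.lift o (c t)) γ P t)
    have hy : Prim (fun t => m.coord (π (γ t))) (fun t => toChart x₀ (π (γ t)) (V t)) r₁ s₁ :=
      (h1.prim_coord (m.coord_smooth.comp hπ.smooth) hrs₁).congr_deriv hrs₁ fun t ht => by
        have h3 := mfderiv_comp (γ t) (m.coord_smooth.mdifferentiable (by simp) (π (γ t)))
          (hπ.smooth.mdifferentiable (by simp) (γ t))
        rw [← m.dir_coord (hm t ht)]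
        exact congrArg (fun L : TangentSpace (𝓡 d) (γ t) →L[ℝ] Eu e =>
          L (D.vel (fun t => hπ.lift o (c t)) γ P t)) h3
    have hFm := contDiffOn_frameMat m F.smooth
    have hE := hy.comp hrs₁ (Φ := frameMat x₀ F.map)
      (Φ' := fun t => fderiv ℝ (frameMat x₀ F.map) (m.coord (π (γ t))))
      (fun t ht => (hFm.contDiffAt (m.isOpen.mem_nhds
        (m.coord_mem (hm t ht)))).hasStrictFDerivAt (by simp))
      ((hFm.continuousOn_fderiv_of_isOpen m.isOpen (by simp)).comp hy.continuousOn
        fun t ht => m.coord_mem (hm t ht))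
    have hrep : ∀ t ∈ Icc r₁ s₁, ∀ w, DiffusionData.redRep x₀ (π (γ t)) (hπ.projTransport γ P t) w
        = frameMat x₀ F.map (m.coord (π (γ t))) (A t (b w)) := fun t ht w => by
      rw [frameMat_coord m F.map (hm t ht)]
      change toChart x₀ (π (γ t)) ((toE _).symm (diffE π (γ t) (P t (D.inclE o (hπ.lift o w))))) = _
      rw [hA t ht, hπ.diffE_inclE, hπ.proj_lift]
      rfl
    have hV : ∀ t ∈ Icc r₁ s₁, toChart x₀ (π (γ t)) (V t)
        = DiffusionData.redRep x₀ (π (γ t)) (hπ.projTransport γ P t) (posSqrt (D'.Sig t) (c t))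
          + rep x₀ (D'.u t) (m.coord (π (γ t))) := fun t ht => by
      simp only [V]
      rw [hπ.mfderiv_vel ⟨hr₁0.trans ht.1, ht.2.trans hs₁T⟩, map_add, rep, m.ofChart_coord (hm t ht)]
      rfl
    -- The transported vector is the frame matrix applied to coefficients that solve A' = -θA; the
    -- product rule and the Christoffel formula for ∇ leave -Γ(V) applied to it.
    have hF : Prim (fun t => DiffusionData.redRep x₀ (π (γ t)) (hπ.projTransport γ P t))
        (fun t => -(m.Γ (m.coord (π (γ t))) (toChart x₀ (π (γ t)) (V t))
          ∘L DiffusionData.redRep x₀ (π (γ t)) (hπ.projTransport γ P t))) r₁ s₁ := by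
      refine Prim.of_apply fun w => ?_
      refine ((hE.clm_apply (hA1 (b w)) hrs₁).congr fun t ht => hrep t ht w).congr_deriv hrs₁
        fun t ht => ?_
      have hd := ((hFm.contDiffAt (m.isOpen.mem_nhds (m.coord_mem (hm t ht)))).differentiableAt
        (by simp)).hasFDerivAt
      have h2 := m.cov_eq' (hm t ht) ((F.smooth (A t (b w))).fieldDiffAt Filter.univ_mem) (V t)
      have h4 : fderiv ℝ (rep x₀ (D'.S.toField fun y => F.map y (A t (b w)))) (m.coord (π (γ t)))
          = (fderiv ℝ (frameMat x₀ F.map) (m.coord (π (γ t)))).flip (A t (b w)) :=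
        (hd.clm_apply (hasFDerivAt_const (A t (b w)) _)).fderiv.trans (by simp)
      rw [(hθ _ (hW t ht) (V t) (A t (b w))).1, ← frameMat_coord m F.map (hm t ht), h4] at h2
      change _ = -(m.Γ (m.coord (π (γ t))) (toChart x₀ (π (γ t)) (V t))
          (DiffusionData.redRep x₀ (π (γ t)) (hπ.projTransport γ P t) w))
      rw [hrep t ht, map_neg, frameMat_coord m F.map (hm t ht) (A t (b w))]
      rw [h2]
      simp only [ContinuousLinearMap.flip_apply, SubRiemannianStructure.toField]
      abel
    refine (hy.prodMk hF).congr_deriv hrs₁ fun t ht => ?_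
    rw [DiffusionData.redField, sys_apply, ← hV t ht]

end IsCompatibleSubmersion

/-! ### The second fundamental form of a map, and the curvature of horizontal fields -/

section SecondForm

variable {E F : Type*} [NormedAddCommGroup E] [NormedSpace ℝ E] [NormedAddCommGroup F]
  [NormedSpace ℝ F]

/-- The covariant second derivative of a map, in coordinates. -/
def secondForm (Γ : E → E →L[ℝ] E →L[ℝ] E) (Γ' : F → F →L[ℝ] F →L[ℝ] F) (p : E → F) (y a b : E) :
    F :=
  fderiv ℝ (fderiv ℝ p) y a b + Γ' (p y) (fderiv ℝ p y a) (fderiv ℝ p y b) - fderiv ℝ p y (Γ y a b)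

/-- The covariant derivative of a vector field, in coordinates. -/
def covRep (Γ : E → E →L[ℝ] E →L[ℝ] E) (H : E → E) (y : E) : E →L[ℝ] E :=
  fderiv ℝ H y + (Γ y).flip (H y)

theorem covRep_apply (Γ : E → E →L[ℝ] E →L[ℝ] E) (H : E → E) (y a : E) :
    covRep Γ H y a = fderiv ℝ H y a + Γ y a (H y) := rfl

variable {Γ : E → E →L[ℝ] E →L[ℝ] E} {Γ' : F → F →L[ℝ] F →L[ℝ] F} {p : E → F} {y : E} {H : E → E}
  {H' : F → F}

theorem hasFDerivAt_fderiv_of_contDiffAt (hp : ContDiffAt ℝ ∞ p y) :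
    HasFDerivAt (fderiv ℝ p) (fderiv ℝ (fderiv ℝ p) y) y :=
  ((hp.fderiv_right (m := 1) (by norm_cast)).differentiableAt (by simp)).hasFDerivAt

/-- Differentiating the relation p_* H = H' ∘ p along a shows that the second form at (a, H) is the
difference of the two covariant derivatives. -/
theorem secondForm_eq_zero (hp : ContDiffAt ℝ ∞ p y) (hH : DifferentiableAt ℝ H y)
    (hH' : DifferentiableAt ℝ H' (p y)) (h : ∀ᶠ z in 𝓝 y, fderiv ℝ p z (H z) = H' (p z)) {a : E}
    (hc : fderiv ℝ p y (covRep Γ H y a) = covRep Γ' H' (p y) (fderiv ℝ p y a)) :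
    secondForm Γ Γ' p y a (H y) = 0 := by
  have h1 := (hasFDerivAt_fderiv_of_contDiffAt hp).clm_apply hH.hasFDerivAt
  have h2 := hH'.hasFDerivAt.comp y (hp.differentiableAt (by simp)).hasFDerivAt
  have h3 := (h1.congr_of_eventuallyEq (f₁ := H' ∘ p) (h.mono fun z hz => hz.symm)).unique h2
  have h4 : fderiv ℝ p y (fderiv ℝ H y a) + fderiv ℝ (fderiv ℝ p) y a (H y)
      = fderiv ℝ H' (p y) (fderiv ℝ p y a) := congrArg (fun L : E →L[ℝ] F => L a) h3
  rw [covRep_apply, covRep_apply, map_add, ← h4, ← h.self_of_nhds] at hc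
  rw [secondForm]
  have h5 : fderiv ℝ p y (Γ y a (H y)) = fderiv ℝ (fderiv ℝ p) y a (H y)
      + Γ' (p y) (fderiv ℝ p y a) (fderiv ℝ p y (H y)) := by
    rw [add_assoc] at hc
    exact add_left_cancel hc
  rw [h5, sub_self]

theorem fderiv_symm_apply (hp : ContDiffAt ℝ ∞ p y) (a b : E) :
    fderiv ℝ (fderiv ℝ p) y a b = fderiv ℝ (fderiv ℝ p) y b a :=
  (hp.isSymmSndFDerivAt (by rw [minSmoothness_of_isRCLikeNormedField]; norm_cast)).eq _ _

theorem differentiableAt_covRep (hΓ : DifferentiableAt ℝ Γ y) (hH : ContDiffAt ℝ ∞ H y) :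
    DifferentiableAt ℝ (covRep Γ H) y := by
  have h1 := (hasFDerivAt_fderiv_of_contDiffAt hH).differentiableAt
  have h2 : DifferentiableAt ℝ (fun z => ContinuousLinearMap.flipₗᵢ ℝ E E E (Γ z)) y :=
    (ContinuousLinearMap.flipₗᵢ ℝ E E E).toContinuousLinearEquiv.differentiableAt.comp y hΓ
  exact h1.add (h2.clm_apply (hH.differentiableAt (by simp)))

/-- The curvature as the antisymmetrized second covariant derivative, with constant coordinate
directions. -/
theorem curvOp_apply_eq_covRep (hΓ : DifferentiableAt ℝ Γ y) (hH : ContDiffAt ℝ ∞ H y) (a b : E) :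
    curvOp Γ y a b (H y) = fderiv ℝ (covRep Γ H) y a b + Γ y a (covRep Γ H y b)
      - (fderiv ℝ (covRep Γ H) y b a + Γ y b (covRep Γ H y a)) := by
  have h := (curvOp_eq hΓ (X := fun _ => a) (Y := fun _ => b) (differentiableAt_const _)
    (differentiableAt_const _) hH).2
  have hd : ∀ a b : E, fderiv ℝ (fun z => fderiv ℝ H z b + Γ z b (H z)) y a
      = fderiv ℝ (covRep Γ H) y a b := fun a b => by
    have := ((differentiableAt_covRep hΓ hH).hasFDerivAt.clm_apply
      (hasFDerivAt_const b y)).fderiv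
    exact (congrArg (fun L : E →L[ℝ] E => L a) this).trans (by simp)
  rw [← h, hd, hd]
  simp [covRep_apply]

/-- The relation between the covariant derivatives of H and H' is differentiated once more. The term
with the second derivative of p is symmetric in the two directions and drops out on
antisymmetrizing; the connection terms match because the second form vanishes on ∇H, which is all
that is needed of it. -/
theorem fderiv_curvOp (hp : ContDiffAt ℝ ∞ p y) (hΓ : DifferentiableAt ℝ Γ y)
    (hΓ' : DifferentiableAt ℝ Γ' (p y)) (hH : ContDiffAt ℝ ∞ H y) (hH' : ContDiffAt ℝ ∞ H' (p y))
    (h : ∀ᶠ z in 𝓝 y, fderiv ℝ p z (H z) = H' (p z))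
    (hc : ∀ᶠ z in 𝓝 y, ∀ a, fderiv ℝ p z (covRep Γ H z a) = covRep Γ' H' (p z) (fderiv ℝ p z a))
    (hs : ∀ a b, secondForm Γ Γ' p y a (covRep Γ H y b) = 0) (a b : E) :
    fderiv ℝ p y (curvOp Γ y a b (H y))
      = curvOp Γ' (p y) (fderiv ℝ p y a) (fderiv ℝ p y b) (fderiv ℝ p y (H y)) := by
  have key : ∀ a b, fderiv ℝ p y (fderiv ℝ (covRep Γ H) y a b + Γ y a (covRep Γ H y b))
      = fderiv ℝ (covRep Γ' H') (p y) (fderiv ℝ p y a) (fderiv ℝ p y b)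
        + Γ' (p y) (fderiv ℝ p y a) (covRep Γ' H' (p y) (fderiv ℝ p y b))
        + covRep Γ' H' (p y) (fderiv ℝ (fderiv ℝ p) y a b) := fun a b => by
    have d2 := hasFDerivAt_fderiv_of_contDiffAt hp
    have dp := (hp.differentiableAt (by simp)).hasFDerivAt
    have h1 := d2.clm_apply ((differentiableAt_covRep hΓ hH).hasFDerivAt.clm_apply
      (hasFDerivAt_const b y))
    have h2 := (((differentiableAt_covRep hΓ' hH').hasFDerivAt.comp y dp)).clm_apply
      (d2.clm_apply (hasFDerivAt_const b y))
    have h3 := (h1.congr_of_eventuallyEq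
      (f₁ := fun z => (covRep Γ' H' ∘ p) z (fderiv ℝ p z b))
      (hc.mono fun z hz => (hz b).symm)).unique h2
    have h4 : fderiv ℝ p y (fderiv ℝ (covRep Γ H) y a b)
        + fderiv ℝ (fderiv ℝ p) y a (covRep Γ H y b)
        = covRep Γ' H' (p y) (fderiv ℝ (fderiv ℝ p) y a b)
          + fderiv ℝ (covRep Γ' H') (p y) (fderiv ℝ p y a) (fderiv ℝ p y b) := by
      simpa using congrArg (fun L : E →L[ℝ] F => L a) h3
    have h5 := hs a b
    rw [secondForm, hc.self_of_nhds b] at h5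
    rw [map_add, eq_sub_of_add_eq h4, ← sub_eq_zero.1 h5]
    abel
  rw [curvOp_apply_eq_covRep hΓ hH, map_sub, key, key, h.self_of_nhds,
    curvOp_apply_eq_covRep hΓ' hH', fderiv_symm_apply hp a b]
  abel

/-- Write B for the second form. The torsion has defect B(b, a) - B(a, b), and differentiating p_* u
= u' ∘ p gives the drift the defect -B(b, u). As B(b, a - u) = 0, only -B(a, b) survives. -/
theorem fderiv_torsion_add (hp : ContDiffAt ℝ ∞ p y) {u : E → E} {u' : F → F}
    (hu : DifferentiableAt ℝ u y) (hu' : DifferentiableAt ℝ u' (p y))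
    (h : ∀ᶠ z in 𝓝 y, fderiv ℝ p z (u z) = u' (p z)) {a : E} (b : E)
    (hs : secondForm Γ Γ' p y b (a - u y) = 0) :
    fderiv ℝ p y (Γ y a b - Γ y b a + covRep Γ u y b)
      = Γ' (p y) (fderiv ℝ p y a) (fderiv ℝ p y b) - Γ' (p y) (fderiv ℝ p y b) (fderiv ℝ p y a)
        + covRep Γ' u' (p y) (fderiv ℝ p y b) - secondForm Γ Γ' p y a b := by
  have h1 := (hasFDerivAt_fderiv_of_contDiffAt hp).clm_apply hu.hasFDerivAt
  have h2 := hu'.hasFDerivAt.comp y (hp.differentiableAt (by simp)).hasFDerivAt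
  have h3 := (h1.congr_of_eventuallyEq (f₁ := u' ∘ p) (h.mono fun z hz => hz.symm)).unique h2
  have h4 : fderiv ℝ p y (fderiv ℝ u y b) + fderiv ℝ (fderiv ℝ p) y b (u y)
      = fderiv ℝ u' (p y) (fderiv ℝ p y b) := congrArg (fun L : E →L[ℝ] F => L b) h3
  rw [covRep_apply, covRep_apply, ← h4, ← h.self_of_nhds, secondForm, fderiv_symm_apply hp a b]
  rw [secondForm] at hs
  simp only [map_add, map_sub] at hs ⊢
  rw [← sub_eq_zero]
  rw [← hs]
  abel

end SecondForm

theorem ChartModel.toChart_cov {d : ℕ} {M : Type*} [TopologicalSpace M]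
    [ChartedSpace (EuclideanSpace ℝ (Fin d)) M] [IsManifold (𝓡 d) ∞ M] [T2Space M]
    {cov : Connection d M} {x₀ x : M} (m : ChartModel cov x₀) (hx : x ∈ m.dom)
    {X : (x : M) → TangentSpace (𝓡 d) x} (hX : FieldDiffAt X x) (v : TangentSpace (𝓡 d) x) :
    toChart x₀ x (cov X x v) = covRep m.Γ (rep x₀ X) (m.coord x) (toChart x₀ x v) := by
  rw [m.cov_eq' hx hX, covRep_apply, rep, m.ofChart_coord hx]

/-! ### The submersion in charts: second form, curvature and torsion -/

namespace IsCompatibleSubmersion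

set_option linter.unusedSectionVars false

variable {d e : ℕ} {M N : Type*}
    [TopologicalSpace M] [ChartedSpace (EuclideanSpace ℝ (Fin d)) M] [IsManifold (𝓡 d) ∞ M]
    [T2Space M]
    [TopologicalSpace N] [ChartedSpace (EuclideanSpace ℝ (Fin e)) N] [IsManifold (𝓡 e) ∞ N]
    [T2Space N]
    {T : ℝ} {o : M} {π : M → N}
    {D : DiffusionData d M o T} {D' : DiffusionData e N (π o) T}
    (hπ : IsCompatibleSubmersion π D D') {x₀ : M} {y₀ : N} (m : ChartModel D.conn x₀)
    (m' : ChartModel D'.conn y₀) {x : M}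

theorem contDiffAt_mapRep (hπ : IsCompatibleSubmersion π D D') (hx : x ∈ m.dom) :
    ContDiffAt ℝ ∞ (mapRep m' x₀ π) (m.coord x) :=
  (contDiffOn_mapRep m m' hπ.smooth).contDiffAt (m.isOpen.mem_nhds (m.coord_mem hx))

theorem eventually_mapRep (hπ : IsCompatibleSubmersion π D D') (hx : x ∈ m.dom)
    (hx' : π x ∈ m'.dom) : ∀ᶠ y in 𝓝 (m.coord x), y ∈ m.O ∧ π (ofChart x₀ y) ∈ m'.dom := by
  refine Filter.Eventually.and (m.isOpen.mem_nhds (m.coord_mem hx))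
    (m.eventually_ofChart (m.coord_mem hx)
      (p := fun x => π x ∈ m'.dom) ?_)
  rw [m.ofChart_coord hx]
  exact (m'.isOpen_dom.preimage hπ.smooth.continuous).mem_nhds hx'

theorem fderiv_mapRep_rep (hπ : IsCompatibleSubmersion π D D') (hx : x ∈ m.dom) (hx' : π x ∈ m'.dom)
    {X : (x : M) → TangentSpace (𝓡 d) x} {Y : (y : N) → TangentSpace (𝓡 e) y}
    (h : ∀ x, mfderiv (𝓡 d) (𝓡 e) π x (X x) = Y (π x)) :
    ∀ᶠ y in 𝓝 (m.coord x), fderiv ℝ (mapRep m' x₀ π) y (rep x₀ X y)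
      = rep y₀ Y (mapRep m' x₀ π y) := by
  filter_upwards [hπ.eventually_mapRep m m' hx hx'] with y hy
  have h1 := toChart_mfderiv m m' hπ.smooth (m.ofChart_mem_dom hy.1) hy.2 (X (ofChart x₀ y))
  rw [m.coord_eq y hy.1, h] at h1
  refine h1.symm.trans ?_
  rw [mapRep, rep, m'.ofChart_coord hy.2]

theorem mfderiv_lift (x : M) (w : D'.S.Fiber (π x)) :
    mfderiv (𝓡 d) (𝓡 e) π x (D.S.incl x (hπ.lift x w)) = D'.S.incl (π x) w := by
  rw [← hπ.incl_proj, hπ.proj_lift]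

theorem mfderiv_cov_lift {Y : (y : N) → D'.S.Fiber y} (hY : SmoothFieldOn (D'.S.toField Y) univ)
    (x : M) (v : TangentSpace (𝓡 d) x) :
    (∃ w, D.conn (D.S.toField fun x => hπ.lift x (Y (π x))) x v = D.S.incl x (hπ.lift x w)) ∧
    mfderiv (𝓡 d) (𝓡 e) π x (D.conn (D.S.toField fun x => hπ.lift x (Y (π x))) x v)
      = D'.conn (D'.S.toField Y) (π x) (mfderiv (𝓡 d) (𝓡 e) π x v) := by
  have hw : D'.conn (D'.S.toField Y) (π x) (mfderiv (𝓡 d) (𝓡 e) π x v) = D'.S.incl (π x)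
      (D'.S.mkFiber _ (D'.conn_compatible.mem Y hY (π x) (mfderiv (𝓡 d) (𝓡 e) π x v))) := rfl
  have h := hπ.cov_lift hY x v hw
  exact ⟨⟨_, h⟩, by rw [h, hπ.mfderiv_lift]; rfl⟩

theorem exists_section (y : N) (w : D'.S.Fiber y) : ∃ Y : (y : N) → D'.S.Fiber y,
    SmoothFieldOn (D'.S.toField Y) univ ∧ Y y = w := by
  obtain ⟨F⟩ := exists_localFrame D'.S y
  obtain ⟨z, rfl⟩ := F.surjective y F.mem w
  exact ⟨fun y => F.map y z, F.smooth z, rfl⟩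

theorem fderiv_covRep_lift (hx : x ∈ m.dom) (hx' : π x ∈ m'.dom) {Y : (y : N) → D'.S.Fiber y}
    (hY : SmoothFieldOn (D'.S.toField Y) univ) (a : Eu d) :
    fderiv ℝ (mapRep m' x₀ π) (m.coord x) (covRep m.Γ
        (rep x₀ (D.S.toField fun x => hπ.lift x (Y (π x)))) (m.coord x) a)
      = covRep m'.Γ (rep y₀ (D'.S.toField Y)) (m'.coord (π x))
        (fderiv ℝ (mapRep m' x₀ π) (m.coord x) a) := by
  obtain ⟨v, rfl⟩ : ∃ v : TangentSpace (𝓡 d) x, toChart x₀ x v = a :=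
    ⟨fromChart x₀ x a, toChart_fromChart hx.1 a⟩
  rw [← m.toChart_cov hx ((hπ.smoothFieldOn_lift hY).fieldDiffAt Filter.univ_mem),
    ← toChart_mfderiv m m' hπ.smooth hx hx', ← toChart_mfderiv m m' hπ.smooth hx hx',
    ← m'.toChart_cov hx' (hY.fieldDiffAt Filter.univ_mem), (hπ.mfderiv_cov_lift hY x v).2]

theorem contDiffAt_rep' {X : (x : M) → TangentSpace (𝓡 d) x} (hX : SmoothFieldOn X univ)
    (hx : x ∈ m.dom) : ContDiffAt ℝ ∞ (rep x₀ X) (m.coord x) :=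
  (m.contDiffOn_rep hX).contDiffAt (m.isOpen.mem_nhds (m.coord_mem hx))

/-- The pull-back hypothesis on horizontal lifts of sections, read as the vanishing of ∇dπ when its
second argument is horizontal. Nothing is claimed for the first argument, since the connections may
have torsion. -/
theorem secondForm_lift (hx : x ∈ m.dom) (hx' : π x ∈ m'.dom) (a : Eu d) (w : D'.S.Fiber (π x)) :
    secondForm m.Γ m'.Γ (mapRep m' x₀ π) (m.coord x) a
      (toChart x₀ x (D.S.incl x (hπ.lift x w))) = 0 := by
  obtain ⟨Y, hY, rfl⟩ := exists_section (D' := D') (π x) w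
  have e : toChart x₀ x (D.S.incl x (hπ.lift x (Y (π x))))
      = rep x₀ (D.S.toField fun x => hπ.lift x (Y (π x))) (m.coord x) := by
    rw [rep, m.ofChart_coord hx]
    rfl
  rw [e]
  refine secondForm_eq_zero (H' := rep y₀ (D'.S.toField Y)) (contDiffAt_mapRep m m' hπ hx)
    ((contDiffAt_rep' m (hπ.smoothFieldOn_lift hY) hx).differentiableAt (by simp)) ?_
    (hπ.fderiv_mapRep_rep m m' hx hx' fun x => hπ.mfderiv_lift x _) ?_
  · rw [mapRep_coord m m' hx]
    exact ((m'.contDiffOn_rep hY).contDiffAt (m'.isOpen.mem_nhds (m'.coord_mem hx'))).differentiableAt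
      (by simp)
  · rw [mapRep_coord m m' hx]
    exact hπ.fderiv_covRep_lift m m' hx hx' hY a

theorem mfderiv_curvature (x : M) (a b : TangentSpace (𝓡 d) x) (w : D'.S.Fiber (π x)) :
    mfderiv (𝓡 d) (𝓡 e) π x (curvature D.conn x a b (D.S.incl x (hπ.lift x w)))
      = curvature D'.conn (π x) (mfderiv (𝓡 d) (𝓡 e) π x a) (mfderiv (𝓡 d) (𝓡 e) π x b)
        (D'.S.incl (π x) w) := by
  obtain ⟨m⟩ := exists_chartModel D.conn_smooth x
  obtain ⟨m'⟩ := exists_chartModel D'.conn_smooth (π x)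
  have hx := m.mem_dom
  have hx' := m'.mem_dom
  obtain ⟨Y, hY, rfl⟩ := exists_section (D' := D') (π x) w
  have hX := hπ.smoothFieldOn_lift hY
  have e : toChart x x (D.S.incl x (hπ.lift x (Y (π x))))
      = rep x (D.S.toField fun x => hπ.lift x (Y (π x))) (m.coord x) := by
    rw [rep, m.ofChart_coord hx]
    rfl
  have hcoord := mapRep_coord m m' hx (π := π)
  have hd := (contDiffAt_rep' m hX hx).differentiableAt (by simp)
  have key := fderiv_curvOp (Γ := m.Γ) (Γ' := m'.Γ) (H' := rep (π x) (D'.S.toField Y))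
    (contDiffAt_mapRep m m' hπ hx) (m.differentiableAt_Γ (m.coord_mem hx))
    (by rw [hcoord]; exact m'.differentiableAt_Γ (m'.coord_mem hx')) (contDiffAt_rep' m hX hx)
    (by
      rw [hcoord]
      exact (m'.contDiffOn_rep hY).contDiffAt (m'.isOpen.mem_nhds (m'.coord_mem hx')))
    (hπ.fderiv_mapRep_rep m m' hx hx' fun x => hπ.mfderiv_lift x _)
    (by
      filter_upwards [hπ.eventually_mapRep m m' hx hx'] with y hy v
      have h := hπ.fderiv_covRep_lift m m' (m.ofChart_mem_dom hy.1) hy.2 hY v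
      rwa [m.coord_eq y hy.1] at h)
    (fun a b => by
      obtain ⟨v, rfl⟩ : ∃ v : TangentSpace (𝓡 d) x, toChart x x v = b :=
        ⟨fromChart x x b, toChart_fromChart hx.1 b⟩
      rw [← m.toChart_cov hx (hX.fieldDiffAt Filter.univ_mem)]
      obtain ⟨w, hw⟩ := (hπ.mfderiv_cov_lift hY x v).1
      rw [hw]
      exact hπ.secondForm_lift m m' hx hx' a w) (toChart x x a) (toChart x x b)
  apply toChart_injective hx'.1
  rw [toChart_mfderiv m m' hπ.smooth hx hx', m.curvature_eq' hx, e, key, ← e,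
    m'.curvature_eq' hx', hcoord, ← toChart_mfderiv m m' hπ.smooth hx hx',
    ← toChart_mfderiv m m' hπ.smooth hx hx', ← toChart_mfderiv m m' hπ.smooth hx hx',
    hπ.mfderiv_lift]

/-- Here a plays the role of the velocity of the lifted curve, whose driven part is horizontal; this
is the condition under which only one second form remains. -/
theorem toChart_mfderiv_torsion (hx : x ∈ m.dom) (hx' : π x ∈ m'.dom) {t : ℝ} (ht : t ∈ Icc 0 T)
    {a : TangentSpace (𝓡 d) x} (b : TangentSpace (𝓡 d) x) {w : D'.S.Fiber (π x)}
    (ha : a = D.S.incl x (hπ.lift x w) + D.u t x) :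
    toChart y₀ (π x) (mfderiv (𝓡 d) (𝓡 e) π x (D.conn.torsion x a b + D.conn (D.u t) x b))
      = toChart y₀ (π x) (D'.conn.torsion (π x) (mfderiv (𝓡 d) (𝓡 e) π x a)
          (mfderiv (𝓡 d) (𝓡 e) π x b) + D'.conn (D'.u t) (π x) (mfderiv (𝓡 d) (𝓡 e) π x b))
        - secondForm m.Γ m'.Γ (mapRep m' x₀ π) (m.coord x) (toChart x₀ x a) (toChart x₀ x b) := by
  have hu := DiffusionData.fieldDiffAt_u (D := D) ht x
  have hu' := DiffusionData.fieldDiffAt_u (D := D') ht (π x)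
  have hcoord := mapRep_coord m m' hx (π := π)
  have eu : toChart x₀ x (D.u t x) = rep x₀ (D.u t) (m.coord x) := by rw [rep, m.ofChart_coord hx]
  have key := fderiv_torsion_add (Γ := m.Γ) (Γ' := m'.Γ) (u' := rep y₀ (D'.u t))
    (contDiffAt_mapRep m m' hπ hx) ((m.differentiableAt_rep hx).1 hu)
    (by rw [hcoord]; exact (m'.differentiableAt_rep hx').1 hu')
    (hπ.fderiv_mapRep_rep m m' hx hx' (hπ.u_related t ht)) (a := toChart x₀ x a) (toChart x₀ x b)
    (by
      rw [ha, map_add, ← eu, add_sub_cancel_right]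
      exact hπ.secondForm_lift m m' hx hx' _ w)
  rw [toChart_mfderiv m m' hπ.smooth hx hx', map_add, m.torsion_eq' hx, m.toChart_cov hx hu, key,
    map_add, m'.torsion_eq' hx', m'.toChart_cov hx' hu', hcoord,
    toChart_mfderiv m m' hπ.smooth hx hx', toChart_mfderiv m m' hπ.smooth hx hx']

end IsCompatibleSubmersion

/-! ### Solutions with continuous controls -/

theorem exists_Icc_mem_nhdsWithin {T t δ : ℝ} (ht : t ∈ Icc 0 T) (hδ : 0 < δ) :
    ∃ r s, 0 ≤ r ∧ r ≤ s ∧ s ≤ T ∧ t ∈ Icc r s ∧ Icc r s ∈ 𝓝[Icc 0 T] t ∧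
      ∀ x ∈ Icc r s, |x - t| < δ := by
  obtain ⟨r, s, hmem, hr, hrs, hs, hI, hI'⟩ := exists_Icc_subset ht hδ
  refine ⟨r, s, hr, hrs, hs, hmem, ?_, hI⟩
  filter_upwards [self_mem_nhdsWithin,
    mem_nhdsWithin_of_mem_nhds (Metric.ball_mem_nhds t (half_pos hδ))] with x hx hxt
  exact hI' x hx (by rwa [Metric.mem_ball, Real.dist_eq] at hxt)

theorem continuousOn_variation {E : Type*} [NormedAddCommGroup E] [NormedSpace ℝ E] {K : Set ℝ}
    {Γ : E → E →L[ℝ] E →L[ℝ] E} {O : Set E} (hO : IsOpen O) (hΓ : ContDiffOn ℝ ∞ Γ O)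
    {x v u c : ℝ → E} {u' p J : ℝ → E →L[ℝ] E} (cx : ContinuousOn x K) (hxO : ∀ t ∈ K, x t ∈ O)
    (cu : ContinuousOn u K) (cu' : ContinuousOn u' K) (cp : ContinuousOn p K)
    (cJ : ContinuousOn J K) (iv : ContinuousOn v K) (ic : ContinuousOn c K)
    (z : E × (E →L[ℝ] E)) :
    ContinuousOn (fun t => (z.2 (c t) + J t (Γ (x t) (v t) (p t z.1)
        - Γ (x t) (p t z.1) (v t) + (u' t (p t z.1) + Γ (x t) (p t z.1) (u t))),
        J t ∘L curvOp Γ (x t) (v t) (p t z.1) ∘L p t)) K := by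
  have cΓ : ContinuousOn (fun t => Γ (x t)) K := hΓ.continuousOn.comp cx hxO
  have cΓ' : ContinuousOn (fun t => fderiv ℝ Γ (x t)) K :=
    (hΓ.continuousOn_fderiv_of_isOpen hO (by simp)).comp cx hxO
  have cw : ContinuousOn (fun t => p t z.1) K := cp.clm_apply continuousOn_const
  have c1 := cΓ.clm_apply iv
  have c2 := cΓ.clm_apply cw
  refine ContinuousOn.prodMk ((z.2.continuous.comp_continuousOn ic).add
    (cJ.clm_apply (((c1.clm_apply cw).sub (c2.clm_apply iv)).add
      ((cu'.clm_apply cw).add (c2.clm_apply cu))))) (cJ.clm_comp (ContinuousOn.clm_comp ?_ cp))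
  have k1 : ContinuousOn (fun t => fderiv ℝ Γ (x t) (v t) (p t z.1)) K :=
    (cΓ'.clm_apply iv).clm_apply cw
  have k2 : ContinuousOn (fun t => fderiv ℝ Γ (x t) (p t z.1) (v t)) K :=
    (cΓ'.clm_apply cw).clm_apply iv
  exact ((k1.sub k2).add (c1.clm_comp c2)).sub (c2.clm_comp c1)

namespace DiffusionData

set_option linter.unusedSectionVars false

variable {d : ℕ} {M : Type*} [TopologicalSpace M] [ChartedSpace (EuclideanSpace ℝ (Fin d)) M]
  [IsManifold (𝓡 d) ∞ M] [T2Space M] {o : M} {T : ℝ} {D : DiffusionData d M o T}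
  {c : ℝ → D.S.Fiber o} {γ : ℝ → M} {P : ℝ → Eu d ≃L[ℝ] Eu d} {r s : ℝ}

theorem IsPath.continuousOn_toChart_vel (h : D.IsPath c γ P r s) (hr : 0 ≤ r) (hrs : r ≤ s)
    (hs : s ≤ T) (hc : ContinuousOn c (Icc 0 T)) {x₀ : M} (m : ChartModel D.conn x₀)
    (hγ : ∀ t ∈ Icc r s, γ t ∈ m.dom) :
    ContinuousOn (fun t => toChart x₀ (γ t) (D.vel c γ P t)) (Icc r s) := by
  have hsub : Icc r s ⊆ Icc 0 T := Icc_subset_Icc hr hs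
  have cx := (h.prim_coord m.coord_smooth hrs).continuousOn
  have h1 : ContinuousOn (fun t => D.diffusion t (c t)) (Icc r s) :=
    ContinuousOn.mono (ContinuousOn.clm_apply (f := D.diffusion) (g := c)
      D.continuousOn_diffusion hc) hsub
  have h2 : ContinuousOn (fun t => frameRep (d := d) x₀ (γ t) (P t) (D.diffusion t (c t)))
    (Icc r s) := (h.prim_frameRep hrs m hγ).continuousOn.clm_apply h1
  have hm : MapsTo (fun t => (t, m.coord (γ t))) (Icc r s) (Icc 0 T ×ˢ (extChartAt (𝓡 d) x₀).target) :=
    fun t ht => ⟨hsub ht, m.subset (m.coord_mem (hγ t ht))⟩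
  have h3 : ContinuousOn (fun t => rep x₀ (D.u t) (m.coord (γ t))) (Icc r s) :=
    ContinuousOn.comp (g := fun p : ℝ × Eu d => rep x₀ (D.u p.1) p.2)
      (f := fun t => (t, m.coord (γ t))) (D.contDiffOn_rep_u x₀).continuousOn
      (continuousOn_id.prodMk cx) hm
  exact (h2.add h3).congr fun t ht => toChart_vel m (hγ t ht)

/-- With a continuous control the coefficients are continuous, so the integrated equations can be
differentiated at every time. -/
theorem IsPath.continuousOn_varOp (hT : 0 < T) (h : D.IsPath c γ P 0 T)
    (hc : ContinuousOn c (Icc 0 T)) : ContinuousOn (D.varOp c γ P) (Icc 0 T) := by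
  refine continuousOn_clm_apply.2 fun z t ht => ?_
  obtain ⟨m⟩ := exists_chartModel D.conn_smooth (γ t)
  obtain ⟨δ, hδ, H⟩ := exists_delta_of_mem_nhds h.continuousOn ht (m.isOpen_dom.mem_nhds m.mem_dom)
  obtain ⟨r, s, hr, hrs, hs, hmem, hnhds, hI⟩ := exists_Icc_mem_nhdsWithin ht hδ
  have hsub : Icc r s ⊆ Icc 0 T := Icc_subset_Icc hr hs
  have hγ : ∀ x ∈ Icc r s, γ x ∈ m.dom := fun x hx => H x (hsub hx) (hI x hx)
  have hp := h.mono hr hrs hs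
  have cx := (hp.prim_coord m.coord_smooth hrs).continuousOn
  have hO : ∀ t ∈ Icc r s, m.coord (γ t) ∈ m.O := fun t ht => m.coord_mem (hγ t ht)
  have hm : MapsTo (fun t => (t, m.coord (γ t))) (Icc r s)
      (Icc 0 T ×ˢ (extChartAt (𝓡 d) (γ t)).target) := fun t ht => ⟨hsub ht, m.subset (hO t ht)⟩
  have key := continuousOn_variation m.isOpen m.smooth cx hO
    ((D.contDiffOn_rep_u (γ t)).continuousOn.comp (continuousOn_id.prodMk cx) hm)
    ((continuousOn_driftDeriv (D := D) hT (γ t)).comp (continuousOn_id.prodMk cx) hm)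
    (hp.prim_frameRep hrs m hγ).continuousOn (hp.prim_frameCorep hrs m hγ).continuousOn
    (hp.continuousOn_toChart_vel hr hrs hs hc m hγ)
    (ContinuousOn.mono (ContinuousOn.clm_apply (f := D.diffusion) (g := c)
      D.continuousOn_diffusion hc) hsub) z
  refine ContinuousWithinAt.mono_of_mem_nhdsWithin (t := Icc r s) ?_ hnhds
  refine (key.congr fun x hx => ?_) t hmem
  exact varOp_chart (hsub hx) m (hγ x hx) z rfl rfl rfl rfl rfl

theorem IsPath.hasMFDerivWithinAt (h : D.IsPath c γ P 0 T) (hc : ContinuousOn c (Icc 0 T)) {t : ℝ}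
    (ht : t ∈ Icc 0 T) : HasMFDerivWithinAt 𝓘(ℝ, ℝ) (𝓡 d) γ (Icc 0 T) t
      ((1 : ℝ →L[ℝ] ℝ).smulRight (D.vel c γ P t)) := by
  obtain ⟨m⟩ := exists_chartModel D.conn_smooth (γ t)
  obtain ⟨δ, hδ, H⟩ := exists_delta_of_mem_nhds h.continuousOn ht (m.isOpen_dom.mem_nhds m.mem_dom)
  obtain ⟨r, s, hr, hrs, hs, hmem, hnhds, hI⟩ := exists_Icc_mem_nhdsWithin ht hδ
  have hγ : ∀ x ∈ Icc r s, γ x ∈ m.dom := fun x hx => H x (Icc_subset_Icc hr hs hx) (hI x hx)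
  have hp := h.mono hr hrs hs
  have cx := (hp.prim_coord m.coord_smooth hrs).congr_deriv hrs fun t ht => m.dir_coord (hγ t ht) _
  have h1 := (cx.hasDerivWithinAt (hp.continuousOn_toChart_vel hr hrs hs hc m hγ)
    hmem).hasFDerivWithinAt.hasMFDerivWithinAt
  have hy := m.coord_mem (hγ t hmem)
  have h2 : MDifferentiableAt 𝓘(ℝ, Eu d) (𝓡 d) (ofChart (γ t)) (m.coord (γ t)) :=
    ((contMDiffOn_ofChart (γ t)).contMDiffAt
      ((isOpen_target (γ t)).mem_nhds (m.subset hy))).mdifferentiableAt (by simp)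
  have h3 := h2.hasMFDerivAt.comp_hasMFDerivWithinAt t h1
  have h4 := h3.congr_of_eventuallyEq (f₁ := γ) (Filter.eventually_of_mem self_mem_nhdsWithin
    fun x hx => (m.ofChart_coord (hγ x hx)).symm) (m.ofChart_coord (hγ t hmem)).symm
  have h5 := h4.mono_of_mem_nhdsWithin hnhds
  refine h5.congr_mfderiv ?_
  ext
  change mfderiv 𝓘(ℝ, Eu d) (𝓡 d) (ofChart (γ t)) (m.coord (γ t))
    ((1 : ℝ) • toChart (γ t) (γ t) (D.vel c γ P t)) = (1 : ℝ) • D.vel c γ P t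
  rw [one_smul, one_smul, m.mfderiv_ofChart hy, m.ofChart_coord (hγ t hmem),
    fromChart_toChart (mem_chart_source _ _)]

end DiffusionData

namespace IsCompatibleSubmersion

/-! ### Transfer of tangent vectors along a lifted solution -/

set_option linter.unusedSectionVars false

variable {d e : ℕ} {M N : Type*}
    [TopologicalSpace M] [ChartedSpace (EuclideanSpace ℝ (Fin d)) M] [IsManifold (𝓡 d) ∞ M]
    [T2Space M]
    [TopologicalSpace N] [ChartedSpace (EuclideanSpace ℝ (Fin e)) N] [IsManifold (𝓡 e) ∞ N]
    [T2Space N]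
    {T : ℝ} {o : M} {π : M → N}
    {D : DiffusionData d M o T} {D' : DiffusionData e N (π o) T}
    (hπ : IsCompatibleSubmersion π D D')

/-- The differential of `π` along a curve, after transport back to the starting points. -/
def transferE (π : M → N) (γ : ℝ → M) (P : ℝ → Eu d ≃L[ℝ] Eu d) (P' : ℝ → Eu e ≃L[ℝ] Eu e)
    (t : ℝ) : Eu d →L[ℝ] Eu e :=
  ((P' t).symm : Eu e →L[ℝ] Eu e) ∘L diffE π (γ t) ∘L (P t : Eu d →L[ℝ] Eu d)

variable {c : ℝ → D'.S.Fiber (π o)} {γ : ℝ → M} {P : ℝ → Eu d ≃L[ℝ] Eu d}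
  {P' : ℝ → Eu e ≃L[ℝ] Eu e} {r s t : ℝ}

theorem apply_transferE (v : Eu d) :
    (toE (π (γ t))).symm (P' t (transferE π γ P P' t v))
      = mfderiv (𝓡 d) (𝓡 e) π (γ t) ((toE (γ t)).symm (P t v)) :=
  (P' t).apply_symm_apply _

theorem mfderiv_vel_eq (ht : t ∈ Icc 0 T)
    (hproj : ∀ w, diffE π (γ t) (P t (D.inclE o (hπ.lift o w))) = P' t (D'.inclE (π o) w)) :
    mfderiv (𝓡 d) (𝓡 e) π (γ t) (D.vel (fun t => hπ.lift o (c t)) γ P t)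
      = D'.vel c (fun t => π (γ t)) P' t := by
  rw [hπ.mfderiv_vel ht, hproj]
  rfl

theorem exists_vel_eq (h : D.IsPath (fun t => hπ.lift o (c t)) γ P 0 T)
    (h0 : γ 0 = o ∧ P 0 = .refl ℝ _) (ht : t ∈ Icc 0 T) : ∃ w : D'.S.Fiber (π (γ t)),
      D.vel (fun t => hπ.lift o (c t)) γ P t
        = D.S.incl (γ t) (hπ.lift (γ t) w) + D.u t (γ t) := by
  obtain ⟨G, hG⟩ := hπ.exists_lift_transport h h0 t ht
  refine ⟨G (posSqrt (D'.Sig t) (c t)), ?_⟩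
  rw [DiffusionData.vel]
  congr 1
  change (toE (γ t)).symm (P t (D.inclE o (posSqrt (D.Sig t) (hπ.lift o (c t))))) = _
  rw [hπ.posSqrt_lift ht, ← hG]
  rfl

theorem transferE_chart (hπ : IsCompatibleSubmersion π D D') {x₀ : M} {y₀ : N} (m : ChartModel D.conn x₀) (m' : ChartModel D'.conn y₀)
    (hx : γ t ∈ m.dom) (hx' : π (γ t) ∈ m'.dom) (v : Eu d) :
    transferE π γ P P' t v = DiffusionData.frameCorep y₀ (π (γ t)) (P' t).symm
      (fderiv ℝ (mapRep m' x₀ π) (m.coord (γ t)) (DiffusionData.frameRep x₀ (γ t) (P t) v)) := by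
  have h1 : transferE π γ P P' t v
      = (P' t).symm (toE _ (mfderiv (𝓡 d) (𝓡 e) π (γ t) ((toE (γ t)).symm (P t v)))) := rfl
  rw [h1, DiffusionData.symm_toE_eq hx'.1, toChart_mfderiv m m' hπ.smooth hx hx']
  rfl

/-- The failure of π_* to intertwine the torsion and drift coefficients is ∇dπ(γ', ·). This is the
quantity that also appears as the derivative of π_* along the curve. -/
theorem varOp_sub_transferE (h : D.IsPath (fun t => hπ.lift o (c t)) γ P 0 T)
    (h0 : γ 0 = o ∧ P 0 = .refl ℝ _) (ht : t ∈ Icc 0 T)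
    (hproj : ∀ w, diffE π (γ t) (P t (D.inclE o (hπ.lift o w))) = P' t (D'.inclE (π o) w))
    {x₀ : M} {y₀ : N} (m : ChartModel D.conn x₀) (m' : ChartModel D'.conn y₀)
    (hx : γ t ∈ m.dom) (hx' : π (γ t) ∈ m'.dom) (v : Eu d) :
    (D'.varOp c (fun t => π (γ t)) P' t (transferE π γ P P' t v, 0)).1
        - transferE π γ P P' t (D.varOp (fun t => hπ.lift o (c t)) γ P t (v, 0)).1
      = DiffusionData.frameCorep y₀ (π (γ t)) (P' t).symm (secondForm m.Γ m'.Γ (mapRep m' x₀ π)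
        (m.coord (γ t)) (toChart x₀ (γ t) (D.vel (fun t => hπ.lift o (c t)) γ P t))
        (DiffusionData.frameRep x₀ (γ t) (P t) v)) := by
  obtain ⟨w, hw⟩ := hπ.exists_vel_eq h h0 ht
  have h1 := hπ.toChart_mfderiv_torsion m m' hx hx' ht ((toE (γ t)).symm (P t v)) hw
  rw [hπ.mfderiv_vel_eq ht hproj] at h1
  have h2 : transferE π γ P P' t (D.varOp (fun t => hπ.lift o (c t)) γ P t (v, 0)).1
      = (P' t).symm (toE (π (γ t)) (mfderiv (𝓡 d) (𝓡 e) π (γ t)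
        (D.conn.torsion (γ t) (D.vel (fun t => hπ.lift o (c t)) γ P t) ((toE (γ t)).symm (P t v))
          + D.conn (D.u t) (γ t) ((toE (γ t)).symm (P t v))))) := by
    rw [DiffusionData.varOp_fst]
    simp only [zero_apply, zero_add]
    change (P' t).symm (diffE π (γ t) (P t ((P t).symm _))) = _
    rw [ContinuousLinearEquiv.apply_symm_apply]
    rfl
  have h3 : (D'.varOp c (fun t => π (γ t)) P' t (transferE π γ P P' t v, 0)).1
      = (P' t).symm (toE (π (γ t)) (D'.conn.torsion (π (γ t)) (D'.vel c (fun t => π (γ t)) P' t)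
          (mfderiv (𝓡 d) (𝓡 e) π (γ t) ((toE (γ t)).symm (P t v)))
        + D'.conn (D'.u t) (π (γ t))
          (mfderiv (𝓡 d) (𝓡 e) π (γ t) ((toE (γ t)).symm (P t v))))) := by
    rw [DiffusionData.varOp_fst]
    simp only [zero_apply, zero_add]
    rw [apply_transferE]
  rw [h2, h3, DiffusionData.symm_toE_eq hx'.1, DiffusionData.symm_toE_eq hx'.1, h1, ← map_sub,
    sub_sub_cancel]
  rfl

/-- Differentiating the inverse frame on N, the differential of π and the frame on M gives the three
terms of the second form at (γ', ·); `varOp_sub_transferE` rewrites it as a difference of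
coefficients. -/
theorem prim_transferE_chart (hrs : r ≤ s) (hr : 0 ≤ r) (hs : s ≤ T)
    (h : D.IsPath (fun t => hπ.lift o (c t)) γ P 0 T)
    (h0 : γ 0 = o ∧ P 0 = .refl ℝ _) (h' : D'.IsPath c (fun t => π (γ t)) P' 0 T)
    (hproj : ∀ t ∈ Icc 0 T, ∀ w,
      diffE π (γ t) (P t (D.inclE o (hπ.lift o w))) = P' t (D'.inclE (π o) w))
    {x₀ : M} {y₀ : N} (m : ChartModel D.conn x₀) (m' : ChartModel D'.conn y₀)
    (hx : ∀ t ∈ Icc r s, γ t ∈ m.dom) (hx' : ∀ t ∈ Icc r s, π (γ t) ∈ m'.dom) (v : Eu d) :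
    Prim (fun t => transferE π γ P P' t v)
      (fun t => (D'.varOp c (fun t => π (γ t)) P' t (transferE π γ P P' t v, 0)).1
        - transferE π γ P P' t (D.varOp (fun t => hπ.lift o (c t)) γ P t (v, 0)).1) r s := by
  have hp := h.mono hr hrs hs
  have hp' := h'.mono hr hrs hs
  have hsub : Icc r s ⊆ Icc 0 T := Icc_subset_Icc hr hs
  have cx := (hp.prim_coord m.coord_smooth hrs).congr_deriv hrs fun t ht => m.dir_coord (hx t ht) _
  have hO : ∀ t ∈ Icc r s, m.coord (γ t) ∈ m.O := fun t ht => m.coord_mem (hx t ht)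
  have hm := contDiffOn_mapRep m m' hπ.smooth
  have hm1 : ContDiffOn ℝ ∞ (fderiv ℝ (mapRep m' x₀ π)) m.O :=
    hm.fderiv_of_isOpen m.isOpen (by norm_cast)
  have h1 := cx.comp hrs (Φ := fderiv ℝ (mapRep m' x₀ π))
    (Φ' := fun t => fderiv ℝ (fderiv ℝ (mapRep m' x₀ π)) (m.coord (γ t)))
    (fun t ht => (hm1.contDiffAt (m.isOpen.mem_nhds (hO t ht))).hasStrictFDerivAt (by simp))
    ((hm1.continuousOn_fderiv_of_isOpen m.isOpen (by simp)).comp cx.continuousOn hO)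
  have h2 := (hp.prim_frameRep hrs m hx).clm (ContinuousLinearMap.apply ℝ (Eu d) v)
  have h3 := (hp'.prim_frameCorep hrs m' hx').clm_apply (h1.clm_apply h2 hrs) hrs
  refine (h3.congr fun t ht => hπ.transferE_chart m m' (hx t ht) (hx' t ht) v).congr_deriv hrs
    fun t ht => ?_
  rw [hπ.varOp_sub_transferE h h0 (hsub ht) (hproj t (hsub ht)) m m' (hx t ht) (hx' t ht),
    secondForm, mapRep_coord m m' (hx t ht), ← hπ.mfderiv_vel_eq (hsub ht) (hproj t (hsub ht)),
    toChart_mfderiv m m' hπ.smooth (hx t ht) (hx' t ht)]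
  change (DiffusionData.frameCorep y₀ (π (γ t)) (P' t).symm) (m'.Γ _ _ _)
    + (DiffusionData.frameCorep y₀ (π (γ t)) (P' t).symm) (_
      + fderiv ℝ (mapRep m' x₀ π) (m.coord (γ t)) (-(m.Γ _ _ _))) = _
  rw [← map_add, map_neg]
  congr 1
  simp only [ContinuousLinearMap.apply_apply]
  abel

theorem prim_transferE (hT : 0 < T) (h : D.IsPath (fun t => hπ.lift o (c t)) γ P 0 T)
    (h0 : γ 0 = o ∧ P 0 = .refl ℝ _) (h' : D'.IsPath c (fun t => π (γ t)) P' 0 T)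
    (hproj : ∀ t ∈ Icc 0 T, ∀ w,
      diffE π (γ t) (P t (D.inclE o (hπ.lift o w))) = P' t (D'.inclE (π o) w)) (v : Eu d) :
    Prim (fun t => transferE π γ P P' t v)
      (fun t => (D'.varOp c (fun t => π (γ t)) P' t (transferE π γ P P' t v, 0)).1
        - transferE π γ P P' t (D.varOp (fun t => hπ.lift o (c t)) γ P t (v, 0)).1) 0 T := by
  refine Icc_induction (p := fun s => Prim (fun t => transferE π γ P P' t v)
      (fun t => (D'.varOp c (fun t => π (γ t)) P' t (transferE π γ P P' t v, 0)).1
        - transferE π γ P P' t (D.varOp (fun t => hπ.lift o (c t)) γ P t (v, 0)).1) 0 s) ?_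
    (fun t ht => ?_) T ⟨hT.le, le_rfl⟩
  · exact ⟨by simp, fun t ht => by
      obtain rfl : t = 0 := le_antisymm ht.2 ht.1
      simp⟩
  obtain ⟨m⟩ := exists_chartModel D.conn_smooth (γ t)
  obtain ⟨m'⟩ := exists_chartModel D'.conn_smooth (π (γ t))
  obtain ⟨δ, hδ, H⟩ := exists_delta_of_mem_nhds h.continuousOn ht (Filter.inter_mem
    (m.isOpen_dom.mem_nhds m.mem_dom) ((m'.isOpen_dom.preimage hπ.smooth.continuous).mem_nhds
      m'.mem_dom))
  refine ⟨δ, hδ, fun r hr s hs hrt hst hrs hp => hp.trans ?_ hr.1 hrs⟩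
  have hW : ∀ x ∈ Icc r s, γ x ∈ m.dom ∩ π ⁻¹' m'.dom := fun x hx =>
    H x ⟨hr.1.trans hx.1, hx.2.trans hs.2⟩ (abs_sub_lt_of_mem_Icc hrt hst hx)
  exact hπ.prim_transferE_chart hrs hr.1 hs.2 h h0 h' hproj m m' (fun x hx => (hW x hx).1)
    (fun x hx => (hW x hx).2) v

end IsCompatibleSubmersion

/-! ### Integrals of two-vectors, and momenta -/

/-- The exterior square carries no norm here, so the primitive is taken in the coordinates of a
basis and tested by functionals. It is normalized to vanish at T. -/
theorem exists_prim_of_forall_dual {W : Type*} [AddCommGroup W] [Module ℝ W] [Module.Finite ℝ W]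
    {T : ℝ} (hT : 0 ≤ T) {f : ℝ → W}
    (hf : ∀ φ : Module.Dual ℝ W, ContinuousOn (fun t => φ (f t)) (Icc 0 T)) :
    ∃ F : ℝ → W, F T = 0 ∧
      ∀ φ : Module.Dual ℝ W, Prim (fun t => φ (F t)) (fun t => φ (f t)) 0 T := by
  let B := Module.finBasis ℝ W
  have hi : ∀ i, IntervalIntegrable (fun t => B.coord i (f t)) volume 0 T := fun i => by
    have h := hf (B.coord i)
    rw [← uIcc_of_le hT] at h
    exact h.intervalIntegrable
  refine ⟨fun t => ∑ i, (-(∫ s in (0 : ℝ)..T, B.coord i (f s))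
    + ∫ s in (0 : ℝ)..t, B.coord i (f s)) • B i, by simp, fun φ => ?_⟩
  have h1 := Prim.finset_sum Finset.univ fun i _ => (Prim.intervalIntegral (hi i)
    (-(∫ s in (0 : ℝ)..T, B.coord i (f s)))).clm (φ (B i) • ContinuousLinearMap.id ℝ ℝ)
  refine (h1.congr fun t _ => ?_).congr_deriv hT fun t _ => ?_
  · simp [mul_comm]
  · conv_rhs => rw [← B.sum_repr (f t), map_sum]
    simp [mul_comm]

/-- The functional on the exterior square is curried to a bilinear form, which is continuous in
finite dimension. -/
theorem continuousOn_ιMulti {V : Type*} [NormedAddCommGroup V] [NormedSpace ℝ V]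
    [FiniteDimensional ℝ V] {K : Set ℝ} {v w : ℝ → V} (hv : ContinuousOn v K)
    (hw : ContinuousOn w K) (φ : Module.Dual ℝ (⋀[ℝ]^2 V)) :
    ContinuousOn (fun t => φ (exteriorPower.ιMulti ℝ 2 ![v t, w t])) K := by
  let z : V [⋀^Fin 0]→ₗ[ℝ] ℝ ≃ₗ[ℝ] ℝ := AlternatingMap.constLinearEquivOfIsEmpty.symm
  let y : V [⋀^Fin 1]→ₗ[ℝ] ℝ →ₗ[ℝ] V →ₗ[ℝ] ℝ :=
    LinearMap.llcomp ℝ V (V [⋀^Fin 0]→ₗ[ℝ] ℝ) ℝ z ∘ₗ AlternatingMap.curryLeftLinearMap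
  let B : V →ₗ[ℝ] V →ₗ[ℝ] ℝ := y ∘ₗ AlternatingMap.curryLeftLinearMap
    (φ.compAlternatingMap (exteriorPower.ιMulti ℝ 2))
  have hB : ∀ v w, B v w = φ (exteriorPower.ιMulti ℝ 2 ![v, w]) := fun v w => rfl
  let C : V →L[ℝ] V →L[ℝ] ℝ := LinearMap.toContinuousLinearMap
    ((LinearMap.toContinuousLinearMap (𝕜 := ℝ) (E := V) (F' := ℝ)).toLinearMap ∘ₗ B)
  exact ((C.continuous.comp_continuousOn hv).clm_apply hw).congr fun t _ => (hB _ _).symm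

theorem clm_prod_sub_apply {V W : Type*} [NormedAddCommGroup V] [NormedSpace ℝ V]
    [NormedAddCommGroup W] [NormedSpace ℝ W] (ℓ : V × W →L[ℝ] ℝ) (x : V × W) (y : V) :
    -ℓ x + ℓ (x.1 - y, 0) = -ℓ (y, 0) - ℓ (0, x.2) := by
  rw [← map_neg, ← map_neg, ← map_add, ← map_sub]
  congr 1
  refine Prod.ext ?_ ?_
  · change -x.1 + (x.1 - y) = -y - 0
    abel
  · simp

theorem Prim.costate_apply {V : Type*} [NormedAddCommGroup V] [NormedSpace ℝ V]
    [FiniteDimensional ℝ V] {a b : ℝ} (hab : a ≤ b) {ℓ : ℝ → V →L[ℝ] ℝ} {k : ℝ → V →L[ℝ] V}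
    (hℓ : ∀ z, Prim (fun t => ℓ t z) (fun t => - ℓ t (k t z)) a b) {z z' : ℝ → V}
    (hz : Prim z z' a b) :
    Prim (fun t => ℓ t (z t)) (fun t => - ℓ t (k t (z t)) + ℓ t (z' t)) a b :=
  haveI : CompleteSpace V := FiniteDimensional.complete ℝ V
  (Prim.of_apply (L := ℓ) (L' := fun t => -(ℓ t ∘L k t)) hℓ).clm_apply hz hab

theorem continuousOn_costate {V : Type*} [NormedAddCommGroup V] [NormedSpace ℝ V]
    [FiniteDimensional ℝ V] {a b : ℝ} {ℓ : ℝ → V →L[ℝ] ℝ} {k : ℝ → V →L[ℝ] V}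
    (hℓ : ∀ z, Prim (fun t => ℓ t z) (fun t => - ℓ t (k t z)) a b) : ContinuousOn ℓ (Icc a b) :=
  (Prim.of_apply (L := ℓ) (L' := fun t => -(ℓ t ∘L k t)) hℓ).continuousOn

namespace DiffusionData

set_option linter.unusedSectionVars false

variable {d : ℕ} {M : Type*} [TopologicalSpace M] [ChartedSpace (EuclideanSpace ℝ (Fin d)) M]
  [IsManifold (𝓡 d) ∞ M] [T2Space M] {o : M} {T : ℝ} {D : DiffusionData d M o T}
  {c : ℝ → D.S.Fiber o} {γ : ℝ → M} {P : ℝ → Eu d ≃L[ℝ] Eu d}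

theorem varOp_zero_fst (t : ℝ) (A : Eu d →L[ℝ] Eu d) :
    D.varOp c γ P t (0, A) = (A (D.diffusion t (c t)), 0) := by
  ext1
  · rw [varOp_fst]
    simp
  · simp [varOp]

/-- The part of a costate that pairs with tangent vectors. -/
def costateE (ℓ : ℝ → (Eu d × (Eu d →L[ℝ] Eu d)) →L[ℝ] ℝ) (t : ℝ) : Eu d →L[ℝ] ℝ :=
  ℓ t ∘L ContinuousLinearMap.inl ℝ (Eu d) (Eu d →L[ℝ] Eu d)

variable (D) in
/-- The Riesz representative of a costate. -/
def costateSharp (ℓ : ℝ → (Eu d × (Eu d →L[ℝ] Eu d)) →L[ℝ] ℝ) (t : ℝ) : D.S.Fiber o :=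
  (InnerProductSpace.toDual ℝ (D.S.Fiber o)).symm (costateE ℓ t ∘L D.inclE o)

variable {ℓ : ℝ → (Eu d × (Eu d →L[ℝ] Eu d)) →L[ℝ] ℝ}

theorem inner_costateSharp (t : ℝ) (w : D.S.Fiber o) :
    ⟪D.costateSharp ℓ t, w⟫ = costateE ℓ t (D.inclE o w) := by
  rw [costateSharp, InnerProductSpace.toDual_symm_apply]
  rfl

theorem continuousOn_costateE {K : Set ℝ} (hℓ : ContinuousOn ℓ K) :
    ContinuousOn (costateE ℓ) K := hℓ.clm_comp continuousOn_const

theorem continuousOn_costateSharp {K : Set ℝ} (hℓ : ContinuousOn ℓ K) :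
    ContinuousOn (D.costateSharp ℓ) K :=
  (LinearIsometryEquiv.continuous _).comp_continuousOn
    ((continuousOn_costateE hℓ).clm_comp continuousOn_const)

/-- The control is Σ^{1/2} applied to the sharp of the one-form, because Σ^{1/2} is symmetric. -/
theorem posSqrt_costateSharp {t : ℝ} (ht : t ∈ Icc 0 T)
    (hc : ∀ w, ⟪c t, w⟫ = ℓ t (D.diffusion t w, 0)) :
    posSqrt (D.Sig t) (D.costateSharp ℓ t) = c t := by
  refine ext_inner_right ℝ fun w => ?_
  refine Eq.trans ((posSqrt_Sig_spec (D := D) ht).1.isSymmetric _ w) ?_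
  rw [hc]
  exact inner_costateSharp t _

theorem Sig_costateSharp {t : ℝ} (ht : t ∈ Icc 0 T)
    (hc : ∀ w, ⟪c t, w⟫ = ℓ t (D.diffusion t w, 0)) :
    D.Sig t (D.costateSharp ℓ t) = posSqrt (D.Sig t) (c t) := by
  rw [← posSqrt_costateSharp ht hc, ← (posSqrt_Sig_spec (D := D) ht).2]
  simp only [ContinuousLinearMap.comp_apply]
  rw [(posSqrt_Sig_spec (D := D) ht).2]

end DiffusionData

namespace IsCompatibleSubmersion

set_option linter.unusedSectionVars false

variable {d e : ℕ} {M N : Type*}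
    [TopologicalSpace M] [ChartedSpace (EuclideanSpace ℝ (Fin d)) M] [IsManifold (𝓡 d) ∞ M]
    [T2Space M]
    [TopologicalSpace N] [ChartedSpace (EuclideanSpace ℝ (Fin e)) N] [IsManifold (𝓡 e) ∞ N]
    [T2Space N]
    {T : ℝ} {o : M} {π : M → N}
    {D : DiffusionData d M o T} {D' : DiffusionData e N (π o) T}
    (hπ : IsCompatibleSubmersion π D D')
    {c : ℝ → D'.S.Fiber (π o)} {γ : ℝ → M} {P : ℝ → Eu d ≃L[ℝ] Eu d}
    {P' : ℝ → Eu e ≃L[ℝ] Eu e} {ℓ : ℝ → (Eu e × (Eu e →L[ℝ] Eu e)) →L[ℝ] ℝ}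

/-- The adjoint equation contributes the coefficients of N and the derivative of `transferE`
contributes their difference to those of M. The sum leaves the torsion and drift terms of M, and the
curvature term of N acting on frame variations. -/
theorem hasDerivWithinAt_costate (hT : 0 < T)
    (h : D.IsPath (fun t => hπ.lift o (c t)) γ P 0 T) (h0 : γ 0 = o ∧ P 0 = .refl ℝ _)
    (h' : D'.IsPath c (fun t => π (γ t)) P' 0 T) (hc : ContinuousOn c (Icc 0 T))
    (hproj : ∀ t ∈ Icc 0 T, ∀ w,
      diffE π (γ t) (P t (D.inclE o (hπ.lift o w))) = P' t (D'.inclE (π o) w))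
    (hℓ : ∀ z, Prim (fun t => ℓ t z)
      (fun t => - ℓ t (D'.varOp c (fun t => π (γ t)) P' t z)) 0 T) (v : Eu d) {t : ℝ}
    (ht : t ∈ Icc 0 T) :
    HasDerivWithinAt (fun t => DiffusionData.costateE ℓ t (transferE π γ P P' t v))
      (- DiffusionData.costateE ℓ t
          (transferE π γ P P' t (D.varOp (fun t => hπ.lift o (c t)) γ P t (v, 0)).1)
        - ℓ t (0, (D'.varOp c (fun t => π (γ t)) P' t (transferE π γ P P' t v, 0)).2))
      (Icc 0 T) t := by
  have hq := fun v => hπ.prim_transferE hT h h0 h' hproj v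
  have cq : ContinuousOn (transferE π γ P P') (Icc 0 T) :=
    (Prim.of_apply (L := transferE π γ P P') (L' := fun t =>
      ContinuousLinearMap.fst ℝ _ _ ∘L D'.varOp c (fun t => π (γ t)) P' t ∘L
        ContinuousLinearMap.inl ℝ _ _ ∘L transferE π γ P P' t
      - transferE π γ P P' t ∘L ContinuousLinearMap.fst ℝ _ _ ∘L
        D.varOp (fun t => hπ.lift o (c t)) γ P t ∘L ContinuousLinearMap.inl ℝ _ _) hq).continuousOn
  have cℓ := continuousOn_costate hℓ
  have cv : ContinuousOn (D.varOp (fun t => hπ.lift o (c t)) γ P) (Icc 0 T) :=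
    h.continuousOn_varOp hT ((LinearMap.toContinuousLinearMap
      (hπ.lift o)).continuous.comp_continuousOn hc)
  have cv' : ContinuousOn (D'.varOp c (fun t => π (γ t)) P') (Icc 0 T) :=
    h'.continuousOn_varOp hT hc
  have k1 : ContinuousOn (fun t => transferE π γ P P' t v) (Icc 0 T) :=
    cq.clm_apply continuousOn_const
  have k2 : ContinuousOn (fun t => (D.varOp (fun t => hπ.lift o (c t)) γ P t (v, 0)).1) (Icc 0 T) :=
    (cv.clm_apply continuousOn_const).fst
  have k3 : ContinuousOn (fun t =>
      (D'.varOp c (fun t => π (γ t)) P' t (transferE π γ P P' t v, 0)).2) (Icc 0 T) :=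
    (cv'.clm_apply (k1.prodMk continuousOn_const)).snd
  have key := Prim.costate_apply hT.le hℓ ((hq v).prodMk (Prim.const (0 : Eu e →L[ℝ] Eu e) 0 T))
  refine Prim.hasDerivWithinAt (y' := fun t => - DiffusionData.costateE ℓ t
          (transferE π γ P P' t (D.varOp (fun t => hπ.lift o (c t)) γ P t (v, 0)).1)
        - ℓ t (0, (D'.varOp c (fun t => π (γ t)) P' t (transferE π γ P P' t v, 0)).2))
    (key.congr_deriv hT.le fun t _ => ?_) ?_ ht
  · simp only [DiffusionData.costateE, ContinuousLinearMap.comp_apply,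
      ContinuousLinearMap.inl_apply]
    exact clm_prod_sub_apply _ _ _
  · exact ((DiffusionData.continuousOn_costateE cℓ).clm_apply (cq.clm_apply k2)).neg.sub
      (cℓ.clm_apply (continuousOn_const.prodMk k3))

end IsCompatibleSubmersion

namespace IsCompatibleSubmersion

/-! ### Lifting the equations -/

set_option linter.unusedSectionVars false

variable {d e : ℕ} {M N : Type*}
    [TopologicalSpace M] [ChartedSpace (EuclideanSpace ℝ (Fin d)) M] [IsManifold (𝓡 d) ∞ M]
    [T2Space M]
    [TopologicalSpace N] [ChartedSpace (EuclideanSpace ℝ (Fin e)) N] [IsManifold (𝓡 e) ∞ N]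
    [T2Space N]
    {T : ℝ} {o : M} {π : M → N}
    {D : DiffusionData d M o T} {D' : DiffusionData e N (π o) T}
    (hπ : IsCompatibleSubmersion π D D')
    {c : ℝ → D'.S.Fiber (π o)} {γ : ℝ → M} {P : ℝ → Eu d ≃L[ℝ] Eu d}
    {P' : ℝ → Eu e ≃L[ℝ] Eu e} {ℓ : ℝ → (Eu e × (Eu e →L[ℝ] Eu e)) →L[ℝ] ℝ} {t : ℝ}

theorem inclE_lift_transport {G : D'.S.Fiber (π o) ≃ₗᵢ[ℝ] D'.S.Fiber (π (γ t))}
    (hG : ∀ w, D.inclE (γ t) (hπ.lift (γ t) (G w)) = P t (D.inclE o (hπ.lift o w)))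
    (hproj : ∀ w, diffE π (γ t) (P t (D.inclE o (hπ.lift o w))) = P' t (D'.inclE (π o) w))
    (w : D'.S.Fiber (π o)) : D'.inclE (π (γ t)) (G w) = P' t (D'.inclE (π o) w) := by
  rw [← hproj, ← hG, hπ.diffE_inclE, hπ.proj_lift]

theorem transport_lift {Q : D.S.Fiber o ≃ₗᵢ[ℝ] D.S.Fiber (γ t)}
    (hQ : ∀ v, D.inclE (γ t) (Q v) = P t (D.inclE o v))
    {G : D'.S.Fiber (π o) ≃ₗᵢ[ℝ] D'.S.Fiber (π (γ t))}
    (hG : ∀ w, D.inclE (γ t) (hπ.lift (γ t) (G w)) = P t (D.inclE o (hπ.lift o w)))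
    (w : D'.S.Fiber (π o)) : Q (hπ.lift o w) = hπ.lift (γ t) (G w) :=
  DiffusionData.inclE_injective (D := D) (γ t) (by rw [hQ, hG])

/-- By adjointness of lift and projection, pairing R with a lifted vector only sees its projection,
and there the curvatures are intertwined. So K on M, evaluated on lifted two-vectors, is the
curvature coefficient on N. -/
theorem exists_curvature_pairing (ht : t ∈ Icc 0 T) {Q : D.S.Fiber o ≃ₗᵢ[ℝ] D.S.Fiber (γ t)}
    (hQ : ∀ v, D.inclE (γ t) (Q v) = P t (D.inclE o v))
    {G : D'.S.Fiber (π o) ≃ₗᵢ[ℝ] D'.S.Fiber (π (γ t))}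
    (hG : ∀ w, D.inclE (γ t) (hπ.lift (γ t) (G w)) = P t (D.inclE o (hπ.lift o w)))
    (hproj : ∀ w, diffE π (γ t) (P t (D.inclE o (hπ.lift o w))) = P' t (D'.inclE (π o) w))
    {κ : ⋀[ℝ]^2 (D.S.Fiber (γ t)) →ₗ[ℝ] Module.Dual ℝ (TangentSpace (𝓡 d) (γ t))}
    (hκ : D.S.IsK D.conn (γ t) (D.vel (fun t => hπ.lift o (c t)) γ P t) κ) (v : Eu d)
    (α β : D'.S.Fiber (π o)) :
    ∃ y : D'.S.Fiber (π o), D'.inclE (π o) y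
        = (D'.varOp c (fun t => π (γ t)) P' t (transferE π γ P P' t v, 0)).2 (D'.inclE (π o) α) ∧
      κ (D.S.wedge (Q (hπ.lift o α)) (Q (hπ.lift o β))) ((toE (γ t)).symm (P t v)) = ⟪y, β⟫ := by
  obtain ⟨z, hz, hκz⟩ := hκ (Q (hπ.lift o α)) (Q (hπ.lift o β)) ((toE (γ t)).symm (P t v))
  rw [hπ.transport_lift hQ hG] at hz
  refine ⟨G.symm (hπ.proj (γ t) z), ?_, ?_⟩
  · rw [DiffusionData.varOp_snd, ContinuousLinearEquiv.eq_symm_apply,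
      ← hπ.inclE_lift_transport hG hproj, LinearIsometryEquiv.apply_symm_apply, apply_transferE,
      ← hπ.inclE_lift_transport hG hproj, ← hπ.mfderiv_vel_eq ht hproj]
    have h1 := hπ.mfderiv_curvature (γ t) (D.vel (fun t => hπ.lift o (c t)) γ P t)
      ((toE (γ t)).symm (P t v)) (G α)
    rw [← hz] at h1
    exact congrArg (toE (π (γ t))) h1
  · rw [hκz, hπ.transport_lift hQ hG, real_inner_comm, hπ.inner_lift_left, real_inner_comm,
      ← G.inner_map_map, LinearIsometryEquiv.apply_symm_apply]

/-- The sharp of a pulled-back form is the horizontal lift of the sharp, since lifting is adjoint to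
π_* and transport is isometric. -/
theorem sharp_costate {Q : D.S.Fiber o ≃ₗᵢ[ℝ] D.S.Fiber (γ t)}
    (hQ : ∀ v, D.inclE (γ t) (Q v) = P t (D.inclE o v))
    {G : D'.S.Fiber (π o) ≃ₗᵢ[ℝ] D'.S.Fiber (π (γ t))}
    (hG : ∀ w, D.inclE (γ t) (hπ.lift (γ t) (G w)) = P t (D.inclE o (hπ.lift o w)))
    (hproj : ∀ w, diffE π (γ t) (P t (D.inclE o (hπ.lift o w))) = P' t (D'.inclE (π o) w))
    {lam : Module.Dual ℝ (TangentSpace (𝓡 d) (γ t))}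
    (hlam : ∀ v, lam v = DiffusionData.costateE ℓ t
      ((P' t).symm (toE _ (mfderiv (𝓡 d) (𝓡 e) π (γ t) v)))) :
    D.S.sharp (γ t) lam = Q (hπ.lift o (D'.costateSharp ℓ t)) := by
  refine ext_inner_right ℝ fun y => ?_
  have h1 : ⟪D.S.sharp (γ t) lam, y⟫ = lam (D.S.incl (γ t) y) := by
    rw [SubRiemannianStructure.sharp, InnerProductSpace.toDual_symm_apply]
    rfl
  have h2 : D'.inclE (π o) (G.symm (hπ.proj (γ t) y))
      = (P' t).symm (toE _ (mfderiv (𝓡 d) (𝓡 e) π (γ t) (D.S.incl (γ t) y))) := by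
    rw [ContinuousLinearEquiv.eq_symm_apply, ← hπ.inclE_lift_transport hG hproj,
      LinearIsometryEquiv.apply_symm_apply]
    rfl
  rw [h1, hlam, ← h2, ← DiffusionData.inner_costateSharp, hπ.transport_lift hQ hG,
    hπ.inner_lift_left, ← G.inner_map_map, LinearIsometryEquiv.apply_symm_apply]

/-- The two-vector of a costate. -/
theorem exists_twoVector (hT : 0 < T) {γ' : ℝ → N}
    (hcℓ : ∀ t ∈ Icc 0 T, ∀ w, ⟪c t, w⟫ = ℓ t (D'.diffusion t w, 0))
    (hℓ : ∀ z, Prim (fun t => ℓ t z) (fun t => - ℓ t (D'.varOp c γ' P' t z)) 0 T)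
    (hℓT : ∀ A, ℓ T (0, A) = 0) :
    ∃ χ : ℝ → ⋀[ℝ]^2 (D.S.Fiber o), χ T = 0 ∧
      (∀ t ∈ Icc 0 T, ∀ φ : Module.Dual ℝ (⋀[ℝ]^2 (D.S.Fiber o)),
        HasDerivWithinAt (fun s => φ (χ s)) (φ (D.S.wedge
          (hπ.lift o (D'.Sig t (D'.costateSharp ℓ t))) (hπ.lift o (D'.costateSharp ℓ t))))
          (Icc 0 T) t) ∧
      ∀ (φ : Module.Dual ℝ (⋀[ℝ]^2 (D.S.Fiber o))) (A : Eu e →L[ℝ] Eu e),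
        (∀ α β, ∃ y, D'.inclE (π o) y = A (D'.inclE (π o) α) ∧
          φ (D.S.wedge (hπ.lift o α) (hπ.lift o β)) = ⟪y, β⟫) →
        ∀ t ∈ Icc 0 T, φ (χ t) = - ℓ t (0, A) := by
  have cs := DiffusionData.continuousOn_costateSharp (D := D') (continuousOn_costate hℓ)
  have cl : Continuous (hπ.lift o) := (hπ.lift o).continuous_of_finiteDimensional
  have cS : ContinuousOn (fun t => D'.Sig t (D'.costateSharp ℓ t)) (Icc 0 T) :=
    D'.Sig_smooth.continuousOn.clm_apply cs
  have cw : ∀ φ : Module.Dual ℝ (⋀[ℝ]^2 (D.S.Fiber o)), ContinuousOn (fun t => φ (D.S.wedge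
      (hπ.lift o (D'.Sig t (D'.costateSharp ℓ t))) (hπ.lift o (D'.costateSharp ℓ t))))
      (Icc 0 T) := continuousOn_ιMulti (cl.comp_continuousOn cS) (cl.comp_continuousOn cs)
  obtain ⟨χ, hχT, hχ⟩ := exists_prim_of_forall_dual hT.le cw
  refine ⟨χ, hχT, fun t ht φ => (hχ φ).hasDerivWithinAt (cw φ) ht, fun φ A hφ t ht => ?_⟩
  -- The derivative of φ(χ) is ⟪AΣ♯, ♯⟫ and that of ℓ(0, A) is -ℓ(AΣ^{1/2}c, 0), which cancels it
  -- because Σ♯ = Σ^{1/2}c. The sum is constant and vanishes at T.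
  have h1 := ((hχ φ).add (hℓ (0, A))).congr_deriv (z' := fun _ => (0 : ℝ)) hT.le fun t ht => by
    obtain ⟨y, hy, hφy⟩ := hφ (D'.Sig t (D'.costateSharp ℓ t)) (D'.costateSharp ℓ t)
    rw [hφy, real_inner_comm, DiffusionData.inner_costateSharp, hy,
      DiffusionData.Sig_costateSharp ht (hcℓ t ht), DiffusionData.varOp_zero_fst]
    exact add_neg_cancel _
  have h2 := (h1.eq_left ht).trans (h1.eq_left ⟨hT.le, le_rfl⟩).symm
  rw [hχT, hℓT, map_zero, add_zero] at h2
  exact eq_neg_of_add_eq_zero_left h2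

end IsCompatibleSubmersion

theorem map_ιMulti_pair {V W : Type*} [AddCommGroup V] [Module ℝ V] [AddCommGroup W] [Module ℝ W]
    (f : V →ₗ[ℝ] W) (v w : V) : exteriorPower.map 2 f (exteriorPower.ιMulti ℝ 2 ![v, w])
      = exteriorPower.ιMulti ℝ 2 ![f v, f w] := by
  rw [exteriorPower.map_apply_ιMulti]
  congr 1
  ext i
  fin_cases i <;> rfl

theorem DiffusionData.IsRedPath.congr_control {d : ℕ} {M : Type*} [TopologicalSpace M]
    [ChartedSpace (EuclideanSpace ℝ (Fin d)) M] [IsManifold (𝓡 d) ∞ M] {o : M} {T : ℝ}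
    {D : DiffusionData d M o T} {ξ c : ℝ → D.S.Fiber o} {γ : ℝ → M}
    {F : ℝ → D.S.Fiber o →L[ℝ] Eu d} {a b : ℝ} (h : D.IsRedPath ξ γ F a b)
    (hc : ∀ᵐ t, t ∈ Icc a b → ξ t = c t) : D.IsRedPath c γ F a b := by
  refine ⟨h.continuousOn, fun x₀ m r s hr hrs hs hγ =>
    (h.chart x₀ m r s hr hrs hs hγ).congr_deriv_ae hrs ?_⟩
  filter_upwards [hc] with t ht hab
  unfold redField
  rw [ht ⟨hr.trans hab.1, hab.2.trans hs⟩]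

namespace IsCompatibleSubmersion

set_option linter.unusedSectionVars false

variable {d e : ℕ} {M N : Type*}
    [TopologicalSpace M] [ChartedSpace (EuclideanSpace ℝ (Fin d)) M] [IsManifold (𝓡 d) ∞ M]
    [T2Space M]
    [TopologicalSpace N] [ChartedSpace (EuclideanSpace ℝ (Fin e)) N] [IsManifold (𝓡 e) ∞ N]
    [T2Space N]
    {T : ℝ} {o : M} {π : M → N}
    {D : DiffusionData d M o T} {D' : DiffusionData e N (π o) T}
    (hπ : IsCompatibleSubmersion π D D')
    {c : ℝ → D'.S.Fiber (π o)} {γ' : ℝ → N} {P' : ℝ → Eu e ≃L[ℝ] Eu e}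

/-- A continuously driven solution on the base lifts. -/
theorem exists_lift_path (hT : 0 < T)
    (hcomplete : ∀ ξ : D.CameronMartin, ∃ γ : ℝ → M, D.IsSolution ξ γ)
    (hc : ContinuousOn c (Icc 0 T)) {ξ : D'.CameronMartin}
    (hae : ∀ᵐ t, t ∈ Icc 0 T → ξ t = c t) (h' : D'.IsPath c γ' P' 0 T)
    (h0' : γ' 0 = π o ∧ P' 0 = .refl ℝ _) :
    ∃ (γ : ℝ → M) (P : ℝ → Eu d ≃L[ℝ] Eu d), D.IsPath (fun t => hπ.lift o (c t)) γ P 0 T ∧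
      (γ 0 = o ∧ P 0 = .refl ℝ _) ∧ (∀ t ∈ Icc 0 T, π (γ t) = γ' t) ∧
      (∀ t ∈ Icc 0 T, ∀ w,
        diffE π (γ t) (P t (D.inclE o (hπ.lift o w))) = P' t (D'.inclE (π o) w)) ∧
      ∀ t, ∃ Q : D.S.Fiber o ≃ₗᵢ[ℝ] D.S.Fiber (γ t),
        ∀ v, D.inclE (γ t) (Q v) = P t (D.inclE o v) := by
  have cl : ContinuousOn (fun t => hπ.lift o (c t)) (Icc 0 T) :=
    (hπ.lift o).continuous_of_finiteDimensional.comp_continuousOn hc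
  have hmem : MemLp (fun t => hπ.lift o (c t)) 2 (volume.restrict (Icc 0 T)) := by
    obtain ⟨K, hK⟩ := isCompact_Icc.exists_bound_of_continuousOn cl
    exact MemLp.of_bound (cl.aestronglyMeasurable measurableSet_Icc) K
      ((ae_restrict_iff' measurableSet_Icc).2 (.of_forall hK))
  obtain ⟨γ, hγ⟩ := hcomplete (hmem.toLp _)
  obtain ⟨h0, P, hP, hP0⟩ := (DiffusionData.isSolution_iff hT).1 hγ
  have hP := hP.congr_control hT.le ((ae_restrict_iff' measurableSet_Icc).1 hmem.coeFn_toLp)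
  -- The projected lift and the given path solve one reduced system with the same control and the
  -- same initial transport.
  have hunique := DiffusionData.IsRedPath.unique hT (ξ := ξ)
    ((hπ.isRedPath_projTransport hP ⟨h0, hP0⟩).congr_control
      (hae.mono fun t ht h => (ht h).symm))
    (h'.isRedPath.congr_control (hae.mono fun t ht h => (ht h).symm))
    ⟨by simp only [h0, h0'.1], by
      ext1 w
      change diffE π (γ 0) (P 0 (D.inclE o (hπ.lift o w))) = P' 0 (D'.inclE (π o) w)
      rw [h0, hP0, h0'.2]
      change diffE π o (D.inclE o (hπ.lift o w)) = D'.inclE (π o) w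
      rw [hπ.diffE_inclE, hπ.proj_lift]⟩
  -- Time is clamped to [0, T], so that the isometry Q of fibers exists for every real t and not
  -- only where the curve is controlled.
  let τ : ℝ → ℝ := fun t => projIcc 0 T hT.le t
  have hτ : ∀ t, τ t ∈ Icc 0 T := fun t => (projIcc 0 T hT.le t).2
  have hτ' : ∀ t ∈ Icc 0 T, τ t = t := fun t ht => congrArg Subtype.val (projIcc_of_mem hT.le ht)
  have hτ0 := hτ' 0 ⟨le_rfl, hT.le⟩
  refine ⟨fun t => γ (τ t), fun t => P (τ t), hP.congr hT.le fun t ht => by simp only [hτ' t ht, and_self],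
    by simp only [hτ0, h0, hP0, and_self], fun t ht => ?_, fun t ht w => ?_,
    fun t => hP.exists_fiber_transport ⟨h0, hP0⟩ (τ t) (hτ t)⟩
  · simp only [hτ' t ht]
    exact (hunique t ht).1
  · simp only [hτ' t ht]
    exact congrArg (fun L => L w) (hunique t ht).2

end IsCompatibleSubmersion

end SubRiem

end

theorem mainTheorem5 {d e : ℕ} {M N : Type*}
    [TopologicalSpace M] [ChartedSpace (EuclideanSpace ℝ (Fin d)) M] [IsManifold (𝓡 d) ∞ M]
    [T2Space M] [SigmaCompactSpace M]
    [TopologicalSpace N] [ChartedSpace (EuclideanSpace ℝ (Fin e)) N] [IsManifold (𝓡 e) ∞ N]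
    [T2Space N] [SigmaCompactSpace N]
    (T : ℝ) (hT : 0 < T) (o : M) (π : M → N)
    (D : SubRiem.DiffusionData d M o T) (D' : SubRiem.DiffusionData e N (π o) T)
    (hπ : SubRiem.IsCompatibleSubmersion π D D')
    (hcomplete : ∀ ξ : D.CameronMartin, ∃ γ : ℝ → M, D.IsSolution ξ γ)
    (γ' : ℝ → N) (hγ' : D'.IsMostProbablePath γ') (hreg : ¬ D'.IsSingular γ') :
    ∃ (γ : ℝ → M) (lam : (t : ℝ) → Module.Dual ℝ (TangentSpace (𝓡 d) (γ t)))
      (chi : (t : ℝ) → ⋀[ℝ]^2 (D.S.Fiber (γ t))),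
      D.SolvesMPP γ lam chi ∧ γ 0 = o ∧
      (∀ v ∈ SubRiem.vertical e π (γ 0), lam 0 v = 0) ∧
      ∀ t ∈ Icc 0 T, π (γ t) = γ' t := by
  obtain ⟨P', ℓ, ξ, c, hae, hc, h', h0', hcℓ, hℓ, hℓT⟩ :=
    SubRiem.DiffusionData.exists_momentum hT hγ' hreg
  obtain ⟨γ, P, h, h0, hπγ, hproj, hQ⟩ := hπ.exists_lift_path hT hcomplete hc hae h' h0'
  choose Q hQ using hQ
  have hG := hπ.exists_lift_transport h h0
  obtain ⟨χ, hχT, hχ, hχℓ⟩ := hπ.exists_twoVector hT hcℓ hℓ hℓT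
  have h'' : D'.IsPath c (fun t => π (γ t)) P' 0 T :=
    h'.congr hT.le fun t ht => ⟨hπγ t ht, rfl⟩
  -- The coefficients along the given path and along π ∘ γ agree on [0, T].
  have hℓ' : ∀ z, SubRiem.Prim (fun t => ℓ t z)
      (fun t => - ℓ t (D'.varOp c (fun t => π (γ t)) P' t z)) 0 T := fun z =>
    (hℓ z).congr_deriv hT.le fun t ht => by
      unfold SubRiem.DiffusionData.varOp SubRiem.DiffusionData.vel
      rw [← hπγ t ht]
  choose κ hκ using fun t => SubRiem.exists_isK D.conn_smooth D.conn_compatible (γ t)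
    (D.vel (fun t => hπ.lift o (c t)) γ P t)
  -- The pull-back by π of the one-form on N, which is the tangent part of the costate transported
  -- to the point.
  let lam : (t : ℝ) → Module.Dual ℝ (TangentSpace (𝓡 d) (γ t)) := fun t =>
    (SubRiem.DiffusionData.costateE ℓ t ∘L ((P' t).symm : SubRiem.Eu e →L[ℝ] SubRiem.Eu e) ∘L
      (SubRiem.toE (π (γ t))).toContinuousLinearMap ∘L mfderiv (𝓡 d) (𝓡 e) π (γ t)).toLinearMap
  have hsharp : ∀ t ∈ Icc 0 T, D.S.sharp (γ t) (lam t) = Q t (hπ.lift o (D'.costateSharp ℓ t)) :=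
    fun t ht => by
      obtain ⟨G, hG⟩ := hG t ht
      exact hπ.sharp_costate (hQ t) hG (hproj t ht) fun v => rfl
  have hmap : ∀ t, exteriorPower.map 2 (Q t).symm.toLinearEquiv.toLinearMap ∘ₗ
      exteriorPower.map 2 (Q t).toLinearEquiv.toLinearMap = .id := fun t => by
    rw [← exteriorPower.map_comp, ← exteriorPower.map_id]
    congr 1
    ext v
    simp
  -- Transported back to o, Σ♯λ is the lift of its counterpart on N; this gives both the velocity
  -- equation and the equation of chi.
  have hSig : ∀ t ∈ Icc 0 T, D.Sig t ((Q t).toLinearEquiv.symm (D.S.sharp (γ t) (lam t)))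
      = hπ.lift o (D'.Sig t (D'.costateSharp ℓ t)) := fun t ht => by
    rw [hsharp t ht, ← hπ.Sig_lift ht]
    congr 1
    exact (Q t).symm_apply_apply _
  refine ⟨γ, lam, fun t => exteriorPower.map 2 (Q t).toLinearEquiv.toLinearMap (χ t),
    ⟨h0.1, D.vel (fun t => hπ.lift o (c t)) γ P, _, fun t => (Q t).toLinearEquiv, κ,
      fun t ht => h.hasMFDerivWithinAt
        ((hπ.lift o).continuous_of_finiteDimensional.comp_continuousOn hc) ht,
      h.isParallelTransport h0, fun t ht v => ?_, fun t _ => hκ t, fun t ht => ?_, fun t ht v => ?_,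
      fun t ht φ => ?_, ?_⟩, h0.1, fun v hv => ?_, hπγ⟩
  · exact hQ t v
  · rw [hSig t ht, SubRiem.DiffusionData.Sig_costateSharp ht (hcℓ t ht),
      SubRiem.DiffusionData.vel, add_sub_cancel_right]
    change (SubRiem.toE (γ t)).symm (P t (D.inclE o (SubRiem.posSqrt (D.Sig t)
      (hπ.lift o (c t))))) = (SubRiem.toE (γ t)).symm (D.inclE (γ t) _)
    rw [hπ.posSqrt_lift ht]
    exact congrArg _ (hQ t _).symm
  · have h1 := hπ.hasDerivWithinAt_costate hT h h0 h'' hc hproj hℓ' (SubRiem.toE o v) ht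
    refine HasDerivWithinAt.congr_deriv h1 ?_
    set V := (SubRiem.toE (γ t)).symm (P t (SubRiem.toE o v))
    -- Transport to γ_t cancels the inverse transport in `varOp`, so the torsion and drift terms are
    -- those of M tested by lam.
    have e1 : SubRiem.DiffusionData.costateE ℓ t (SubRiem.IsCompatibleSubmersion.transferE π γ P P' t
          (D.varOp (fun t => hπ.lift o (c t)) γ P t (SubRiem.toE o v, 0)).1)
        = lam t (D.conn.torsion (γ t) (D.vel (fun t => hπ.lift o (c t)) γ P t) V
          + D.conn (D.u t) (γ t) V) := by
      rw [SubRiem.DiffusionData.varOp_fst]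
      simp only [zero_apply, zero_add]
      change SubRiem.DiffusionData.costateE ℓ t ((P' t).symm
        (SubRiem.IsCompatibleSubmersion.diffE π (γ t) (P t ((P t).symm _)))) = _
      rw [ContinuousLinearEquiv.apply_symm_apply]
      rfl
    -- The functional is K evaluated at V after transport, and the frame variation is the curvature
    -- coefficient on N. The two pair alike on lifted two-vectors, so the value at χ_t is minus the
    -- curvature term of the costate.
    have e2 : κ t (exteriorPower.map 2 (Q t).toLinearEquiv.toLinearMap (χ t)) V = _ :=
      hχℓ ((LinearMap.applyₗ V) ∘ₗ κ t ∘ₗ exteriorPower.map 2 (Q t).toLinearEquiv.toLinearMap)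
        (D'.varOp c (fun t => π (γ t)) P' t (SubRiem.IsCompatibleSubmersion.transferE π γ P P' t
          (SubRiem.toE o v), 0)).2 (fun α β => by
        obtain ⟨G, hG⟩ := hG t ht
        obtain ⟨y, hy, hκy⟩ := hπ.exists_curvature_pairing ht (hQ t) hG (hproj t ht) (hκ t)
          (SubRiem.toE o v) α β
        refine ⟨y, hy, Eq.trans ?_ hκy⟩
        exact congrArg (fun χ => κ t χ V) (SubRiem.map_ιMulti_pair _ _ _)) t ht
    rw [e1, map_add]
    change _ = - lam t (D.conn (D.u t) (γ t) V) - lam t (D.conn.torsion (γ t) _ V)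
      + κ t (exteriorPower.map 2 (Q t).toLinearEquiv.toLinearMap (χ t)) V
    rw [e2]
    ring
  -- Transport back to o undoes the definition of chi, leaving χ, whose derivative is already known.
  · have e : ∀ s, exteriorPower.map 2 (Q s).toLinearEquiv.symm.toLinearMap
        (exteriorPower.map 2 (Q s).toLinearEquiv.toLinearMap (χ s)) = χ s := fun s =>
      congrArg (fun L => L (χ s)) (hmap s)
    simp only [e]
    refine (hχ t ht φ).congr_deriv (congrArg φ (Eq.symm ?_))
    refine (SubRiem.map_ιMulti_pair _ _ _).trans ?_
    change D.S.wedge ((Q t).toLinearEquiv.symm ((Q t).toLinearEquiv _))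
      ((Q t).toLinearEquiv.symm (D.S.sharp (γ t) (lam t))) = _
    rw [LinearEquiv.symm_apply_apply, hSig t ht, hsharp t ht]
    congr 1
    exact (Q t).symm_apply_apply _
  · change exteriorPower.map 2 (Q T).toLinearEquiv.toLinearMap (χ T) = 0
    rw [hχT, map_zero]
  · change SubRiem.DiffusionData.costateE ℓ 0 ((P' 0).symm (SubRiem.toE (π (γ 0))
      (mfderiv (𝓡 d) (𝓡 e) π (γ 0) v))) = 0
    rw [show mfderiv (𝓡 d) (𝓡 e) π (γ 0) v = 0 from hv, map_zero, map_zero, map_zero]
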